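/- **Conventions.** Let $k$ be a field of characteristic $0$ and $V$ a $\mathbb Z/2$-graded $k$-vector space (of any dimension) with parity reversion $\Pi V$; $|x|$ is the parity of $x$, and $\pm$ is always the Koszul sign. A cochain is a sequence $\varphi=(\varphi_n)_{n\ge 0}$ of multilinear maps $\varphi_n:(\Pi V)^n\to\Pi V$; it has parity $q$ if $|\varphi_n(x_1,\dots,x_n)|=\sum|x_i|+q$. It is the same thing as a continuous derivation of $\hat T\Pi V^*$, and, if graded symmetric, as one of $\hat S\Pi V^*$; "without constant term" means $\varphi_0=0$. Put $$(\varphi\circ\psi)(x_1,\dots,x_n)=\sum_{1\le a\le b\le n}\pm\varphi(x_1,\dots,\psi(x_a,\dots,x_b),\dots,x_n),\qquad (\varphi\bullet\psi)(x_1,\dots,x_n)=\sum_{S\sqcup T=\{1,\dots,n\}}\pm\varphi(\psi(x_S),x_T),$$ where $\circ$ is used for cochains without constant term and $\bullet$ for graded symmetric cochains; $[\ ,\ ]$ denotes the corresponding graded commutator. An $A_\infty$-structure on $V$ is an odd cochain $m$ with $m_0=0$ and $m\circ m=0$; an $L_\infty$-structure is a graded symmetric odd cochain $m$ with $m_0=0$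 and $m\bullet m=0$. An $A_\infty$-structure $m$ defines the $L_\infty$-structure $\overline m_n(x_1,\dots,x_n)=\sum_{\sigma\in S_n}\pm m_n(x_{\sigma(1)},\dots,x_{\sigma(n)})$, and $L_\infty$-maps out of an $A_\infty$-algebra are meant with respect to it. A dgla $\mathfrak g$ is an $L_\infty$-algebra with $l_1(\Pi x)=-\Pi dx$, $l_2(\Pi x,\Pi y)=(-1)^{|x|}\Pi[x,y]$ and $l_n=0$ for $n\geq3$. An $L_\infty$-map $(V,m)\to(W,l)$ is a family of even graded symmetric multilinear maps $f_r:(\Pi V)^r\to\Pi W$, $r\ge 1$, with $$\sum_{S\sqcup T=\{1,\dots,n\},\,S\ne\emptyset}\pm f_{|T|+1}(m(x_S),x_T)=\sum_{j\ge1}\frac1{j!}\sum_{B_1\sqcup\dots\sqcup B_j=\{1,\dots,n\},\,B_i\ne\emptyset}\pm\, l_j(f(x_{B_1}),\dots,f(x_{B_j}))$$ for all $n\ge1$ and all homogeneous $x_1,\dots,x_n\in\Pi V$. For an $A_\infty$-algebra, $\overline{\mathrm{Hoch}}(V,V)$ is the dgla of cochains without constant term with the bracket $[\ ,\ ]$ and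 the differential $[m,-]$; for an $L_\infty$-algebra, $\overline{\mathrm{CE}}(V,V)$ is the dgla of graded symmetric cochains without constant term, with the same formulas. Let $\langle\,,\rangle$ be a graded symmetric non-degenerate inner product on $V$, homogeneous of some parity, and let $\omega(\Pi a,\Pi b)=(-1)^{|a|}\langle a,b\rangle$ be the induced graded antisymmetric form on $\Pi V$. A cochain $\varphi$ is cyclic if $\omega(\varphi_n(x_1,\dots,x_n),x_{n+1})$ is invariant, up to the Koszul sign, under cyclic permutations of $x_1,\dots,x_{n+1}\in\Pi V$; an $A_\infty$- or $L_\infty$-algebra is cyclic if $m$ is. For cyclic algebras, $\overline{\mathrm{CHoch}}(V,V)\subset\overline{\mathrm{Hoch}}(V,V)$ and $\overline{\mathrm{CE}}(V)\subset\overline{\mathrm{CE}}(V,V)$ are the sub-dglas of cyclic cochains. A formal cdga $A$ is the inverse limit of an inverse system, over a directed set, of finite-dimensional unital graded commutative dg algebras $A_j=k\oplus (A_j)_+$ with $(A_j)_+$ a nilpotent dg ideal; $U\otimes A=\varprojlim_j U\otimes A_j$ and $U\otimes A_+=\varprojlim_j U\otimes (A_j)_+$. Multilinear maps are extended $A$-multilinearly.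 For an $L_\infty$-algebra (resp. $A_\infty$-algebra) $(V,m)$, $\mathrm{MC}(V,A)$ is the set of even $\xi\in\Pi V\otimes A_+$ with $d_A\xi+\sum_{i\ge1}\frac1{i!}m_i(\xi,\dots,\xi)=0$ (resp. $d_A\xi+\sum_{i\ge1}m_i(\xi,\dots,\xi)=0$). An $L_\infty$-map $\mathbf f$ sends $\xi$ to $\mathbf f_*(\xi)=\sum_{r\ge1}\frac1{r!}f_r(\xi,\dots,\xi)$. Twisting by $\xi$ gives, for $n\ge1$, $$m^\xi_n(x_1,\dots,x_n)=\sum_{i\ge0}\tfrac1{i!}m_{i+n}(\xi,\dots,\xi,x_1,\dots,x_n)\quad\text{resp.}\quad m^\xi_n(x_1,\dots,x_n)=\sum_{i\ge0}\sum_z m_{i+n}(z_1,\dots,z_{i+n}),$$ the last sum running over all sequences $z$ that contain $x_1,\dots,x_n$ in order together with $i$ copies of $\xi$. **Theorem.** 1. (a) Let $(V,m)$ be an $L_\infty$-algebra. The maps $f_r:(\Pi V)^{r}\to\Pi\overline{\mathrm{CE}}(V,V)$, $r\ge1$, $$f_r(w_1,\dots,w_r)(x_1,\dots,x_n)=m_{r+n}(w_1,\dots,w_r,x_1,\dots,x_n)\qquad(n\ge1),$$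 define an $L_\infty$-map $\mathbf f:V\to\overline{\mathrm{CE}}(V,V)$. It is characterized by the property that, for every formal cdga $A$, every $\xi\in\mathrm{MC}(V,A)$ is sent to an element of $\mathrm{MC}(\overline{\mathrm{CE}}(V,V),A)$, namely to the one given by $m^\xi-m$. That is, $\mathbf f$ has this property and is the only $L_\infty$-map $V\to\overline{\mathrm{CE}}(V,V)$ that has it. (b) If $(V,m)$ is a cyclic $L_\infty$-algebra, the same holds with $\overline{\mathrm{CE}}(V)$ in place of $\overline{\mathrm{CE}}(V,V)$. 2. (a) Let $(V,m)$ be an $A_\infty$-algebra. The maps $f_r:(\Pi V)^{r}\to\Pi\overline{\mathrm{Hoch}}(V,V)$, $r\ge1$, $$f_r(w_1,\dots,w_r)(x_1,\dots,x_n)=\sum_{\sigma\in S_r}\pm\, m_{r+n}(w_{\sigma(1)},\dots,w_{\sigma(r)}\,|\,x_1,\dots,x_n)\qquad(n\ge1),$$ where $m_{r+n}(w_1,\dots,w_r|x_1,\dots,x_n)=\sum\pm m_{r+n}(z_1,\dots,z_{r+n})$ is the sum over all $\binom{r+n}{r}$ shuffles $z$ of the sequences $w$ and $x$, define an $L_\infty$-map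 $\mathbf f:V\to\overline{\mathrm{Hoch}}(V,V)$. It is characterized, as in (1a), by sending every $\xi\in\mathrm{MC}(V,A)$, for every formal cdga $A$, to the element of $\mathrm{MC}(\overline{\mathrm{Hoch}}(V,V),A)$ given by $m^\xi-m$. (b) If $(V,m)$ is a cyclic $A_\infty$-algebra, the same holds with $\overline{\mathrm{CHoch}}(V,V)$ in place of $\overline{\mathrm{Hoch}}(V,V)$. (Included in the claim are the background facts that the four complexes are dglas, and that $\overline m$ is an $L_\infty$-structure.) -/

import Mathlib

open scoped TensorProduct

universe u v w

noncomputable section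

/-! ## Super vector spaces -/

section Super

variable {k : Type*} [Field k] {U : Type*} [AddCommGroup U] [Module k U]

/-- The sign `(-1)^i` of a parity `i`. -/
def psign (i : ZMod 2) : ℤ := if i = 0 then 1 else -1

/-- The projection of a `ℤ/2`-graded vector space onto its component of parity `i`. -/
def parityProj (𝒰 : ZMod 2 → Submodule k U) [DirectSum.Decomposition 𝒰] (i : ZMod 2) :
    U →ₗ[k] U :=
  (𝒰 i).subtype ∘ₗ DirectSum.component k (ZMod 2) (fun j => 𝒰 j) i ∘ₗ
    (DirectSum.decomposeLinearEquiv 𝒰).toLinearMap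

/-- The parity involution `x ↦ (-1)^|x| x`. -/
def parityInv (𝒰 : ZMod 2 → Submodule k U) [DirectSum.Decomposition 𝒰] : U →ₗ[k] U :=
  ∑ i : ZMod 2, psign i • parityProj 𝒰 i

/-- The map `x ↦ (-1)^(q|x|) x`: the Koszul sign for moving `x` past something of parity `q`. -/
def signTwist (𝒰 : ZMod 2 → Submodule k U) [DirectSum.Decomposition 𝒰] (q : ZMod 2) :
    U →ₗ[k] U :=
  if q = 0 then LinearMap.id else parityInv 𝒰

/-- The grading of the parity reversion `ΠV` (on the same underlying vector space). -/
def parityRev (𝒰 : ZMod 2 → Submodule k U) (i : ZMod 2) : Submodule k U := 𝒰 (i + 1)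

theorem parityProj_mem (𝒰 : ZMod 2 → Submodule k U) [DirectSum.Decomposition 𝒰]
    (i : ZMod 2) (x : U) : parityProj 𝒰 i x ∈ 𝒰 i :=
  Submodule.coe_mem _

theorem parityProj_eq (𝒰 : ZMod 2 → Submodule k U) [DirectSum.Decomposition 𝒰]
    (i : ZMod 2) (x : U) : parityProj 𝒰 i x = (DirectSum.decompose 𝒰 x i : U) := rfl

theorem parityProj_of_mem (𝒰 : ZMod 2 → Submodule k U) [DirectSum.Decomposition 𝒰]
    {i j : ZMod 2} {x : U} (hx : x ∈ 𝒰 j) :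
    parityProj 𝒰 i x = if i = j then x else 0 := by
  rw [parityProj_eq]
  split_ifs with h
  · subst h; exact DirectSum.decompose_of_mem_same 𝒰 hx
  · exact DirectSum.decompose_of_mem_ne 𝒰 hx (Ne.symm h)

theorem sum_parityProj (𝒰 : ZMod 2 → Submodule k U) [DirectSum.Decomposition 𝒰] (x : U) :
    ∑ i : ZMod 2, parityProj 𝒰 i x = x := by
  classical
  conv_rhs => rw [← DirectSum.sum_support_decompose 𝒰 x]
  simp only [parityProj_eq]
  refine (Finset.sum_subset (Finset.subset_univ _) ?_).symm
  intro i _ hi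
  simpa using hi

/-- A direct sum decomposition is the same thing as a family of projections. -/
@[reducible] def decompositionOfProj (𝒰 : ZMod 2 → Submodule k U) (P : ZMod 2 → U →ₗ[k] U)
    (hmem : ∀ i x, P i x ∈ 𝒰 i) (hsum : ∀ x, ∑ i, P i x = x)
    (hP : ∀ i j x, x ∈ 𝒰 j → P i x = if i = j then x else 0) :
    DirectSum.Decomposition 𝒰 :=
  DirectSum.Decomposition.ofLinearMap 𝒰
    (∑ i, DirectSum.lof k (ZMod 2) (fun j => 𝒰 j) i ∘ₗ (P i).codRestrict (𝒰 i) (hmem i))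
    (by
      ext x
      simp [hsum])
    (by
      ext j x : 2
      simp only [LinearMap.comp_apply, DirectSum.coeLinearMap_lof, LinearMap.sum_apply,
        LinearMap.id_apply]
      rw [Finset.sum_eq_single j]
      · congr 1
        ext
        simp [hP j j x x.2]
      · intro i _ hij
        have : (P i).codRestrict (𝒰 i) (hmem i) (x : U) = 0 := by
          ext
          simp [hP i j x x.2, hij]
        rw [this, map_zero]
      · simp)

instance parityRevDecomposition (𝒰 : ZMod 2 → Submodule k U) [DirectSum.Decomposition 𝒰] :
    DirectSum.Decomposition (parityRev 𝒰) :=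
  decompositionOfProj (parityRev 𝒰) (fun i => parityProj 𝒰 (i + 1))
    (fun i x => parityProj_mem 𝒰 (i + 1) x)
    (fun x => by
      conv_rhs => rw [← sum_parityProj 𝒰 x]
      exact Equiv.sum_comp (Equiv.addRight (1 : ZMod 2)) (fun i => parityProj 𝒰 i x))
    (fun i j x hx => by
      rw [parityProj_of_mem 𝒰 (j := j + 1) hx]
      simp)

end Super

/-! ## Cochains -/

section Cochains

variable (k : Type*) [Field k] (U W : Type*) [AddCommGroup U] [Module k U]
  [AddCommGroup W] [Module k W]

/-- A (possibly infinite) sum of multilinear maps `U^n → W`, `n = 0, 1, 2, …`. -/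
abbrev Cochain := ∀ n : ℕ, MultilinearMap k (fun _ : Fin n => U) W

variable {k U W}
variable (𝒰 : ZMod 2 → Submodule k U) (𝒲 : ZMod 2 → Submodule k W)

/-- `φ` has parity `q`: it maps arguments of parities `p 0, …, p (n-1)` to parity `∑ p + q`. -/
def HasParity (q : ZMod 2) (φ : Cochain k U W) : Prop :=
  ∀ (n : ℕ) (p : Fin n → ZMod 2) (x : Fin n → U), (∀ i, x i ∈ 𝒰 (p i)) →
    φ n x ∈ 𝒲 (∑ i, p i + q)

/-- The Koszul sign of the reordering `x 0, …, x (n-1) ↦ x (σ 0), …, x (σ (n-1))` of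
homogeneous elements of parities `p 0, …, p (n-1)`. -/
def koszulSign {n : ℕ} (p : Fin n → ZMod 2) (σ : Equiv.Perm (Fin n)) : ℤ :=
  ∏ i, ∏ j, if i < j ∧ σ j < σ i then psign (p (σ i) * p (σ j)) else 1

/-- Graded symmetry. -/
def GradedSymmetric (φ : Cochain k U W) : Prop :=
  ∀ (n : ℕ) (σ : Equiv.Perm (Fin n)) (p : Fin n → ZMod 2) (x : Fin n → U),
    (∀ i, x i ∈ 𝒰 (p i)) → φ n (fun i => x (σ i)) = koszulSign p σ • φ n x

/-- The cochains of parity `q`. -/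
def cochainGrading (q : ZMod 2) : Submodule k (Cochain k U W) where
  carrier := {φ | HasParity 𝒰 𝒲 q φ}
  add_mem' h h' n p x hx := Submodule.add_mem _ (h n p x hx) (h' n p x hx)
  zero_mem' _ _ _ _ := Submodule.zero_mem _
  smul_mem' c _ h n p x hx := Submodule.smul_mem _ c (h n p x hx)

variable [DirectSum.Decomposition 𝒰] [DirectSum.Decomposition 𝒲]

/-- The component of parity `q` of a cochain. -/
def cochainProj (q : ZMod 2) : Cochain k U W →ₗ[k] Cochain k U W where
  toFun φ n := ∑ p : Fin n → ZMod 2, (parityProj 𝒲 (∑ i, p i + q)).compMultilinearMap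
    ((φ n).compLinearMap fun i => parityProj 𝒰 (p i))
  map_add' φ ψ := by
    ext n x
    simp [Finset.sum_add_distrib]
  map_smul' c φ := by
    ext n x
    simp [Finset.smul_sum]

theorem sum_map_parityProj {n : ℕ} (φ : MultilinearMap k (fun _ : Fin n => U) W)
    (x : Fin n → U) :
    ∑ p : Fin n → ZMod 2, φ (fun i => parityProj 𝒰 (p i) (x i)) = φ x := by
  rw [← MultilinearMap.map_sum φ (fun i j => parityProj 𝒰 j (x i))]
  simp only [sum_parityProj]

theorem cochainProj_apply (q : ZMod 2) (φ : Cochain k U W) (n : ℕ) (x : Fin n → U) :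
    cochainProj 𝒰 𝒲 q φ n x = ∑ p : Fin n → ZMod 2,
      parityProj 𝒲 (∑ i, p i + q) (φ n fun i => parityProj 𝒰 (p i) (x i)) := by
  simp [cochainProj]

theorem cochainProj_apply_of_mem (q : ZMod 2) (φ : Cochain k U W) (n : ℕ) (p : Fin n → ZMod 2)
    (x : Fin n → U) (hx : ∀ i, x i ∈ 𝒰 (p i)) :
    cochainProj 𝒰 𝒲 q φ n x = parityProj 𝒲 (∑ i, p i + q) (φ n x) := by
  rw [cochainProj_apply, Finset.sum_eq_single p]
  · congr 2
    funext i
    simp [parityProj_of_mem 𝒰 (hx i)]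
  · intro p' _ hp'
    obtain ⟨i, hi⟩ : ∃ i, p' i ≠ p i := by
      by_contra h
      exact hp' (funext fun i => by by_contra h'; exact h ⟨i, h'⟩)
    rw [MultilinearMap.map_coord_zero (φ n) i (by simp [parityProj_of_mem 𝒰 (hx i), hi]), map_zero]
  · simp

instance cochainDecomposition : DirectSum.Decomposition (cochainGrading 𝒰 𝒲) :=
  decompositionOfProj (cochainGrading 𝒰 𝒲) (cochainProj 𝒰 𝒲)
    (fun q φ n p x hx => by
      rw [cochainProj_apply_of_mem 𝒰 𝒲 q φ n p x hx]
      exact parityProj_mem 𝒲 _ _)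
    (fun φ => by
      ext n x
      rw [Finset.sum_apply, sum_apply]
      simp only [cochainProj_apply]
      rw [Finset.sum_comm]
      rw [← sum_map_parityProj 𝒰 (φ n) x]
      refine Finset.sum_congr rfl fun p _ => ?_
      conv_rhs => rw [← sum_parityProj 𝒲 (φ n fun i => parityProj 𝒰 (p i) (x i))]
      exact Equiv.sum_comp (Equiv.addLeft (∑ i, p i))
        (fun i => parityProj 𝒲 i (φ n fun i => parityProj 𝒰 (p i) (x i))))
    (fun i j φ hφ => by
      ext n x
      rw [cochainProj_apply]
      have key : ∀ p : Fin n → ZMod 2,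
          parityProj 𝒲 (∑ l, p l + i) (φ n fun l => parityProj 𝒰 (p l) (x l)) =
            if i = j then φ n (fun l => parityProj 𝒰 (p l) (x l)) else 0 := fun p => by
        rw [parityProj_of_mem 𝒲 (hφ n p _ fun l => parityProj_mem 𝒰 _ _)]
        simp
      simp only [key]
      split_ifs
      · exact sum_map_parityProj 𝒰 (φ n) x
      · simp)

end Cochains

/-! ## Compositions of cochains and the associated brackets

A cochain `φ` on `U` with values in `U` is the same thing as a continuous derivation of the
completed tensor algebra of `U^*`, and a graded symmetric one is the same thing as a continuous
derivation of the completed symmetric algebra of `U^*`; the commutator of derivations is the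
commutator of the following compositions. -/

section Composition

variable {k : Type*} [Field k] {U W : Type*} [AddCommGroup U] [Module k U]
  [AddCommGroup W] [Module k W]
variable (𝒰 : ZMod 2 → Submodule k U) [DirectSum.Decomposition 𝒰]

/-- The Koszul sign of moving the arguments with index in `S` (in order) in front of the others
(in order). -/
def unshuffleSign {n : ℕ} (S : Finset (Fin n)) (p : Fin n → ZMod 2) : ℤ :=
  ∏ i ∈ S, ∏ j ∈ Sᶜ, if j < i then psign (p i * p j) else 1

/-- `(φ ∘ ψ)(x 0, …, x (n-1)) = ∑ ± φ(ψ(x_S), x_T)`, the sum over all decompositions of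
`{0, …, n-1}` into disjoint subsets `S` and `T = Sᶜ`, with the Koszul sign. -/
def symComp (φ : Cochain k U W) (ψ : Cochain k U U) : Cochain k U W := fun n =>
  ∑ S : Finset (Fin n), ∑ p : Fin n → ZMod 2, unshuffleSign S p •
    ((MultilinearMap.curryFinFinset k W U (s := S) rfl rfl).symm
      ((φ (Sᶜ.card + 1)).curryLeft.compMultilinearMap (ψ S.card))).compLinearMap
        fun i => parityProj 𝒰 (p i)

/-- `(φ ∘ ψ)(x 0, …, x (n-1)) = ∑ ± φ(x 0, …, x (a-1), ψ(x a, …, x b), x (b+1), …, x (n-1))`,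
the sum over all `a ≤ b`, with the sign `(-1)^(|ψ| (|x 0| + … + |x (a-1)|))`.
Used for `ψ` without constant term only. -/
def tensorComp (φ ψ : Cochain k U U) : Cochain k U U := fun n =>
  ∑ a : Fin n, ∑ b : Fin n, if a ≤ b then
    ∑ p : Fin n → ZMod 2,
      ((MultilinearMap.curryFinFinset k U U (s := Finset.Icc a b) rfl rfl).symm
        (((φ ((Finset.Icc a b)ᶜ.card + 1)).curryMid
            (Fin.ofNat ((Finset.Icc a b)ᶜ.card + 1) a)).compMultilinearMap
          (signTwist (cochainGrading 𝒰 𝒰) (∑ i ∈ Finset.Iio a, p i) ψ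
            (Finset.Icc a b).card))).compLinearMap
        fun i => parityProj 𝒰 (p i)
    else 0

/-- `symComp` as a bilinear operation. -/
def symCompₗ : Cochain k U U →ₗ[k] Cochain k U U →ₗ[k] Cochain k U U :=
  LinearMap.mk₂ k (symComp 𝒰)
    (fun φ φ' ψ => by
      ext n x
      simp [symComp, Finset.sum_add_distrib])
    (fun c φ ψ => by
      ext n x
      simp [symComp, Finset.smul_sum, smul_comm c])
    (fun φ ψ ψ' => by
      ext n x
      simp [symComp, Finset.sum_add_distrib])
    (fun c φ ψ => by
      ext n x
      simp [symComp, Finset.smul_sum, smul_comm c])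

/-- `tensorComp` as a bilinear operation. -/
def tensorCompₗ : Cochain k U U →ₗ[k] Cochain k U U →ₗ[k] Cochain k U U :=
  LinearMap.mk₂ k (tensorComp 𝒰)
    (fun φ φ' ψ => by
      ext n x
      simp only [tensorComp, Pi.add_apply, add_apply, sum_apply,
        ← Finset.sum_add_distrib]
      refine Finset.sum_congr rfl fun a _ => Finset.sum_congr rfl fun b _ => ?_
      split_ifs <;> simp [Finset.sum_add_distrib])
    (fun c φ ψ => by
      ext n x
      simp only [tensorComp, Pi.smul_apply, smul_apply, sum_apply,
        Finset.smul_sum]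
      refine Finset.sum_congr rfl fun a _ => Finset.sum_congr rfl fun b _ => ?_
      split_ifs <;> simp [Finset.smul_sum])
    (fun φ ψ ψ' => by
      ext n x
      simp only [tensorComp, Pi.add_apply, add_apply, sum_apply,
        ← Finset.sum_add_distrib]
      refine Finset.sum_congr rfl fun a _ => Finset.sum_congr rfl fun b _ => ?_
      split_ifs <;> simp [Finset.sum_add_distrib])
    (fun c φ ψ => by
      ext n x
      simp only [tensorComp, Pi.smul_apply, smul_apply, sum_apply,
        Finset.smul_sum]
      refine Finset.sum_congr rfl fun a _ => Finset.sum_congr rfl fun b _ => ?_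
      split_ifs <;> simp [Finset.smul_sum])

/-- The graded commutator `[φ, ψ] = φ ∘ ψ - (-1)^(|φ||ψ|) ψ ∘ φ` of a bilinear operation. -/
def superCommutator {g : Type*} [AddCommGroup g] [Module k g] (𝒢 : ZMod 2 → Submodule k g)
    [DirectSum.Decomposition 𝒢] (comp : g →ₗ[k] g →ₗ[k] g) : g →ₗ[k] g →ₗ[k] g :=
  comp - ∑ q : ZMod 2, ∑ q' : ZMod 2,
    psign (q * q') • comp.flip.compl₁₂ (parityProj 𝒢 q) (parityProj 𝒢 q')

end Composition

/-! ## Differential graded Lie algebras, `L_∞`-algebras and `A_∞`-algebras -/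

section Infinity

variable {k : Type*} [Field k]

/-- The bracket `br` and the differential `d` restrict to the graded subspace `S` of `g` and make
it a differential graded Lie algebra. -/
structure IsDGLAOn {g : Type*} [AddCommGroup g] [Module k g] (𝒢 : ZMod 2 → Submodule k g)
    [DirectSum.Decomposition 𝒢] (d : g →ₗ[k] g) (br : g →ₗ[k] g →ₗ[k] g)
    (S : Submodule k g) : Prop where
  graded : ∀ q, ∀ x ∈ S, parityProj 𝒢 q x ∈ S
  d_mem : ∀ x ∈ S, d x ∈ S
  br_mem : ∀ x ∈ S, ∀ y ∈ S, br x y ∈ S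
  d_odd : ∀ i, ∀ x ∈ S, x ∈ 𝒢 i → d x ∈ 𝒢 (i + 1)
  br_even : ∀ i j, ∀ x ∈ S, ∀ y ∈ S, x ∈ 𝒢 i → y ∈ 𝒢 j → br x y ∈ 𝒢 (i + j)
  d_d : ∀ x ∈ S, d (d x) = 0
  leibniz : ∀ i, ∀ x ∈ S, ∀ y ∈ S, x ∈ 𝒢 i →
    d (br x y) = br (d x) y + psign i • br x (d y)
  antisymm : ∀ i j, ∀ x ∈ S, ∀ y ∈ S, x ∈ 𝒢 i → y ∈ 𝒢 j →
    br x y = -(psign (i * j) • br y x)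
  jacobi : ∀ i j, ∀ x ∈ S, ∀ y ∈ S, ∀ z ∈ S, x ∈ 𝒢 i → y ∈ 𝒢 j →
    br x (br y z) = br (br x y) z + psign (i * j) • br y (br x z)

/-- The structure maps on `Πg` of a differential graded Lie algebra `g` regarded as an
`L_∞`-algebra: `l_1(Πx) = -Π(dx)`, `l_2(Πx, Πy) = (-1)^|x| Π[x, y]`, and `l_n = 0` otherwise. -/
def dglaStructure {g : Type*} [AddCommGroup g] [Module k g] (𝒢 : ZMod 2 → Submodule k g)
    [DirectSum.Decomposition 𝒢] (d : g →ₗ[k] g) (br : g →ₗ[k] g →ₗ[k] g) : Cochain k g g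
  | 1 => MultilinearMap.ofSubsingleton k g g 0 (-d)
  | 2 => LinearMap.uncurryLeft (n := 1) (M := fun _ => g)
      ((MultilinearMap.ofSubsingletonₗ k k g g (0 : Fin 1)).toLinearMap ∘ₗ br ∘ₗ parityInv 𝒢)
  | _ => 0

variable {U W : Type*} [AddCommGroup U] [Module k U] [AddCommGroup W] [Module k W]
variable (𝒰 : ZMod 2 → Submodule k U) [DirectSum.Decomposition 𝒰]
  (𝒲 : ZMod 2 → Submodule k W)

/-- `m` is the family of structure maps, on `U = ΠV`, of an `L_∞`-algebra `V`. -/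
structure IsLInfty (m : Cochain k U U) : Prop where
  zero : m 0 = 0
  symm : GradedSymmetric 𝒰 m
  odd : HasParity 𝒰 𝒰 1 m
  square : symComp 𝒰 m m = 0

/-- `m` is the family of structure maps, on `U = ΠV`, of an `A_∞`-algebra `V`. -/
structure IsAInfty (m : Cochain k U U) : Prop where
  zero : m 0 = 0
  odd : HasParity 𝒰 𝒰 1 m
  square : tensorComp 𝒰 m m = 0

/-- The indices which `c` puts into the block `a`. -/
def block {n j : ℕ} (c : Fin n → Fin j) (a : Fin j) : Finset (Fin n) :=
  Finset.univ.filter fun i => c i = a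

/-- The Koszul sign of sorting the arguments into the blocks of `c`. -/
def blockSign {n j : ℕ} (c : Fin n → Fin j) (p : Fin n → ZMod 2) : ℤ :=
  ∏ i, ∏ i', if i < i' ∧ c i' < c i then psign (p i * p i') else 1

/-- `f` is the family of components of an `L_∞`-map, `m` and `l` being the structure maps of the
source (on `U`) and of the target (on `W`). The right-hand side of the main equation is
`∑_j 1/j! ∑ ± l_j(f(x_{B_0}), …, f(x_{B_{j-1}}))`, the sum over all ordered partitions of the
arguments into `j` blocks (an empty block contributes zero, since `f` has no constant term). -/
structure IsLInftyMap (m : Cochain k U U) (l : Cochain k W W) (f : Cochain k U W) : Prop where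
  zero : f 0 = 0
  symm : GradedSymmetric 𝒰 f
  even : HasParity 𝒰 𝒲 0 f
  map : ∀ (n : ℕ) (p : Fin n → ZMod 2) (x : Fin n → U), (∀ i, x i ∈ 𝒰 (p i)) →
    symComp 𝒰 f m n x =
      ∑ j ∈ Finset.range (n + 1), ((Nat.factorial j : k))⁻¹ • ∑ c : Fin n → Fin j,
        blockSign c p • l j fun a =>
          f (block c a).card fun i => x ((block c a).orderEmbOfFin rfl i)

/-- `x ↦ ± φ(x (τ 0), …, x (τ (n-1)))` with the Koszul sign. -/
def permute {n : ℕ} (τ : Equiv.Perm (Fin n)) (φ : MultilinearMap k (fun _ : Fin n => U) W) :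
    MultilinearMap k (fun _ : Fin n => U) W :=
  ∑ p : Fin n → ZMod 2,
    koszulSign p τ • (φ.domDomCongr τ).compLinearMap fun i => parityProj 𝒰 (p i)

/-- The `L_∞`-structure associated with an `A_∞`-structure: the sum over all permutations of the
arguments, with Koszul signs. -/
def symmetrization (m : Cochain k U U) : Cochain k U U := fun n =>
  ∑ σ : Equiv.Perm (Fin n), permute 𝒰 σ (m n)

/-- `z ↦ z ∘ τ` is a shuffle of `z 0, …, z (r-1)` and `z r, …, z (r+n-1)`. -/
def IsShuffle (r n : ℕ) (τ : Equiv.Perm (Fin (r + n))) : Prop :=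
  ∀ i j : Fin (r + n), i < j → ((j : ℕ) < r ∨ r ≤ (i : ℕ)) → τ.symm i < τ.symm j

open Classical in
/-- The map `(w 1, …, w r, x 1, …, x n) ↦ φ(w 1, …, w r | x 1, …, x n) = ∑ ± φ(z 1, …, z (r+n))`,
the sum over all shuffles `z` of the sequences `w` and `x`. -/
def shuffleSum (r n : ℕ) (φ : MultilinearMap k (fun _ : Fin (r + n) => U) W) :
    MultilinearMap k (fun _ : Fin (r + n) => U) W :=
  ∑ τ : Equiv.Perm (Fin (r + n)) with IsShuffle r n τ, permute 𝒰 τ φ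

/-- A permutation of the first `r` of `r + n` arguments. -/
def leftPerm (r n : ℕ) (σ : Equiv.Perm (Fin r)) : Equiv.Perm (Fin (r + n)) :=
  finSumFinEquiv.permCongr (Equiv.sumCongr σ (Equiv.refl (Fin n)))

/-- `w ↦ (x ↦ φ(w 1, …, w r, x 1, …, x n))`. -/
def curryArgs (r n : ℕ) (φ : MultilinearMap k (fun _ : Fin (r + n) => U) W) :
    MultilinearMap k (fun _ : Fin r => U) (MultilinearMap k (fun _ : Fin n => U) W) :=
  (φ.domDomCongr finSumFinEquiv.symm).currySum

/-- The maps `f_r(w 1, …, w r)(x 1, …, x n) = m_{r+n}(w 1, …, w r, x 1, …, x n)`, `r, n ≥ 1`. -/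
def lInftyTwistingMap (m : Cochain k U U) : Cochain k U (Cochain k U U) := fun r =>
  if r = 0 then 0 else MultilinearMap.pi fun n => if n = 0 then 0 else
    curryArgs r n (m (r + n))

/-- The maps
`f_r(w 1, …, w r)(x 1, …, x n) = ∑_σ ± m_{r+n}(w (σ 1), …, w (σ r) | x 1, …, x n)`, `r, n ≥ 1`. -/
def aInftyTwistingMap (m : Cochain k U U) : Cochain k U (Cochain k U U) := fun r =>
  if r = 0 then 0 else MultilinearMap.pi fun n => if n = 0 then 0 else
    curryArgs r n (∑ σ : Equiv.Perm (Fin r),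
      permute 𝒰 (leftPerm r n σ) (shuffleSum 𝒰 r n (m (r + n))))

/-- The `L_∞`-structure on the parity reversion of the space of cochains on `U`, with the
commutator bracket of `comp` and the differential `[m, -]`. -/
def deformationStructure (comp : Cochain k U U →ₗ[k] Cochain k U U →ₗ[k] Cochain k U U)
    (m : Cochain k U U) : Cochain k (Cochain k U U) (Cochain k U U) :=
  dglaStructure (cochainGrading 𝒰 𝒰) (superCommutator (cochainGrading 𝒰 𝒰) comp m)
    (superCommutator (cochainGrading 𝒰 𝒰) comp)

end Infinity

/-! ## Formal cdgas and Maurer-Cartan elements -/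

/-- A finite-dimensional cdga obtained by adjoining a unit to a nilpotent non-unital cdga
(the augmentation ideal, i.e. the kernel of `aug`). -/
structure NilpotentCdga (k : Type u) [Field k] where
  carrier : Type v
  [ring : Ring carrier]
  [algebra : Algebra k carrier]
  gr : ZMod 2 → Submodule k carrier
  [gradedAlgebra : GradedAlgebra gr]
  [finiteDimensional : FiniteDimensional k carrier]
  graded_comm : ∀ i j, ∀ a ∈ gr i, ∀ b ∈ gr j, a * b = psign (i * j) • (b * a)
  d : carrier →ₗ[k] carrier
  d_odd : ∀ i, ∀ a ∈ gr i, d a ∈ gr (i + 1)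
  d_d : ∀ a, d (d a) = 0
  leibniz : ∀ i, ∀ a ∈ gr i, ∀ b, d (a * b) = d a * b + psign i • (a * d b)
  aug : carrier →ₐ[k] k
  aug_d : ∀ a, aug a = 0 → aug (d a) = 0
  nilpotent : ∃ N : ℕ, (LinearMap.ker aug.toLinearMap) ^ N = ⊥

attribute [instance] NilpotentCdga.ring NilpotentCdga.algebra NilpotentCdga.gradedAlgebra
  NilpotentCdga.finiteDimensional

/-- The augmentation ideal. -/
def NilpotentCdga.plus {k : Type u} [Field k] (A : NilpotentCdga.{u, v} k) :
    Submodule k A.carrier :=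
  LinearMap.ker A.aug.toLinearMap

/-- A formal cdga: (the inverse limit of) an inverse system, over a directed index set, of
finite-dimensional cdgas as above. -/
structure FormalCdga (k : Type u) [Field k] where
  index : Type w
  [preorder : Preorder index]
  [directed : IsDirectedOrder index]
  [nonempty : Nonempty index]
  level : index → NilpotentCdga.{u, v} k
  map : ∀ {i j : index}, i ≤ j → (level j).carrier →ₐ[k] (level i).carrier
  map_gr : ∀ {i j : index} (h : i ≤ j) (q : ZMod 2), ∀ a ∈ (level j).gr q,
    map h a ∈ (level i).gr q
  map_d : ∀ {i j : index} (h : i ≤ j) (a : (level j).carrier),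
    map h ((level j).d a) = (level i).d (map h a)
  map_refl : ∀ (i : index) (a : (level i).carrier), map (le_refl i) a = a
  map_trans : ∀ {i j l : index} (h : i ≤ j) (h' : j ≤ l) (a : (level l).carrier),
    map h (map h' a) = map (h.trans h') a

attribute [instance] FormalCdga.preorder

/-- `ξ` is an even element of `U ⊗ A_+`, the inverse limit of the spaces `U ⊗ (A_j)_+`. -/
structure IsEvenElement {k : Type u} [Field k] {U : Type*} [AddCommGroup U] [Module k U]
    (𝒰 : ZMod 2 → Submodule k U) (A : FormalCdga.{u, v, w} k)
    (ξ : ∀ j, U ⊗[k] (A.level j).carrier) : Prop where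
  compatible : ∀ {i j : A.index} (h : i ≤ j),
    LinearMap.lTensor U (A.map h).toLinearMap (ξ j) = ξ i
  mem_plus : ∀ j, ξ j ∈ LinearMap.range (LinearMap.lTensor U (A.level j).plus.subtype)
  even : ∀ j, ξ j ∈ ⨆ q : ZMod 2,
    LinearMap.range (TensorProduct.map (𝒰 q).subtype ((A.level j).gr q).subtype)

section MaurerCartan

variable {k : Type u} [Field k] {U W : Type*} [AddCommGroup U] [Module k U]
  [AddCommGroup W] [Module k W]
variable (𝒰 : ZMod 2 → Submodule k U) [DirectSum.Decomposition 𝒰]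

/-- `(w ⊗ b) ⊗ a ↦ w ⊗ (a * b)`. -/
def insertCoeff (W : Type*) [AddCommGroup W] [Module k W] (A : NilpotentCdga.{u, v} k) :
    (W ⊗[k] A.carrier) ⊗[k] A.carrier →ₗ[k] W ⊗[k] A.carrier :=
  LinearMap.lTensor W
      (LinearMap.mul' k A.carrier ∘ₗ (TensorProduct.comm k A.carrier A.carrier).toLinearMap) ∘ₗ
    (TensorProduct.assoc k W A.carrier A.carrier).toLinearMap

/-- The `A`-multilinear extension `φ^A` of a multilinear map `φ`, applied to elements of `U ⊗ A`:
`φ^A(x 1 ⊗ a 1, …, x n ⊗ a n) = ± φ(x 1, …, x n) ⊗ a 1 ⋯ a n`, where the Koszul sign is that of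
moving every `a i` to the right past all the `x j`, `j > i`. -/
def extendScalars (A : NilpotentCdga.{u, v} k) : (n : ℕ) → (Fin n → U ⊗[k] A.carrier) →
    (MultilinearMap k (fun _ : Fin n => U) W →ₗ[k] W ⊗[k] A.carrier)
  | 0, _ =>
    { toFun := fun φ => φ Fin.elim0 ⊗ₜ[k] (1 : A.carrier)
      map_add' := fun φ φ' => by simp [TensorProduct.add_tmul]
      map_smul' := fun c φ => by simp [TensorProduct.smul_tmul'] }
  | n + 1, z =>
    { toFun := fun φ => ∑ q : ZMod 2, insertCoeff W A (TensorProduct.map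
          (extendScalars A n (fun i => LinearMap.rTensor A.carrier (signTwist 𝒰 q) (z i.succ)) ∘ₗ
            φ.curryLeft)
          (parityProj A.gr q) (z 0))
      map_add' := fun φ φ' => by
        have h : (φ + φ').curryLeft = φ.curryLeft + φ'.curryLeft := rfl
        simp only [h, LinearMap.comp_add, TensorProduct.map_add_left, LinearMap.add_apply,
          map_add, Finset.sum_add_distrib]
      map_smul' := fun c φ => by
        have h : (c • φ).curryLeft = c • φ.curryLeft := rfl
        simp only [h, LinearMap.comp_smul, TensorProduct.map_smul_left, LinearMap.smul_apply,
          map_smul, Finset.smul_sum, RingHom.id_apply] }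

/-- The differential of `U ⊗ A` induced by that of `A`: `x ⊗ a ↦ (-1)^|x| x ⊗ da`. -/
def coeffDiff (A : NilpotentCdga.{u, v} k) : U ⊗[k] A.carrier →ₗ[k] U ⊗[k] A.carrier :=
  TensorProduct.map (parityInv 𝒰) A.d

/-- `ξ ∈ MC(V, A)` for the `L_∞`-algebra `V` with structure maps `m` on `U = ΠV`:
`d_A ξ + ∑_{i ≥ 1} 1/i! m_i(ξ, …, ξ) = 0` (a finite sum in each `U ⊗ A_j`). -/
structure IsLInftyMC (m : Cochain k U U) (A : FormalCdga.{u, v, w} k)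
    (ξ : ∀ j, U ⊗[k] (A.level j).carrier) : Prop extends IsEvenElement 𝒰 A ξ where
  eq : ∀ j, coeffDiff 𝒰 (A.level j) (ξ j) + ∑ᶠ i : ℕ, ((Nat.factorial (i + 1) : k))⁻¹ •
    extendScalars 𝒰 (A.level j) (i + 1) (fun _ => ξ j) (m (i + 1)) = 0

/-- `ξ ∈ MC(V, A)` for the `A_∞`-algebra `V` with structure maps `m` on `U = ΠV`:
`d_A ξ + ∑_{i ≥ 1} m_i(ξ, …, ξ) = 0`. -/
structure IsAInftyMC (m : Cochain k U U) (A : FormalCdga.{u, v, w} k)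
    (ξ : ∀ j, U ⊗[k] (A.level j).carrier) : Prop extends IsEvenElement 𝒰 A ξ where
  eq : ∀ j, coeffDiff 𝒰 (A.level j) (ξ j) + ∑ᶠ i : ℕ,
    extendScalars 𝒰 (A.level j) (i + 1) (fun _ => ξ j) (m (i + 1)) = 0

/-- The image `∑_{r ≥ 1} 1/r! f_r(ξ, …, ξ)` of `ξ` under an `L_∞`-map with components `f`. -/
def pushforward (f : Cochain k U W) (A : FormalCdga.{u, v, w} k)
    (ξ : ∀ j, U ⊗[k] (A.level j).carrier) (j : A.index) : W ⊗[k] (A.level j).carrier :=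
  ∑ᶠ r : ℕ, ((Nat.factorial (r + 1) : k))⁻¹ •
    extendScalars 𝒰 (A.level j) (r + 1) (fun _ => ξ j) (f (r + 1))

/-- The structure maps of the twisting of an `L_∞`-algebra by `ξ`:
`m^ξ_n(x 1, …, x n) = ∑_i 1/i! m_{i+n}(ξ, …, ξ, x 1, …, x n)`. -/
def lInftyTwist (m : Cochain k U U) (A : NilpotentCdga.{u, v} k) (ξ : U ⊗[k] A.carrier) (n : ℕ)
    (x : Fin n → U ⊗[k] A.carrier) : U ⊗[k] A.carrier :=
  ∑ᶠ i : ℕ, ((Nat.factorial i : k))⁻¹ •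
    extendScalars 𝒰 A (i + n) (Fin.append (fun _ : Fin i => ξ) x) (m (i + n))

open Classical in
/-- The structure maps of the twisting of an `A_∞`-algebra by `ξ`:
`m^ξ_n(x 1, …, x n) = ∑_i ∑ m_{i+n}(z 1, …, z (i+n))`, the inner sum over all sequences `z` that
contain `x 1, …, x n` in order together with `i` copies of `ξ`. -/
def aInftyTwist (m : Cochain k U U) (A : NilpotentCdga.{u, v} k) (ξ : U ⊗[k] A.carrier) (n : ℕ)
    (x : Fin n → U ⊗[k] A.carrier) : U ⊗[k] A.carrier :=
  ∑ᶠ i : ℕ, ∑ τ : Equiv.Perm (Fin (i + n)) with IsShuffle i n τ,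
    extendScalars 𝒰 A (i + n) (fun l => Fin.append (fun _ : Fin i => ξ) x (τ l)) (m (i + n))

/-- The `A`-valued cochain `x ↦ ± φ(x 1, …, x n) ⊗ a` given by `φ ⊗ a`, with the sign
`(-1)^(|a| (|x 1| + … + |x n|))`. -/
def evalCochain (A : NilpotentCdga.{u, v} k) (n : ℕ) (x : Fin n → U) :
    Cochain k U U ⊗[k] A.carrier →ₗ[k] U ⊗[k] A.carrier :=
  ∑ q : ZMod 2, TensorProduct.map
    ({ toFun := fun φ => φ n fun i => signTwist 𝒰 q (x i)
       map_add' := fun _ _ => rfl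
       map_smul' := fun _ _ => rfl } : Cochain k U U →ₗ[k] U)
    (parityProj A.gr q)

/-- `f` sends every Maurer-Cartan element `ξ ∈ MC(V, A)`, for every formal cdga `A`, to a
Maurer-Cartan element of `S` (a sub-dgla of the dgla of cochains with structure maps `l`), namely
to `m^ξ - m`. Here `isMC` and `twist` are the Maurer-Cartan condition and the twisting for `m`. -/
def SendsMCToTwist (l : Cochain k (Cochain k U U) (Cochain k U U))
    (S : Submodule k (Cochain k U U))
    (isMC : ∀ A : FormalCdga.{u, v, w} k, (∀ j, U ⊗[k] (A.level j).carrier) → Prop)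
    (twist : ∀ A : NilpotentCdga.{u, v} k, U ⊗[k] A.carrier → ∀ n : ℕ,
      (Fin n → U ⊗[k] A.carrier) → U ⊗[k] A.carrier)
    (m : Cochain k U U) (f : Cochain k U (Cochain k U U)) : Prop :=
  ∀ (A : FormalCdga.{u, v, w} k) (ξ : ∀ j, U ⊗[k] (A.level j).carrier), isMC A ξ →
    IsLInftyMC (parityRev (cochainGrading 𝒰 𝒰)) l A (pushforward 𝒰 f A ξ) ∧
    ∀ j, pushforward 𝒰 f A ξ j ∈ LinearMap.range (LinearMap.rTensor (A.level j).carrier S.subtype) ∧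
      ∀ (n : ℕ) (x : Fin (n + 1) → U),
        evalCochain 𝒰 (A.level j) (n + 1) x (pushforward 𝒰 f A ξ j) =
          twist (A.level j) (ξ j) (n + 1) (fun i => x i ⊗ₜ[k] (1 : (A.level j).carrier)) -
            m (n + 1) x ⊗ₜ[k] (1 : (A.level j).carrier)

/-- Let `S` be a space of cochains on `U = ΠV` which, with the commutator bracket of `comp` and the
differential `[m, -]`, is a differential graded Lie algebra, and let `V` be regarded as an
`L_∞`-algebra with structure maps `mL`. Then `f` consists of the components of an `L_∞`-map
`V → S`, which is characterized by sending every Maurer-Cartan element `ξ` of `V` to the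
Maurer-Cartan element `m^ξ - m` of `S`. -/
structure IsTwistingLInftyMap
    (comp : Cochain k U U →ₗ[k] Cochain k U U →ₗ[k] Cochain k U U) (m mL : Cochain k U U)
    (S : Submodule k (Cochain k U U))
    (isMC : ∀ A : FormalCdga.{u, v, w} k, (∀ j, U ⊗[k] (A.level j).carrier) → Prop)
    (twist : ∀ A : NilpotentCdga.{u, v} k, U ⊗[k] A.carrier → ∀ n : ℕ,
      (Fin n → U ⊗[k] A.carrier) → U ⊗[k] A.carrier)
    (f : Cochain k U (Cochain k U U)) : Prop where
  source : IsLInfty 𝒰 mL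
  target : IsDGLAOn (cochainGrading 𝒰 𝒰) (superCommutator (cochainGrading 𝒰 𝒰) comp m)
    (superCommutator (cochainGrading 𝒰 𝒰) comp) S
  isMap : IsLInftyMap 𝒰 (parityRev (cochainGrading 𝒰 𝒰)) mL (deformationStructure 𝒰 comp m) f
  mem : ∀ (r : ℕ) (x : Fin r → U), f r x ∈ S
  sends : SendsMCToTwist 𝒰 (deformationStructure 𝒰 comp m) S isMC twist m f
  unique : ∀ g : Cochain k U (Cochain k U U),
    IsLInftyMap 𝒰 (parityRev (cochainGrading 𝒰 𝒰)) mL (deformationStructure 𝒰 comp m) g →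
    (∀ (r : ℕ) (x : Fin r → U), g r x ∈ S) →
    SendsMCToTwist 𝒰 (deformationStructure 𝒰 comp m) S isMC twist m g → g = f

end MaurerCartan

/-! ## The truncated complexes and their cyclic versions -/

section Complexes

variable {k : Type*} [Field k] {V : Type*} [AddCommGroup V] [Module k V]

/-- The underlying space of the truncated Hochschild complex: cochains without constant term. -/
def truncHoch (k V : Type*) [Field k] [AddCommGroup V] [Module k V] :
    Submodule k (Cochain k V V) where
  carrier := {φ | φ 0 = 0}
  add_mem' h h' := by
    simp only [Set.mem_ofPred_eq] at h h' ⊢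
    simp [h, h']
  zero_mem' := rfl
  smul_mem' c φ h := by
    simp only [Set.mem_ofPred_eq] at h ⊢
    simp [h]

/-- The underlying space of the truncated Chevalley-Eilenberg complex: graded symmetric cochains
without constant term, on `ΠV`. -/
def truncCE (𝒱 : ZMod 2 → Submodule k V) : Submodule k (Cochain k V V) where
  carrier := {φ | φ 0 = 0 ∧ GradedSymmetric (parityRev 𝒱) φ}
  add_mem' h h' := by
    refine ⟨by simp [h.1, h'.1], fun n σ p x hx => ?_⟩
    simp [h.2 n σ p x hx, h'.2 n σ p x hx]
  zero_mem' := ⟨rfl, fun n σ p x hx => by simp⟩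
  smul_mem' c φ h := by
    refine ⟨by simp [h.1], fun n σ p x hx => ?_⟩
    simp [h.2 n σ p x hx, smul_comm c]

/-- `B` is a graded symmetric non-degenerate inner product of parity `c` on `V`. -/
structure IsInnerProduct (𝒱 : ZMod 2 → Submodule k V) (B : V →ₗ[k] V →ₗ[k] k) (c : ZMod 2) :
    Prop where
  homogeneous : ∀ i j, ∀ a ∈ 𝒱 i, ∀ b ∈ 𝒱 j, i + j ≠ c → B a b = 0
  symm : ∀ i j, ∀ a ∈ 𝒱 i, ∀ b ∈ 𝒱 j, B a b = psign (i * j) • B b a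
  nondegenerate : B.Nondegenerate

/-- The form `(Πa, Πb) ↦ (-1)^|a| ⟨a, b⟩` on `ΠV` induced by an inner product on `V`; it is graded
antisymmetric. -/
def shiftedForm (𝒱 : ZMod 2 → Submodule k V) [DirectSum.Decomposition 𝒱]
    (B : V →ₗ[k] V →ₗ[k] k) : V →ₗ[k] V →ₗ[k] k :=
  B ∘ₗ parityInv 𝒱

/-- The cochains `φ` on `ΠV` for which `⟨φ(x 0, …, x (n-1)), x n⟩` is invariant under cyclic
permutations of `x 0, …, x n ∈ ΠV` (with the Koszul sign). -/
def cyclicCochains (𝒱 : ZMod 2 → Submodule k V) [DirectSum.Decomposition 𝒱]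
    (B : V →ₗ[k] V →ₗ[k] k) : Submodule k (Cochain k V V) where
  carrier := {φ | ∀ (n : ℕ) (p : Fin (n + 1) → ZMod 2) (x : Fin (n + 1) → V),
    (∀ i, x i ∈ parityRev 𝒱 (p i)) →
      shiftedForm 𝒱 B (φ n fun i => x i.castSucc) (x (Fin.last n)) =
        psign (p 0 * ∑ i : Fin n, p i.succ) • shiftedForm 𝒱 B (φ n fun i => x i.succ) (x 0)}
  add_mem' h h' n p x hx := by
    simp [h n p x hx, h' n p x hx]
  zero_mem' n p x hx := by simp
  smul_mem' c φ h n p x hx := by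
    simp [h n p x hx, mul_left_comm]

end Complexes

end

open scoped TensorProduct

noncomputable section

set_option linter.unusedSectionVars false

/-! ## Signs -/

/-! Cochains are treated as functions of lists (`ev`) that are additive in every entry, with parity
expressed by twisting the entries with signs. In this language composition (`lcomp`) satisfies the
graded pre-Lie identity `lcomp_lcomp`: the difference of (f∘ψ)∘χ and f∘(ψ∘χ) consists of the terms
in which ψ and χ act on disjoint blocks, so it is graded symmetric in ψ and χ. The dgla and
`L_∞`-map statements all rest on this one identity.

A vector w is a cochain with nothing but a constant term, and composing with it inserts w in all
possible places (`lcomp_constFun`). With one constant, the pre-Lie identity says that insertion is a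
derivation of composition; with two, that insertions commute up to sign. Inserting w_1, …, w_r one
after the other into m produces all shuffles of all permutations of the w_i with the remaining
arguments. This is f_r(w) up to its constant term (`ev_aInftyTwistingMap`), and it is the
symmetrized operation m̄(w) when no argument remains (`symmetrization_apply`). Apply the Leibniz
rule for iterated insertions to m∘m = 0 and split off the constant term of the inner factor
(`liter_lcomp_eq`): the result is ∑ ± f(m̄(w_S), w_T) + ∑ ± f(w_T)∘f(w_S) = 0, where f of no
arguments is read as m. The summands with S or T empty make up [m, f(w)], the others half of the
bracket terms, and this is the equation of an `L_∞`-map into a dgla (`isLInftyMap_twisting`).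

The `L_∞` case is reduced to the same computation. A graded symmetric m is the symmetrization of the
cochain with components m_n/n!; symmetrization carries ∘ to • (`symmetrization_tensorComp`) and the
twisting map of the cochain m_n/n! to that of m. The cochain m_n/n! need not square to zero, but the
symmetrization of its square does, and this suffices after the Leibniz rule has been symmetrized.
The pre-Lie identity for • is transported in the same way.

For cyclic cochains, rotating the arguments of φ∘ψ spoils only those terms in which the inner block
contains the argument that is rotated; they cancel against terms of ψ∘φ, so commutators of cyclic
cochains are cyclic (`ListCyclic.bracket`). Insertion of w is the commutator with a constant, which
is trivially cyclic, so the twisting maps take cyclic values.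

A Maurer-Cartan element is, at each finite-dimensional level, a finite sum of even pure tensors
("letters"), and the sums over ξ, …, ξ become sums over words weighted by 1/n!. Evenness absorbs the
Koszul signs (`usum_eq_psum`), and the exponential formula `esum_psum` turns sums over splittings
into double sums. Writing f(e^ξ) for ∑ 1/n! f_n(ξ, …, ξ), the chain rule d f(e^ξ) = f(dξ, e^ξ) and
the equation for f turn the Maurer-Cartan expression of the image into f(dξ + m(e^ξ), e^ξ), which is
zero (`IsLInftyMap.mc_esum`). The image is m^ξ − m because copies of the even ξ are permuted and
shuffled without signs, so that the factorials cancel.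

Uniqueness needs enough Maurer-Cartan elements. Given homogeneous x_1, …, x_r, take square zero
generators t_i with |t_i| = |x_i|. The element L = ∑ x_i ⊗ t_i need not satisfy the equation, so the
algebra is enlarged by elements θt with d(θt) = t, one for every nontrivial monomial t; θ itself is
left out, since dθ would be 1. Multiplication by θ is a homotopy h for the projection π that kills
these new elements. Put ξ = L − h(m(e^L)). Its curvature is killed by π, and the Bianchi identity
together with the homotopy forces it to vanish (`Contraction.exists_mc`). The coefficient of t_1⋯t_r
factors through π, so it reads off f_r(x_1, …, x_r), up to a nonzero scalar, from the image of ξ.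
Two maps with the same values on Maurer-Cartan elements therefore coincide (`eq_of_sendsMCToTwist`).
-/

theorem psign_add (i j : ZMod 2) : psign (i + j) = psign i * psign j := by
  revert i j; decide

theorem psign_zero : psign 0 = 1 := rfl

theorem psign_mul_self (i : ZMod 2) : psign i * psign i = 1 := by
  revert i; decide

theorem psign_smul_smul {M : Type*} [AddCommGroup M] (i : ZMod 2) (x : M) :
    psign i • psign i • x = x := by
  rw [smul_smul, psign_mul_self, one_smul]

/-! ## Sums over the splittings of a list -/

section Splittings

variable {α β M N : Type*} [AddCommMonoid M] [AddCommMonoid N]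

/-- The sum of `F a b` over all decompositions `l = a ++ b`. -/
def ssum (F : List α → List α → M) : List α → M
  | [] => F [] []
  | x :: l => F [] (x :: l) + ssum (fun a b => F (x :: a) b) l
termination_by l => l.length

@[simp] theorem ssum_nil (F : List α → List α → M) : ssum F [] = F [] [] := by
  rw [ssum]

theorem ssum_cons (F : List α → List α → M) (x : α) (l : List α) :
    ssum F (x :: l) = F [] (x :: l) + ssum (fun a b => F (x :: a) b) l := by
  rw [ssum]

theorem ssum_add (F G : List α → List α → M) (l : List α) :
    ssum (fun a b => F a b + G a b) l = ssum F l + ssum G l := by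
  induction l generalizing F G with
  | nil => simp
  | cons x l ih => simp only [ssum_cons, ih]; abel

theorem map_ssum {Φ : Type*} [FunLike Φ M N] [AddMonoidHomClass Φ M N] (φ : Φ)
    (F : List α → List α → M) (l : List α) :
    φ (ssum F l) = ssum (fun a b => φ (F a b)) l := by
  induction l generalizing F with
  | nil => simp
  | cons x l ih => simp only [ssum_cons, map_add, ih]

theorem ssum_zero (l : List α) : ssum (fun _ _ => (0 : M)) l = 0 := by
  induction l with
  | nil => simp
  | cons x l ih => simp [ssum_cons, ih]

theorem ssum_congr_mem {F G : List α → List α → M} (l : List α)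
    (h : ∀ a b, a ++ b = l → F a b = G a b) : ssum F l = ssum G l := by
  induction l generalizing F G with
  | nil => simpa using h [] [] rfl
  | cons x l ih =>
    rw [ssum_cons, ssum_cons, h [] (x :: l) rfl,
      ih (fun a b hab => h (x :: a) b (by rw [List.cons_append, hab]))]

theorem ssum_map (g : α → β) (F : List β → List β → M) (l : List α) :
    ssum F (l.map g) = ssum (fun a b => F (a.map g) (b.map g)) l := by
  induction l generalizing F with
  | nil => simp
  | cons x l ih => simp only [List.map_cons, ssum_cons, ih, List.map_nil]

theorem ssum_append_cons (F : List α → List α → M) (a : List α) (y : α) (c : List α) :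
    ssum F (a ++ y :: c) =
      ssum (fun a₁ a₂ => F a₁ (a₂ ++ y :: c)) a + ssum (fun c₁ c₂ => F (a ++ y :: c₁) c₂) c := by
  induction a generalizing F with
  | nil => simp [ssum_cons]
  | cons x a ih => simp only [List.cons_append, ssum_cons, ih, add_assoc]

/-- Coassociativity of deconcatenation: both sides run over the cuts of `l` into three consecutive
pieces. -/
theorem ssum_ssum (G : List α → List α → List α → M) (l : List α) :
    ssum (fun r c => ssum (fun a b => G a b c) r) l =
      ssum (fun a r => ssum (fun b c => G a b c) r) l := by
  induction l generalizing G with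
  | nil => simp
  | cons x l ih =>
    simp only [ssum_cons, ssum_nil, ssum_add, ih (fun a b c => G (x :: a) b c)]
    abel

theorem ssum_comm (G : List α → List α → List β → List β → M) (l : List α) (l' : List β) :
    ssum (fun a b => ssum (fun c d => G a b c d) l') l =
      ssum (fun c d => ssum (fun a b => G a b c d) l) l' := by
  induction l generalizing G with
  | nil => simp
  | cons x l ih => simp only [ssum_cons, ssum_add, ih]

/-- Both sides run over the cuts into five consecutive pieces. This is the bookkeeping for two
disjoint inner blocks `b₁` and `b`. -/
theorem ssum_ssum_left (G : List α → List α → List α → List α → List α → M) (l : List α) :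
    ssum (fun a r => ssum (fun b c => ssum (fun a₁ a₂ => ssum (fun b₁ b₂ =>
      G a₁ b₁ b₂ b c) a₂) a) r) l =
    ssum (fun a₁ r₁ => ssum (fun b₁ r₂ => ssum (fun b₂ r₃ => ssum (fun b c =>
      G a₁ b₁ b₂ b c) r₃) r₂) r₁) l := by
  have h : ∀ a r : List α, ssum (fun b c => ssum (fun a₁ a₂ => ssum (fun b₁ b₂ =>
      G a₁ b₁ b₂ b c) a₂) a) r = ssum (fun a₁ a₂ => ssum (fun b₁ b₂ => ssum (fun b c =>
      G a₁ b₁ b₂ b c) r) a₂) a := by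
    intro a r
    rw [ssum_comm]
    congr! 3 with a₁ a₂
    rw [ssum_comm]
  simp only [h]
  rw [ssum_ssum (fun a₁ a₂ r => ssum (fun b₁ b₂ => ssum (fun b c => G a₁ b₁ b₂ b c) r) a₂)]
  congr! 3 with a₁ r₁
  rw [ssum_ssum (fun b₁ b₂ r => ssum (fun b c => G a₁ b₁ b₂ b c) r)]

/-- The same five pieces, now grouped so that the block `b` lies inside the larger block made of
`a₂`, `b`, `c₁`: the bookkeeping for nested compositions. -/
theorem ssum_ssum_mid (G : List α → List α → List α → List α → List α → M) (l : List α) :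
    ssum (fun a r => ssum (fun b c => ssum (fun a₁ a₂ => ssum (fun c₁ c₂ =>
      G a₁ a₂ b c₁ c₂) c) a) r) l =
    ssum (fun a₁ r => ssum (fun b c₂ => ssum (fun a₂ r' => ssum (fun b c₁ =>
      G a₁ a₂ b c₁ c₂) r') b) r) l := by
  have h : ∀ a r : List α, ssum (fun b c => ssum (fun a₁ a₂ => ssum (fun c₁ c₂ =>
      G a₁ a₂ b c₁ c₂) c) a) r = ssum (fun a₁ a₂ => ssum (fun b c => ssum (fun c₁ c₂ =>
      G a₁ a₂ b c₁ c₂) c) r) a := by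
    intro a r
    rw [ssum_comm]
  simp only [h]
  rw [ssum_ssum (fun a₁ a₂ r => ssum (fun b c => ssum (fun c₁ c₂ => G a₁ a₂ b c₁ c₂) c) r)]
  congr! 3 with a₁ r
  rw [ssum_ssum (fun a₂ r' c₂ => ssum (fun b c₁ => G a₁ a₂ b c₁ c₂) r')]
  congr! 3 with a₂ r'
  rw [ssum_ssum (fun b c₁ c₂ => G a₁ a₂ b c₁ c₂)]

end Splittings

/-! ## Sums over the subsets of a list, with Koszul signs -/

section Unshuffle

variable {α M : Type*} [AddCommGroup M]

/-- The sum of the parities of a list of elements with parities. -/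
def par (ws : List (ZMod 2 × α)) : ZMod 2 := (ws.map Prod.fst).sum

@[simp] theorem par_nil : par ([] : List (ZMod 2 × α)) = 0 := rfl
@[simp] theorem par_cons (h : ZMod 2 × α) (ws : List (ZMod 2 × α)) :
    par (h :: ws) = h.1 + par ws := by simp [par]
@[simp] theorem par_append (ws ws' : List (ZMod 2 × α)) :
    par (ws ++ ws') = par ws + par ws' := by simp [par]

/-- The sum of `± G S T` over all decompositions of a list into a sublist `S` and its
complement `T`, with the Koszul sign of moving `S` to the front. -/
def usum (G : List (ZMod 2 × α) → List (ZMod 2 × α) → M) : List (ZMod 2 × α) → M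
  | [] => G [] []
  | h :: l => usum (fun S T => G (h :: S) T) l +
      usum (fun S T => psign (h.1 * par S) • G S (h :: T)) l
termination_by l => l.length

@[simp] theorem usum_nil (G : List (ZMod 2 × α) → List (ZMod 2 × α) → M) :
    usum G [] = G [] [] := by rw [usum]

theorem usum_cons (G : List (ZMod 2 × α) → List (ZMod 2 × α) → M) (h : ZMod 2 × α)
    (l : List (ZMod 2 × α)) : usum G (h :: l) = usum (fun S T => G (h :: S) T) l +
      usum (fun S T => psign (h.1 * par S) • G S (h :: T)) l := by rw [usum]

theorem usum_add (F G : List (ZMod 2 × α) → List (ZMod 2 × α) → M) (l : List (ZMod 2 × α)) :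
    usum (fun S T => F S T + G S T) l = usum F l + usum G l := by
  induction l generalizing F G with
  | nil => simp
  | cons x l ih => simp only [usum_cons, smul_add, ih]; abel

theorem map_usum {N : Type*} [AddCommGroup N] {Φ : Type*} [FunLike Φ M N]
    [AddMonoidHomClass Φ M N] (φ : Φ)
    (G : List (ZMod 2 × α) → List (ZMod 2 × α) → M) (l : List (ZMod 2 × α)) :
    φ (usum G l) = usum (fun S T => φ (G S T)) l := by
  induction l generalizing G with
  | nil => simp
  | cons x l ih => simp only [usum_cons, map_add, ih, map_zsmul]

theorem zsmul_usum (n : ℤ) (G : List (ZMod 2 × α) → List (ZMod 2 × α) → M)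
    (l : List (ZMod 2 × α)) : n • usum G l = usum (fun S T => n • G S T) l :=
  map_usum (zsmulAddGroupHom n) G l

theorem usum_congr {F G : List (ZMod 2 × α) → List (ZMod 2 × α) → M} {l : List (ZMod 2 × α)}
    (h : ∀ S T, S.Sublist l → T.Sublist l → par S + par T = par l →
      S.length + T.length = l.length → F S T = G S T) :
    usum F l = usum G l := by
  induction l generalizing F G with
  | nil => simpa using h [] [] (.refl _) (.refl _) (by simp)
  | cons x l ih =>
    rw [usum_cons, usum_cons]
    congr 1
    · refine ih fun S T hS hT hp hn => h _ _ (hS.cons_cons x) (hT.cons x) ?_ ?_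
      · rw [par_cons, par_cons, ← hp, add_assoc]
      · simp only [List.length_cons]; omega
    · refine ih fun S T hS hT hp hn => ?_
      rw [h S (x :: T) (hS.cons x) (hT.cons_cons x)]
      · rw [par_cons, par_cons, ← hp]; abel
      · simp only [List.length_cons]; omega

/-- Exchanging the two parts. -/
theorem usum_flip (G : List (ZMod 2 × α) → List (ZMod 2 × α) → M) (l : List (ZMod 2 × α)) :
    usum (fun S T => psign (par S * par T) • G T S) l = usum G l := by
  induction l generalizing G with
  | nil => simp [psign_zero]
  | cons h l ih =>
    have h1 : ∀ a b c : ZMod 2, a * b + b * (a + c) = b * c := by decide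
    have h2 : ∀ a b c : ZMod 2, (a + b) * c = b * c + a * c := by decide
    rw [usum_cons, usum_cons, add_comm, ← ih (fun S T => G (h :: S) T),
      ← ih (fun S T => psign (h.1 * par S) • G S (h :: T))]
    simp only [par_cons, smul_smul, ← psign_add, h1, h2]

end Unshuffle

/-! ## Compositions of functions on lists -/

section ListComp

variable {k : Type*} [Field k] {U W : Type*} [AddCommGroup U] [Module k U] [AddCommGroup W]
variable (𝒰 : ZMod 2 → Submodule k U) [DirectSum.Decomposition 𝒰]

theorem signTwist_of_mem {p : ZMod 2} {x : U} (hx : x ∈ 𝒰 p) (q : ZMod 2) :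
    signTwist 𝒰 q x = psign (q * p) • x := by
  unfold signTwist
  split_ifs with h
  · simp [h, psign_zero]
  · have hq : q = 1 := by revert q; decide
    subst hq
    simp only [parityInv, LinearMap.sum_apply, LinearMap.smul_apply, parityProj_of_mem 𝒰 hx]
    rw [Finset.sum_eq_single p] <;> simp +contextual

theorem induction_homogeneous {P : U → Prop} (h0 : P 0) (hadd : ∀ x y, P x → P y → P (x + y))
    (hom : ∀ p, ∀ x ∈ 𝒰 p, P x) (x : U) : P x := by
  rw [← sum_parityProj 𝒰 x]
  exact Finset.sum_induction _ P hadd h0 fun i _ => hom i _ (parityProj_mem 𝒰 i x)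

theorem signTwist_signTwist (q q' : ZMod 2) (x : U) :
    signTwist 𝒰 q (signTwist 𝒰 q' x) = signTwist 𝒰 (q + q') x := by
  induction x using induction_homogeneous 𝒰 with
  | h0 => simp
  | hadd x y hx hy => simp [hx, hy]
  | hom p x hx =>
    rw [signTwist_of_mem 𝒰 hx, map_zsmul, signTwist_of_mem 𝒰 hx, signTwist_of_mem 𝒰 hx,
      smul_smul, add_mul, psign_add, mul_comm]

@[simp] theorem signTwist_zero : signTwist 𝒰 0 = LinearMap.id := rfl

/-- The function `f` on lists is additive in every entry. -/
def MultiAdd (f : List U → W) : Prop :=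
  ∀ a x y c, f (a ++ (x + y) :: c) = f (a ++ x :: c) + f (a ++ y :: c)

/-- An additive function on lists as an additive function of one entry. -/
def MultiAdd.slot {f : List U → W} (hf : MultiAdd f) (a c : List U) : U →+ W :=
  AddMonoidHom.mk' (fun x => f (a ++ x :: c)) fun x y => hf a x y c

theorem MultiAdd.map_zero {f : List U → W} (hf : MultiAdd f) (a c : List U) :
    f (a ++ 0 :: c) = 0 := (hf.slot a c).map_zero

theorem MultiAdd.map_zsmul {f : List U → W} (hf : MultiAdd f) (a c : List U) (n : ℤ) (x : U) :
    f (a ++ (n • x) :: c) = n • f (a ++ x :: c) := (hf.slot a c).map_zsmul _ _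

theorem MultiAdd.map_ssum {α : Type*} {f : List U → W} (hf : MultiAdd f) (a c : List U)
    (F : List α → List α → U) (l : List α) :
    f (a ++ ssum F l :: c) = ssum (fun b b' => f (a ++ F b b' :: c)) l :=
  _root_.map_ssum (hf.slot a c) F l

/-- `f` has parity `q`. -/
def ListParity (q : ZMod 2) (f : List U → U) : Prop :=
  ∀ p l, signTwist 𝒰 p (f l) = psign (p * q) • f (l.map (signTwist 𝒰 p))

/-- The composition `∑ ± f(a, ψ(b), c)` over all `l = a ++ b ++ c`, for `ψ` of parity `q`. -/
def lcomp (q : ZMod 2) (f : List U → W) (ψ : List U → U) (l : List U) : W :=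
  ssum (fun a r => ssum (fun b c => f (a.map (signTwist 𝒰 q) ++ ψ b :: c)) r) l

/-- Relative to the marked entry `y`, the block fed to `ψ` lies to its left, contains it, or lies to
its right. -/
theorem lcomp_append_cons (q : ZMod 2) (f : List U → W) (ψ : List U → U) (a : List U) (y : U)
    (c : List U) : lcomp 𝒰 q f ψ (a ++ y :: c) =
      ssum (fun a₁ a₂ => ssum (fun b₁ b₂ =>
        f (a₁.map (signTwist 𝒰 q) ++ ψ b₁ :: (b₂ ++ y :: c))) a₂) a +
      ssum (fun a₁ a₂ => ssum (fun c₁ c₂ =>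
        f (a₁.map (signTwist 𝒰 q) ++ ψ (a₂ ++ y :: c₁) :: c₂)) c) a +
      ssum (fun c₁ c₂ => ssum (fun d e =>
        f ((a ++ y :: c₁).map (signTwist 𝒰 q) ++ ψ d :: e)) c₂) c := by
  simp only [lcomp, ssum_append_cons, ssum_add]

variable {𝒰}

theorem MultiAdd.lcomp {f : List U → W} (hf : MultiAdd f) {ψ : List U → U} (hψ : MultiAdd ψ)
    (q : ZMod 2) : MultiAdd (lcomp 𝒰 q f ψ) := by
  intro a x y c
  have h1 : ∀ a₁ b₁ b₂ : List U, ∀ z : U, a₁ ++ ψ b₁ :: (b₂ ++ z :: c) =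
      (a₁ ++ ψ b₁ :: b₂) ++ z :: c := by simp
  have h3 : ∀ c₁ d e : List U, ∀ z : U,
      (a ++ z :: c₁).map (signTwist 𝒰 q) ++ ψ d :: e = a.map (signTwist 𝒰 q) ++
        signTwist 𝒰 q z :: (c₁.map (signTwist 𝒰 q) ++ ψ d :: e) := by simp
  simp only [lcomp_append_cons, h1, h3, hf _ x y, map_add, hψ _ x y, hf _ (ψ _) (ψ _),
    hf _ (signTwist 𝒰 q x), ssum_add]
  abel

theorem ListParity.lcomp {φ ψ : List U → U} {p q : ZMod 2} (hφ : ListParity 𝒰 p φ)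
    (hφ' : MultiAdd φ) (hψ : ListParity 𝒰 q ψ) : ListParity 𝒰 (p + q) (lcomp 𝒰 q φ ψ) := by
  intro r l
  simp only [_root_.lcomp, map_ssum, hφ r, ssum_map, List.map_append, List.map_cons, hψ r,
    hφ'.map_zsmul, smul_smul, List.map_map, mul_add, psign_add]
  simp only [← zsmulAddGroupHom_apply (_ * _), ← map_ssum]
  congr! 9
  ext x
  simp [signTwist_signTwist, add_comm]

variable (𝒰)

/-- The terms of `(f ∘ ψ) ∘ χ` in which `ψ` stands to the left of `χ`. -/
def lcompDisjoint (q q' : ZMod 2) (f : List U → W) (ψ χ : List U → U) (l : List U) : W :=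
  ssum (fun a r₁ => ssum (fun b r₂ => ssum (fun c r₃ => ssum (fun d e =>
    f (a.map (signTwist 𝒰 (q + q')) ++ ψ (b.map (signTwist 𝒰 q')) ::
      (c.map (signTwist 𝒰 q') ++ χ d :: e))) r₃) r₂) r₁) l

variable {𝒰}

/-- Mark the entry produced by `χ`. If `ψ` acts to its left, the result is a disjoint term; if `ψ`
swallows it, the composite of `ψ` and `χ` is formed inside `f`; if `ψ` acts to its right, the result
is a disjoint term with the roles exchanged, and the sign comes from moving `ψ` past `χ`. -/
theorem lcomp_lcomp_eq {f : List U → W} (hf : MultiAdd f) {ψ χ : List U → U} {q q' : ZMod 2}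
    (hχ : ListParity 𝒰 q' χ) (l : List U) :
    lcomp 𝒰 q' (lcomp 𝒰 q f ψ) χ l = lcompDisjoint 𝒰 q q' f ψ χ l +
      lcomp 𝒰 (q + q') f (lcomp 𝒰 q' ψ χ) l +
      psign (q * q') • lcompDisjoint 𝒰 q' q f χ ψ l := by
  have hmap : ∀ a : List U, (a.map (signTwist 𝒰 q')).map (signTwist 𝒰 q) =
      a.map (signTwist 𝒰 (q + q')) := by
    intro a
    simp [signTwist_signTwist]
  rw [lcomp]
  simp only [lcomp_append_cons, ssum_add]
  congr 1
  · congr 1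
    · simp only [ssum_map, hmap]
      rw [lcompDisjoint, ← ssum_ssum_left]
    · simp only [ssum_map, hmap]
      rw [ssum_ssum_mid (fun a₁ a₂ b c₁ c₂ => f (a₁.map (signTwist 𝒰 (q + q')) ++
        ψ (a₂.map (signTwist 𝒰 q') ++ χ b :: c₁) :: c₂))]
      simp only [lcomp, hf.map_ssum]
  · rw [lcompDisjoint, ← zsmulAddGroupHom_apply (psign (q * q'))]
    simp only [map_ssum, zsmulAddGroupHom_apply, List.map_append, List.map_cons, hmap,
      hχ q, List.append_assoc, List.cons_append, hf.map_zsmul, add_comm q' q]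

/-- The graded pre-Lie identity. -/
theorem lcomp_lcomp {f : List U → W} (hf : MultiAdd f) {ψ χ : List U → U} {q q' : ZMod 2}
    (hψ : ListParity 𝒰 q ψ) (hχ : ListParity 𝒰 q' χ) (l : List U) :
    lcomp 𝒰 q' (lcomp 𝒰 q f ψ) χ l - lcomp 𝒰 (q + q') f (lcomp 𝒰 q' ψ χ) l =
      psign (q * q') • (lcomp 𝒰 q (lcomp 𝒰 q' f χ) ψ l -
        lcomp 𝒰 (q + q') f (lcomp 𝒰 q χ ψ) l) := by
  -- After the nested terms are subtracted, only the two disjoint sums remain, and exchanging `ψ`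
  -- with `χ` permutes them up to the sign.
  rw [lcomp_lcomp_eq hf hχ, lcomp_lcomp_eq hf hψ, add_comm q' q, mul_comm q' q]
  simp only [smul_add, smul_sub, psign_smul_smul]
  abel

/-! ## Insertion of constants -/

/-- The list function with constant term `w` and no other terms. -/
def constFun (w : U) : List U → U
  | [] => w
  | _ :: _ => 0

theorem multiAdd_constFun (w : U) : MultiAdd (constFun w) := by
  intro a x y c
  cases a <;> simp [constFun]

theorem listParity_constFun {p : ZMod 2} {w : U} (hw : w ∈ 𝒰 p) :
    ListParity 𝒰 p (constFun w) := by
  intro q l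
  cases l
  · simpa [constFun] using signTwist_of_mem 𝒰 hw q
  · simp [constFun]

variable (𝒰) in
/-- The insertion `l ↦ ∑ ± f(a, w, c)`, the sum over all `l = a ++ c`, of `w` of parity `p`. -/
def linsert (p : ZMod 2) (w : U) (f : List U → W) (l : List U) : W :=
  ssum (fun a c => f (a.map (signTwist 𝒰 p) ++ w :: c)) l

/-- The constant is nonzero on the empty block only, so just one cut of `r` survives. This makes
insertion a special case of composition, to which the pre-Lie identity applies. -/
theorem lcomp_constFun {f : List U → W} (hf : MultiAdd f) (p : ZMod 2) (w : U) :
    lcomp 𝒰 p f (constFun w) = linsert 𝒰 p w f := by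
  funext l
  rw [lcomp, linsert]
  congr! 3 with a r
  cases r <;> simp [ssum_cons, constFun, hf.map_zero, ssum_zero]

theorem constFun_lcomp (q : ZMod 2) (w : U) (ψ : List U → U) :
    lcomp 𝒰 q (constFun w) ψ = fun _ => 0 := by
  funext l
  have h : ∀ (a c : List U) (x : U), constFun w (a ++ x :: c) = 0 := by
    intro a c x
    cases a <;> rfl
  simp only [lcomp, h, ssum_zero]

theorem lcomp_zero {f : List U → W} (hf : MultiAdd f) (q : ZMod 2) (l : List U) :
    lcomp 𝒰 q f (fun _ => 0) l = 0 := by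
  simp only [lcomp, hf.map_zero, ssum_zero]

theorem MultiAdd.linsert {f : List U → W} (hf : MultiAdd f) (p : ZMod 2) (w : U) :
    MultiAdd (linsert 𝒰 p w f) := by
  rw [← lcomp_constFun hf]
  exact hf.lcomp (multiAdd_constFun w) p

theorem ListParity.linsert {f : List U → U} {p q : ZMod 2} {w : U} (hf : ListParity 𝒰 q f)
    (hf' : MultiAdd f) (hw : w ∈ 𝒰 p) : ListParity 𝒰 (q + p) (linsert 𝒰 p w f) := by
  rw [← lcomp_constFun hf']
  exact hf.lcomp hf' (listParity_constFun hw)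

/-- The pre-Lie identity with the constant `w` as second inner function. A composite with the
constant on the outside vanishes, and what is left says that insertion is a graded derivation of
composition. -/
theorem linsert_lcomp {f : List U → W} (hf : MultiAdd f) {ψ : List U → U} (hψ' : MultiAdd ψ)
    {p q : ZMod 2} (hψ : ListParity 𝒰 q ψ) {w : U} (hw : w ∈ 𝒰 p) (l : List U) :
    linsert 𝒰 p w (lcomp 𝒰 q f ψ) l = psign (p * q) • lcomp 𝒰 q (linsert 𝒰 p w f) ψ l +
      lcomp 𝒰 (q + p) f (linsert 𝒰 p w ψ) l := by
  have := lcomp_lcomp hf hψ (listParity_constFun hw) l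
  rw [constFun_lcomp, lcomp_zero hf, sub_zero, lcomp_constFun (hf.lcomp hψ' q),
    lcomp_constFun hf, lcomp_constFun hψ', sub_eq_iff_eq_add, mul_comm q p] at this
  exact this

/-- The pre-Lie identity for two constants, whose nested terms both vanish. -/
theorem linsert_linsert {f : List U → W} (hf : MultiAdd f) {p p' : ZMod 2} {w w' : U}
    (hw : w ∈ 𝒰 p) (hw' : w' ∈ 𝒰 p') (l : List U) :
    linsert 𝒰 p' w' (linsert 𝒰 p w f) l =
      psign (p * p') • linsert 𝒰 p w (linsert 𝒰 p' w' f) l := by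
  have := lcomp_lcomp hf (listParity_constFun hw) (listParity_constFun hw') l
  rw [constFun_lcomp, constFun_lcomp, lcomp_zero hf, sub_zero, sub_zero,
    lcomp_constFun hf, lcomp_constFun hf, lcomp_constFun (hf.linsert _ _),
    lcomp_constFun (hf.linsert _ _)] at this
  exact this

theorem linsert_add (p : ZMod 2) (w : U) (f g : List U → W) (l : List U) :
    linsert 𝒰 p w (fun l => f l + g l) l = linsert 𝒰 p w f l + linsert 𝒰 p w g l := by
  simp only [linsert, ssum_add]

theorem linsert_zsmul (p : ZMod 2) (w : U) (n : ℤ) (f : List U → W) (l : List U) :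
    linsert 𝒰 p w (fun l => n • f l) l = n • linsert 𝒰 p w f l := by
  simp only [linsert, ← zsmulAddGroupHom_apply n, ← map_ssum]

/-! ## Iterated insertions -/

variable (𝒰) in
/-- All entries are homogeneous of the given parities. -/
def Homog (ws : List (ZMod 2 × U)) : Prop := ∀ h ∈ ws, h.2 ∈ 𝒰 h.1

theorem Homog.sublist {ws ws' : List (ZMod 2 × U)} (h : Homog 𝒰 ws) (h' : ws'.Sublist ws) :
    Homog 𝒰 ws' := fun x hx => h x (h'.subset hx)

theorem homog_cons {h : ZMod 2 × U} {ws : List (ZMod 2 × U)} :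
    Homog 𝒰 (h :: ws) ↔ h.2 ∈ 𝒰 h.1 ∧ Homog 𝒰 ws := by simp [Homog]

variable (𝒰) in
/-- The iterated insertion of `ws` into the arguments of `f`. -/
def liter : List (ZMod 2 × U) → (List U → W) → List U → W
  | [], f => f
  | h :: ws, f => liter ws (linsert 𝒰 h.1 h.2 f)

@[simp] theorem liter_nil (f : List U → W) : liter 𝒰 [] f = f := rfl
theorem liter_cons (h : ZMod 2 × U) (ws : List (ZMod 2 × U)) (f : List U → W) :
    liter 𝒰 (h :: ws) f = liter 𝒰 ws (linsert 𝒰 h.1 h.2 f) := rfl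

theorem liter_append (ws ws' : List (ZMod 2 × U)) (f : List U → W) :
    liter 𝒰 (ws ++ ws') f = liter 𝒰 ws' (liter 𝒰 ws f) := by
  induction ws generalizing f with
  | nil => rfl
  | cons h ws ih => exact ih _

theorem MultiAdd.liter {f : List U → W} (hf : MultiAdd f) (ws : List (ZMod 2 × U)) :
    MultiAdd (liter 𝒰 ws f) := by
  induction ws generalizing f with
  | nil => exact hf
  | cons h ws ih => exact ih (hf.linsert _ _)

theorem ListParity.liter {f : List U → U} {q : ZMod 2} (hf : ListParity 𝒰 q f)
    (hf' : MultiAdd f) {ws : List (ZMod 2 × U)} (hws : Homog 𝒰 ws) :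
    ListParity 𝒰 (q + par ws) (liter 𝒰 ws f) := by
  induction ws generalizing f q with
  | nil => simpa using hf
  | cons h ws ih =>
    rw [homog_cons] at hws
    rw [par_cons, ← add_assoc]
    exact ih (hf.linsert hf' hws.1) (hf'.linsert _ _) hws.2

theorem liter_add (ws : List (ZMod 2 × U)) (f g : List U → W) (l : List U) :
    liter 𝒰 ws (fun l => f l + g l) l = liter 𝒰 ws f l + liter 𝒰 ws g l := by
  induction ws generalizing f g with
  | nil => rfl
  | cons h ws ih =>
    simp only [liter_cons, ← ih]
    congr 1
    funext l
    exact linsert_add _ _ _ _ _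

theorem liter_zsmul (ws : List (ZMod 2 × U)) (n : ℤ) (f : List U → W) (l : List U) :
    liter 𝒰 ws (fun l => n • f l) l = n • liter 𝒰 ws f l := by
  induction ws generalizing f with
  | nil => rfl
  | cons h ws ih =>
    simp only [liter_cons, ← ih]
    congr 1
    funext l
    exact linsert_zsmul _ _ _ _ _

theorem liter_swap {f : List U → W} (hf : MultiAdd f) {h h' : ZMod 2 × U}
    (hh : h.2 ∈ 𝒰 h.1) (hh' : h'.2 ∈ 𝒰 h'.1) (a b : List (ZMod 2 × U)) (l : List U) :
    liter 𝒰 (a ++ h :: h' :: b) f l =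
      psign (h.1 * h'.1) • liter 𝒰 (a ++ h' :: h :: b) f l := by
  simp only [liter_append, liter_cons, ← liter_zsmul]
  congr 1
  funext l
  exact linsert_linsert (hf.liter a) hh hh' l

theorem liter_rotate {f : List U → W} (hf : MultiAdd f) {h : ZMod 2 × U}
    (hh : h.2 ∈ 𝒰 h.1) {ws : List (ZMod 2 × U)} (hws : Homog 𝒰 ws) (l : List U) :
    liter 𝒰 (h :: ws) f l = psign (h.1 * par ws) • liter 𝒰 (ws ++ [h]) f l := by
  induction ws generalizing f with
  | nil => simp [psign_zero]
  | cons h' ws ih =>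
    rw [homog_cons] at hws
    have := liter_swap hf hh hws.1 [] ws l
    rw [List.nil_append, List.nil_append] at this
    rw [this, liter_cons, ih (hf.linsert _ _) hws.2, smul_smul, par_cons, mul_add, psign_add]
    rfl

/-! ## The Leibniz rule -/

/-- The Leibniz rule for iterated insertions. -/
theorem liter_lcomp {f : List U → W} (hf : MultiAdd f) {ψ : List U → U} (hψ' : MultiAdd ψ)
    {q : ZMod 2} (hψ : ListParity 𝒰 q ψ) {ws : List (ZMod 2 × U)} (hws : Homog 𝒰 ws)
    (l : List U) :
    liter 𝒰 ws (lcomp 𝒰 q f ψ) l = usum (fun S T => psign (par T * (q + par S)) •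
      lcomp 𝒰 (q + par S) (liter 𝒰 T f) (liter 𝒰 S ψ) l) ws := by
  induction ws generalizing f ψ q with
  | nil => simp [psign_zero]
  | cons h ws ih =>
    rw [homog_cons] at hws
    have h1 : linsert 𝒰 h.1 h.2 (lcomp 𝒰 q f ψ) = fun l =>
        psign (h.1 * q) • lcomp 𝒰 q (linsert 𝒰 h.1 h.2 f) ψ l +
      lcomp 𝒰 (q + h.1) f (linsert 𝒰 h.1 h.2 ψ) l :=
      funext fun l => linsert_lcomp hf hψ' hψ hws.1 l
    have h2 : ∀ a b c q : ZMod 2, a * q + c * (q + b) = a * b + (a + c) * (q + b) := by decide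
    -- The first inserted element goes either into `f` or into `ψ`; these are the two branches of
    -- the recursion for `usum`.
    rw [liter_cons, h1, liter_add, liter_zsmul, ih (hf.linsert _ _) hψ' hψ hws.2,
      ih hf (hψ'.linsert _ _) (hψ.linsert hψ' hws.1) hws.2, usum_cons, add_comm, zsmul_usum]
    simp only [par_cons, smul_smul, ← psign_add, add_assoc, h2]
    rfl

end ListComp

/-! ## Cochains as functions on lists -/

section Evaluation

variable {k : Type*} [Field k] {U W : Type*} [AddCommGroup U] [Module k U] [AddCommGroup W]
  [Module k W]

/-- A cochain as a function on lists. -/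
def ev (φ : Cochain k U W) (l : List U) : W := φ l.length l.get

theorem ev_eq (φ : Cochain k U W) {n : ℕ} (l : List U) (h : l.length = n) :
    ev φ l = φ n fun i => l.get (i.cast h.symm) := by
  subst h; rfl

@[simp] theorem ev_ofFn (φ : Cochain k U W) {n : ℕ} (x : Fin n → U) :
    ev φ (List.ofFn x) = φ n x := by
  rw [ev_eq φ _ (List.length_ofFn (f := x))]
  congr 1
  funext i
  simp

theorem ev_ext {φ ψ : Cochain k U W} (h : ∀ l, ev φ l = ev ψ l) : φ = ψ := by
  funext n
  ext x
  rw [← ev_ofFn, ← ev_ofFn, h]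

theorem exists_ofFn (l : List U) : ∃ (n : ℕ) (x : Fin n → U), l = List.ofFn x :=
  ⟨_, l.get, (List.ofFn_get l).symm⟩

theorem ev_nil (φ : Cochain k U W) : ev φ [] = φ 0 Fin.elim0 :=
  congrArg (φ 0) (Subsingleton.elim _ _)

theorem ev_nil_eq_zero_iff {φ : Cochain k U W} : ev φ [] = 0 ↔ φ 0 = 0 := by
  rw [ev_nil]
  refine ⟨fun h => ?_, fun h => by simp [h]⟩
  ext x
  rw [Subsingleton.elim x Fin.elim0, h]
  rfl

@[simp] theorem ev_add (φ ψ : Cochain k U W) (l : List U) : ev (φ + ψ) l = ev φ l + ev ψ l := rfl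
@[simp] theorem ev_sub (φ ψ : Cochain k U W) (l : List U) : ev (φ - ψ) l = ev φ l - ev ψ l := rfl
@[simp] theorem ev_zero (l : List U) : ev (0 : Cochain k U W) l = 0 := rfl
@[simp] theorem ev_smul (c : k) (φ : Cochain k U W) (l : List U) : ev (c • φ) l = c • ev φ l := rfl
@[simp] theorem ev_zsmul (c : ℤ) (φ : Cochain k U W) (l : List U) :
    ev (c • φ) l = c • ev φ l := rfl

theorem ev_usum {α : Type*} (G : List (ZMod 2 × α) → List (ZMod 2 × α) → Cochain k U W)
    (ws : List (ZMod 2 × α)) (l : List U) :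
    ev (usum G ws) l = usum (fun S T => ev (G S T) l) ws :=
  map_usum (⟨⟨fun φ => ev φ l, rfl⟩, fun _ _ => rfl⟩ : Cochain k U W →+ W) G ws

theorem multiAdd_ev (φ : Cochain k U W) : MultiAdd (ev φ) := by
  intro a x y c
  have h : ∀ z : U, ev φ (a ++ z :: c) = φ (a.length + 1 + c.length)
      (Function.update (fun i => (a ++ x :: c).get (i.cast (by simp; omega)))
        ⟨a.length, by omega⟩ z) := by
    intro z
    rw [ev_eq φ (n := a.length + 1 + c.length) _ (by simp; omega)]
    congr 1
    funext i
    rcases eq_or_ne i ⟨a.length, by omega⟩ with rfl | hi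
    · simp
    · rw [Function.update_of_ne hi]
      have hi' : (i : ℕ) ≠ a.length := fun h => hi (Fin.ext h)
      simp only [List.get_eq_getElem, Fin.val_cast]
      rcases lt_or_gt_of_ne hi' with h | h
      · rw [List.getElem_append_left h, List.getElem_append_left h]
      · rw [List.getElem_append_right h.le, List.getElem_append_right h.le]
        obtain ⟨j, hj⟩ : ∃ j, (i : ℕ) - a.length = j + 1 := ⟨i - a.length - 1, by omega⟩
        simp [hj]
  rw [h, h, h, MultilinearMap.map_update_add]

variable (𝒰 : ZMod 2 → Submodule k U)

theorem homog_ofFn {n : ℕ} {p : Fin n → ZMod 2} {x : Fin n → U} (hx : ∀ i, x i ∈ 𝒰 (p i)) :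
    Homog 𝒰 (List.ofFn fun i => (p i, x i)) := by
  intro h hh
  rw [List.mem_ofFn] at hh
  obtain ⟨i, rfl⟩ := hh
  exact hx i

theorem exists_ofFn_homog {ws : List (ZMod 2 × U)} (hws : Homog 𝒰 ws) :
    ∃ (n : ℕ) (p : Fin n → ZMod 2) (x : Fin n → U), (∀ i, x i ∈ 𝒰 (p i)) ∧
      ws = List.ofFn fun i => (p i, x i) :=
  ⟨ws.length, fun i => (ws.get i).1, fun i => (ws.get i).2, fun i => hws _ (ws.get_mem i),
    (List.ofFn_get ws).symm⟩

theorem par_ofFn {α : Type*} {n : ℕ} (p : Fin n → ZMod 2) (x : Fin n → α) :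
    par (List.ofFn fun i => (p i, x i)) = ∑ i, p i := by
  simp [par, List.map_ofFn, List.sum_ofFn, Function.comp_def]

theorem map_snd_ofFn {α : Type*} {n : ℕ} (p : Fin n → ZMod 2) (x : Fin n → α) :
    (List.ofFn fun i => (p i, x i)).map Prod.snd = List.ofFn x := by
  simp [List.map_ofFn, Function.comp_def]

theorem hasParity_iff {𝒲 : ZMod 2 → Submodule k W} {q : ZMod 2} {φ : Cochain k U W} :
    HasParity 𝒰 𝒲 q φ ↔ ∀ ws, Homog 𝒰 ws → ev φ (ws.map Prod.snd) ∈ 𝒲 (par ws + q) := by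
  constructor
  · intro h ws hws
    obtain ⟨n, p, x, hx, rfl⟩ := exists_ofFn_homog 𝒰 hws
    rw [map_snd_ofFn, par_ofFn, ev_ofFn]
    exact h n p x hx
  · intro h n p x hx
    have := h _ (homog_ofFn 𝒰 hx)
    rwa [map_snd_ofFn, par_ofFn, ev_ofFn] at this

variable [DirectSum.Decomposition 𝒰]

theorem map_signTwist_homog {ws : List (ZMod 2 × U)} (hws : Homog 𝒰 ws) (q : ZMod 2)
    {f : List U → W} (hf : MultiAdd f) (a c : List U) :
    f (a ++ (ws.map Prod.snd).map (signTwist 𝒰 q) ++ c) =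
      psign (q * par ws) • f (a ++ ws.map Prod.snd ++ c) := by
  induction ws generalizing a with
  | nil => simp [psign_zero]
  | cons h ws ih =>
    rw [homog_cons] at hws
    have := ih hws.2 (a ++ [h.2])
    simp only [List.map_cons, List.append_assoc, List.cons_append, List.nil_append] at this ⊢
    rw [signTwist_of_mem 𝒰 hws.1, hf.map_zsmul, this, smul_smul, par_cons, mul_add, psign_add]

/-- Two additive functions on lists agree if they agree on homogeneous entries. -/
theorem MultiAdd.ext_homog {f g : List U → W} (hf : MultiAdd f) (hg : MultiAdd g)
    (h : ∀ ws, Homog 𝒰 ws → f (ws.map Prod.snd) = g (ws.map Prod.snd)) (l : List U) :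
    f l = g l := by
  -- Entries are made homogeneous one at a time, each moving from `l` to the homogeneous prefix
  -- `ws`.
  suffices H : ∀ (l : List U) (ws : List (ZMod 2 × U)), Homog 𝒰 ws →
      f (ws.map Prod.snd ++ l) = g (ws.map Prod.snd ++ l) by
    simpa using H l [] (by simp [Homog])
  intro l
  induction l with
  | nil => simpa using h
  | cons x l ih =>
    intro ws hws
    induction x using induction_homogeneous 𝒰 with
    | h0 => rw [hf.map_zero, hg.map_zero]
    | hadd x y hx hy => rw [hf, hg, hx, hy]
    | hom p x hx =>
      have := ih (ws ++ [(p, x)]) (by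
        intro h hh
        rcases List.mem_append.1 hh with hh | hh
        · exact hws h hh
        · rw [List.mem_singleton] at hh
          subst hh
          exact hx)
      simpa using this

theorem listParity_ev {q : ZMod 2} {φ : Cochain k U U} (hφ : HasParity 𝒰 𝒰 q φ) :
    ListParity 𝒰 q (ev φ) := by
  intro p l
  refine MultiAdd.ext_homog 𝒰 (f := fun l => signTwist 𝒰 p (ev φ l))
    (g := fun l => psign (p * q) • ev φ (l.map (signTwist 𝒰 p))) ?_ ?_ ?_ l
  · intro a x y c
    simp [multiAdd_ev φ a x y]
  · intro a x y c
    simp [multiAdd_ev φ _ (signTwist 𝒰 p x)]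
  · intro ws hws
    have := map_signTwist_homog 𝒰 hws p (multiAdd_ev φ) [] []
    simp only [List.nil_append, List.append_nil] at this
    simp only [this]
    rw [signTwist_of_mem 𝒰 ((hasParity_iff 𝒰).1 hφ ws hws), smul_smul, ← psign_add, mul_add,
      add_comm]

/-- The twist acts by opposite signs on the two graded pieces, and 2 is invertible, so its
eigenspaces are exactly the graded pieces. This converts `ListParity` back into membership. -/
theorem mem_of_signTwist [CharZero k] {q : ZMod 2} {x : U} (h : signTwist 𝒰 1 x = psign q • x) :
    x ∈ 𝒰 q := by
  have hx := sum_parityProj 𝒰 x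
  have h' := h
  rw [← hx] at h'
  rw [map_sum, Finset.smul_sum] at h'
  have h1 : parityProj 𝒰 (q + 1) x = 0 := by
    have h2 := congrArg (parityProj 𝒰 (q + 1)) h'
    simp only [map_sum, signTwist_of_mem 𝒰 (parityProj_mem 𝒰 _ _), map_zsmul,
      parityProj_of_mem 𝒰 (parityProj_mem 𝒰 _ _), smul_ite, smul_zero, Finset.sum_ite_eq,
      Finset.mem_univ, if_true, one_mul] at h2
    rw [psign_add, mul_smul, ← sub_eq_zero, ← smul_sub] at h2
    have h3 : psign 1 • parityProj 𝒰 (q + 1) x - parityProj 𝒰 (q + 1) x =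
        (-2 : k) • parityProj 𝒰 (q + 1) x := by
      have : psign 1 = -1 := by decide
      rw [this]
      module
    have h4 := congrArg (psign q • ·) h2
    simp only [psign_smul_smul, smul_zero, h3] at h4
    simpa using h4
  have h5 : ∑ i : ZMod 2, parityProj 𝒰 i x = parityProj 𝒰 q x + parityProj 𝒰 (q + 1) x := by
    have : ∀ q : ZMod 2, (Finset.univ : Finset (ZMod 2)) = {q, q + 1} := by decide
    rw [this q, Finset.sum_pair]
    intro h
    simp at h
  rw [← hx, h5, h1, add_zero]
  exact parityProj_mem 𝒰 _ _

theorem hasParity_of_listParity [CharZero k] {q : ZMod 2} {φ : Cochain k U U}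
    (hφ : ListParity 𝒰 q (ev φ)) : HasParity 𝒰 𝒰 q φ := by
  rw [hasParity_iff]
  intro ws hws
  refine mem_of_signTwist 𝒰 ?_
  have := map_signTwist_homog 𝒰 hws 1 (multiAdd_ev φ) [] []
  simp only [List.nil_append, List.append_nil] at this
  rw [hφ 1, this, smul_smul, ← psign_add]
  congr 2
  ring

end Evaluation

/-! ## The composition of graded symmetric cochains as a sum over sublists -/

section Sublists

variable {α : Type*}

/-- The sublist of the entries of `h` with index in `S`. -/
def subList {n : ℕ} (h : Fin n → α) (S : Finset (Fin n)) : List α :=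
  ((List.finRange n).filter (· ∈ S)).map h

theorem ofFn_orderEmbOfFin {n m : ℕ} (h : Fin n → α) (S : Finset (Fin n)) (hS : S.card = m) :
    List.ofFn (fun i => h (S.orderEmbOfFin hS i)) = subList h S := by
  have h1 : List.ofFn (fun i => h (S.orderEmbOfFin hS i)) = (S.sort).map h := by
    rw [← S.listMap_orderEmbOfFin_finRange hS, List.map_map, List.ofFn_eq_map]
    rfl
  rw [h1, subList]
  congr 1
  refine S.sortedLT_sort.eq_of_mem_iff ?_ (by simp)
  exact ((List.sortedLT_finRange n).pairwise.filter _).sortedLT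

/-- Subsets are separated according to whether they contain the first index, which is the recursion
defining `usum`. -/
theorem sum_finset_succ {M : Type*} [AddCommMonoid M] {n : ℕ} (f : Finset (Fin (n + 1)) → M) :
    ∑ S, f S = ∑ S : Finset (Fin n), f (insert 0 (S.map (Fin.succEmb n))) +
      ∑ S : Finset (Fin n), f (S.map (Fin.succEmb n)) := by
  have h0 : (0 : Fin (n + 1)) ∉ (Finset.univ : Finset (Fin n)).map (Fin.succEmb n) := by simp
  have h1 : (Finset.univ : Finset (Finset (Fin (n + 1)))) =
      (insert 0 ((Finset.univ : Finset (Fin n)).map (Fin.succEmb n))).powerset := by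
    rw [← Finset.powerset_univ]
    congr 1
    rw [Fin.univ_succ]
    ext; simp
  rw [h1, Finset.sum_powerset_insert h0, add_comm]
  have h2 : ((Finset.univ : Finset (Fin n)).map (Fin.succEmb n)).powerset =
      (Finset.univ : Finset (Finset (Fin n))).image (fun S => S.map (Fin.succEmb n)) := by
    ext T
    simp only [Finset.mem_powerset, Finset.mem_image, Finset.mem_univ, true_and]
    constructor
    · intro hT
      obtain ⟨S, -, hS⟩ := Finset.subset_map_iff.1 hT
      exact ⟨S, hS.symm⟩
    · rintro ⟨S, rfl⟩
      exact Finset.map_subset_map.2 (Finset.subset_univ _)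
  rw [h2, Finset.sum_image, Finset.sum_image] <;>
  exact fun S _ T _ h => Finset.map_injective _ h

theorem subList_insert_zero {n : ℕ} (h : Fin (n + 1) → α) (S : Finset (Fin n)) :
    subList h (insert 0 (S.map (Fin.succEmb n))) = h 0 :: subList (fun i => h i.succ) S := by
  simp [subList, List.finRange_succ, List.filter_map, Function.comp_def]

theorem subList_map_succ {n : ℕ} (h : Fin (n + 1) → α) (S : Finset (Fin n)) :
    subList h (S.map (Fin.succEmb n)) = subList (fun i => h i.succ) S := by
  simp [subList, List.finRange_succ, List.filter_map, Function.comp_def]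

theorem compl_insert_zero {n : ℕ} (S : Finset (Fin n)) :
    (insert 0 (S.map (Fin.succEmb n)))ᶜ = Sᶜ.map (Fin.succEmb n) := by
  ext i
  cases i using Fin.cases <;> simp

theorem compl_map_succ {n : ℕ} (S : Finset (Fin n)) :
    (S.map (Fin.succEmb n))ᶜ = insert 0 (Sᶜ.map (Fin.succEmb n)) := by
  ext i
  cases i using Fin.cases <;> simp

theorem unshuffleSign_insert_zero {n : ℕ} (S : Finset (Fin n)) (p : Fin (n + 1) → ZMod 2) :
    unshuffleSign (insert 0 (S.map (Fin.succEmb n))) p = unshuffleSign S (fun i => p i.succ) := by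
  rw [unshuffleSign, unshuffleSign, Finset.prod_insert (by simp), compl_insert_zero]
  simp

theorem psign_sum {ι : Type*} (s : Finset ι) (f : ι → ZMod 2) :
    psign (∑ i ∈ s, f i) = ∏ i ∈ s, psign (f i) := by
  classical
  induction s using Finset.induction_on with
  | empty => rfl
  | insert a s ha ih => rw [Finset.sum_insert ha, Finset.prod_insert ha, psign_add, ih]

theorem unshuffleSign_map_succ {n : ℕ} (S : Finset (Fin n)) (p : Fin (n + 1) → ZMod 2) :
    unshuffleSign (S.map (Fin.succEmb n)) p =
      psign (p 0 * ∑ i ∈ S, p i.succ) * unshuffleSign S (fun i => p i.succ) := by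
  rw [unshuffleSign, unshuffleSign, Finset.prod_map, compl_map_succ, Finset.mul_sum, psign_sum,
    ← Finset.prod_mul_distrib]
  refine Finset.prod_congr rfl fun i _ => ?_
  rw [Finset.prod_insert (by simp)]
  simp [mul_comm]

theorem par_subList {n : ℕ} (p : Fin n → ZMod 2) (x : Fin n → α) (S : Finset (Fin n)) :
    par (subList (fun i => (p i, x i)) S) = ∑ i ∈ S, p i := by
  rw [← ofFn_orderEmbOfFin _ S rfl, par_ofFn]
  conv_rhs => rw [← S.map_orderEmbOfFin_univ rfl, Finset.sum_map]
  rfl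

/-- Induction on the first index. If it belongs to `S` it already stands in front and costs no sign;
otherwise all of `S` has to cross it, which is the factor in the second branch of `usum`. -/
theorem sum_unshuffleSign {M : Type*} [AddCommGroup M] {n : ℕ} (p : Fin n → ZMod 2)
    (x : Fin n → α) (G : List (ZMod 2 × α) → List (ZMod 2 × α) → M) :
    ∑ S : Finset (Fin n), unshuffleSign S p •
      G (subList (fun i => (p i, x i)) S) (subList (fun i => (p i, x i)) Sᶜ) =
    usum G (List.ofFn fun i => (p i, x i)) := by
  induction n generalizing G with
  | zero =>
    have h (S : Finset (Fin 0)) : S = ∅ := Subsingleton.elim _ _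
    rw [Fintype.sum_unique, h default]
    simp [unshuffleSign, subList]
  | succ n ih =>
    rw [sum_finset_succ, List.ofFn_succ, usum_cons]
    simp only [unshuffleSign_insert_zero, subList_insert_zero, compl_insert_zero,
      subList_map_succ, compl_map_succ, unshuffleSign_map_succ]
    rw [← ih, ← ih]
    simp only [par_subList, smul_smul, mul_comm]

end Sublists

/-! ### The symmetric composition on homogeneous arguments -/

section SymComp

variable {k : Type*} [Field k] {U W : Type*} [AddCommGroup U] [Module k U]
  [AddCommGroup W] [Module k W]
variable (𝒰 : ZMod 2 → Submodule k U) [DirectSum.Decomposition 𝒰]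

/-- On homogeneous arguments, a sum over all parities reduces to one term. -/
theorem sum_parityProj_of_homog {M : Type*} [AddCommMonoid M] {n : ℕ} {p : Fin n → ZMod 2}
    {x : Fin n → U} (hx : ∀ i, x i ∈ 𝒰 (p i)) (F : (Fin n → ZMod 2) → (Fin n → U) → M)
    (hF : ∀ p' y i, y i = 0 → F p' y = 0) :
    ∑ p' : Fin n → ZMod 2, F p' (fun i => parityProj 𝒰 (p' i) (x i)) = F p x := by
  rw [Finset.sum_eq_single p]
  · congr 1
    funext i
    simp [parityProj_of_mem 𝒰 (hx i)]
  · intro p' _ hp'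
    obtain ⟨i, hi⟩ : ∃ i, p' i ≠ p i := by
      by_contra h
      exact hp' (funext fun i => by by_contra h'; exact h ⟨i, h'⟩)
    exact hF _ _ i (by simp [parityProj_of_mem 𝒰 (hx i), hi])
  · simp

theorem symComp_apply {n : ℕ} {p : Fin n → ZMod 2} {x : Fin n → U} (hx : ∀ i, x i ∈ 𝒰 (p i))
    (φ : Cochain k U W) (ψ : Cochain k U U) : symComp 𝒰 φ ψ n x =
      usum (fun S T => ev φ (ev ψ (S.map Prod.snd) :: T.map Prod.snd))
        (List.ofFn fun i => (p i, x i)) := by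
  rw [← sum_unshuffleSign, symComp, sum_apply]
  refine Finset.sum_congr rfl fun S _ => ?_
  rw [sum_apply]
  simp only [smul_apply, MultilinearMap.compLinearMap_apply]
  rw [sum_parityProj_of_homog 𝒰 hx (fun p' y => unshuffleSign S p' •
    ((MultilinearMap.curryFinFinset k W U (s := S) rfl rfl).symm
      ((φ (Sᶜ.card + 1)).curryLeft.compMultilinearMap (ψ S.card))) y)]
  · congr 1
    rw [MultilinearMap.curryFinFinset_symm_apply]
    simp only [finSumEquivOfFinset_inl, finSumEquivOfFinset_inr,
      LinearMap.compMultilinearMap_apply, MultilinearMap.curryLeft_apply]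
    have h1 : ∀ T : Finset (Fin n), (subList (fun i => (p i, x i)) T).map Prod.snd =
        List.ofFn (fun i => x (T.orderEmbOfFin rfl i)) := by
      intro T
      rw [ofFn_orderEmbOfFin]
      simp [subList]
    rw [h1, h1, ev_ofFn, ← ev_ofFn φ, List.ofFn_succ]
    simp
  · intro p' y i hy
    rw [MultilinearMap.map_coord_zero _ i hy, smul_zero]

end SymComp

/-! ## The composition `tensorComp` on lists -/

section TensorComp

theorem ssum_eq_sum {α M : Type*} [AddCommMonoid M] (F : List α → List α → M) (l : List α) :
    ssum F l = ∑ i ∈ Finset.range (l.length + 1), F (l.take i) (l.drop i) := by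
  induction l generalizing F with
  | nil => simp
  | cons x l ih =>
    rw [ssum_cons, ih, List.length_cons, Finset.sum_range_succ' _ (l.length + 1), add_comm]
    simp

/-- Passage from blocks given by a start `i` and a length `j` to blocks given by their end points.
The end points describe nonempty blocks only, hence the hypothesis that length zero contributes
nothing. -/
theorem sum_range_range_eq {M : Type*} [AddCommMonoid M] (T : ℕ → ℕ → M) (hT : ∀ i, T i 0 = 0)
    (n : ℕ) : ∑ i ∈ Finset.range (n + 1), ∑ j ∈ Finset.range (n - i + 1), T i j =
      ∑ a : Fin n, ∑ b : Fin n, if a ≤ b then T a (b - a + 1) else 0 := by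
  rw [Finset.sum_range_succ]
  simp only [Nat.sub_self, zero_add, Finset.range_one, Finset.sum_singleton, hT, add_zero]
  rw [← Fin.sum_univ_eq_sum_range (fun i => ∑ j ∈ Finset.range (n - i + 1), T i j)]
  refine Finset.sum_congr rfl fun a _ => ?_
  rw [Finset.sum_range_succ', hT, add_zero]
  simp only [Fin.le_def]
  rw [Fin.sum_univ_eq_sum_range (fun b => if (a : ℕ) ≤ b then T a (b - a + 1) else 0) n]
  obtain ⟨m, hm⟩ : ∃ m, n = a + m := ⟨n - a, by omega⟩
  have h1 : ∀ N : ℕ, N = a + m → ∑ b ∈ Finset.range N, (if (a : ℕ) ≤ b then T a (b - a + 1) else 0) =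
      ∑ j ∈ Finset.range m, T a (j + 1) := by
    rintro N rfl
    rw [Finset.sum_range_add, Finset.sum_eq_zero, zero_add]
    · simp
    · intro b hb
      rw [Finset.mem_range] at hb
      rw [if_neg (by omega)]
  rw [h1 n hm]
  congr 2
  omega

theorem mem_take_finRange {n : ℕ} (a : ℕ) (i : Fin n) :
    i ∈ (List.finRange n).take a ↔ (i : ℕ) < a := by
  rw [List.mem_take_iff_getElem]
  constructor
  · rintro ⟨j, hj, rfl⟩
    simp at hj ⊢
    omega
  · intro h
    exact ⟨i, by simp; omega, by simp⟩

theorem mem_drop_finRange {n : ℕ} (a : ℕ) (i : Fin n) :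
    i ∈ (List.finRange n).drop a ↔ a ≤ (i : ℕ) := by
  rw [List.mem_drop_iff_getElem]
  constructor
  · rintro ⟨j, hj, rfl⟩
    simp
  · intro h
    refine ⟨i - a, by simp; omega, ?_⟩
    ext
    simp [h]

theorem mem_take_drop_finRange {n : ℕ} (a m : ℕ) (i : Fin n) :
    i ∈ ((List.finRange n).drop a).take m ↔ a ≤ (i : ℕ) ∧ (i : ℕ) < a + m := by
  rw [List.mem_take_iff_getElem]
  constructor
  · rintro ⟨j, hj, rfl⟩
    simp at hj ⊢
    omega
  · rintro ⟨h, h'⟩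
    refine ⟨i - a, by simp; omega, ?_⟩
    ext
    simp [h]

theorem filter_finRange_eq {n : ℕ} (S : Finset (Fin n)) (l : List (Fin n))
    (hl : l.Sublist (List.finRange n)) (h : ∀ i, i ∈ l ↔ i ∈ S) :
    (List.finRange n).filter (· ∈ S) = l := by
  have h0 := (List.sortedLT_finRange n).pairwise
  exact (h0.filter _).sortedLT.eq_of_mem_iff (h0.sublist hl).sortedLT (by simp [h])

theorem ofFn_eq_map_finRange {α : Type*} {n : ℕ} (h : Fin n → α) :
    List.ofFn h = (List.finRange n).map h := List.ofFn_eq_map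

theorem subList_Iio {α : Type*} {n : ℕ} (h : Fin n → α) (a : Fin n) :
    subList h (Finset.Iio a) = (List.ofFn h).take a := by
  rw [ofFn_eq_map_finRange, ← List.map_take, subList,
    filter_finRange_eq (Finset.Iio a) _ (List.take_sublist (a : ℕ) (List.finRange n))]
  intro i
  simp [mem_take_finRange]

theorem subList_Icc {α : Type*} {n : ℕ} (h : Fin n → α) (a b : Fin n) (hab : a ≤ b) :
    subList h (Finset.Icc a b) = ((List.ofFn h).drop a).take (b - a + 1) := by
  rw [ofFn_eq_map_finRange, ← List.map_drop, ← List.map_take, subList,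
    filter_finRange_eq (Finset.Icc a b) (((List.finRange n).drop a).take (b - a + 1))
      ((List.take_sublist _ _).trans (List.drop_sublist _ _))]
  intro i
  rw [mem_take_drop_finRange, Finset.mem_Icc, Fin.le_def, Fin.le_def]
  rw [Fin.le_def] at hab
  omega

theorem subList_compl_Icc {α : Type*} {n : ℕ} (h : Fin n → α) (a b : Fin n) (hab : a ≤ b) :
    subList h (Finset.Icc a b)ᶜ =
      (List.ofFn h).take a ++ ((List.ofFn h).drop a).drop (b - a + 1) := by
  have h1 : ((List.finRange n).drop a).drop (b - a + 1) = (List.finRange n).drop (b + 1) := by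
    rw [List.drop_drop]
    congr 1
    rw [Fin.le_def] at hab
    omega
  rw [ofFn_eq_map_finRange, ← List.map_drop, ← List.map_drop, ← List.map_take, subList,
    ← List.map_append, filter_finRange_eq (Finset.Icc a b)ᶜ
      ((List.finRange n).take a ++ ((List.finRange n).drop a).drop (b - a + 1))]
  · conv_rhs => rw [← List.take_append_drop a (List.finRange n)]
    exact (List.Sublist.refl _).append (List.drop_sublist _ _)
  · intro i
    rw [h1, List.mem_append, mem_take_finRange, mem_drop_finRange, Finset.mem_compl,
      Finset.mem_Icc, Fin.le_def, Fin.le_def]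
    omega

theorem ofFn_insertNth {α : Type*} {n : ℕ} (a : Fin (n + 1)) (y : α) (z : Fin n → α) :
    List.ofFn (Fin.insertNth (α := fun _ => α) a y z) =
      (List.ofFn z).take a ++ y :: (List.ofFn z).drop a := by
  induction n with
  | zero =>
    obtain rfl : a = 0 := Fin.fin_one_eq_zero a
    simp [Fin.insertNth_zero']
  | succ n ih =>
    cases a using Fin.cases with
    | zero => simp [Fin.insertNth_zero', List.ofFn_succ]
    | succ a =>
      rw [← Fin.cons_self_tail z, Fin.insertNth_succ_cons, List.ofFn_cons, List.ofFn_cons, ih]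
      simp

theorem take_subList {α : Type*} {n : ℕ} (h : Fin n → α) (a b : Fin n) (hab : a ≤ b) :
    (subList h (Finset.Icc a b)ᶜ).take a = (List.ofFn h).take a ∧
    (subList h (Finset.Icc a b)ᶜ).drop a = ((List.ofFn h).drop a).drop (b - a + 1) := by
  have h1 : ((List.ofFn h).take a).length = a := by simp [a.2.le]
  rw [subList_compl_Icc h a b hab]
  exact ⟨List.take_left' h1, List.drop_left' h1⟩

variable {k : Type*} [Field k] {U : Type*} [AddCommGroup U] [Module k U]
variable (𝒰 : ZMod 2 → Submodule k U) [DirectSum.Decomposition 𝒰]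

/-- `lcomp` allows empty inner blocks and `tensorComp` does not; the two agree because `ψ` has no
constant term. -/
theorem tensorComp_apply (φ : Cochain k U U) {ψ : Cochain k U U} {q : ZMod 2}
    (hψ : HasParity 𝒰 𝒰 q ψ) (hψ0 : ψ 0 = 0) (l : List U) :
    ev (tensorComp 𝒰 φ ψ) l = lcomp 𝒰 q (ev φ) (ev ψ) l := by
  refine MultiAdd.ext_homog 𝒰 (multiAdd_ev _) ((multiAdd_ev _).lcomp (multiAdd_ev _) _) ?_ l
  intro ws hws
  obtain ⟨n, p, x, hx, rfl⟩ := exists_ofFn_homog 𝒰 hws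
  rw [lcomp, ssum_eq_sum]
  simp only [ssum_eq_sum]
  rw [map_snd_ofFn, ev_ofFn]
  simp only [List.length_ofFn, List.length_drop]
  rw [sum_range_range_eq (fun i j => ev φ (((List.ofFn x).take i).map (signTwist 𝒰 q) ++
    ev ψ (((List.ofFn x).drop i).take j) :: ((List.ofFn x).drop i).drop j))]
  swap
  · intro i
    simp only [List.take_zero, ev_nil_eq_zero_iff.2 hψ0, (multiAdd_ev φ).map_zero]
  rw [tensorComp, sum_apply]
  refine Finset.sum_congr rfl fun a _ => ?_
  rw [sum_apply]
  refine Finset.sum_congr rfl fun b _ => ?_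
  split_ifs with hab
  swap
  · rfl
  rw [sum_apply]
  simp only [MultilinearMap.compLinearMap_apply]
  rw [sum_parityProj_of_homog 𝒰 hx (fun p' y =>
      (MultilinearMap.curryFinFinset k U U (s := Finset.Icc a b) rfl rfl).symm
        (((φ ((Finset.Icc a b)ᶜ.card + 1)).curryMid
            (Fin.ofNat ((Finset.Icc a b)ᶜ.card + 1) a)).compMultilinearMap
          (signTwist (cochainGrading 𝒰 𝒰) (∑ i ∈ Finset.Iio a, p' i) ψ
            (Finset.Icc a b).card)) y)
      (fun p' y i hy => MultilinearMap.map_coord_zero _ i hy),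
    MultilinearMap.curryFinFinset_symm_apply]
  simp only [finSumEquivOfFinset_inl, finSumEquivOfFinset_inr,
      LinearMap.compMultilinearMap_apply, MultilinearMap.curryMid_apply_apply]
  rw [signTwist_of_mem (cochainGrading 𝒰 𝒰) (x := ψ) (p := q) hψ]
  -- `Fin.ofNat` reduces modulo the number of slots of `φ`; since `a` arguments stand in front of
  -- the block, `a` is small enough not to be changed.
  have hcard : (a : ℕ) < (Finset.Icc a b)ᶜ.card + 1 := by
    rw [Finset.card_compl, Fin.card_Icc, Fintype.card_fin]
    rw [Fin.le_def] at hab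
    omega
  have ha : ((Fin.ofNat ((Finset.Icc a b)ᶜ.card + 1) a : Fin _) : ℕ) = a :=
    Nat.mod_eq_of_lt hcard
  rw [← ev_ofFn φ, ofFn_insertNth, ha, ofFn_orderEmbOfFin x _ rfl, (take_subList x a b hab).1,
    (take_subList x a b hab).2, Pi.smul_apply, smul_apply, ← ev_ofFn ψ, ofFn_orderEmbOfFin x _ rfl,
    subList_Icc x a b hab, (multiAdd_ev φ).map_zsmul]
  have h2 := map_signTwist_homog 𝒰 (hws.sublist (List.take_sublist a _)) q (multiAdd_ev φ) []
    (ev ψ (((List.ofFn x).drop a).take (b - a + 1)) :: ((List.ofFn x).drop a).drop (b - a + 1))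
  simp only [List.map_take, map_snd_ofFn, List.nil_append] at h2
  rw [← List.map_take, ← subList_Iio (fun i => (p i, x i))] at h2
  rw [h2, par_subList, mul_comm q]

end TensorComp

/-! ## Koszul signs of permutations -/

section Permutations

/-- The permutation of `Fin (n + 1)` obtained from `σ` by putting `0` in place `j`. -/
def insPerm {n : ℕ} (j : Fin (n + 1)) (σ : Equiv.Perm (Fin n)) : Equiv.Perm (Fin (n + 1)) :=
  ((finSuccEquiv' j).trans (Equiv.optionCongr σ)).trans (finSuccEquiv' 0).symm

@[simp] theorem insPerm_same {n : ℕ} (j : Fin (n + 1)) (σ : Equiv.Perm (Fin n)) :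
    insPerm j σ j = 0 := by simp [insPerm]

@[simp] theorem insPerm_succAbove {n : ℕ} (j : Fin (n + 1)) (σ : Equiv.Perm (Fin n)) (i : Fin n) :
    insPerm j σ (j.succAbove i) = (σ i).succ := by simp [insPerm]

theorem insPerm_symm_succ {n : ℕ} (j : Fin (n + 1)) (σ : Equiv.Perm (Fin n)) (i : Fin n) :
    (insPerm j σ).symm i.succ = j.succAbove (σ.symm i) := by
  rw [Equiv.symm_apply_eq, insPerm_succAbove, Equiv.apply_symm_apply]

theorem insPerm_bijective (n : ℕ) :
    Function.Bijective fun q : Fin (n + 1) × Equiv.Perm (Fin n) => insPerm q.1 q.2 := by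
  rw [Fintype.bijective_iff_injective_and_card]
  constructor
  · rintro ⟨j, σ⟩ ⟨j', σ'⟩ h
    have hj : j = j' := by
      apply (insPerm j σ).injective
      rw [insPerm_same]
      exact ((congrArg (fun e : Equiv.Perm (Fin (n + 1)) => e j') h).trans (insPerm_same j' σ')).symm
    subst hj
    congr 1
    ext i
    have := congrArg (fun e : Equiv.Perm (Fin (n + 1)) => e (j.succAbove i)) h
    simp only [insPerm_succAbove] at this
    rw [Fin.succ_injective _ this]
  · simp [Fintype.card_perm, Nat.factorial_succ]

theorem sum_perm_succ {M : Type*} [AddCommMonoid M] {n : ℕ}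
    (F : Equiv.Perm (Fin (n + 1)) → M) :
    ∑ ρ, F ρ = ∑ σ : Equiv.Perm (Fin n), ∑ j : Fin (n + 1), F (insPerm j σ) := by
  rw [← (insPerm_bijective n).sum_comp, Fintype.sum_prod_type_right]

/-- The inversions that involve the entry `0` are those with the entries placed before position `j`;
all others are inversions of `σ`. -/
theorem koszulSign_insPerm {n : ℕ} (p : Fin (n + 1) → ZMod 2) (j : Fin (n + 1))
    (σ : Equiv.Perm (Fin n)) : koszulSign p (insPerm j σ) =
      psign (p 0 * ∑ i : Fin n with i.castSucc < j, p (σ i).succ) *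
        koszulSign (fun i => p i.succ) σ := by
  simp only [koszulSign, Fin.prod_univ_succAbove _ j, insPerm_same, insPerm_succAbove,
    Fin.not_lt_zero, and_false, if_false, Finset.prod_const_one, one_mul, Fin.succ_pos,
    and_true, Fin.succAbove_lt_succAbove_iff, Fin.succ_lt_succ_iff, Finset.prod_mul_distrib]
  congr 1
  rw [Finset.mul_sum, psign_sum, Finset.prod_filter]
  refine Finset.prod_congr rfl fun i _ => ?_
  simp only [Fin.succAbove_lt_iff_castSucc_lt, mul_comm]

theorem ofFn_insPerm {α : Type*} {n : ℕ} (h : Fin (n + 1) → α) (j : Fin (n + 1))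
    (σ : Equiv.Perm (Fin n)) : List.ofFn (fun i => h (insPerm j σ i)) =
      (List.ofFn fun i => h (σ i).succ).take j ++ h 0 ::
        (List.ofFn fun i => h (σ i).succ).drop j := by
  rw [← ofFn_insertNth]
  congr 1
  funext i
  cases i using Fin.succAboveCases j <;> simp

theorem take_ofFn_eq_subList {α : Type*} {n : ℕ} (h : Fin n → α) (j : Fin (n + 1)) :
    (List.ofFn h).take j = subList h {i : Fin n | i.castSucc < j} := by
  rw [ofFn_eq_map_finRange, ← List.map_take, subList,
    filter_finRange_eq _ _ (List.take_sublist (j : ℕ) (List.finRange n))]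
  intro i
  simp [mem_take_finRange, Fin.lt_def]

theorem par_take_ofFn {α : Type*} {n : ℕ} (p : Fin n → ZMod 2) (x : Fin n → α) (j : Fin (n + 1)) :
    par ((List.ofFn fun i => (p i, x i)).take j) = ∑ i : Fin n with i.castSucc < j, p i := by
  rw [take_ofFn_eq_subList, par_subList]

theorem koszulSign_one {n : ℕ} (p : Fin n → ZMod 2) : koszulSign p 1 = 1 := by
  unfold koszulSign
  refine Finset.prod_eq_one fun i _ => Finset.prod_eq_one fun j _ => if_neg ?_
  simp only [Equiv.Perm.coe_one, id_eq, not_and, not_lt]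
  exact le_of_lt

/-- The letter `h` crosses the entries of `a` one by one, and the signs multiply to that of the
total parity of `a`. -/
theorem move_front {α M : Type*} [AddCommGroup M]
    (R : ZMod 2 × α → ZMod 2 × α → Prop) (g : List (ZMod 2 × α) → M)
    (hg : ∀ a h h' b, R h h' → g (a ++ h' :: h :: b) = psign (h.1 * h'.1) • g (a ++ h :: h' :: b))
    (a b : List (ZMod 2 × α)) (h : ZMod 2 × α) (hR : ∀ h' ∈ a, R h h') :
    g (a ++ h :: b) = psign (h.1 * par a) • g (h :: (a ++ b)) := by
  induction a using List.reverseRecOn generalizing b with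
  | nil => simp [psign_zero]
  | append_singleton a h' ih =>
    rw [List.append_assoc, List.singleton_append, hg _ _ _ _ (hR h' (by simp)),
      ih _ (fun h'' hh => hR h'' (by simp [hh])), smul_smul, ← psign_add]
    congr 2
    · simp [mul_add, add_comm]
    · simp

/-- A function on lists which is graded symmetric with respect to exchanges of adjacent entries
in the relation `R` is graded symmetric with respect to permutations which invert only such
pairs of entries. -/
theorem koszulSign_of_adjacent {α M : Type*} [AddCommGroup M]
    (R : ZMod 2 × α → ZMod 2 × α → Prop) (g : List (ZMod 2 × α) → M)
    (hg : ∀ a h h' b, R h h' → g (a ++ h' :: h :: b) = psign (h.1 * h'.1) • g (a ++ h :: h' :: b))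
    {n : ℕ} (p : Fin n → ZMod 2) (x : Fin n → α) (σ : Equiv.Perm (Fin n))
    (hσ : ∀ i j, i < j → σ j < σ i → R (p (σ j), x (σ j)) (p (σ i), x (σ i))) :
    g (List.ofFn fun i => (p (σ i), x (σ i))) =
      koszulSign p σ • g (List.ofFn fun i => (p i, x i)) := by
  induction n generalizing g with
  | zero => simp [koszulSign]
  | succ n ih =>
    -- The entry with index `0` is brought to the front from its place `j`; the induction then
    -- concerns `g` with that entry fixed as the head.
    obtain ⟨⟨j, σ⟩, rfl⟩ := (insPerm_bijective n).2 σ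
    simp only at hσ ⊢
    rw [ofFn_insPerm (fun i => (p i, x i)), move_front R g hg, List.take_append_drop,
      ih (fun l => g ((p 0, x 0) :: l)) (fun a h h' b => hg (_ :: a) h h' b) (fun i => p i.succ)
        (fun i => x i.succ), koszulSign_insPerm, smul_smul,
      par_take_ofFn (fun i => p (σ i).succ), List.ofFn_succ]
    · intro i i' hi hi'
      simpa using hσ (j.succAbove i) (j.succAbove i') (by simpa using hi) (by simpa using hi')
    · rw [take_ofFn_eq_subList (fun i => (p (σ i).succ, x (σ i).succ))]
      intro h' hh'
      simp only [subList, List.mem_map, List.mem_filter] at hh'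
      obtain ⟨i, hi, rfl⟩ := hh'
      simp only [Finset.mem_filter, Finset.mem_univ, true_and, decide_eq_true_eq] at hi
      simpa using hσ (j.succAbove i) j (Fin.succAbove_lt_iff_castSucc_lt _ _ |>.2 hi.2) (by simp)

variable {k : Type*} [Field k] {U W : Type*} [AddCommGroup U] [Module k U] [AddCommGroup W]
  [Module k W]
variable (𝒰 : ZMod 2 → Submodule k U) [DirectSum.Decomposition 𝒰]

open Classical in
/-- Iterated insertions as a sum over permutations. -/
theorem sum_koszulSign_eq_liter (r : ℕ) {n : ℕ} {f : List U → W} (hf : MultiAdd f)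
    {p : Fin n → ZMod 2} {x : Fin n → U} (hx : ∀ i, x i ∈ 𝒰 (p i)) :
    ∑ ρ : Equiv.Perm (Fin n) with ∀ i j : Fin n, i < j → r ≤ (i : ℕ) → ρ.symm i < ρ.symm j,
      koszulSign p ρ • f (List.ofFn fun i => x (ρ i)) =
    liter 𝒰 ((List.ofFn fun i => (p i, x i)).take r) f ((List.ofFn x).drop r) := by
  induction r generalizing n f with
  | zero =>
    rw [Finset.sum_eq_single 1]
    · simp [koszulSign_one]
    · intro ρ hρ hρ1
      refine absurd ?_ hρ1
      simp only [Finset.mem_filter, Finset.mem_univ, true_and, Nat.zero_le, true_implies] at hρ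
      have h1 : StrictMono ρ.symm := fun i j h => hρ i j h
      have h2 := Subsingleton.elim (h1.orderIsoOfSurjective ρ.symm ρ.symm.surjective)
        (OrderIso.refl (Fin n))
      ext i
      have h3 := congrArg (fun e : Fin n ≃o Fin n => e (ρ i)) h2
      simp only [StrictMono.coe_orderIsoOfSurjective, Equiv.symm_apply_apply,
        OrderIso.refl_apply] at h3
      rw [← h3]
      rfl
    · intro h
      refine absurd ?_ h
      simp only [Finset.mem_filter, Finset.mem_univ, true_and]
      exact fun i j hij _ => hij
  | succ r ih =>
    cases n with
    | zero =>
      rw [Finset.filter_true_of_mem (fun ρ _ i => i.elim0), Fintype.sum_unique]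
      simp [koszulSign]
    | succ n =>
      rw [Finset.sum_filter, sum_perm_succ, List.ofFn_succ, List.ofFn_succ, List.take_succ_cons,
        List.drop_succ_cons, liter_cons, ← ih (hf.linsert _ _) (fun i => hx i.succ),
        Finset.sum_filter]
      refine Finset.sum_congr rfl fun σ _ => ?_
      -- The order condition involves only indices above `r`, never the index `0`. Its place `j` is
      -- therefore free, and summing over `j` is one insertion.
      have hcond : ∀ j : Fin (n + 1), (∀ i i' : Fin (n + 1), i < i' → r + 1 ≤ (i : ℕ) →
          (insPerm j σ).symm i < (insPerm j σ).symm i') ↔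
          ∀ i i' : Fin n, i < i' → r ≤ (i : ℕ) → σ.symm i < σ.symm i' := by
        intro j
        constructor
        · intro h i i' hi hr
          have := h i.succ i'.succ (by simpa using hi) (by simpa using hr)
          simpa [insPerm_symm_succ] using this
        · intro h i i' hi hr
          cases i using Fin.cases with
          | zero => simp at hr
          | succ i =>
            cases i' using Fin.cases with
            | zero => simp at hi
            | succ i' =>
              simpa [insPerm_symm_succ] using h i i' (by simpa using hi) (by simpa using hr)
      simp only [hcond]
      split_ifs
      swap
      · simp
      rw [linsert, ssum_eq_sum, Finset.smul_sum, List.length_ofFn,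
        ← Fin.sum_univ_eq_sum_range (fun j => koszulSign (fun i => p i.succ) σ • f
          (((List.ofFn fun i => x (σ i).succ).take j).map (signTwist 𝒰 (p 0)) ++
            x 0 :: (List.ofFn fun i => x (σ i).succ).drop j))]
      refine Finset.sum_congr rfl fun j _ => ?_
      have h2 := map_signTwist_homog 𝒰 ((homog_ofFn 𝒰 (p := fun i => p (σ i).succ)
        (x := fun i => x (σ i).succ) fun i => hx _).sublist (List.take_sublist j _)) (p 0) hf []
        (x 0 :: (List.ofFn fun i => x (σ i).succ).drop j)
      rw [par_take_ofFn (fun i => p (σ i).succ)] at h2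
      simp only [List.map_take, map_snd_ofFn, List.nil_append] at h2
      rw [List.map_take, h2, smul_smul, ofFn_insPerm, koszulSign_insPerm, mul_comm]

end Permutations

/-! ### Splitting off constant terms -/

section Truncation

variable {k : Type*} [Field k] [CharZero k] {U W : Type*} [AddCommGroup U] [Module k U]
  [AddCommGroup W]
variable {𝒰 : ZMod 2 → Submodule k U} [DirectSum.Decomposition 𝒰]

/-- A list function without its constant term. -/
def ltrunc (f : List U → W) : List U → W
  | [] => 0
  | x :: l => f (x :: l)

@[simp] theorem ltrunc_nil (f : List U → W) : ltrunc f [] = 0 := rfl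
@[simp] theorem ltrunc_cons (f : List U → W) (x : U) (l : List U) :
    ltrunc f (x :: l) = f (x :: l) := rfl
theorem ltrunc_of_ne_nil (f : List U → W) {l : List U} (hl : l ≠ []) : ltrunc f l = f l := by
  cases l with
  | nil => exact absurd rfl hl
  | cons => rfl

theorem MultiAdd.ltrunc {f : List U → W} (hf : MultiAdd f) : MultiAdd (ltrunc f) := by
  intro a x y c
  simp only [ltrunc_of_ne_nil f (List.append_ne_nil_of_right_ne_nil a (List.cons_ne_nil _ c)), hf a]

/-- The constant term of the inner function splits off from a composition. -/
theorem lcomp_eq_add {f : List U → W} (hf : MultiAdd f) (q : ZMod 2) (ψ : List U → U)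
    (l : List U) :
    lcomp 𝒰 q f ψ l = linsert 𝒰 q (ψ []) f l + lcomp 𝒰 q (ltrunc f) (ltrunc ψ) l := by
  have h : ψ = fun l => constFun (ψ []) l + ltrunc ψ l := by
    funext l
    cases l <;> simp [constFun]
  conv_lhs => rw [h]
  rw [← lcomp_constFun hf]
  simp only [lcomp, hf _ (constFun _ _), ssum_add]
  congr 4
  funext a
  congr! 3 with b c
  rw [ltrunc_of_ne_nil f (List.append_ne_nil_of_right_ne_nil _ (List.cons_ne_nil _ _))]

/-- Iterated insertions into a composition. -/
theorem liter_lcomp_eq {f : List U → W} (hf : MultiAdd f) {ψ : List U → U} (hψ' : MultiAdd ψ)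
    {q : ZMod 2} (hψ : ListParity 𝒰 q ψ) {ws : List (ZMod 2 × U)} (hws : Homog 𝒰 ws)
    (l : List U) :
    liter 𝒰 ws (lcomp 𝒰 q f ψ) l =
      usum (fun S T => liter 𝒰 ((q + par S, liter 𝒰 S ψ []) :: T) f l) ws +
      usum (fun S T => psign (par T * (q + par S)) •
        lcomp 𝒰 (q + par S) (ltrunc (liter 𝒰 T f)) (ltrunc (liter 𝒰 S ψ)) l) ws := by
  rw [liter_lcomp hf hψ' hψ hws, ← usum_add]
  refine usum_congr fun S T hS hT _ _ => ?_
  rw [lcomp_eq_add (hf.liter T), smul_add]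
  congr 1
  have hmem : liter 𝒰 S ψ [] ∈ 𝒰 (q + par S) := by
    refine mem_of_signTwist 𝒰 ?_
    simpa using hψ.liter hψ' (hws.sublist hS) 1 []
  -- The constant term of the inner function is inserted last. Moving it to the front of `T`
  -- produces precisely the sign present in the Leibniz rule.
  rw [liter_rotate hf hmem (hws.sublist hT), liter_append, mul_comm]
  rfl

end Truncation

/-! ### Symmetrization as iterated insertion -/

section Symmetrization

variable {k : Type*} [Field k] {U W : Type*} [AddCommGroup U] [Module k U] [AddCommGroup W]
  [Module k W]
variable (𝒰 : ZMod 2 → Submodule k U) [DirectSum.Decomposition 𝒰]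

theorem permute_apply {n : ℕ} (τ : Equiv.Perm (Fin n)) (φ : MultilinearMap k (fun _ : Fin n => U) W)
    {p : Fin n → ZMod 2} {x : Fin n → U} (hx : ∀ i, x i ∈ 𝒰 (p i)) :
    permute 𝒰 τ φ x = koszulSign p τ • φ fun i => x (τ i) := by
  rw [permute, sum_apply]
  simp only [smul_apply, MultilinearMap.compLinearMap_apply]
  rw [sum_parityProj_of_homog 𝒰 hx (fun p' y => koszulSign p' τ • φ.domDomCongr τ y)]
  · rfl
  · intro p' y i hy
    rw [MultilinearMap.map_coord_zero _ i hy, smul_zero]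

/-- When every argument is inserted and none remains, the iterated insertion runs over all
permutations without restriction. -/
theorem symmetrization_apply (m : Cochain k U U) {ws : List (ZMod 2 × U)} (hws : Homog 𝒰 ws) :
    ev (symmetrization 𝒰 m) (ws.map Prod.snd) = liter 𝒰 ws (ev m) [] := by
  classical
  obtain ⟨n, p, x, hx, rfl⟩ := exists_ofFn_homog 𝒰 hws
  have h := sum_koszulSign_eq_liter 𝒰 n (multiAdd_ev m) hx
  rw [Finset.filter_true_of_mem (fun ρ _ i j _ hi => absurd i.2 (by omega)),
    List.take_of_length_le (by simp), List.drop_of_length_le (by simp)] at h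
  rw [← h, map_snd_ofFn, ev_ofFn, symmetrization, sum_apply]
  exact Finset.sum_congr rfl fun σ _ => by rw [permute_apply 𝒰 σ _ hx, ev_ofFn]

/-- `symmetrization` as a linear map. -/
def symmetrizationₗ : Cochain k U U →ₗ[k] Cochain k U U where
  toFun := symmetrization 𝒰
  map_add' φ ψ := by
    ext n x
    simp [symmetrization, permute, Finset.sum_add_distrib]
  map_smul' c φ := by
    ext n x
    simp [symmetrization, permute, Finset.smul_sum, smul_comm c]

theorem symmetrizationₗ_apply (φ : Cochain k U U) :
    symmetrizationₗ 𝒰 φ = symmetrization 𝒰 φ := rfl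

variable {𝒰}

theorem gradedSymmetric_of_swap {φ : Cochain k U W} (h : ∀ a h h' b, Homog 𝒰 (a ++ h :: h' :: b) →
      ev φ ((a ++ h' :: h :: b).map Prod.snd) =
        psign (h.1 * h'.1) • ev φ ((a ++ h :: h' :: b).map Prod.snd)) :
    GradedSymmetric 𝒰 φ := by
  intro n σ p x hx
  -- `koszulSign_of_adjacent` wants its exchange rule on arbitrary lists, while exchange is known
  -- for homogeneous entries only. So each entry carries a proof of its parity, and the function is
  -- set to zero on lists whose labels disagree with these parities.
  let x' : Fin n → Σ i, 𝒰 i := fun i => ⟨p i, x i, hx i⟩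
  have := koszulSign_of_adjacent (α := Σ i, 𝒰 i) (fun h h' => h.1 = h.2.1 ∧ h'.1 = h'.2.1)
    (fun l => if ∀ h ∈ l, h.1 = h.2.1 then ev φ (l.map fun h => (h.2.2 : U)) else 0) ?_ p x' σ
    (by simp [x'])
  · have h1 : ∀ τ : Equiv.Perm (Fin n), ∀ h ∈ List.ofFn fun i => (p (τ i), x' (τ i)),
        h.1 = h.2.1 := by
      intro τ h hh
      rw [List.mem_ofFn] at hh
      obtain ⟨i, rfl⟩ := hh
      rfl
    have h2 := h1 1
    simp only [Equiv.Perm.coe_one, id_eq] at h2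
    rw [if_pos (h1 σ), if_pos h2] at this
    simpa [List.map_ofFn, Function.comp_def, x'] using this
  · intro a y y' b hR
    by_cases hall : ∀ h ∈ a ++ y :: y' :: b, h.1 = h.2.1
    · have hall' : ∀ h ∈ a ++ y' :: y :: b, h.1 = h.2.1 := by
        intro h hh
        refine hall h ?_
        simp only [List.mem_append, List.mem_cons] at hh ⊢
        tauto
      rw [if_pos hall, if_pos hall']
      have h0 : ∀ l : List (ZMod 2 × Σ i, 𝒰 i), (l.map fun h => (h.2.2 : U)) =
          (l.map fun h => (h.1, (h.2.2 : U))).map Prod.snd := by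
        intro l
        simp [List.map_map, Function.comp_def]
      rw [h0, h0]
      have h3 := h (a.map fun h => (h.1, (h.2.2 : U))) (y.1, (y.2.2 : U)) (y'.1, (y'.2.2 : U))
        (b.map fun h => (h.1, (h.2.2 : U))) ?_
      · simpa using h3
      intro z hz
      have hz₁ : z ∈ (a ++ y :: y' :: b).map fun h => (h.1, (h.2.2 : U)) := by simpa using hz
      rw [List.mem_map] at hz₁
      obtain ⟨z, hz₂, rfl⟩ := hz₁
      have := hall z hz₂
      simp only [this]
      exact z.2.2.2
    · rw [if_neg hall, if_neg, smul_zero]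
      contrapose! hall
      intro h hh
      refine hall h ?_
      simp only [List.mem_append, List.mem_cons] at hh ⊢
      tauto

theorem homog_append {a b : List (ZMod 2 × U)} : Homog 𝒰 (a ++ b) ↔ Homog 𝒰 a ∧ Homog 𝒰 b := by
  simp [Homog, or_imp, forall_and]

/-- The graded commutativity of insertions (`liter_swap`) is all that is needed. -/
theorem gradedSymmetric_symmetrization (m : Cochain k U U) :
    GradedSymmetric 𝒰 (symmetrization 𝒰 m) := by
  refine gradedSymmetric_of_swap fun a h h' b hl => ?_
  have hl' : Homog 𝒰 (a ++ h' :: h :: b) := by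
    rw [homog_append, homog_cons, homog_cons] at hl ⊢
    tauto
  rw [symmetrization_apply 𝒰 m hl, symmetrization_apply 𝒰 m hl']
  rw [homog_append, homog_cons, homog_cons] at hl
  rw [liter_swap (multiAdd_ev m) hl.2.2.1 hl.2.1, mul_comm]

theorem hasParity_symmetrization [CharZero k] {m : Cochain k U U} {q : ZMod 2}
    (hm : HasParity 𝒰 𝒰 q m) : HasParity 𝒰 𝒰 q (symmetrization 𝒰 m) := by
  rw [hasParity_iff]
  intro ws hws
  rw [symmetrization_apply 𝒰 m hws]
  refine mem_of_signTwist 𝒰 ?_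
  have := (listParity_ev 𝒰 hm).liter (multiAdd_ev m) hws 1 []
  simpa [add_comm] using this

theorem symmetrization_zero {m : Cochain k U U} (hm : m 0 = 0) : symmetrization 𝒰 m 0 = 0 := by
  rw [← ev_nil_eq_zero_iff] at hm ⊢
  have := symmetrization_apply 𝒰 m (ws := []) (by simp [Homog])
  simpa [hm] using this

theorem cochain_ext_homog {φ ψ : Cochain k U W}
    (h : ∀ ws, Homog 𝒰 ws → ev φ (ws.map Prod.snd) = ev ψ (ws.map Prod.snd)) : φ = ψ :=
  ev_ext ((multiAdd_ev φ).ext_homog 𝒰 (multiAdd_ev ψ) h)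

theorem ev_symComp (φ : Cochain k U W) (ψ : Cochain k U U) {ws : List (ZMod 2 × U)}
    (hws : Homog 𝒰 ws) : ev (symComp 𝒰 φ ψ) (ws.map Prod.snd) =
      usum (fun S T => ev φ (ev ψ (S.map Prod.snd) :: T.map Prod.snd)) ws := by
  obtain ⟨n, p, x, hx, rfl⟩ := exists_ofFn_homog 𝒰 hws
  rw [map_snd_ofFn, ev_ofFn, symComp_apply 𝒰 hx]

theorem liter_nil_mem [CharZero k] {m : Cochain k U U} {q : ZMod 2} (hm : HasParity 𝒰 𝒰 q m)
    {ws : List (ZMod 2 × U)} (hws : Homog 𝒰 ws) : liter 𝒰 ws (ev m) [] ∈ 𝒰 (q + par ws) := by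
  rw [← symmetrization_apply 𝒰 m hws, add_comm]
  exact (hasParity_iff 𝒰).1 (hasParity_symmetrization hm) ws hws

/-- Symmetrization turns `tensorComp` into `symComp`. -/
theorem symmetrization_tensorComp [CharZero k] (φ : Cochain k U U) {ψ : Cochain k U U}
    {q : ZMod 2} (hψ : HasParity 𝒰 𝒰 q ψ) (hψ0 : ψ 0 = 0) :
    symmetrization 𝒰 (tensorComp 𝒰 φ ψ) =
      symComp 𝒰 (symmetrization 𝒰 φ) (symmetrization 𝒰 ψ) := by
  refine cochain_ext_homog (𝒰 := 𝒰) fun ws hws => ?_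
  rw [symmetrization_apply 𝒰 _ hws, ev_symComp _ _ hws, funext (tensorComp_apply 𝒰 φ hψ hψ0),
    liter_lcomp_eq (multiAdd_ev φ) (multiAdd_ev ψ) (listParity_ev 𝒰 hψ) hws]
  -- With no arguments left, the truncated composites reduce to a value at the entry zero and
  -- vanish; only the terms with an inserted constant survive, and they form `symComp`.
  have h0 : ∀ q (f g : List U → U), lcomp 𝒰 q (ltrunc f) (ltrunc g) [] = ltrunc f [0] := by
    intro q f g
    simp [lcomp]
  have h1 : ∀ T, ltrunc (liter 𝒰 T (ev φ)) [0] = 0 := fun T =>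
    ((multiAdd_ev φ).liter T).ltrunc.map_zero [] []
  simp only [h0, h1, smul_zero]
  have h2 : ∀ l : List (ZMod 2 × U), usum (fun _ _ => (0 : U)) l = 0 :=
    fun l => (map_usum (0 : U →+ U) (fun _ _ => 0) l).symm
  rw [h2, add_zero]
  refine usum_congr fun S T hS hT _ _ => ?_
  have hS' := hws.sublist hS
  rw [symmetrization_apply 𝒰 ψ hS', ← symmetrization_apply 𝒰 φ (homog_cons.2
    ⟨liter_nil_mem hψ hS', hws.sublist hT⟩), List.map_cons]

theorem koszulSign_mul_self {n : ℕ} (p : Fin n → ZMod 2) (σ : Equiv.Perm (Fin n)) :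
    koszulSign p σ * koszulSign p σ = 1 := by
  rw [koszulSign, ← Finset.prod_mul_distrib]
  refine Finset.prod_eq_one fun i _ => ?_
  rw [← Finset.prod_mul_distrib]
  refine Finset.prod_eq_one fun j _ => ?_
  split_ifs
  · exact psign_mul_self _
  · rfl

/-- The sign from graded symmetry cancels the sign in the sum, so all permutations contribute
equally. -/
theorem symmetrization_of_gradedSymmetric {φ : Cochain k U U} (hφ : GradedSymmetric 𝒰 φ) (n : ℕ) :
    symmetrization 𝒰 φ n = (n.factorial : k) • φ n := by
  have h : ∀ l, ev (symmetrization 𝒰 φ) l = (l.length.factorial : k) • ev φ l := by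
    refine (multiAdd_ev _).ext_homog 𝒰 (g := fun l => (l.length.factorial : k) • ev φ l) ?_ ?_
    · intro a x y c
      simp [multiAdd_ev φ a x y]
    · intro ws hws
      obtain ⟨n, p, x, hx, rfl⟩ := exists_ofFn_homog 𝒰 hws
      rw [map_snd_ofFn, ev_ofFn, symmetrization, sum_apply]
      simp only [permute_apply 𝒰 _ _ hx, hφ n _ p x hx, smul_smul, koszulSign_mul_self, one_smul]
      simp [Fintype.card_perm, Nat.cast_smul_eq_nsmul]
  ext x
  have := h (List.ofFn x)
  simpa using this

/-- The components of `φ` divided by factorials. -/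
def divFactorial (φ : Cochain k U W) : Cochain k U W := fun n => (n.factorial : k)⁻¹ • φ n

theorem symmetrization_divFactorial [CharZero k] {φ : Cochain k U U}
    (hφ : GradedSymmetric 𝒰 φ) : symmetrization 𝒰 (divFactorial φ) = φ := by
  have h : GradedSymmetric 𝒰 (divFactorial φ) := by
    intro n σ p x hx
    simp [divFactorial, hφ n σ p x hx, smul_comm (koszulSign p σ)]
  funext n
  rw [symmetrization_of_gradedSymmetric h, divFactorial, smul_smul, mul_inv_cancel₀, one_smul]
  exact_mod_cast n.factorial_ne_zero

theorem hasParity_divFactorial {φ : Cochain k U U} {q : ZMod 2} (hφ : HasParity 𝒰 𝒰 q φ) :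
    HasParity 𝒰 𝒰 q (divFactorial φ) := fun n p x hx =>
  Submodule.smul_mem _ _ (hφ n p x hx)

end Symmetrization

/-! ## Shuffles and permutations -/

section Shuffles

/-- A sign attached to a list of distinct labels with parities. -/
def inversionSign : List (ZMod 2 × ℕ) → ℤ
  | [] => 1
  | h :: l => (l.map fun h' => if h'.2 < h.2 then psign (h.1 * h'.1) else 1).prod *
      inversionSign l

theorem inversionSign_ne_zero (l : List (ZMod 2 × ℕ)) : inversionSign l ≠ 0 := by
  induction l with
  | nil => simp [inversionSign]
  | cons h l ih =>
    rw [inversionSign]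
    refine mul_ne_zero (List.prod_ne_zero ?_) ih
    simp only [List.mem_map, not_exists, not_and]
    intro h' _ h0
    have h1 : ∀ a : ZMod 2, psign a ≠ 0 := by decide
    split_ifs at h0
    · exact h1 _ h0
    · exact one_ne_zero h0

theorem inversionSign_swap (a : List (ZMod 2 × ℕ)) (h h' : ZMod 2 × ℕ) (b : List (ZMod 2 × ℕ))
    (hne : h.2 ≠ h'.2) : inversionSign (a ++ h' :: h :: b) =
      psign (h.1 * h'.1) • inversionSign (a ++ h :: h' :: b) := by
  induction a with
  | nil =>
    simp only [List.nil_append, inversionSign, List.map_cons, List.prod_cons, smul_eq_mul]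
    rcases lt_or_gt_of_ne hne with hlt | hlt
    · rw [if_pos hlt, if_neg hlt.not_gt, mul_comm h'.1]
      ring
    · rw [if_pos hlt, if_neg hlt.not_gt]
      linear_combination (-(inversionSign b *
        (List.map (fun h'' => if h''.2 < h.2 then psign (h.1 * h''.1) else 1) b).prod *
        (List.map (fun h'' => if h''.2 < h'.2 then psign (h'.1 * h''.1) else 1) b).prod)) *
        psign_mul_self (h.1 * h'.1)
  | cons x a ih =>
    simp only [List.cons_append, inversionSign, ih, smul_eq_mul, List.map_append, List.map_cons,
      List.prod_append, List.prod_cons]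
    ring

/-- `inversionSign` never vanishes and is graded symmetric under exchanges of neighbours with
distinct labels, so by `koszulSign_of_adjacent` it changes under a permutation by the Koszul sign.
Following it along `σ * τ` at once and in two stages and cancelling its value gives the cocycle
rule. -/
theorem koszulSign_mul {n : ℕ} (p : Fin n → ZMod 2) (σ τ : Equiv.Perm (Fin n)) :
    koszulSign p (σ * τ) = koszulSign p σ * koszulSign (fun i => p (σ i)) τ := by
  have h := fun (p : Fin n → ZMod 2) (x : Fin n → ℕ) (hx : Function.Injective x) σ =>
    koszulSign_of_adjacent (fun h h' => h.2 ≠ h'.2) inversionSign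
    (fun a h h' b => inversionSign_swap a h h' b) p x σ
    (fun i j hij _ hh => hij.ne' (σ.injective (hx hh)))
  have h1 := h p _ Fin.val_injective (σ * τ)
  have h2 := h (fun i => p (σ i)) (fun i => (σ i : ℕ)) (Fin.val_injective.comp σ.injective) τ
  have h3 := h p _ Fin.val_injective σ
  rw [h3] at h2
  have h4 := h1.symm.trans h2
  rw [smul_smul] at h4
  rw [mul_comm]
  exact mul_right_cancel₀ (inversionSign_ne_zero _) h4

theorem leftPerm_castAdd {r n : ℕ} (σ : Equiv.Perm (Fin r)) (i : Fin r) :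
    leftPerm r n σ (Fin.castAdd n i) = Fin.castAdd n (σ i) := by
  simp [leftPerm, Equiv.permCongr_apply]

theorem leftPerm_natAdd {r n : ℕ} (σ : Equiv.Perm (Fin r)) (i : Fin n) :
    leftPerm r n σ (Fin.natAdd r i) = Fin.natAdd r i := by
  simp [leftPerm, Equiv.permCongr_apply]

/-- Dividing `ρ` by a permutation of the first `r` indices leaves a shuffle exactly when `ρ` keeps
the last `n` indices in order and `σ` lists the first `r` in the order of their places under `ρ`. -/
theorem isShuffle_leftPerm_inv_mul {r n : ℕ} (σ : Equiv.Perm (Fin r))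
    (ρ : Equiv.Perm (Fin (r + n))) : IsShuffle r n ((leftPerm r n σ)⁻¹ * ρ) ↔
      (∀ i j : Fin (r + n), i < j → r ≤ (i : ℕ) → ρ.symm i < ρ.symm j) ∧
      StrictMono ((fun i => ρ.symm (Fin.castAdd n i)) ∘ σ) := by
  have h : ∀ i, ((leftPerm r n σ)⁻¹ * ρ).symm i = ρ.symm (leftPerm r n σ i) := fun i => rfl
  simp only [IsShuffle, h]
  constructor
  · intro H
    refine ⟨fun i j hij hi => ?_, fun i j hij => ?_⟩
    · have h1 := H i j hij (Or.inr hi)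
      obtain ⟨i, rfl⟩ : ∃ i', i = Fin.natAdd r i' := ⟨⟨i - r, by omega⟩, by ext; simp; omega⟩
      have hj : r ≤ (j : ℕ) := hi.trans (Fin.le_def.1 hij.le)
      obtain ⟨j, rfl⟩ : ∃ j', j = Fin.natAdd r j' := ⟨⟨j - r, by omega⟩, by ext; simp; omega⟩
      rwa [leftPerm_natAdd, leftPerm_natAdd] at h1
    · have h1 := H (Fin.castAdd n i) (Fin.castAdd n j) hij (Or.inl (by simp))
      rwa [leftPerm_castAdd, leftPerm_castAdd] at h1
  · rintro ⟨h1, h2⟩ i j hij (hj | hi)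
    · obtain ⟨j, rfl⟩ : ∃ j', j = Fin.castAdd n j' := ⟨⟨j, hj⟩, rfl⟩
      obtain ⟨i, rfl⟩ : ∃ i', i = Fin.castAdd n i' := ⟨⟨i, (Fin.lt_def.1 hij).trans hj⟩, rfl⟩
      rw [leftPerm_castAdd, leftPerm_castAdd]
      exact h2 hij
    · have h3 := h1 i j hij hi
      obtain ⟨i, rfl⟩ : ∃ i', i = Fin.natAdd r i' := ⟨⟨i - r, by omega⟩, by ext; simp; omega⟩
      have hj : r ≤ (j : ℕ) := hi.trans (Fin.le_def.1 hij.le)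
      obtain ⟨j, rfl⟩ : ∃ j', j = Fin.natAdd r j' := ⟨⟨j - r, by omega⟩, by ext; simp; omega⟩
      rwa [leftPerm_natAdd, leftPerm_natAdd]

-- Every `ρ` that keeps the last `n` indices in order is counted once: the only admissible `σ` is
-- the one which sorts the places of the first `r` indices, and these places are distinct.
open Classical in
theorem sum_leftPerm_isShuffle {M : Type*} [AddCommMonoid M] (r n : ℕ)
    (F : Equiv.Perm (Fin (r + n)) → M) :
    ∑ σ : Equiv.Perm (Fin r), ∑ τ with IsShuffle r n τ, F (leftPerm r n σ * τ) =
      ∑ ρ with ∀ i j : Fin (r + n), i < j → r ≤ (i : ℕ) → ρ.symm i < ρ.symm j, F ρ := by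
  have h1 : ∀ σ : Equiv.Perm (Fin r), ∑ τ with IsShuffle r n τ, F (leftPerm r n σ * τ) =
      ∑ ρ, if IsShuffle r n ((leftPerm r n σ)⁻¹ * ρ) then F ρ else 0 := by
    intro σ
    rw [Finset.sum_filter]
    exact Fintype.sum_equiv (Equiv.mulLeft (leftPerm r n σ)) _ _ (by simp)
  simp only [h1]
  rw [Finset.sum_comm, Finset.sum_filter]
  refine Finset.sum_congr rfl fun ρ _ => ?_
  simp only [isShuffle_leftPerm_inv_mul]
  split_ifs with hρ
  · have hinj : Function.Injective fun i : Fin r => ρ.symm (Fin.castAdd n i) :=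
      ρ.symm.injective.comp (Fin.castAdd_injective r n)
    have hmono := (Tuple.monotone_sort (fun i : Fin r => ρ.symm (Fin.castAdd n i))).strictMono_of_injective
      (hinj.comp (Equiv.injective _))
    rw [Finset.sum_eq_single (Tuple.sort fun i : Fin r => ρ.symm (Fin.castAdd n i))]
    · rw [if_pos ⟨hρ, hmono⟩]
    · intro σ _ hσ
      refine if_neg fun hs => hσ ?_
      have := (hs.2.range_inj hmono).1 (by simp [Set.range_comp])
      ext i
      exact congrArg _ (hinj (congrFun this i))
    · simp
  · exact Finset.sum_eq_zero fun σ _ => if_neg fun h => hρ h.1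

end Shuffles

/-! ### The twisting maps on lists -/

section TwistingMaps

variable {k : Type*} [Field k] {U : Type*} [AddCommGroup U] [Module k U]
variable {𝒰 : ZMod 2 → Submodule k U} [DirectSum.Decomposition 𝒰]

theorem curryArgs_apply (r n : ℕ) (φ : MultilinearMap k (fun _ : Fin (r + n) => U) U)
    (w : Fin r → U) (x : Fin n → U) : curryArgs r n φ w x = φ (Fin.append w x) := by
  simp only [curryArgs, MultilinearMap.currySum_apply, MultilinearMap.domDomCongr_apply]
  congr 1
  funext i
  cases i using Fin.addCases <;> simp

theorem ev_lInftyTwistingMap (m : Cochain k U U) (w l : List U) :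
    ev (ev (lInftyTwistingMap m) w) l = if w = [] ∨ l = [] then 0 else ev m (w ++ l) := by
  obtain ⟨r, w, rfl⟩ := exists_ofFn w
  obtain ⟨n, x, rfl⟩ := exists_ofFn l
  simp only [ev_ofFn, List.ofFn_eq_nil_iff, ← List.ofFn_fin_append, lInftyTwistingMap]
  by_cases hr : r = 0
  · simp [hr]
  by_cases hn : n = 0
  · simp [hr, hn]
  simp only [hr, hn, if_false, or_self, MultilinearMap.pi_apply, curryArgs_apply]

/-- A permutation of the `w`'s followed by a shuffle is the same as a permutation that keeps the
`x`'s in order, and summing over these is iterated insertion. The truncation appears because only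
arities `n ≥ 1` are kept in the definition. -/
theorem ev_aInftyTwistingMap (m : Cochain k U U) {ws : List (ZMod 2 × U)} (hws : Homog 𝒰 ws)
    (l : List U) : ev (ev (aInftyTwistingMap 𝒰 m) (ws.map Prod.snd)) l =
      if ws = [] then 0 else ltrunc (liter 𝒰 ws (ev m)) l := by
  classical
  obtain ⟨r, p, w, hw, rfl⟩ := exists_ofFn_homog 𝒰 hws
  simp only [map_snd_ofFn, ev_ofFn, List.ofFn_eq_nil_iff, aInftyTwistingMap]
  by_cases hr : r = 0
  · simp [hr]
  simp only [hr, if_false]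
  refine MultiAdd.ext_homog 𝒰 (multiAdd_ev _) ((multiAdd_ev m).liter _).ltrunc ?_ l
  intro vs hvs
  obtain ⟨n, p', x, hx, rfl⟩ := exists_ofFn_homog 𝒰 hvs
  rw [map_snd_ofFn, ev_ofFn]
  by_cases hn : n = 0
  · subst hn
    simp
  rw [ltrunc_of_ne_nil _ (by simpa using hn)]
  simp only [hn, if_false, MultilinearMap.pi_apply, curryArgs_apply, sum_apply]
  have happ : ∀ i, Fin.append w x i ∈ 𝒰 (Fin.append p p' i) := by
    intro i
    cases i using Fin.addCases <;> simp [hw, hx]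
  have h := sum_koszulSign_eq_liter 𝒰 r (multiAdd_ev m) happ
  have h1 : (List.ofFn fun i => (Fin.append p p' i, Fin.append w x i)).take r =
      List.ofFn fun i => (p i, w i) := by
    have : (fun i => (Fin.append p p' i, Fin.append w x i)) =
        Fin.append (fun i => (p i, w i)) (fun i => (p' i, x i)) := by
      funext i
      cases i using Fin.addCases <;> simp
    rw [this, List.ofFn_fin_append, List.take_left' (by simp)]
  have h2 : (List.ofFn (Fin.append w x)).drop r = List.ofFn x := by
    rw [List.ofFn_fin_append, List.drop_left' (by simp)]
  rw [h1, h2, ← sum_leftPerm_isShuffle] at h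
  rw [← h]
  refine Finset.sum_congr rfl fun σ _ => ?_
  rw [permute_apply 𝒰 _ _ happ, shuffleSum, sum_apply, Finset.smul_sum]
  refine Finset.sum_congr rfl fun τ _ => ?_
  rw [permute_apply 𝒰 τ _ (fun i => happ _), smul_smul, koszulSign_mul, ev_ofFn]
  rfl

end TwistingMaps

/-! ## Differential graded Lie algebras from graded pre-Lie algebras -/

section PreLie

variable {k : Type*} [Field k] [CharZero k] {g : Type*} [AddCommGroup g] [Module k g]
variable (𝒢 : ZMod 2 → Submodule k g) [DirectSum.Decomposition 𝒢]

theorem superCommutator_apply (comp : g →ₗ[k] g →ₗ[k] g) {i j : ZMod 2} {x y : g} (hx : x ∈ 𝒢 i)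
    (hy : y ∈ 𝒢 j) :
    superCommutator 𝒢 comp x y = comp x y - psign (i * j) • comp y x := by
  simp only [superCommutator, LinearMap.sub_apply, LinearMap.sum_apply, LinearMap.smul_apply,
    LinearMap.compl₁₂_apply, LinearMap.flip_apply]
  rw [Finset.sum_eq_single i, Finset.sum_eq_single j]
  · simp [parityProj_of_mem 𝒢 hx, parityProj_of_mem 𝒢 hy]
  · intro b _ hb
    simp [parityProj_of_mem 𝒢 hy, hb]
  · simp
  · intro b _ hb
    simp [parityProj_of_mem 𝒢 hx, hb]
  · simp

theorem psign_eq_or (i : ZMod 2) : psign i = 1 ∨ psign i = -1 := by revert i; decide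

variable {𝒢}

theorem superCommutator_jacobi {comp : g →ₗ[k] g →ₗ[k] g} {i j l : ZMod 2} {x y z : g}
    (hx : x ∈ 𝒢 i) (hy : y ∈ 𝒢 j) (hz : z ∈ 𝒢 l)
    (hyz : comp y z ∈ 𝒢 (j + l)) (hzy : comp z y ∈ 𝒢 (j + l))
    (hxy : comp x y ∈ 𝒢 (i + j)) (hyx : comp y x ∈ 𝒢 (i + j))
    (hxz : comp x z ∈ 𝒢 (i + l)) (hzx : comp z x ∈ 𝒢 (i + l))
    (h1 : comp (comp x y) z - comp x (comp y z) =
      psign (j * l) • (comp (comp x z) y - comp x (comp z y)))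
    (h2 : comp (comp y x) z - comp y (comp x z) =
      psign (i * l) • (comp (comp y z) x - comp y (comp z x)))
    (h3 : comp (comp z x) y - comp z (comp x y) =
      psign (i * j) • (comp (comp z y) x - comp z (comp y x))) :
    superCommutator 𝒢 comp x (superCommutator 𝒢 comp y z) =
      superCommutator 𝒢 comp (superCommutator 𝒢 comp x y) z +
        psign (i * j) • superCommutator 𝒢 comp y (superCommutator 𝒢 comp x z) := by
  have e1 : ∀ (s : ℤ) {a : g} {q : ZMod 2}, a ∈ 𝒢 q → s • a ∈ 𝒢 q :=
    fun s a q ha => zsmul_mem ha s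
  rw [superCommutator_apply 𝒢 comp hy hz, superCommutator_apply 𝒢 comp hx hy,
    superCommutator_apply 𝒢 comp hx hz,
    superCommutator_apply 𝒢 comp hx (sub_mem hyz (e1 _ hzy)),
    superCommutator_apply 𝒢 comp (sub_mem hxy (e1 _ hyx)) hz,
    superCommutator_apply 𝒢 comp hy (sub_mem hxz (e1 _ hzx))]
  simp only [mul_add, add_mul, psign_add, mul_comm j i, map_sub, map_zsmul, LinearMap.sub_apply,
    LinearMap.smul_apply]
  -- Only the three pairwise signs matter. For each of their eight values the Jacobi identity is a
  -- signed sum of the three pre-Lie identities.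
  rcases psign_eq_or (i * j) with s | s <;> rcases psign_eq_or (i * l) with t | t <;>
    rcases psign_eq_or (j * l) with u | u <;> rw [s] at h3 <;> rw [t] at h2 <;> rw [u] at h1 <;>
    rw [s, t, u]
  · linear_combination (norm := module) -h1 + h2 - h3
  · linear_combination (norm := module) -h1 + h2 + h3
  · linear_combination (norm := module) -h1 + h2 + h3
  · linear_combination (norm := module) -h1 + h2 - h3
  · linear_combination (norm := module) -h1 - h2 - h3
  · linear_combination (norm := module) -h1 - h2 + h3
  · linear_combination (norm := module) -h1 - h2 + h3
  · linear_combination (norm := module) -h1 - h2 - h3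

/-- The commutator of a graded pre-Lie product satisfies the Jacobi identity, first for homogeneous
entries and then, by decomposing the third one, as required. Taken with `m` in front, the Jacobi
identity is the Leibniz rule for the differential. Only commutators, not products, need to stay in
`S`, as is the case for cyclic cochains. -/
theorem isDGLAOn_of_preLie (comp : g →ₗ[k] g →ₗ[k] g) (S : Submodule k g)
    (hgr : ∀ q, ∀ x ∈ S, parityProj 𝒢 q x ∈ S)
    (heven : ∀ i j, ∀ x ∈ S, ∀ y ∈ S, x ∈ 𝒢 i → y ∈ 𝒢 j → comp x y ∈ 𝒢 (i + j))
    (hassoc : ∀ j l, ∀ x ∈ S, ∀ y ∈ S, ∀ z ∈ S, y ∈ 𝒢 j → z ∈ 𝒢 l → (∃ i, x ∈ 𝒢 i) →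
      comp (comp x y) z - comp x (comp y z) =
        psign (j * l) • (comp (comp x z) y - comp x (comp z y)))
    (hbr : ∀ i j, ∀ x ∈ S, ∀ y ∈ S, x ∈ 𝒢 i → y ∈ 𝒢 j →
      comp x y - psign (i * j) • comp y x ∈ S)
    {m : g} (hmS : m ∈ S) (hm : m ∈ 𝒢 1) (hmm : comp m m = 0) :
    IsDGLAOn 𝒢 (superCommutator 𝒢 comp m) (superCommutator 𝒢 comp) S := by
  have hsum : ∀ x ∈ S, x = ∑ q, parityProj 𝒢 q x := fun x _ => (sum_parityProj 𝒢 x).symm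
  have hbr' : ∀ x ∈ S, ∀ y ∈ S, superCommutator 𝒢 comp x y ∈ S := by
    intro x hx y hy
    rw [hsum x hx, hsum y hy, LinearMap.map_sum₂]
    refine Submodule.sum_mem _ fun i _ => ?_
    rw [map_sum]
    refine Submodule.sum_mem _ fun j _ => ?_
    rw [superCommutator_apply 𝒢 comp (parityProj_mem 𝒢 i x) (parityProj_mem 𝒢 j y)]
    exact hbr i j _ (hgr i x hx) _ (hgr j y hy) (parityProj_mem 𝒢 i x) (parityProj_mem 𝒢 j y)
  have hbe : ∀ i j, ∀ x ∈ S, ∀ y ∈ S, x ∈ 𝒢 i → y ∈ 𝒢 j →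
      superCommutator 𝒢 comp x y ∈ 𝒢 (i + j) := by
    intro i j x hx y hy hxi hyj
    rw [superCommutator_apply 𝒢 comp hxi hyj]
    refine sub_mem (heven i j x hx y hy hxi hyj) (zsmul_mem ?_ _)
    rw [add_comm]
    exact heven j i y hy x hx hyj hxi
  have hjac : ∀ i j, ∀ x ∈ S, ∀ y ∈ S, ∀ z ∈ S, x ∈ 𝒢 i → y ∈ 𝒢 j →
      superCommutator 𝒢 comp x (superCommutator 𝒢 comp y z) =
        superCommutator 𝒢 comp (superCommutator 𝒢 comp x y) z +
          psign (i * j) • superCommutator 𝒢 comp y (superCommutator 𝒢 comp x z) := by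
    intro i j x hx y hy z hz hxi hyj
    rw [hsum z hz]
    simp only [map_sum, Finset.smul_sum, ← Finset.sum_add_distrib]
    refine Finset.sum_congr rfl fun l _ => ?_
    have hz' := hgr l z hz
    have hzl := parityProj_mem 𝒢 l z
    refine superCommutator_jacobi hxi hyj hzl (heven j l _ hy _ hz' hyj hzl) ?_
      (heven i j _ hx _ hy hxi hyj) ?_ (heven i l _ hx _ hz' hxi hzl) ?_
      (hassoc j l _ hx _ hy _ hz' hyj hzl ⟨i, hxi⟩) (hassoc i l _ hy _ hx _ hz' hxi hzl ⟨j, hyj⟩)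
      (hassoc i j _ hz' _ hx _ hy hxi hyj ⟨l, hzl⟩)
    · rw [add_comm]; exact heven l j _ hz' _ hy hzl hyj
    · rw [add_comm]; exact heven j i _ hy _ hx hyj hxi
    · rw [add_comm]; exact heven l i _ hz' _ hx hzl hxi
  refine ⟨hgr, hbr' m hmS, hbr', fun i x hx hxi => ?_, hbe, fun x hx => ?_,
    fun i x hx y hy hxi => ?_, fun i j x hx y hy hxi hyj => ?_, hjac⟩
  · rw [add_comm]
    exact hbe 1 i m hmS x hx hm hxi
  -- Since `[m, m] = 0` and `m` is odd, the Jacobi identity reads `d (d x) = -d (d x)`, and 2 is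
  -- invertible.
  · have h := hjac 1 1 m hmS m hmS x hx hm hm
    have h0 : superCommutator 𝒢 comp m m = 0 := by
      rw [superCommutator_apply 𝒢 comp hm hm, hmm, smul_zero, sub_zero]
    have h1 : psign (1 * 1) = -1 := by decide
    rw [h0, LinearMap.map_zero₂, zero_add, h1, neg_smul, one_smul] at h
    have h2 := eq_neg_iff_add_eq_zero.1 h
    rw [← two_smul k, smul_eq_zero] at h2
    exact h2.resolve_left two_ne_zero
  · simpa using hjac 1 i m hmS x hx y hy hm hxi
  · rw [superCommutator_apply 𝒢 comp hxi hyj, superCommutator_apply 𝒢 comp hyj hxi, smul_sub,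
      mul_comm j i, psign_smul_smul, neg_sub]

end PreLie

/-! ## The dgla of Hochschild cochains and the dgla of Chevalley-Eilenberg cochains -/

section Deformation

variable {k : Type*} [Field k] [CharZero k] {U : Type*} [AddCommGroup U] [Module k U]
variable {𝒰 : ZMod 2 → Submodule k U} [DirectSum.Decomposition 𝒰]

theorem tensorComp_zero (φ ψ : Cochain k U U) : tensorComp 𝒰 φ ψ 0 = 0 := by
  ext x
  simp [tensorComp]

theorem hasParity_tensorComp {φ ψ : Cochain k U U} {p q : ZMod 2} (hφ : HasParity 𝒰 𝒰 p φ)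
    (hψ : HasParity 𝒰 𝒰 q ψ) (hψ0 : ψ 0 = 0) : HasParity 𝒰 𝒰 (p + q) (tensorComp 𝒰 φ ψ) := by
  refine hasParity_of_listParity 𝒰 ?_
  rw [funext (tensorComp_apply 𝒰 φ hψ hψ0)]
  exact (listParity_ev 𝒰 hφ).lcomp (multiAdd_ev φ) (listParity_ev 𝒰 hψ)

theorem tensorComp_assoc (φ : Cochain k U U) {ψ χ : Cochain k U U} {q q' : ZMod 2}
    (hψ : HasParity 𝒰 𝒰 q ψ) (hψ0 : ψ 0 = 0) (hχ : HasParity 𝒰 𝒰 q' χ) (hχ0 : χ 0 = 0) :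
    tensorComp 𝒰 (tensorComp 𝒰 φ ψ) χ - tensorComp 𝒰 φ (tensorComp 𝒰 ψ χ) =
      psign (q * q') • (tensorComp 𝒰 (tensorComp 𝒰 φ χ) ψ -
        tensorComp 𝒰 φ (tensorComp 𝒰 χ ψ)) := by
  refine ev_ext fun l => ?_
  have h := lcomp_lcomp (multiAdd_ev φ) (listParity_ev 𝒰 hψ) (listParity_ev 𝒰 hχ) l
  simp only [ev_sub, ev_zsmul]
  rw [tensorComp_apply 𝒰 _ hχ hχ0, tensorComp_apply 𝒰 _ hψ hψ0,
    tensorComp_apply 𝒰 _ (hasParity_tensorComp hψ hχ hχ0) (tensorComp_zero _ _),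
    tensorComp_apply 𝒰 _ (hasParity_tensorComp hχ hψ hψ0) (tensorComp_zero _ _),
    funext (tensorComp_apply 𝒰 φ hψ hψ0), funext (tensorComp_apply 𝒰 φ hχ hχ0),
    funext (tensorComp_apply 𝒰 ψ hχ hχ0), funext (tensorComp_apply 𝒰 χ hψ hψ0), add_comm q' q]
  exact h

theorem gradedSymmetric_cochainProj {φ : Cochain k U U} (hφ : GradedSymmetric 𝒰 φ) (q : ZMod 2) :
    GradedSymmetric 𝒰 (cochainProj 𝒰 𝒰 q φ) := by
  intro n σ p x hx
  rw [cochainProj_apply_of_mem 𝒰 𝒰 q φ n (fun i => p (σ i)) _ fun i => hx _,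
    cochainProj_apply_of_mem 𝒰 𝒰 q φ n p x hx, hφ n σ p x hx, Equiv.sum_comp σ p, map_zsmul]

theorem parityProj_cochain (q : ZMod 2) (φ : Cochain k U U) :
    parityProj (cochainGrading 𝒰 𝒰) q φ = cochainProj 𝒰 𝒰 q φ := by
  have h := sum_parityProj (cochainGrading 𝒰 𝒰) φ
  conv_rhs => rw [← h]
  rw [map_sum, Finset.sum_eq_single q]
  · ext n x
    refine MultiAdd.ext_homog 𝒰 (multiAdd_ev _) (multiAdd_ev _) (fun ws hws => ?_)
      (List.ofFn x) |> fun h => by simpa using h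
    obtain ⟨n, p, x, hx, rfl⟩ := exists_ofFn_homog 𝒰 hws
    rw [map_snd_ofFn, ev_ofFn, ev_ofFn, cochainProj_apply_of_mem 𝒰 𝒰 q _ n p x hx,
      parityProj_of_mem 𝒰 ((parityProj_mem (cochainGrading 𝒰 𝒰) q φ : HasParity 𝒰 𝒰 q _) n p x hx),
      if_pos rfl]
  · intro j _ hj
    refine cochain_ext_homog (𝒰 := 𝒰) fun ws hws => ?_
    obtain ⟨n, p, x, hx, rfl⟩ := exists_ofFn_homog 𝒰 hws
    rw [map_snd_ofFn, ev_ofFn, ev_ofFn, cochainProj_apply_of_mem 𝒰 𝒰 q _ n p x hx,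
      parityProj_of_mem 𝒰 ((parityProj_mem (cochainGrading 𝒰 𝒰) j φ : HasParity 𝒰 𝒰 j _) n p x hx),
      if_neg (by simpa using hj.symm)]
    rfl
  · simp

theorem cochainProj_zero (q : ZMod 2) {φ : Cochain k U U} (hφ : φ 0 = 0) :
    cochainProj 𝒰 𝒰 q φ 0 = 0 := by
  ext x
  rw [cochainProj_apply, hφ]
  simp

/-- A graded subspace of cochains without constant term, closed under the commutator of
`tensorComp`, is a dgla. -/
theorem isDGLAOn_tensorComp {S : Submodule k (Cochain k U U)} (hS0 : ∀ φ ∈ S, φ 0 = 0)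
    (hgr : ∀ q, ∀ φ ∈ S, cochainProj 𝒰 𝒰 q φ ∈ S)
    (hbr : ∀ i j, ∀ φ ∈ S, ∀ ψ ∈ S, HasParity 𝒰 𝒰 i φ → HasParity 𝒰 𝒰 j ψ →
      tensorComp 𝒰 φ ψ - psign (i * j) • tensorComp 𝒰 ψ φ ∈ S)
    {m : Cochain k U U} (hmS : m ∈ S) (hm : HasParity 𝒰 𝒰 1 m) (hmm : tensorComp 𝒰 m m = 0) :
    IsDGLAOn (cochainGrading 𝒰 𝒰) (superCommutator (cochainGrading 𝒰 𝒰) (tensorCompₗ 𝒰) m)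
      (superCommutator (cochainGrading 𝒰 𝒰) (tensorCompₗ 𝒰)) S := by
  refine isDGLAOn_of_preLie _ S (fun q φ hφ => ?_) (fun i j φ _ ψ hψ hi hj => ?_)
    (fun j l φ _ ψ hψ χ hχ hj hl _ => ?_) (fun i j φ hφ ψ hψ hi hj => hbr i j φ hφ ψ hψ hi hj)
    hmS hm hmm
  · rw [parityProj_cochain]
    exact hgr q φ hφ
  · exact hasParity_tensorComp hi hj (hS0 ψ hψ)
  · exact tensorComp_assoc φ hj (hS0 ψ hψ) hl (hS0 χ hχ)

/-- Every graded symmetric cochain without constant term is a symmetrization. -/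
theorem exists_symmetrization_eq {φ : Cochain k U U} (hφ : GradedSymmetric 𝒰 φ) (hφ0 : φ 0 = 0) :
    ∃ φ', symmetrization 𝒰 φ' = φ ∧ φ' 0 = 0 ∧
      (∀ q, HasParity 𝒰 𝒰 q φ → HasParity 𝒰 𝒰 q φ') :=
  ⟨divFactorial φ, symmetrization_divFactorial hφ, by simp [divFactorial, hφ0],
    fun _ h => hasParity_divFactorial h⟩

/-- Each cochain in `S` is a symmetrization, and symmetrization is multiplicative from `tensorComp`
to `symComp`; hence the pre-Lie identity carries over from the associative side. -/
theorem isDGLAOn_symComp {S : Submodule k (Cochain k U U)} (hS0 : ∀ φ ∈ S, φ 0 = 0)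
    (hsym : ∀ φ ∈ S, GradedSymmetric 𝒰 φ)
    (hgr : ∀ q, ∀ φ ∈ S, cochainProj 𝒰 𝒰 q φ ∈ S)
    (hbr : ∀ i j, ∀ φ ∈ S, ∀ ψ ∈ S, HasParity 𝒰 𝒰 i φ → HasParity 𝒰 𝒰 j ψ →
      symComp 𝒰 φ ψ - psign (i * j) • symComp 𝒰 ψ φ ∈ S)
    {m : Cochain k U U} (hmS : m ∈ S) (hm : HasParity 𝒰 𝒰 1 m) (hmm : symComp 𝒰 m m = 0) :
    IsDGLAOn (cochainGrading 𝒰 𝒰) (superCommutator (cochainGrading 𝒰 𝒰) (symCompₗ 𝒰) m)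
      (superCommutator (cochainGrading 𝒰 𝒰) (symCompₗ 𝒰)) S := by
  refine isDGLAOn_of_preLie _ S (fun q φ hφ => ?_) (fun i j φ hφ ψ hψ hi hj => ?_)
    (fun j l φ hφ ψ hψ χ hχ hj hl _ => ?_) (fun i j φ hφ ψ hψ hi hj => hbr i j φ hφ ψ hψ hi hj)
    hmS hm hmm
  · rw [parityProj_cochain]
    exact hgr q φ hφ
  · obtain ⟨φ', h1, -, h3⟩ := exists_symmetrization_eq (hsym φ hφ) (hS0 φ hφ)
    obtain ⟨ψ', h1', h2', h3'⟩ := exists_symmetrization_eq (hsym ψ hψ) (hS0 ψ hψ)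
    have := hasParity_symmetrization (hasParity_tensorComp (h3 i hi) (h3' j hj) h2')
    rw [symmetrization_tensorComp φ' (h3' j hj) h2', h1, h1'] at this
    exact this
  · obtain ⟨φ', rfl, -, -⟩ := exists_symmetrization_eq (hsym φ hφ) (hS0 φ hφ)
    obtain ⟨ψ', hψ', h2', h3'⟩ := exists_symmetrization_eq (hsym ψ hψ) (hS0 ψ hψ)
    obtain ⟨χ', hχ', h2'', h3''⟩ := exists_symmetrization_eq (hsym χ hχ) (hS0 χ hχ)
    have hj' := h3' j hj
    have hl' := h3'' l hl
    have := congrArg (symmetrizationₗ 𝒰) (tensorComp_assoc φ' hj' h2' hl' h2'')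
    rw [map_sub, map_zsmul, map_sub] at this
    simp only [symmetrizationₗ_apply] at this
    rw [symmetrization_tensorComp _ hl' h2'', symmetrization_tensorComp _ hj' h2',
      symmetrization_tensorComp _ (hasParity_tensorComp hj' hl' h2'') (tensorComp_zero _ _),
      symmetrization_tensorComp _ hl' h2'', symmetrization_tensorComp _ hj' h2',
      symmetrization_tensorComp _ hl' h2'',
      symmetrization_tensorComp _ (hasParity_tensorComp hl' hj' h2') (tensorComp_zero _ _),
      symmetrization_tensorComp _ hj' h2', hψ', hχ'] at this
    exact this

end Deformation

/-! ## The equation for `L_∞`-maps into a dgla -/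

section MapEquation

section Usum

variable {α M : Type*} [AddCommGroup M]

theorem usum_zero (l : List (ZMod 2 × α)) : usum (fun _ _ => (0 : M)) l = 0 :=
  (map_usum (0 : M →+ M) (fun _ _ => 0) l).symm

theorem usum_right_nil (H : List (ZMod 2 × α) → M) (l : List (ZMod 2 × α)) :
    usum (fun S T => if T = [] then H S else 0) l = H l := by
  induction l generalizing H with
  | nil => simp
  | cons h l ih => simp [usum_cons, ih (fun S => H (h :: S)), usum_zero]

theorem usum_left_nil (H : List (ZMod 2 × α) → M) (l : List (ZMod 2 × α)) :
    usum (fun S T => if S = [] then H T else 0) l = H l := by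
  induction l generalizing H with
  | nil => simp
  | cons h l ih =>
    have h1 : ∀ S T : List (ZMod 2 × α), psign (h.1 * par S) • (if S = [] then H (h :: T) else 0) =
        if S = [] then H (h :: T) else 0 := by
      intro S T
      split_ifs with hS
      · simp [hS, psign_zero]
      · simp
    simp [usum_cons, h1, ih (fun T => H (h :: T)), usum_zero]

end Usum

variable {k : Type*} [Field k] [CharZero k] {U W : Type*} [AddCommGroup U] [Module k U]
  [AddCommGroup W] [Module k W]
variable {𝒰 : ZMod 2 → Submodule k U} [DirectSum.Decomposition 𝒰]

theorem subList_snd {n : ℕ} (p : Fin n → ZMod 2) (x : Fin n → U) (S : Finset (Fin n)) :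
    (subList (fun i => (p i, x i)) S).map Prod.snd = subList x S := by
  simp [subList]

theorem subList_univ {α : Type*} {n : ℕ} (x : Fin n → α) :
    subList x Finset.univ = List.ofFn x := by
  simp [subList, List.ofFn_eq_map]

theorem apply_block (f : Cochain k U W) {n j : ℕ} (c : Fin n → Fin j) (x : Fin n → U)
    (a : Fin j) : (f (block c a).card fun i => x ((block c a).orderEmbOfFin rfl i)) =
      ev f (subList x (block c a)) := by
  rw [← ofFn_orderEmbOfFin x _ rfl, ev_ofFn]

/-- A map to a two-element set is the subset of indices sent to `0`, and sorting into the two blocks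
has the sign of the unshuffle. -/
theorem sum_blocks_two {n : ℕ} (p : Fin n → ZMod 2) (x : Fin n → U) (l : Cochain k W W)
    (f : Cochain k U W) : (∑ c : Fin n → Fin 2, blockSign c p • l 2 fun a =>
        f (block c a).card fun i => x ((block c a).orderEmbOfFin rfl i)) =
      usum (fun S T => ev l [ev f (S.map Prod.snd), ev f (T.map Prod.snd)])
        (List.ofFn fun i => (p i, x i)) := by
  rw [← sum_unshuffleSign]
  refine Finset.sum_bij' (fun c _ => block c 0) (fun S _ i => if i ∈ S then 0 else 1) (by simp)
    (by simp) ?_ ?_ ?_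
  · intro c _
    funext i
    simp only [block, Finset.mem_filter, Finset.mem_univ, true_and]
    split_ifs with h
    · exact h.symm
    · have := (c i).2
      ext
      have h' : (c i : ℕ) ≠ 0 := fun h0 => h (Fin.ext h0)
      simp only [Fin.coe_ofNat_eq_mod]
      omega
  · intro S _
    ext i
    simp [block]
  · intro c _
    have h1 : block c 1 = (block c 0)ᶜ := by
      ext i
      simp only [block, Finset.mem_filter, Finset.mem_univ, true_and, Finset.mem_compl]
      generalize c i = a
      revert a; decide
    have hsign : blockSign c p = unshuffleSign (block c 0) p := by
      rw [blockSign, unshuffleSign, Finset.prod_comm, block, Finset.prod_filter]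
      refine Finset.prod_congr rfl fun i _ => ?_
      split_ifs with hi
      · rw [Finset.compl_filter, Finset.prod_filter]
        refine Finset.prod_congr rfl fun j _ => ?_
        have h2 : c i < c j ↔ ¬ c j = 0 := by
          rw [hi]
          generalize c j = a
          revert a; decide
        simp only [h2, mul_comm]
        split_ifs <;> tauto
      · refine Finset.prod_eq_one fun j _ => if_neg fun h => hi ?_
        have h2 := h.2
        revert h2
        generalize c i = a, c j = b
        revert a b; decide
    rw [hsign]
    congr 1
    simp only [apply_block, subList_snd]
    rw [← h1, ← ev_ofFn l]
    congr 1

/-- The right-hand side of the equation for `L_∞`-maps to an algebra with only unary and binary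
operations. -/
theorem sum_blocks {n : ℕ} (p : Fin n → ZMod 2) (x : Fin n → U) {l : Cochain k W W}
    (hl : ∀ j, j ≠ 1 → j ≠ 2 → l j = 0) {f : Cochain k U W} (hf : f 0 = 0) :
    (∑ j ∈ Finset.range (n + 1), ((Nat.factorial j : k))⁻¹ • ∑ c : Fin n → Fin j,
        blockSign c p • l j fun a =>
          f (block c a).card fun i => x ((block c a).orderEmbOfFin rfl i)) =
      ev l [ev f (List.ofFn x)] + (2 : k)⁻¹ •
        usum (fun S T => ev l [ev f (S.map Prod.snd), ev f (T.map Prod.snd)])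
          (List.ofFn fun i => (p i, x i)) := by
  -- With more blocks than arguments some block is empty and `f` vanishes on it. So the range of `j`
  -- may be enlarged until it contains 1 and 2 for every `n`, including `n = 0` and `n = 1`.
  have hlarge : ∀ j, n < j → ∀ c : Fin n → Fin j, (l j fun a =>
      f (block c a).card fun i => x ((block c a).orderEmbOfFin rfl i)) = 0 := by
    intro j hj c
    obtain ⟨a, ha⟩ : ∃ a, ∀ i, c i ≠ a := by
      by_contra! h
      have := Fintype.card_le_of_surjective c h
      simp only [Fintype.card_fin] at this
      omega
    refine (l j).map_coord_zero a ?_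
    have hb : block c a = ∅ := by
      ext i
      simp [block, ha i]
    rw [apply_block, hb]
    simpa [subList] using ev_nil_eq_zero_iff.2 hf
  have hsub : Finset.range (n + 1) ⊆ Finset.range (n + 3) := by
    intro i
    simp only [Finset.mem_range]
    omega
  rw [Finset.sum_subset hsub]
  · rw [Finset.sum_eq_add_of_mem 1 2 (by simp) (by simp) (by decide)]
    · congr 1
      · rw [Fintype.sum_unique]
        have h1 : block (default : Fin n → Fin 1) 0 = Finset.univ := by
          ext i
          simp [block]
        have h2 : blockSign (default : Fin n → Fin 1) p = 1 := by
          simp [blockSign]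
        rw [h2, ← ev_ofFn l]
        simp only [apply_block, List.ofFn_succ, List.ofFn_zero, h1, subList_univ]
        simp
      · rw [sum_blocks_two]
        simp
    · intro j _ hj
      simp [hl j hj.1 hj.2]
  · intro j _ hj
    rw [Finset.sum_eq_zero, smul_zero]
    intro c _
    rw [hlarge j (by simpa using hj), smul_zero]

end MapEquation

/-! ## The twisting map -/

section Twisting

variable {k : Type*} [Field k] [CharZero k] {U : Type*} [AddCommGroup U] [Module k U]
variable {𝒰 : ZMod 2 → Submodule k U} [DirectSum.Decomposition 𝒰]

theorem ListParity.ltrunc {f : List U → U} {q : ZMod 2} (hf : ListParity 𝒰 q f) :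
    ListParity 𝒰 q (ltrunc f) := by
  intro p l
  cases l with
  | nil => simp
  | cons x l => exact hf p (x :: l)

theorem aInftyTwistingMap_zero (m : Cochain k U U) : aInftyTwistingMap 𝒰 m 0 = 0 := rfl

theorem gradedSymmetric_aInftyTwistingMap (m : Cochain k U U) :
    GradedSymmetric 𝒰 (aInftyTwistingMap 𝒰 m) := by
  refine gradedSymmetric_of_swap fun a h h' b hl => ?_
  have hl' : Homog 𝒰 (a ++ h' :: h :: b) := by
    rw [homog_append, homog_cons, homog_cons] at hl ⊢
    tauto
  refine ev_ext fun l => ?_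
  rw [ev_zsmul, ev_aInftyTwistingMap m hl, ev_aInftyTwistingMap m hl', if_neg (by simp),
    if_neg (by simp)]
  rw [homog_append, homog_cons, homog_cons] at hl
  cases l with
  | nil => simp
  | cons x l =>
    simp only [ltrunc_cons]
    rw [liter_swap (multiAdd_ev m) hl.2.2.1 hl.2.1, mul_comm]

theorem hasParity_ev_aInftyTwistingMap {m : Cochain k U U} {q : ZMod 2}
    (hm : HasParity 𝒰 𝒰 q m) {ws : List (ZMod 2 × U)} (hws : Homog 𝒰 ws) :
    HasParity 𝒰 𝒰 (q + par ws) (ev (aInftyTwistingMap 𝒰 m) (ws.map Prod.snd)) := by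
  refine hasParity_of_listParity 𝒰 ?_
  rw [funext (ev_aInftyTwistingMap m hws)]
  split_ifs
  · intro p l
    simp
  · exact ((listParity_ev 𝒰 hm).liter (multiAdd_ev m) hws).ltrunc

theorem ev_aInftyTwistingMap_zero (m : Cochain k U U) {ws : List (ZMod 2 × U)}
    (hws : Homog 𝒰 ws) : ev (aInftyTwistingMap 𝒰 m) (ws.map Prod.snd) 0 = 0 := by
  rw [← ev_nil_eq_zero_iff, ev_aInftyTwistingMap m hws]
  simp

variable (𝒰) in
/-- The truncated iterated insertion as a cochain. -/
def twistCochain (m : Cochain k U U) (ws : List (ZMod 2 × U)) : Cochain k U U :=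
  if ws = [] then m else ev (aInftyTwistingMap 𝒰 m) (ws.map Prod.snd)

theorem ev_twistCochain {m : Cochain k U U} (hm : m 0 = 0) {ws : List (ZMod 2 × U)}
    (hws : Homog 𝒰 ws) (l : List U) :
    ev (twistCochain 𝒰 m ws) l = ltrunc (liter 𝒰 ws (ev m)) l := by
  rw [twistCochain]
  split_ifs with h
  · subst h
    cases l with
    | nil => simpa using ev_nil_eq_zero_iff.2 hm
    | cons => rfl
  · rw [ev_aInftyTwistingMap m hws, if_neg h]

theorem hasParity_twistCochain {m : Cochain k U U} {q : ZMod 2}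
    (hm : HasParity 𝒰 𝒰 q m) {ws : List (ZMod 2 × U)} (hws : Homog 𝒰 ws) :
    HasParity 𝒰 𝒰 (q + par ws) (twistCochain 𝒰 m ws) := by
  rw [twistCochain]
  split_ifs with h
  · simpa [h] using hm
  · exact hasParity_ev_aInftyTwistingMap hm hws

theorem twistCochain_zero {m : Cochain k U U} (hm : m 0 = 0) {ws : List (ZMod 2 × U)}
    (hws : Homog 𝒰 ws) : twistCochain 𝒰 m ws 0 = 0 := by
  rw [← ev_nil_eq_zero_iff, ev_twistCochain hm hws, ltrunc_nil]

/-- `liter_lcomp_eq` restated for cochains: the terms with an inserted constant are the twisting map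
precomposed with the symmetrization of `ψ`, the rest are composites of twists. For `φ = ψ = μ` this
is the equation of an `L_∞`-map, before the empty parts are separated. -/
theorem twistCochain_tensorComp {φ ψ : Cochain k U U} {q : ZMod 2} (hφ0 : φ 0 = 0)
    (hψ : HasParity 𝒰 𝒰 q ψ) (hψ0 : ψ 0 = 0) {ws : List (ZMod 2 × U)} (hws : Homog 𝒰 ws) :
    twistCochain 𝒰 (tensorComp 𝒰 φ ψ) ws =
      ev (symComp 𝒰 (aInftyTwistingMap 𝒰 φ) (symmetrization 𝒰 ψ)) (ws.map Prod.snd) +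
      usum (fun S T => psign (par T * (q + par S)) •
        tensorComp 𝒰 (twistCochain 𝒰 φ T) (twistCochain 𝒰 ψ S)) ws := by
  refine ev_ext fun l => ?_
  have hcons : ∀ S T, Homog 𝒰 S → Homog 𝒰 T → Homog 𝒰 ((q + par S, liter 𝒰 S (ev ψ) []) :: T) :=
    fun S T hS hT => homog_cons.2 ⟨liter_nil_mem hψ hS, hT⟩
  rw [ev_twistCochain (tensorComp_zero _ _) hws, ev_add, ev_symComp _ _ hws, ev_usum, ev_usum]
  have h1 : usum (fun S T => ev (ev (aInftyTwistingMap 𝒰 φ)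
      (ev (symmetrization 𝒰 ψ) (S.map Prod.snd) :: T.map Prod.snd)) l) ws =
      usum (fun S T => ltrunc (liter 𝒰 ((q + par S, liter 𝒰 S (ev ψ) []) :: T) (ev φ)) l) ws := by
    refine usum_congr fun S T hS hT _ _ => ?_
    have hS' := hws.sublist hS
    have := ev_aInftyTwistingMap φ (hcons S T hS' (hws.sublist hT)) l
    rw [if_neg (by simp)] at this
    rw [symmetrization_apply 𝒰 ψ hS', ← this, List.map_cons]
  have h2 : usum (fun S T => ev (psign (par T * (q + par S)) •
      tensorComp 𝒰 (twistCochain 𝒰 φ T) (twistCochain 𝒰 ψ S)) l) ws =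
      usum (fun S T => psign (par T * (q + par S)) • lcomp 𝒰 (q + par S)
        (ltrunc (liter 𝒰 T (ev φ))) (ltrunc (liter 𝒰 S (ev ψ))) l) ws := by
    refine usum_congr fun S T hS hT _ _ => ?_
    have hS' := hws.sublist hS
    rw [ev_zsmul, tensorComp_apply 𝒰 _ (hasParity_twistCochain hψ hS') (twistCochain_zero hψ0 hS'),
      funext (ev_twistCochain hψ0 hS'), funext (ev_twistCochain hφ0 (hws.sublist hT))]
  rw [h1, h2, funext (tensorComp_apply 𝒰 φ hψ hψ0)]
  cases l with
  | nil =>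
    have h0 : ∀ q (f g : List U → U), lcomp 𝒰 q (ltrunc f) (ltrunc g) [] = ltrunc f [0] := by
      intro q f g
      simp [lcomp]
    have h1 : ∀ T, ltrunc (liter 𝒰 T (ev φ)) [0] = 0 := fun T =>
      ((multiAdd_ev φ).liter T).ltrunc.map_zero [] []
    simp only [h0, h1, smul_zero, ltrunc_nil, usum_zero, add_zero]
  | cons x l =>
    simp only [ltrunc_cons]
    exact liter_lcomp_eq (multiAdd_ev φ) (multiAdd_ev ψ) (listParity_ev 𝒰 hψ) hws _

theorem deformationStructure_eq_zero (comp : Cochain k U U →ₗ[k] Cochain k U U →ₗ[k] Cochain k U U)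
    (m : Cochain k U U) (j : ℕ) (h1 : j ≠ 1) (h2 : j ≠ 2) :
    deformationStructure 𝒰 comp m j = 0 := by
  match j with
  | 0 => rfl
  | 1 => exact absurd rfl h1
  | 2 => exact absurd rfl h2
  | _ + 3 => rfl

theorem ev_deformationStructure_one
    (comp : Cochain k U U →ₗ[k] Cochain k U U →ₗ[k] Cochain k U U) (m φ : Cochain k U U) :
    ev (deformationStructure 𝒰 comp m) [φ] =
      -superCommutator (cochainGrading 𝒰 𝒰) comp m φ := rfl

theorem ev_deformationStructure_two
    (comp : Cochain k U U →ₗ[k] Cochain k U U →ₗ[k] Cochain k U U) (m φ ψ : Cochain k U U) :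
    ev (deformationStructure 𝒰 comp m) [φ, ψ] = superCommutator (cochainGrading 𝒰 𝒰) comp
      (signTwist (cochainGrading 𝒰 𝒰) 1 φ) ψ := by
  have : signTwist (cochainGrading 𝒰 𝒰) 1 = parityInv (cochainGrading 𝒰 𝒰) :=
    if_neg one_ne_zero
  rw [this]
  rfl

/-- The twisting map of an odd cochain `μ`, followed by a homomorphism `T` from `tensorComp` to
another composition which makes the twisting map of `μ ∘ μ` vanish, is an `L_∞`-map. -/
theorem isLInftyMap_twisting {μ : Cochain k U U} (hμ : HasParity 𝒰 𝒰 1 μ) (hμ0 : μ 0 = 0)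
    (comp : Cochain k U U →ₗ[k] Cochain k U U →ₗ[k] Cochain k U U)
    (T : Cochain k U U →ₗ[k] Cochain k U U)
    (hT : ∀ φ ψ q, HasParity 𝒰 𝒰 q ψ → ψ 0 = 0 → T (tensorComp 𝒰 φ ψ) = comp (T φ) (T ψ))
    (hTpar : ∀ φ q, HasParity 𝒰 𝒰 q φ → HasParity 𝒰 𝒰 q (T φ))
    (hTμ : ∀ ws, Homog 𝒰 ws → T (twistCochain 𝒰 (tensorComp 𝒰 μ μ) ws) = 0)
    {f : Cochain k U (Cochain k U U)} (hf : ∀ w, ev f w = T (ev (aInftyTwistingMap 𝒰 μ) w)) :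
    IsLInftyMap 𝒰 (parityRev (cochainGrading 𝒰 𝒰)) (symmetrization 𝒰 μ)
      (deformationStructure 𝒰 comp (T μ)) f := by
  have hf0 : f 0 = 0 := by
    rw [← ev_nil_eq_zero_iff, hf, ev_nil_eq_zero_iff.2 (aInftyTwistingMap_zero μ), map_zero]
  have hfr : ∀ n x, f n x = T (aInftyTwistingMap 𝒰 μ n x) := by
    intro n x
    rw [← ev_ofFn, hf, ev_ofFn]
  have hfpar : ∀ ws, Homog 𝒰 ws → ev f (ws.map Prod.snd) ∈ cochainGrading 𝒰 𝒰 (1 + par ws) :=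
    fun ws hws => by
      rw [hf]
      exact hTpar _ _ (hasParity_ev_aInftyTwistingMap hμ hws)
  refine ⟨hf0, ?_, ?_, ?_⟩
  · intro n σ p x hx
    rw [hfr, hfr, gradedSymmetric_aInftyTwistingMap μ n σ p x hx, map_zsmul]
  · rw [hasParity_iff]
    intro ws hws
    have := hfpar ws hws
    rwa [parityRev, add_zero, add_comm]
  · intro n p x hx
    rw [sum_blocks p x (deformationStructure_eq_zero comp _) hf0]
    have hws := homog_ofFn 𝒰 hx
    set ws := List.ofFn fun i => (p i, x i) with hwsdef
    have hx' : List.ofFn x = ws.map Prod.snd := (map_snd_ofFn p x).symm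
    rw [← ev_ofFn, hx', ev_deformationStructure_one]
    simp only [ev_deformationStructure_two]
    have key := congrArg T (twistCochain_tensorComp hμ0 hμ hμ0 hws)
    rw [hTμ ws hws, map_add, map_usum] at key
    have hsym : T (ev (symComp 𝒰 (aInftyTwistingMap 𝒰 μ) (symmetrization 𝒰 μ)) (ws.map Prod.snd)) =
        ev (symComp 𝒰 f (symmetrization 𝒰 μ)) (ws.map Prod.snd) := by
      rw [ev_symComp _ _ hws, ev_symComp _ _ hws, map_usum]
      simp only [hf]
    -- The twist by no vectors is `μ` itself, whereas `f` has no constant term. This difference is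
    -- the source of the terms that form the differential.
    have htw : ∀ S, Homog 𝒰 S → T (twistCochain 𝒰 μ S) =
        ev f (S.map Prod.snd) + if S = [] then T μ else 0 := by
      intro S _
      rw [twistCochain]
      split_ifs with h
      · subst h
        rw [List.map_nil, ev_nil_eq_zero_iff.2 hf0, zero_add]
      · rw [hf, add_zero]
    have hμμ : comp (T μ) (T μ) = 0 := by
      rw [← hT μ μ 1 hμ hμ0]
      exact hTμ [] (by simp [Homog])
    -- the quadratic term
    have hquad : usum (fun S T' => T (psign (par T' * (1 + par S)) •
        tensorComp 𝒰 (twistCochain 𝒰 μ T') (twistCochain 𝒰 μ S))) ws =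
        usum (fun S T' => psign (par T' * (1 + par S)) •
          comp (ev f (T'.map Prod.snd)) (ev f (S.map Prod.snd))) ws +
        (comp (T μ) (ev f (ws.map Prod.snd)) +
          psign (par ws) • comp (ev f (ws.map Prod.snd)) (T μ)) := by
      rw [← usum_right_nil (fun S => comp (T μ) (ev f (S.map Prod.snd))) ws,
        ← usum_left_nil (fun S => psign (par S) • comp (ev f (S.map Prod.snd)) (T μ)) ws,
        ← usum_add, ← usum_add]
      refine usum_congr fun S T' hS hT' _ _ => ?_
      have hS' := hws.sublist hS
      have hT'' := hws.sublist hT'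
      rw [map_zsmul, hT _ _ _ (hasParity_twistCochain hμ hS') (twistCochain_zero hμ0 hS'),
        htw S hS', htw T' hT'']
      by_cases h1 : S = [] <;> by_cases h2 : T' = [] <;>
        simp [h1, h2, hμμ, psign_zero, ev_nil_eq_zero_iff.2 hf0]
    -- Exchanging the two parts of the unshuffle identifies the two halves of the commutator. The
    -- resulting factor 2 cancels the 1/2! in the equation for `L_∞`-maps.
    have hcomm : usum (fun S T' => superCommutator (cochainGrading 𝒰 𝒰) comp
        (signTwist (cochainGrading 𝒰 𝒰) 1 (ev f (S.map Prod.snd))) (ev f (T'.map Prod.snd))) ws =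
        -(2 : k) • usum (fun S T' => psign (par T' * (1 + par S)) •
          comp (ev f (T'.map Prod.snd)) (ev f (S.map Prod.snd))) ws := by
      have h1 : usum (fun S T' => superCommutator (cochainGrading 𝒰 𝒰) comp
        (signTwist (cochainGrading 𝒰 𝒰) 1 (ev f (S.map Prod.snd))) (ev f (T'.map Prod.snd))) ws =
          usum (fun S T' => psign (1 + par S) •
            comp (ev f (S.map Prod.snd)) (ev f (T'.map Prod.snd)) +
            -(psign (par T' * (1 + par S)) •
              comp (ev f (T'.map Prod.snd)) (ev f (S.map Prod.snd)))) ws := by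
        refine usum_congr fun S T' hS hT' _ _ => ?_
        have hS' := hfpar S (hws.sublist hS)
        have hT'' := hfpar T' (hws.sublist hT')
        rw [signTwist_of_mem _ hS', one_mul, map_zsmul, LinearMap.smul_apply,
          superCommutator_apply _ comp hS' hT'', smul_sub, smul_smul, ← psign_add]
        have : ∀ a b : ZMod 2, 1 + a + (1 + a) * (1 + b) = b * (1 + a) := by decide
        rw [this]
        abel
      have h2 := usum_flip (fun S T' => psign (1 + par S) •
            comp (ev f (S.map Prod.snd)) (ev f (T'.map Prod.snd))) ws
      rw [h1, usum_add, ← h2]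
      have h3 : ∀ a b : ZMod 2, psign (a * b) * psign (1 + b) = -psign (b * (1 + a)) := by decide
      simp only [smul_smul, h3, neg_smul, two_smul]
      have h4 := fun (G : List (ZMod 2 × U) → List (ZMod 2 × U) → Cochain k U U) =>
        (map_usum (-AddMonoidHom.id (Cochain k U U)) G ws).symm
      simp only [AddMonoidHom.neg_apply, AddMonoidHom.id_apply] at h4
      rw [h4, neg_add]
    rw [hsym, hquad] at key
    rw [hcomm, superCommutator_apply _ comp (hTpar μ 1 hμ) (hfpar ws hws), smul_smul]
    have h5 : (2 : k)⁻¹ * -2 = -1 := by norm_num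
    have h6 : psign (1 * (1 + par ws)) = -psign (par ws) := by
      generalize par ws = a
      revert a; decide
    rw [h5, h6]
    have h7 := eq_neg_of_add_eq_zero_left key.symm
    rw [h7]
    module

end Twisting

/-! ## Cyclic cochains -/

section Cyclic

variable {k : Type*} [Field k] [CharZero k] {U : Type*} [AddCommGroup U] [Module k U]
variable {𝒰 : ZMod 2 → Submodule k U} [DirectSum.Decomposition 𝒰]

theorem mem_of_listParity {f : List U → U} {q : ZMod 2} (hf : ListParity 𝒰 q f)
    (hf' : MultiAdd f) {ws : List (ZMod 2 × U)} (hws : Homog 𝒰 ws) :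
    f (ws.map Prod.snd) ∈ 𝒰 (q + par ws) := by
  refine mem_of_signTwist 𝒰 ?_
  have := map_signTwist_homog 𝒰 hws 1 hf' [] []
  simp only [List.nil_append, List.append_nil] at this
  rw [hf, this, smul_smul, ← psign_add]
  congr 2
  ring

variable (𝒰) in
/-- Cyclic invariance of `ω(f(x 0, …, x (n-1)), x n)`. -/
def ListCyclic (ω : U →ₗ[k] U →ₗ[k] k) (f : List U → U) : Prop :=
  ∀ p, ∀ x ∈ 𝒰 p, ∀ l y,
    ω (f (x :: l)) y = ω (f (l.map (signTwist 𝒰 p) ++ [signTwist 𝒰 p y])) x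

/-- Cyclic invariance may be checked on homogeneous elements. -/
theorem listCyclic_of_homog {ω : U →ₗ[k] U →ₗ[k] k} {f : List U → U} (hf : MultiAdd f)
    (h : ∀ (h : ZMod 2 × U) (ws : List (ZMod 2 × U)) (h' : ZMod 2 × U), Homog 𝒰 (h :: ws) → h'.2 ∈ 𝒰 h'.1 →
      ω (f (h.2 :: ws.map Prod.snd)) h'.2 = psign (h.1 * (par ws + h'.1)) •
        ω (f (ws.map Prod.snd ++ [h'.2])) h.2) : ListCyclic 𝒰 ω f := by
  intro p x hx l y
  induction y using induction_homogeneous 𝒰 with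
  | h0 =>
    have := hf.map_zero (l.map (signTwist 𝒰 p)) []
    simp [this]
  | hadd y y' hy hy' => simp [hy, hy', hf _ _ _ []]
  | hom r y hy =>
    refine MultiAdd.ext_homog 𝒰 (f := fun l => ω (f (x :: l)) y)
      (g := fun l => ω (f (l.map (signTwist 𝒰 p) ++ [signTwist 𝒰 p y])) x) ?_ ?_ ?_ l
    · intro a z z' c
      simpa using congrArg (fun t => ω t y) (hf (x :: a) z z' c)
    · intro a z z' c
      simpa using congrArg (fun t => ω t x) (hf (a.map (signTwist 𝒰 p)) (signTwist 𝒰 p z)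
        (signTwist 𝒰 p z') (c.map (signTwist 𝒰 p) ++ [signTwist 𝒰 p y]))
    · intro ws hws
      have h1 := map_signTwist_homog 𝒰 hws p hf [] [psign (p * r) • y]
      rw [List.nil_append, List.nil_append, hf.map_zsmul (ws.map Prod.snd) []] at h1
      have h2 := h (p, x) ws (r, y) (homog_cons.2 ⟨hx, hws⟩) hy
      simp only at h2 ⊢
      rw [signTwist_of_mem 𝒰 hy, h1, h2]
      simp only [map_zsmul, LinearMap.smul_apply, smul_smul, ← psign_add]
      congr 2
      ring

theorem ListCyclic.homog {ω : U →ₗ[k] U →ₗ[k] k} {f : List U → U} (hf : MultiAdd f)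
    (h : ListCyclic 𝒰 ω f) {p r : ZMod 2} {x y : U} {ws : List (ZMod 2 × U)} (hx : x ∈ 𝒰 p)
    (hws : Homog 𝒰 ws) (hy : y ∈ 𝒰 r) :
    ω (f (x :: ws.map Prod.snd)) y = psign (p * (par ws + r)) •
        ω (f (ws.map Prod.snd ++ [y])) x := by
  have h1 := map_signTwist_homog 𝒰 hws p hf [] [psign (p * r) • y]
  rw [List.nil_append, List.nil_append, hf.map_zsmul (ws.map Prod.snd) []] at h1
  rw [h p x hx, signTwist_of_mem 𝒰 hy, h1]
  simp only [map_zsmul, LinearMap.smul_apply, smul_smul, ← psign_add]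
  congr 2
  ring

variable {ω : U →ₗ[k] U →ₗ[k] k}

/-- Cyclicity only concerns values on nonempty lists, where a constant vanishes. -/
theorem listCyclic_constFun (w : U) : ListCyclic 𝒰 ω (constFun w) := by
  intro p x hx l y
  cases l <;> simp [constFun]

theorem ListCyclic.ltrunc {f : List U → U} (hf : ListCyclic 𝒰 ω f) :
    ListCyclic 𝒰 ω (ltrunc f) := by
  intro p x hx l y
  rw [ltrunc_of_ne_nil _ (by simp), ltrunc_of_ne_nil _ (by simp), hf p x hx]

/-- The form `ω` is graded antisymmetric. -/
def GradedAntisymmetric (𝒰 : ZMod 2 → Submodule k U) (ω : U →ₗ[k] U →ₗ[k] k) : Prop :=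
  ∀ i j, ∀ a ∈ 𝒰 i, ∀ b ∈ 𝒰 j, ω a b = -(psign (i * j) • ω b a)

/-- The terms in which `ψ` is applied to the first argument. -/
theorem form_apply_first {φ ψ : List U → U} {i j : ZMod 2} (hφ : MultiAdd φ)
    (hφi : ListParity 𝒰 i φ) (hφc : ListCyclic 𝒰 ω φ) (hψ : MultiAdd ψ) (hψj : ListParity 𝒰 j ψ)
    (hψc : ListCyclic 𝒰 ω ψ) (hω : GradedAntisymmetric 𝒰 ω) {h h' : ZMod 2 × U}
    {b c : List (ZMod 2 × U)} (hh : h.2 ∈ 𝒰 h.1) (hh' : h'.2 ∈ 𝒰 h'.1) (hb : Homog 𝒰 b)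
    (hc : Homog 𝒰 c) :
    ω (φ (ψ (h.2 :: b.map Prod.snd) :: c.map Prod.snd)) h'.2 =
      -(psign (i * j + i * par b + h.1 * (par b + par c + h'.1)) •
        ω (ψ (b.map Prod.snd ++ [φ (c.map Prod.snd ++ [h'.2])])) h.2) := by
  have hb' : Homog 𝒰 (h :: b) := homog_cons.2 ⟨hh, hb⟩
  have hc' : Homog 𝒰 (c ++ [h']) := homog_append.2 ⟨hc, homog_cons.2 ⟨hh', by simp [Homog]⟩⟩
  have h1 := mem_of_listParity hψj hψ hb'
  have h2 := mem_of_listParity hφi hφ hc'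
  simp only [List.map_cons, List.map_append, List.map_nil, par_cons, par_append, par_nil] at h1 h2
  rw [hφc.homog hφ h1 hc hh', hω _ _ _ h2 _ h1, hψc.homog hψ hh hb h2]
  simp only [smul_neg, smul_smul, ← psign_add]
  congr 3
  generalize par c = c
  generalize par b = b
  generalize h.1 = h
  generalize h'.1 = h'
  clear * -
  revert i j h h' b c
  decide

/-- Rotating the arguments of `φ` alone carries the leading argument to the second slot of the form
and leaves the block fed to `ψ` untouched. -/
theorem form_apply_last {φ ψ : List U → U} {j : ZMod 2} (hφ : MultiAdd φ)
    (hφc : ListCyclic 𝒰 ω φ) (hψ : MultiAdd ψ) (hψj : ListParity 𝒰 j ψ)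
    {h h' : ZMod 2 × U} {a b c : List (ZMod 2 × U)} (hh : h.2 ∈ 𝒰 h.1) (hh' : h'.2 ∈ 𝒰 h'.1)
    (ha : Homog 𝒰 a) (hb : Homog 𝒰 b) (hc : Homog 𝒰 c) :
    ω (φ ((h.2 :: a.map Prod.snd).map (signTwist 𝒰 j) ++ ψ (b.map Prod.snd) :: c.map Prod.snd))
      h'.2 = psign (h.1 * (par a + par b + par c + h'.1)) •
        ω (φ ((a.map Prod.snd).map (signTwist 𝒰 j) ++
          ψ (b.map Prod.snd) :: (c.map Prod.snd ++ [h'.2]))) h.2 := by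
  have h1 := map_signTwist_homog 𝒰 (homog_cons.2 ⟨hh, ha⟩) j hφ []
    (ψ (b.map Prod.snd) :: c.map Prod.snd)
  have h2 := map_signTwist_homog 𝒰 ha j hφ [] (ψ (b.map Prod.snd) :: (c.map Prod.snd ++ [h'.2]))
  simp only [List.nil_append, List.map_cons] at h1 h2 ⊢
  have hψb := mem_of_listParity hψj hψ hb
  have h3 := hφc.homog hφ hh (ws := a ++ (j + par b, ψ (b.map Prod.snd)) :: c)
    (homog_append.2 ⟨ha, homog_cons.2 ⟨hψb, hc⟩⟩) hh'
  simp only [List.map_append, List.map_cons, List.append_assoc, List.cons_append] at h3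
  rw [h1, h2]
  simp only [List.cons_append, map_zsmul, LinearMap.smul_apply, h3, par_cons, par_append, smul_smul, ← psign_add]
  congr 2
  generalize par c = c
  generalize par b = b
  generalize par a = a
  generalize h.1 = h
  generalize h'.1 = h'
  clear * -
  revert j h h' a b c
  decide

/-- Cyclicity of `φ` matches all terms whose inner block contains neither the first argument on the
left nor the last one on the right; the exceptional blocks are subtracted on both sides. The empty
block in front of everything corresponds to the empty block at the very end, and this pair is
compared separately. -/
theorem form_lcomp_cons {φ ψ : List U → U} {j : ZMod 2} (hφ : MultiAdd φ)
    (hφc : ListCyclic 𝒰 ω φ) (hψ : MultiAdd ψ) (hψj : ListParity 𝒰 j ψ)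
    {h h' : ZMod 2 × U} {ws : List (ZMod 2 × U)} (hh : h.2 ∈ 𝒰 h.1) (hh' : h'.2 ∈ 𝒰 h'.1)
    (hws : Homog 𝒰 ws) :
    ω (lcomp 𝒰 j φ ψ (h.2 :: ws.map Prod.snd)) h'.2 -
        ssum (fun b c => ω (φ (ψ (h.2 :: b.map Prod.snd) :: c.map Prod.snd)) h'.2) ws =
      psign (h.1 * (par ws + h'.1)) • (ω (lcomp 𝒰 j φ ψ (ws.map Prod.snd ++ [h'.2])) h.2 -
        ssum (fun a b => ω (φ ((a.map Prod.snd).map (signTwist 𝒰 j) ++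
          [ψ (b.map Prod.snd ++ [h'.2])])) h.2) ws) := by
  have hw : ψ [] ∈ 𝒰 j := by
    simpa using mem_of_listParity hψj hψ (ws := []) (by simp [Homog])
  have e1 : ∀ z : U, (fun x => ω x z) = ω.flip z := fun z => rfl
  have h1 : ω (φ (ψ [] :: h.2 :: ws.map Prod.snd)) h'.2 = psign (h.1 * (par ws + h'.1)) •
      ω (φ ((ws.map Prod.snd ++ [h'.2]).map (signTwist 𝒰 j) ++ [ψ []])) h.2 := by
    have hl : Homog 𝒰 (ws ++ [h']) := homog_append.2 ⟨hws, homog_cons.2 ⟨hh', by simp [Homog]⟩⟩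
    have h2 := hφc.homog hφ hw (homog_cons.2 ⟨hh, hws⟩) hh'
    have h3 := hφc.homog hφ hh hl hw
    have h4 := map_signTwist_homog 𝒰 hl j hφ [] [ψ []]
    simp only [List.map_append, List.map_cons, List.map_nil, List.nil_append, par_append, par_cons,
      par_nil, List.cons_append] at h2 h3 h4 ⊢
    rw [h2, h3, h4]
    simp only [map_zsmul, LinearMap.smul_apply, smul_smul, ← psign_add]
    congr 2
    generalize par ws = c
    generalize h.1 = h
    generalize h'.1 = h'
    clear * -
    revert j h h' c
    decide
  have h2 : ssum (fun a r => ssum (fun b c => ω (φ ((h.2 :: a.map Prod.snd).map (signTwist 𝒰 j) ++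
        ψ (b.map Prod.snd) :: c.map Prod.snd)) h'.2) r) ws =
      psign (h.1 * (par ws + h'.1)) • ssum (fun a r => ssum (fun b c =>
        ω (φ ((a.map Prod.snd).map (signTwist 𝒰 j) ++
          ψ (b.map Prod.snd) :: (c.map Prod.snd ++ [h'.2]))) h.2) r) ws := by
    rw [← zsmulAddGroupHom_apply, map_ssum]
    refine ssum_congr_mem ws fun a r har => ?_
    rw [map_ssum]
    refine ssum_congr_mem r fun b c hbc => ?_
    subst hbc har
    rw [homog_append, homog_append] at hws
    rw [form_apply_last hφ hφc hψ hψj hh hh' hws.1 hws.2.1 hws.2.2, par_append, par_append,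
      zsmulAddGroupHom_apply]
    congr 3
    ring
  have h3 : ω (lcomp 𝒰 j φ ψ (h.2 :: ws.map Prod.snd)) h'.2 =
      ω (φ (ψ [] :: h.2 :: ws.map Prod.snd)) h'.2 +
      ssum (fun b c => ω (φ (ψ (h.2 :: b.map Prod.snd) :: c.map Prod.snd)) h'.2) ws +
      ssum (fun a r => ssum (fun b c => ω (φ ((h.2 :: a.map Prod.snd).map (signTwist 𝒰 j) ++
        ψ (b.map Prod.snd) :: c.map Prod.snd)) h'.2) r) ws := by
    rw [lcomp, ssum_cons, ssum_cons, ssum_map, ssum_map, ← LinearMap.flip_apply]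
    simp only [map_add, map_ssum, ssum_map, LinearMap.flip_apply, List.map_nil, List.nil_append]
  have h4 : ω (lcomp 𝒰 j φ ψ (ws.map Prod.snd ++ [h'.2])) h.2 =
      ssum (fun a r => ssum (fun b c => ω (φ ((a.map Prod.snd).map (signTwist 𝒰 j) ++
        ψ (b.map Prod.snd) :: (c.map Prod.snd ++ [h'.2]))) h.2) r) ws +
      ssum (fun a b => ω (φ ((a.map Prod.snd).map (signTwist 𝒰 j) ++
          [ψ (b.map Prod.snd ++ [h'.2])])) h.2) ws +
      ω (φ ((ws.map Prod.snd ++ [h'.2]).map (signTwist 𝒰 j) ++ [ψ []])) h.2 := by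
    rw [lcomp_append_cons, ssum_map, ssum_map, ← LinearMap.flip_apply]
    simp only [map_add, map_ssum, ssum_map, LinearMap.flip_apply, ssum_nil]
  rw [h3, h4, h1, h2]
  simp only [smul_add, smul_sub]
  abel

/-- The exceptional terms of `form_lcomp_cons` do not match within one composite. By cyclicity of
both factors and antisymmetry of `ω`, the terms where `ψ` takes the first argument equal, up to
sign, those of the opposite composite where `φ` takes the last one, so they cancel in the
commutator. -/
theorem ListCyclic.bracket {φ ψ : List U → U} {i j : ZMod 2} (hφ : MultiAdd φ)
    (hφi : ListParity 𝒰 i φ) (hφc : ListCyclic 𝒰 ω φ) (hψ : MultiAdd ψ) (hψj : ListParity 𝒰 j ψ)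
    (hψc : ListCyclic 𝒰 ω ψ) (hω : GradedAntisymmetric 𝒰 ω) : ListCyclic 𝒰 ω
    (fun l => lcomp 𝒰 j φ ψ l - psign (i * j) • lcomp 𝒰 i ψ φ l) := by
  have key : ∀ {φ ψ : List U → U} {i j : ZMod 2} (hφ : MultiAdd φ)
      (hφi : ListParity 𝒰 i φ) (hφc : ListCyclic 𝒰 ω φ) (hψ : MultiAdd ψ)
      (hψj : ListParity 𝒰 j ψ) (hψc : ListCyclic 𝒰 ω ψ) {h h' : ZMod 2 × U}
      {ws : List (ZMod 2 × U)} (hh : h.2 ∈ 𝒰 h.1) (hh' : h'.2 ∈ 𝒰 h'.1) (hws : Homog 𝒰 ws),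
      ssum (fun b c => ω (φ (ψ (h.2 :: b.map Prod.snd) :: c.map Prod.snd)) h'.2) ws =
      -(psign (i * j) • psign (h.1 * (par ws + h'.1)) • 
        ssum (fun a b => ω (ψ ((a.map Prod.snd).map (signTwist 𝒰 i) ++
          [φ (b.map Prod.snd ++ [h'.2])])) h.2) ws) := by
    intro φ ψ i j hφ hφi hφc hψ hψj hψc h h' ws hh hh' hws
    rw [← neg_smul, smul_smul, ← zsmulAddGroupHom_apply, map_ssum]
    refine ssum_congr_mem ws fun b c hbc => ?_
    subst hbc
    rw [homog_append] at hws
    have h1 := map_signTwist_homog 𝒰 hws.1 i hψ [] [φ (c.map Prod.snd ++ [h'.2])]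
    rw [List.nil_append, List.nil_append] at h1
    rw [form_apply_first hφ hφi hφc hψ hψj hψc hω hh hh' hws.1 hws.2, zsmulAddGroupHom_apply, h1]
    simp only [map_zsmul, LinearMap.smul_apply, smul_smul, neg_mul, neg_smul, ← psign_add,
      par_append]
    congr 3
    ring
  refine listCyclic_of_homog ?_ fun h ws h' hws hh' => ?_
  · intro a x y c
    simp only [hφ.lcomp hψ j a x y c, hψ.lcomp hφ i a x y c]
    simp only [smul_add]
    abel
  · rw [homog_cons] at hws
    have h1 := form_lcomp_cons hφ hφc hψ hψj hws.1 hh' hws.2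
    have h2 := form_lcomp_cons hψ hψc hφ hφi hws.1 hh' hws.2
    have h3 := key hφ hφi hφc hψ hψj hψc hws.1 hh' hws.2
    have h4 := key hψ hψj hψc hφ hφi hφc hws.1 hh' hws.2
    rw [sub_eq_iff_eq_add] at h1 h2
    simp only [map_sub, map_zsmul, LinearMap.sub_apply, LinearMap.smul_apply, h1, h2, h3, h4,
      mul_comm j i]
    rcases psign_eq_or (i * j) with e | e <;>
    rcases psign_eq_or (h.1 * (par ws + h'.1)) with e' | e' <;>
    · simp only [e, e', one_smul, neg_smul, neg_neg]
      abel

/-- Insertion is the commutator with a constant, because composing with the constant on the outside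
gives zero. -/
theorem ListCyclic.linsert {f : List U → U} {q p : ZMod 2} (hf : MultiAdd f)
    (hfq : ListParity 𝒰 q f) (hfc : ListCyclic 𝒰 ω f) (hω : GradedAntisymmetric 𝒰 ω) {w : U}
    (hw : w ∈ 𝒰 p) : ListCyclic 𝒰 ω (linsert 𝒰 p w f) := by
  have := ListCyclic.bracket hf hfq hfc (multiAdd_constFun w) (listParity_constFun hw)
    (listCyclic_constFun w) hω
  simpa [lcomp_constFun hf, constFun_lcomp] using this

theorem ListCyclic.liter {f : List U → U} {q : ZMod 2} (hf : MultiAdd f)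
    (hfq : ListParity 𝒰 q f) (hfc : ListCyclic 𝒰 ω f) (hω : GradedAntisymmetric 𝒰 ω)
    {ws : List (ZMod 2 × U)} (hws : Homog 𝒰 ws) : ListCyclic 𝒰 ω (liter 𝒰 ws f) := by
  induction ws generalizing f q with
  | nil => exact hfc
  | cons h ws ih =>
    rw [homog_cons] at hws
    exact ih (hf.linsert _ _) (hfq.linsert hf hws.1) (hfc.linsert hf hfq hω hws.1) hws.2

/-- The symmetrization of a cyclic cochain is cyclic. -/
theorem ListCyclic.symmetrization {φ : Cochain k U U} {q : ZMod 2} (hφ : HasParity 𝒰 𝒰 q φ)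
    (hφc : ListCyclic 𝒰 ω (ev φ)) (hω : GradedAntisymmetric 𝒰 ω) :
    ListCyclic 𝒰 ω (ev (symmetrization 𝒰 φ)) := by
  refine listCyclic_of_homog (multiAdd_ev _) fun h ws h' hws hh' => ?_
  have hws' := homog_cons.1 hws
  have hl : Homog 𝒰 (ws ++ [h']) := homog_append.2 ⟨hws'.2, homog_cons.2 ⟨hh', by simp [Homog]⟩⟩
  have h1 := symmetrization_apply 𝒰 φ hws
  have h2 := symmetrization_apply 𝒰 φ hl
  -- All arguments but one are inserted. Cyclicity then only compares the two ways of distributing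
  -- the last two vectors between the remaining argument and the form.
  have h3 := (hφc.liter (multiAdd_ev φ) (listParity_ev 𝒰 hφ) hω hws'.2).homog
    ((multiAdd_ev φ).liter ws) hws'.1 (ws := []) (by simp [Homog]) hh'
  rw [liter_rotate (multiAdd_ev φ) hws'.1 hws'.2, liter_append] at h1
  rw [liter_append] at h2
  simp only [List.map_append, List.map_cons, List.map_nil, liter_cons, liter_nil, _root_.linsert, ssum_nil,
    List.nil_append,
    par_nil, zero_add] at h1 h2 h3
  rw [h1, h2]
  simp only [map_zsmul, LinearMap.smul_apply, h3, smul_smul, ← psign_add]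
  congr 2
  ring

end Cyclic

/-! ## The dglas and the `L_∞`-maps -/

section CyclicCochains

variable {k : Type*} [Field k] [CharZero k] {V : Type*} [AddCommGroup V] [Module k V]
variable {𝒱 : ZMod 2 → Submodule k V} [DirectSum.Decomposition 𝒱] {B : V →ₗ[k] V →ₗ[k] k}
  {c : ZMod 2}

theorem shiftedForm_apply {i : ZMod 2} {a : V} (ha : a ∈ parityRev 𝒱 i) (b : V) :
    shiftedForm 𝒱 B a b = psign (i + 1) • B a b := by
  have h : parityInv 𝒱 = signTwist 𝒱 1 := (if_neg one_ne_zero).symm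
  rw [shiftedForm, LinearMap.comp_apply, h, signTwist_of_mem 𝒱 ha, one_mul, map_zsmul,
    LinearMap.smul_apply]

theorem gradedAntisymmetric_shiftedForm (hB : IsInnerProduct 𝒱 B c) :
    GradedAntisymmetric (parityRev 𝒱) (shiftedForm 𝒱 B) := by
  intro i j a ha b hb
  by_cases hij : i + 1 + (j + 1) = c
  · rw [shiftedForm_apply ha, shiftedForm_apply hb, hB.symm _ _ a ha b hb, smul_smul, smul_smul,
      ← neg_smul]
    congr 1
    clear * -
    revert i j
    decide
  · rw [shiftedForm_apply ha, shiftedForm_apply hb, hB.homogeneous _ _ a ha b hb hij,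
      hB.homogeneous _ _ b hb a ha (by rwa [add_comm])]
    simp

theorem mem_cyclicCochains_iff {φ : Cochain k V V} :
    φ ∈ cyclicCochains 𝒱 B ↔ ListCyclic (parityRev 𝒱) (shiftedForm 𝒱 B) (ev φ) := by
  constructor
  · intro h
    refine listCyclic_of_homog (multiAdd_ev φ) fun g ws g' hws hg' => ?_
    obtain ⟨n, p, x, hx, rfl⟩ := exists_ofFn_homog _ (homog_cons.1 hws).2
    have h1 := h (n + 1) (Fin.cons g.1 (Fin.snoc p g'.1)) (Fin.cons g.2 (Fin.snoc x g'.2)) ?_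
    · rw [← ev_ofFn, ← ev_ofFn] at h1
      simp only [map_snd_ofFn, par_ofFn]
      convert h1 using 3
      · congr 2
        simp [List.ofFn_succ, Fin.cons_succ]
      · rw [← Fin.succ_last]
        simp
      · simp [Fin.sum_univ_castSucc]
      · congr 2
        simp only [Fin.cons_succ]
        rw [List.ofFn_succ']
        simp [List.concat_eq_append]
      · rfl
    · intro i
      refine Fin.cases ?_ (fun i => ?_) i
      · exact (homog_cons.1 hws).1
      · refine Fin.lastCases ?_ (fun i => ?_) i
        · simpa using hg'
        · simpa using hx i
  · intro h n p x hx
    cases n with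
    | zero =>
      -- In arity zero the condition on cochains is vacuous, which is why `ListCyclic` need not
      -- mention the empty list.
      simp only [Finset.univ_eq_empty, Finset.sum_empty, mul_zero, psign_zero, one_smul]
      rw [Subsingleton.elim (fun i : Fin 0 => x i.castSucc) fun i => x i.succ]
      rfl
    | succ n =>
      rw [← ev_ofFn, ← ev_ofFn]
      have h1 := h.homog (multiAdd_ev φ) (hx 0) (ws := List.ofFn fun i : Fin n =>
        (p i.succ.castSucc, x i.succ.castSucc)) (homog_ofFn _ fun i => hx _) (hx (Fin.last _))
      rw [map_snd_ofFn, par_ofFn] at h1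
      rw [List.ofFn_succ, List.ofFn_succ', Fin.sum_univ_castSucc]
      simpa [List.concat_eq_append] using h1

/-- The form is homogeneous, so a homogeneous vector pairs with only one graded component of `a`. -/
theorem shiftedForm_parityProj (hB : IsInnerProduct 𝒱 B c) {r : ZMod 2} {b : V}
    (hb : b ∈ parityRev 𝒱 r) (j : ZMod 2) (a : V) :
    shiftedForm 𝒱 B (parityProj (parityRev 𝒱) j a) b =
      if j + r = c then shiftedForm 𝒱 B a b else 0 := by
  induction a using induction_homogeneous (parityRev 𝒱) with
  | h0 => simp
  | hadd x y hx hy =>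
    simp only [map_add, LinearMap.add_apply, hx, hy]
    split_ifs <;> simp
  | hom i x hx =>
    have h0 : i + r ≠ c → shiftedForm 𝒱 B x b = 0 := by
      intro h
      rw [shiftedForm_apply hx, hB.homogeneous _ _ x hx b hb, smul_zero]
      intro h'
      apply h
      rw [← h']
      clear * -
      revert i r
      decide
    rw [parityProj_of_mem _ hx]
    by_cases hj : j = i
    · subst hj
      by_cases hjr : j + r = c
      · simp [hjr]
      · simp [hjr, h0 hjr]
    · rw [if_neg hj, map_zero, LinearMap.zero_apply]
      split_ifs with hjr
      · rw [h0]
        rw [← hjr]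
        simpa using Ne.symm hj
      · rfl

/-- Projecting to parity `q` multiplies the form by a condition on `q` plus the total parity of all
`n + 1` arguments, which rotation does not change. -/
theorem cochainProj_mem_cyclicCochains (hB : IsInnerProduct 𝒱 B c) (q : ZMod 2)
    {φ : Cochain k V V} (hφ : φ ∈ cyclicCochains 𝒱 B) :
    cochainProj (parityRev 𝒱) (parityRev 𝒱) q φ ∈ cyclicCochains 𝒱 B := by
  intro n p x hx
  rw [cochainProj_apply_of_mem _ _ q φ n _ _ fun i => hx i.castSucc,
    cochainProj_apply_of_mem _ _ q φ n _ _ fun i => hx i.succ,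
    shiftedForm_parityProj hB (hx _), shiftedForm_parityProj hB (hx _), hφ n p x hx]
  have h1 : ∑ i : Fin n, p i.castSucc + q + p (Fin.last n) =
      ∑ i : Fin n, p i.succ + q + p 0 := by
    rw [add_right_comm, ← Fin.sum_univ_castSucc, add_right_comm, add_comm _ (p 0),
      ← Fin.sum_univ_succ]
  rw [h1]
  split_ifs <;> simp

theorem tensorComp_bracket_mem_cyclicCochains (hB : IsInnerProduct 𝒱 B c) {i j : ZMod 2}
    {φ ψ : Cochain k V V} (hφ : φ ∈ cyclicCochains 𝒱 B) (hψ : ψ ∈ cyclicCochains 𝒱 B)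
    (hi : HasParity (parityRev 𝒱) (parityRev 𝒱) i φ)
    (hj : HasParity (parityRev 𝒱) (parityRev 𝒱) j ψ) (hφ0 : φ 0 = 0) (hψ0 : ψ 0 = 0) :
    tensorComp (parityRev 𝒱) φ ψ - psign (i * j) • tensorComp (parityRev 𝒱) ψ φ ∈
      cyclicCochains 𝒱 B := by
  rw [mem_cyclicCochains_iff] at hφ hψ ⊢
  have := ListCyclic.bracket (multiAdd_ev φ) (listParity_ev _ hi) hφ (multiAdd_ev ψ)
    (listParity_ev _ hj) hψ (gradedAntisymmetric_shiftedForm hB)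
  intro p x hx l y
  simpa only [ev_sub, ev_zsmul, tensorComp_apply _ _ hj hψ0, tensorComp_apply _ _ hi hφ0] using
    this p x hx l y

theorem symmetrization_mem_cyclicCochains (hB : IsInnerProduct 𝒱 B c) {φ : Cochain k V V}
    {q : ZMod 2} (hq : HasParity (parityRev 𝒱) (parityRev 𝒱) q φ) (hφ : φ ∈ cyclicCochains 𝒱 B) :
    symmetrization (parityRev 𝒱) φ ∈ cyclicCochains 𝒱 B := by
  rw [mem_cyclicCochains_iff] at hφ ⊢
  exact hφ.symmetrization hq (gradedAntisymmetric_shiftedForm hB)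

theorem divFactorial_mem_cyclicCochains {φ : Cochain k V V} (hφ : φ ∈ cyclicCochains 𝒱 B) :
    divFactorial φ ∈ cyclicCochains 𝒱 B := by
  intro n p x hx
  simp [divFactorial, hφ n p x hx, mul_left_comm]

theorem hasParity_sub {U : Type*} [AddCommGroup U] [Module k U]
    {𝒰 : ZMod 2 → Submodule k U} {φ ψ : Cochain k U U} {q : ZMod 2}
    (hφ : HasParity 𝒰 𝒰 q φ) (hψ : HasParity 𝒰 𝒰 q ψ) : HasParity 𝒰 𝒰 q (φ - ψ) :=
  (cochainGrading 𝒰 𝒰 q).sub_mem hφ hψ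

theorem hasParity_zsmul {U : Type*} [AddCommGroup U] [Module k U]
    {𝒰 : ZMod 2 → Submodule k U} {φ : Cochain k U U} {q : ZMod 2} (n : ℤ)
    (hφ : HasParity 𝒰 𝒰 q φ) : HasParity 𝒰 𝒰 q (n • φ) :=
  (cochainGrading 𝒰 𝒰 q).toAddSubgroup.zsmul_mem hφ n

/-- Transport along symmetrization, so that closure properties of the associative commutator pass to
the symmetric one. -/
theorem symComp_bracket_eq {U : Type*} [AddCommGroup U] [Module k U] {𝒰 : ZMod 2 → Submodule k U}
    [DirectSum.Decomposition 𝒰] {i j : ZMod 2}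
    {φ ψ : Cochain k U U} (hφ : GradedSymmetric 𝒰 φ) (hψ : GradedSymmetric 𝒰 ψ)
    (hi : HasParity 𝒰 𝒰 i φ) (hj : HasParity 𝒰 𝒰 j ψ) (hφ0 : φ 0 = 0) (hψ0 : ψ 0 = 0) :
    symComp 𝒰 φ ψ - psign (i * j) • symComp 𝒰 ψ φ =
      symmetrization 𝒰 (tensorComp 𝒰 (divFactorial φ) (divFactorial ψ) -
        psign (i * j) • tensorComp 𝒰 (divFactorial ψ) (divFactorial φ)) := by
  rw [← symmetrizationₗ_apply, map_sub, map_zsmul, symmetrizationₗ_apply, symmetrizationₗ_apply,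
    symmetrization_tensorComp _ (hasParity_divFactorial hj) (by simp [divFactorial, hψ0]),
    symmetrization_tensorComp _ (hasParity_divFactorial hi) (by simp [divFactorial, hφ0]),
    symmetrization_divFactorial hφ, symmetrization_divFactorial hψ]

theorem symComp_bracket_mem_cyclicCochains (hB : IsInnerProduct 𝒱 B c) {i j : ZMod 2}
    {φ ψ : Cochain k V V} (hφ : φ ∈ cyclicCochains 𝒱 B) (hψ : ψ ∈ cyclicCochains 𝒱 B)
    (hφs : GradedSymmetric (parityRev 𝒱) φ) (hψs : GradedSymmetric (parityRev 𝒱) ψ)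
    (hi : HasParity (parityRev 𝒱) (parityRev 𝒱) i φ)
    (hj : HasParity (parityRev 𝒱) (parityRev 𝒱) j ψ) (hφ0 : φ 0 = 0) (hψ0 : ψ 0 = 0) :
    symComp (parityRev 𝒱) φ ψ - psign (i * j) • symComp (parityRev 𝒱) ψ φ ∈
      cyclicCochains 𝒱 B := by
  have h1 : divFactorial φ 0 = 0 := by simp [divFactorial, hφ0]
  have h2 : divFactorial ψ 0 = 0 := by simp [divFactorial, hψ0]
  have h3 := hasParity_divFactorial hi
  have h4 := hasParity_divFactorial hj
  rw [symComp_bracket_eq hφs hψs hi hj hφ0 hψ0]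
  refine symmetrization_mem_cyclicCochains hB (hasParity_sub (hasParity_tensorComp h3 h4 h2)
    (hasParity_zsmul _ ?_)) (tensorComp_bracket_mem_cyclicCochains hB
    (divFactorial_mem_cyclicCochains hφ) (divFactorial_mem_cyclicCochains hψ) h3 h4 h1 h2)
  rw [add_comm]
  exact hasParity_tensorComp h4 h3 h1

/-- Modulo `S` the membership becomes an equality of additive functions on lists, which may be
tested on homogeneous entries. -/
theorem ev_mem_of_homog {U W : Type*} [AddCommGroup U] [Module k U] [AddCommGroup W] [Module k W]
    {𝒰 : ZMod 2 → Submodule k U} [DirectSum.Decomposition 𝒰] (f : Cochain k U W)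
    (S : Submodule k W) (h : ∀ ws, Homog 𝒰 ws → ev f (ws.map Prod.snd) ∈ S) (l : List U) :
    ev f l ∈ S := by
  rw [← Submodule.Quotient.mk_eq_zero, ← Submodule.mkQ_apply]
  refine MultiAdd.ext_homog 𝒰 (f := fun l => S.mkQ (ev f l)) (g := fun _ => 0) ?_ ?_ ?_ l
  · intro a x y c
    simp [multiAdd_ev f a x y c]
  · intro a x y c
    simp
  · intro ws hws
    simpa using h ws hws

theorem aInftyTwistingMap_mem_cyclicCochains (hB : IsInnerProduct 𝒱 B c) {φ : Cochain k V V}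
    {q : ZMod 2} (hq : HasParity (parityRev 𝒱) (parityRev 𝒱) q φ) (hφ : φ ∈ cyclicCochains 𝒱 B)
    (w : List V) : ev (aInftyTwistingMap (parityRev 𝒱) φ) w ∈ cyclicCochains 𝒱 B := by
  refine ev_mem_of_homog (𝒰 := parityRev 𝒱) _ _ (fun ws hws => ?_) w
  rw [mem_cyclicCochains_iff] at hφ ⊢
  rw [funext (ev_aInftyTwistingMap φ hws)]
  split_ifs
  · intro p x hx l y
    simp
  · exact (hφ.liter (multiAdd_ev φ) (listParity_ev _ hq) (gradedAntisymmetric_shiftedForm hB)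
      hws).ltrunc

end CyclicCochains

/-! ### The `L_∞` case through symmetrization -/

section LInfty

variable {k : Type*} [Field k] [CharZero k] {U : Type*} [AddCommGroup U] [Module k U]
variable {𝒰 : ZMod 2 → Submodule k U} [DirectSum.Decomposition 𝒰]

/-- After at least one insertion the function is never evaluated on the empty list, so truncating it
makes no difference. -/
theorem liter_ltrunc (ws : List (ZMod 2 × U)) (f : List U → U) :
    liter 𝒰 ws (ltrunc f) [] = if ws = [] then 0 else liter 𝒰 ws f [] := by
  cases ws with
  | nil => rfl
  | cons h ws =>
    have : linsert 𝒰 h.1 h.2 (ltrunc f) = linsert 𝒰 h.1 h.2 f := by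
      funext l
      refine ssum_congr_mem l fun a b _ => ltrunc_of_ne_nil _ (by simp)
    simp [liter_cons, this]

/-- Inserting `ws` and then `ls` is inserting their concatenation; thus symmetrization turns
shuffled insertion into plain substitution in the first slots. -/
theorem ev_symmetrization_twistCochain {φ : Cochain k U U} (hφ0 : φ 0 = 0)
    {ws ls : List (ZMod 2 × U)} (hws : Homog 𝒰 ws) (hls : Homog 𝒰 ls) :
    ev (symmetrization 𝒰 (twistCochain 𝒰 φ ws)) (ls.map Prod.snd) =
      if ls = [] then 0 else ev (symmetrization 𝒰 φ) ((ws ++ ls).map Prod.snd) := by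
  rw [symmetrization_apply _ _ hls, funext (ev_twistCochain hφ0 hws), liter_ltrunc,
    symmetrization_apply _ _ (homog_append.2 ⟨hws, hls⟩), liter_append]

theorem divFactorial_zero {φ : Cochain k U U} (hφ0 : φ 0 = 0) : divFactorial φ 0 = 0 := by
  simp [divFactorial, hφ0]

/-- The `L_∞` twisting map is the symmetrized `A_∞` twisting map of the components divided by
factorials, so the results on `A_∞` twists apply to it. -/
theorem ev_lInftyTwistingMap_eq {m : Cochain k U U} (hm0 : m 0 = 0) (hm : GradedSymmetric 𝒰 m)
    (w : List U) : ev (lInftyTwistingMap m) w =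
      symmetrization 𝒰 (ev (aInftyTwistingMap 𝒰 (divFactorial m)) w) := by
  rw [← symmetrizationₗ_apply]
  refine MultiAdd.ext_homog 𝒰 (f := fun w => ev (lInftyTwistingMap m) w) (g := fun w =>
    symmetrizationₗ 𝒰 (ev (aInftyTwistingMap 𝒰 (divFactorial m)) w)) (multiAdd_ev _) ?_ ?_ w
  · intro a x y c
    simp only [multiAdd_ev _ a x y c, map_add]
  · intro ws hws
    refine cochain_ext_homog (𝒰 := 𝒰) fun ls hls => ?_
    rw [ev_lInftyTwistingMap, symmetrizationₗ_apply]
    by_cases h : ws = []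
    · subst h
      have h0 : ev (aInftyTwistingMap 𝒰 (divFactorial m)) [] = 0 := rfl
      rw [List.map_nil, h0, ← symmetrizationₗ_apply, map_zero]
      simp
    · have h1 := ev_symmetrization_twistCochain (divFactorial_zero hm0) hws hls
      rw [twistCochain, if_neg h, symmetrization_divFactorial hm, List.map_append] at h1
      rw [h1]
      simp [h]

theorem isLInfty_symmetrization {m : Cochain k U U} (hm : IsAInfty 𝒰 m) :
    IsLInfty 𝒰 (symmetrization 𝒰 m) where
  zero := symmetrization_zero hm.zero
  symm := gradedSymmetric_symmetrization m
  odd := hasParity_symmetrization hm.odd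
  square := by
    rw [← symmetrization_tensorComp m hm.odd hm.zero, hm.square, ← symmetrizationₗ_apply, map_zero]

theorem isLInftyMap_aInftyTwistingMap {m : Cochain k U U} (hm : IsAInfty 𝒰 m) :
    IsLInftyMap 𝒰 (parityRev (cochainGrading 𝒰 𝒰)) (symmetrization 𝒰 m)
      (deformationStructure 𝒰 (tensorCompₗ 𝒰) m) (aInftyTwistingMap 𝒰 m) := by
  refine isLInftyMap_twisting hm.odd hm.zero (tensorCompₗ 𝒰) LinearMap.id (fun _ _ _ _ _ => rfl)
    (fun _ _ h => h) (fun ws hws => ?_) fun _ => rfl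
  rw [hm.square]
  refine ev_ext fun l => ?_
  have h0 : ev (0 : Cochain k U U) = fun l => (0 : ℤ) • ev (0 : Cochain k U U) l := by
    funext l
    simp [ev_zero]
  rw [LinearMap.id_apply, ev_twistCochain rfl hws, ev_zero]
  cases l with
  | nil => rfl
  | cons x l =>
    rw [ltrunc_of_ne_nil _ (by simp), h0, liter_zsmul, zero_smul]

theorem isLInftyMap_lInftyTwistingMap {m : Cochain k U U} (hm : IsLInfty 𝒰 m) :
    IsLInftyMap 𝒰 (parityRev (cochainGrading 𝒰 𝒰)) m
      (deformationStructure 𝒰 (symCompₗ 𝒰) m) (lInftyTwistingMap m) := by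
  have hN : symmetrizationₗ 𝒰 (divFactorial m) = m := symmetrization_divFactorial hm.symm
  have := isLInftyMap_twisting (hasParity_divFactorial hm.odd) (divFactorial_zero hm.zero)
    (symCompₗ 𝒰) (symmetrizationₗ 𝒰) (fun φ ψ q hψ hψ0 => symmetrization_tensorComp φ hψ hψ0)
    (fun _ _ h => hasParity_symmetrization h) (fun ws hws => ?_)
    (ev_lInftyTwistingMap_eq hm.zero hm.symm)
  · rwa [← symmetrizationₗ_apply, hN] at this
  -- `divFactorial m` need not be an `A_∞`-structure. What is needed is weaker: the symmetrized
  -- twists of its square vanish, because the symmetrization of the square is the symmetric square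
  -- of `m`.
  · refine cochain_ext_homog (𝒰 := 𝒰) fun ls hls => ?_
    rw [symmetrizationₗ_apply, ev_symmetrization_twistCochain (tensorComp_zero _ _) hws hls,
      symmetrization_tensorComp _ (hasParity_divFactorial hm.odd) (divFactorial_zero hm.zero),
      symmetrization_divFactorial hm.symm, hm.square, ev_zero, ev_zero, ite_self]

theorem aInftyTwistingMap_mem_truncHoch (m : Cochain k U U) (w : List U) :
    ev (aInftyTwistingMap 𝒰 m) w ∈ truncHoch k U :=
  ev_mem_of_homog (𝒰 := 𝒰) _ _ (fun _ hws => ev_aInftyTwistingMap_zero m hws) w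

theorem apply_mem_of_ev {W : Type*} [AddCommGroup W] [Module k W] {f : Cochain k U W}
    {S : Submodule k W} (h : ∀ w, ev f w ∈ S) (r : ℕ) (x : Fin r → U) : f r x ∈ S := by
  rw [← ev_ofFn]
  exact h _

end LInfty

/-! ### The four target dglas -/

section Targets

variable {k : Type*} [Field k] [CharZero k] {V : Type*} [AddCommGroup V] [Module k V]
variable {𝒱 : ZMod 2 → Submodule k V} [DirectSum.Decomposition 𝒱] {B : V →ₗ[k] V →ₗ[k] k}
  {c : ZMod 2}

theorem lInftyTwistingMap_mem_truncCE {m : Cochain k V V} (hm : IsLInfty (parityRev 𝒱) m)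
    (w : List V) : ev (lInftyTwistingMap m) w ∈ truncCE 𝒱 := by
  rw [ev_lInftyTwistingMap_eq hm.zero hm.symm]
  exact ⟨symmetrization_zero (aInftyTwistingMap_mem_truncHoch _ w),
    gradedSymmetric_symmetrization _⟩

theorem lInftyTwistingMap_mem_cyclicCochains {m : Cochain k V V} (hm : IsLInfty (parityRev 𝒱) m)
    (hB : IsInnerProduct 𝒱 B c) (hmc : m ∈ cyclicCochains 𝒱 B) (w : List V) :
    ev (lInftyTwistingMap m) w ∈ cyclicCochains 𝒱 B := by
  refine ev_mem_of_homog (𝒰 := parityRev 𝒱) _ _ (fun ws hws => ?_) w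
  rw [ev_lInftyTwistingMap_eq hm.zero hm.symm]
  have hμ := hasParity_divFactorial hm.odd
  exact symmetrization_mem_cyclicCochains hB (hasParity_ev_aInftyTwistingMap hμ hws)
    (aInftyTwistingMap_mem_cyclicCochains hB hμ (divFactorial_mem_cyclicCochains hmc) _)

theorem isDGLAOn_truncHoch {m : Cochain k V V} (hm : IsAInfty (parityRev 𝒱) m) :
    IsDGLAOn (cochainGrading (parityRev 𝒱) (parityRev 𝒱))
      (superCommutator (cochainGrading (parityRev 𝒱) (parityRev 𝒱)) (tensorCompₗ (parityRev 𝒱)) m)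
      (superCommutator (cochainGrading (parityRev 𝒱) (parityRev 𝒱)) (tensorCompₗ (parityRev 𝒱)))
      (truncHoch k V) :=
  isDGLAOn_tensorComp (S := truncHoch k V) (fun _ h => h) (fun q _ h => cochainProj_zero q h)
    (fun i j φ _ ψ _ _ _ => by
      change tensorComp (parityRev 𝒱) φ ψ 0 - psign (i * j) • tensorComp (parityRev 𝒱) ψ φ 0 = 0
      rw [tensorComp_zero, tensorComp_zero, smul_zero, sub_zero]) hm.zero hm.odd hm.square

theorem isDGLAOn_cyclic_truncHoch {m : Cochain k V V} (hm : IsAInfty (parityRev 𝒱) m)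
    (hB : IsInnerProduct 𝒱 B c) (hmc : m ∈ cyclicCochains 𝒱 B) :
    IsDGLAOn (cochainGrading (parityRev 𝒱) (parityRev 𝒱))
      (superCommutator (cochainGrading (parityRev 𝒱) (parityRev 𝒱)) (tensorCompₗ (parityRev 𝒱)) m)
      (superCommutator (cochainGrading (parityRev 𝒱) (parityRev 𝒱)) (tensorCompₗ (parityRev 𝒱)))
      (truncHoch k V ⊓ cyclicCochains 𝒱 B) :=
  isDGLAOn_tensorComp (S := truncHoch k V ⊓ cyclicCochains 𝒱 B) (fun _ h => h.1)
    (fun q _ h => ⟨cochainProj_zero q h.1, cochainProj_mem_cyclicCochains hB q h.2⟩)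
    (fun i j φ hφ ψ hψ hi hj => by
      refine ⟨?_, tensorComp_bracket_mem_cyclicCochains hB hφ.2 hψ.2 hi hj hφ.1 hψ.1⟩
      change tensorComp (parityRev 𝒱) φ ψ 0 - psign (i * j) • tensorComp (parityRev 𝒱) ψ φ 0 = 0
      rw [tensorComp_zero, tensorComp_zero, smul_zero, sub_zero]) ⟨hm.zero, hmc⟩ hm.odd hm.square

theorem symComp_bracket_mem_truncCE {i j : ZMod 2} {φ ψ : Cochain k V V} (hφ : φ ∈ truncCE 𝒱)
    (hψ : ψ ∈ truncCE 𝒱) (hi : HasParity (parityRev 𝒱) (parityRev 𝒱) i φ)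
    (hj : HasParity (parityRev 𝒱) (parityRev 𝒱) j ψ) :
    symComp (parityRev 𝒱) φ ψ - psign (i * j) • symComp (parityRev 𝒱) ψ φ ∈ truncCE 𝒱 := by
  rw [symComp_bracket_eq hφ.2 hψ.2 hi hj hφ.1 hψ.1]
  refine ⟨symmetrization_zero ?_, gradedSymmetric_symmetrization _⟩
  rw [Pi.sub_apply, Pi.smul_apply, tensorComp_zero, tensorComp_zero, smul_zero, sub_zero]

theorem isDGLAOn_truncCE {m : Cochain k V V} (hm : IsLInfty (parityRev 𝒱) m) :
    IsDGLAOn (cochainGrading (parityRev 𝒱) (parityRev 𝒱))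
      (superCommutator (cochainGrading (parityRev 𝒱) (parityRev 𝒱)) (symCompₗ (parityRev 𝒱)) m)
      (superCommutator (cochainGrading (parityRev 𝒱) (parityRev 𝒱)) (symCompₗ (parityRev 𝒱)))
      (truncCE 𝒱) :=
  isDGLAOn_symComp (S := truncCE 𝒱) (fun _ h => h.1) (fun _ h => h.2)
    (fun q _ h => ⟨cochainProj_zero q h.1, gradedSymmetric_cochainProj h.2 q⟩)
    (fun _ _ _ hφ _ hψ hi hj => symComp_bracket_mem_truncCE hφ hψ hi hj) ⟨hm.zero, hm.symm⟩
    hm.odd hm.square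

theorem isDGLAOn_cyclic_truncCE {m : Cochain k V V} (hm : IsLInfty (parityRev 𝒱) m)
    (hB : IsInnerProduct 𝒱 B c) (hmc : m ∈ cyclicCochains 𝒱 B) :
    IsDGLAOn (cochainGrading (parityRev 𝒱) (parityRev 𝒱))
      (superCommutator (cochainGrading (parityRev 𝒱) (parityRev 𝒱)) (symCompₗ (parityRev 𝒱)) m)
      (superCommutator (cochainGrading (parityRev 𝒱) (parityRev 𝒱)) (symCompₗ (parityRev 𝒱)))
      (truncCE 𝒱 ⊓ cyclicCochains 𝒱 B) :=
  isDGLAOn_symComp (S := truncCE 𝒱 ⊓ cyclicCochains 𝒱 B) (fun _ h => h.1.1) (fun _ h => h.1.2)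
    (fun q _ h => ⟨⟨cochainProj_zero q h.1.1, gradedSymmetric_cochainProj h.1.2 q⟩,
      cochainProj_mem_cyclicCochains hB q h.2⟩)
    (fun _ _ _ hφ _ hψ hi hj => ⟨symComp_bracket_mem_truncCE hφ.1 hψ.1 hi hj,
      symComp_bracket_mem_cyclicCochains hB hφ.2 hψ.2 hφ.1.2 hψ.1.2 hi hj hφ.1.1 hψ.1.1⟩)
    ⟨⟨hm.zero, hm.symm⟩, hmc⟩ hm.odd hm.square

end Targets

/-! ## Extension of scalars -/

section ExtendScalars

variable {k : Type u} [Field k] {U W : Type*} [AddCommGroup U] [Module k U]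
  [AddCommGroup W] [Module k W]
variable (𝒰 : ZMod 2 → Submodule k U) [DirectSum.Decomposition 𝒰] (A : NilpotentCdga.{u, v} k)

theorem insertCoeff_tmul (w : W) (b a : A.carrier) :
    insertCoeff W A ((w ⊗ₜ b) ⊗ₜ a) = w ⊗ₜ[k] (a * b) := rfl

theorem extendScalars_succ (n : ℕ) (z : Fin (n + 1) → U ⊗[k] A.carrier)
    (φ : MultilinearMap k (fun _ : Fin (n + 1) => U) W) :
    extendScalars 𝒰 A (n + 1) z φ = ∑ q : ZMod 2, insertCoeff W A (TensorProduct.map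
      (extendScalars 𝒰 A n (fun i => LinearMap.rTensor A.carrier (signTwist 𝒰 q) (z i.succ)) ∘ₗ
        φ.curryLeft) (parityProj A.gr q) (z 0)) := rfl

theorem rTensor_update_succ (q : ZMod 2) {n : ℕ} (z : Fin (n + 1) → U ⊗[k] A.carrier) (i : Fin n)
    (t : U ⊗[k] A.carrier) : (fun j : Fin n => LinearMap.rTensor A.carrier (signTwist 𝒰 q)
      (Function.update z i.succ t j.succ)) = Function.update
        (fun j : Fin n => LinearMap.rTensor A.carrier (signTwist 𝒰 q) (z j.succ)) i
        (LinearMap.rTensor A.carrier (signTwist 𝒰 q) t) := by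
  funext j
  by_cases hj : j = i
  · subst hj; simp
  · simp [Function.update_of_ne hj, Function.update_of_ne (Fin.succ_injective _ |>.ne hj)]

/-- The `A`-multilinear extension of `φ` as a `k`-multilinear map. -/
def extendScalarsMulti : (n : ℕ) → (φ : MultilinearMap k (fun _ : Fin n => U) W) →
    MultilinearMap k (fun _ : Fin n => U ⊗[k] A.carrier) (W ⊗[k] A.carrier) := fun n φ =>
  { toFun := fun z => extendScalars 𝒰 A n z φ
    map_update_add' := fun {inst} z i x y => by
      rw [Subsingleton.elim inst (instDecidableEqFin n)]
      clear inst
      induction n generalizing x y with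
      | zero => exact i.elim0
      | succ n ih =>
        simp only [extendScalars_succ]
        rw [← Finset.sum_add_distrib]
        refine Finset.sum_congr rfl fun q _ => ?_
        refine Fin.cases ?_ (fun i => ?_) i
        · simp
        · simp only [rTensor_update_succ, Function.update_of_ne (Fin.succ_ne_zero i).symm]
          rw [← map_add, ← LinearMap.add_apply, ← TensorProduct.map_add_left, ← LinearMap.add_comp]
          congr 4
          ext ψ
          rw [map_add, ih]
          rfl
    map_update_smul' := fun {inst} z i c x => by
      rw [Subsingleton.elim inst (instDecidableEqFin n)]
      clear inst
      induction n generalizing x with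
      | zero => exact i.elim0
      | succ n ih =>
        simp only [extendScalars_succ]
        rw [Finset.smul_sum]
        refine Finset.sum_congr rfl fun q _ => ?_
        refine Fin.cases ?_ (fun i => ?_) i
        · simp
        · simp only [rTensor_update_succ, Function.update_of_ne (Fin.succ_ne_zero i).symm]
          rw [← map_smul, ← LinearMap.smul_apply, ← TensorProduct.map_smul_left,
            ← LinearMap.smul_comp]
          congr 4
          ext ψ
          rw [map_smul, ih]
          rfl }

theorem extendScalarsMulti_apply {n : ℕ} (φ : MultilinearMap k (fun _ : Fin n => U) W)
    (z : Fin n → U ⊗[k] A.carrier) :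
    extendScalarsMulti 𝒰 A n φ z = extendScalars 𝒰 A n z φ := rfl

variable {𝒰 A}

/-- A pure tensor `x ⊗ a` together with the parities of `x` and `a`. -/
abbrev Letter (U R : Type*) := ZMod 2 × (ZMod 2 × U × R)

/-- The pure tensor of a letter. -/
def Letter.tensor {A : NilpotentCdga.{u, v} k} (h : Letter U A.carrier) : U ⊗[k] A.carrier :=
  h.2.2.1 ⊗ₜ h.2.2.2

variable (𝒰) in
/-- The entries of the letter have the given parities. -/
def Letter.Good (h : Letter U A.carrier) : Prop := h.2.2.1 ∈ 𝒰 h.1 ∧ h.2.2.2 ∈ A.gr h.2.1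

/-- The sign of moving all coefficients to the right. -/
def coeffSign {R : Type*} : List (Letter U R) → ℤ
  | [] => 1
  | h :: l => psign (h.2.1 * par l) * coeffSign l

/-- The vectors of a word. -/
def wordVec {R : Type*} (l : List (Letter U R)) : List U := l.map fun h => h.2.2.1

/-- The product of the coefficients of a word. -/
def wordCoeff {R : Type*} [Ring R] (l : List (Letter U R)) : R := (l.map fun h => h.2.2.2).prod

/-- The value of `φ` on a word. -/
def extWord (φ : Cochain k U W) (l : List (Letter U A.carrier)) : W ⊗[k] A.carrier :=
  coeffSign l • (ev φ (wordVec l) ⊗ₜ wordCoeff l)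

theorem map_snd_vec {R : Type*} (l : List (Letter U R)) :
    (l.map fun h => (h.1, h.2.2.1)).map Prod.snd = wordVec l := by
  simp [wordVec]

theorem par_vec {R : Type*} (l : List (Letter U R)) :
    par (l.map fun h => (h.1, h.2.2.1)) = par l := by
  simp [par, Function.comp_def]

theorem homog_vec {l : List (Letter U A.carrier)} (hl : ∀ h ∈ l, Letter.Good 𝒰 h) :
    Homog 𝒰 (l.map fun h => (h.1, h.2.2.1)) := by
  intro h hh
  obtain ⟨h, hm, rfl⟩ := List.mem_map.1 hh
  exact (hl h hm).1

variable (𝒰) in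
/-- The letter `± x ⊗ a` obtained by moving something of parity `c` past `x`. -/
def Letter.twist {R : Type*} (c : ZMod 2) (h : Letter U R) : Letter U R :=
  (h.1, (h.2.1, signTwist 𝒰 c h.2.2.1, h.2.2.2))

theorem coeffSign_map_twist {R : Type*} (c : ZMod 2) (l : List (Letter U R)) :
    coeffSign (l.map (Letter.twist 𝒰 c)) = coeffSign l := by
  induction l with
  | nil => rfl
  | cons h l ih => simp [coeffSign, ih, par, Function.comp_def, Letter.twist]

theorem wordVec_map_twist {R : Type*} (c : ZMod 2) (l : List (Letter U R)) :
    wordVec (l.map (Letter.twist 𝒰 c)) = (wordVec l).map (signTwist 𝒰 c) := by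
  simp [wordVec, Function.comp_def, Letter.twist]

theorem wordCoeff_map_twist {R : Type*} [Ring R] (c : ZMod 2) (l : List (Letter U R)) :
    wordCoeff (l.map (Letter.twist 𝒰 c)) = wordCoeff l := by
  simp [wordCoeff, Function.comp_def, Letter.twist]

/-- The partial evaluation of a cochain. -/
def headCochain (φ : Cochain k U W) (x : U) : Cochain k U W := fun n => (φ (n + 1)).curryLeft x

theorem ev_headCochain (φ : Cochain k U W) (x : U) (l : List U) :
    ev (headCochain φ x) l = ev φ (x :: l) := by
  obtain ⟨n, y, rfl⟩ := exists_ofFn l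
  rw [ev_ofFn, ← List.ofFn_cons, ev_ofFn]
  rfl

/-- Each step of the recursion moves the leading coefficient to the right past the remaining
vectors; the accumulated signs are `coeffSign`. -/
theorem extendScalars_tensor (φ : Cochain k U W) {n : ℕ} (h : Fin n → Letter U A.carrier)
    (hh : ∀ i, Letter.Good 𝒰 (h i)) :
    extendScalars 𝒰 A n (fun i => (h i).tensor) (φ n) = extWord φ (List.ofFn h) := by
  induction n generalizing φ with
  | zero => 
    simp only [extWord, coeffSign, wordVec, wordCoeff, ev_nil, List.ofFn_zero, List.map_nil,
      List.prod_nil, one_smul]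
    rfl
  | succ n ih =>
    have h0 := hh 0
    rw [extendScalars_succ, Finset.sum_eq_single (h 0).2.1]
    · set c := (h 0).2.1 with hc
      have h1 := ih (headCochain φ (h 0).2.2.1)
        (fun i => (h i.succ).twist 𝒰 c)
        (fun i => ⟨?_, (hh i.succ).2⟩)
      · have h2 : parityProj A.gr c (h 0).2.2.2 = (h 0).2.2.2 := by
          rw [parityProj_of_mem A.gr h0.2, if_pos rfl]
        have h4 := map_signTwist_homog 𝒰 (homog_vec (𝒰 := 𝒰)
          (l := List.ofFn fun i : Fin n => h i.succ) (by
            intro g hg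
            obtain ⟨i, rfl⟩ := List.mem_ofFn.1 hg
            exact hh _)) c (multiAdd_ev φ) [(h 0).2.2.1] []
        rw [map_snd_vec, par_vec] at h4
        have h5 : (List.ofFn fun i : Fin n => (h i.succ).twist 𝒰 c) =
            (List.ofFn fun i : Fin n => h i.succ).map (Letter.twist 𝒰 c) := by
          rw [List.map_ofFn]
          rfl
        rw [extWord, h5, coeffSign_map_twist, wordVec_map_twist, wordCoeff_map_twist,
          ev_headCochain] at h1
        simp only [List.append_nil, List.cons_append, List.nil_append] at h4
        rw [h4] at h1
        rw [List.ofFn_succ, extWord]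
        simp only [Letter.tensor, TensorProduct.map_tmul, LinearMap.rTensor_tmul, h2,
          LinearMap.comp_apply]
        have h8 : (φ (n + 1)).curryLeft (h 0).2.2.1 = headCochain φ (h 0).2.2.1 n := rfl
        rw [h8]
        simp only [Letter.tensor, Letter.twist] at h1
        rw [h1]
        simp only [TensorProduct.smul_tmul', insertCoeff_tmul, coeffSign, wordVec, wordCoeff,
          List.map_cons, List.prod_cons, smul_smul]
        rw [mul_comm (coeffSign _)]
      · simp only [Letter.twist]
        rw [signTwist_of_mem 𝒰 (hh i.succ).1]
        exact (𝒰 _).toAddSubgroup.zsmul_mem (hh i.succ).1 _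
    · intro q _ hq
      rw [Letter.tensor, TensorProduct.map_tmul, parityProj_of_mem A.gr h0.2, if_neg hq,
        TensorProduct.tmul_zero, map_zero]
    · simp

end ExtendScalars

/-! ## Sums over words -/

section Words

/-! ### Splittings of words without signs -/

section Psum

variable {α M : Type*} [AddCommMonoid M]

/-- The sum of `G S T` over all decompositions of a list into two complementary sublists. -/
def psum (G : List α → List α → M) : List α → M
  | [] => G [] []
  | h :: l => psum (fun S T => G (h :: S) T) l + psum (fun S T => G S (h :: T)) l
termination_by l => l.length

@[simp]
theorem psum_nil (G : List α → List α → M) : psum G [] = G [] [] := by rw [psum]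

theorem psum_cons (G : List α → List α → M) (h : α) (l : List α) : psum G (h :: l) =
    psum (fun S T => G (h :: S) T) l + psum (fun S T => G S (h :: T)) l := by rw [psum]

theorem map_psum {N : Type*} [AddCommMonoid N] {Φ : Type*} [FunLike Φ M N]
    [AddMonoidHomClass Φ M N] (φ : Φ) (G : List α → List α → M) (l : List α) :
    φ (psum G l) = psum (fun S T => φ (G S T)) l := by
  induction l generalizing G with
  | nil => simp
  | cons h l ih => rw [psum_cons, psum_cons, map_add, ih, ih]

theorem psum_congr {F G : List (ZMod 2 × α) → List (ZMod 2 × α) → M} {l : List (ZMod 2 × α)}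
    (h : ∀ S T, S.Sublist l → T.Sublist l → par S + par T = par l → F S T = G S T) :
    psum F l = psum G l := by
  induction l generalizing F G with
  | nil => simpa using h [] []
  | cons x l ih =>
    rw [psum_cons, psum_cons]
    congr 1
    · refine ih fun S T hS hT hp => h _ _ (hS.cons_cons x) (hT.cons x) ?_
      rw [par_cons, par_cons, ← hp, add_assoc]
    · refine ih fun S T hS hT hp => h _ _ (hS.cons x) (hT.cons_cons x) ?_
      rw [par_cons, par_cons, ← hp]
      ring

end Psum

/-! ### Sums over all words and the exponential formula -/

section Wsum

variable {α ι M : Type*} [Fintype ι] [AddCommMonoid M] (L : ι → α)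

/-- The sum over all words of length `n` in the letters `L i`. -/
def wsum (n : ℕ) (G : List α → M) : M := ∑ r : Fin n → ι, G (List.ofFn fun i => L (r i))

theorem wsum_zero (G : List α → M) : wsum L 0 G = G [] := by simp [wsum]

theorem wsum_succ (n : ℕ) (G : List α → M) :
    wsum L (n + 1) G = ∑ i, wsum L n fun l => G (L i :: l) := by
  rw [wsum, ← (Fin.consEquiv fun _ : Fin (n + 1) => ι).sum_comp, Fintype.sum_prod_type]
  simp [wsum, Fin.consEquiv]

theorem wsum_add (n : ℕ) (F G : List α → M) :
    wsum L n (fun l => F l + G l) = wsum L n F + wsum L n G := Finset.sum_add_distrib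

theorem map_wsum {N : Type*} [AddCommMonoid N] {Φ : Type*} [FunLike Φ M N]
    [AddMonoidHomClass Φ M N] (φ : Φ) (n : ℕ) (G : List α → M) :
    φ (wsum L n G) = wsum L n fun l => φ (G l) := map_sum φ _ _

theorem wsum_congr {n : ℕ} {F G : List α → M}
    (h : ∀ l, l.length = n → (∀ x ∈ l, ∃ i, x = L i) → F l = G l) : wsum L n F = wsum L n G := by
  refine Finset.sum_congr rfl fun r _ => h _ (by simp) fun x hx => ?_
  obtain ⟨i, rfl⟩ := List.mem_ofFn.1 hx
  exact ⟨r i, rfl⟩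

theorem wsum_eq_zero {n : ℕ} {G : List α → M}
    (h : ∀ l, l.length = n → (∀ x ∈ l, ∃ i, x = L i) → G l = 0) : wsum L n G = 0 := by
  rw [wsum_congr L h]
  simp [wsum]

theorem wsum_sum {κ : Type*} (s : Finset κ) (n : ℕ) (G : κ → List α → M) :
    wsum L n (fun l => ∑ j ∈ s, G j l) = ∑ j ∈ s, wsum L n (G j) := Finset.sum_comm

/-- In a sum over all words only the length of the chosen subword matters, and a given length is
chosen in a binomial number of ways. The induction is Pascal's rule. -/
theorem wsum_psum (n : ℕ) (G : List α → List α → M) :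
    wsum L n (psum G) = ∑ x ∈ Finset.HasAntidiagonal.antidiagonal n,
      n.choose x.1 • wsum L x.1 fun S => wsum L x.2 fun T => G S T := by
  induction n generalizing G with
  | zero => simp [wsum_zero]
  | succ n ih =>
    rw [wsum_succ, Finset.sum_antidiagonal_choose_succ_nsmul
      (fun s t => wsum L s fun S => wsum L t fun T => G S T)]
    simp only [psum_cons, wsum_add, ih]
    rw [Finset.sum_add_distrib, Finset.sum_comm, add_comm, Finset.sum_comm]
    congr 1
    · refine Finset.sum_congr rfl fun x _ => ?_
      rw [← Finset.smul_sum, ← wsum_sum]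
      congr 2
      funext S
      rw [wsum_succ]
    · refine Finset.sum_congr rfl fun x hx => ?_
      rw [← Finset.smul_sum, wsum_succ,
      ← Nat.choose_symm_of_eq_add (Finset.HasAntidiagonal.mem_antidiagonal.1 hx).symm]

variable {k : Type*} [Field k] [Module k M]

/-- The sum over all words of length less than `N`, with weight `1/n!` for words of length `n`. -/
def esum (k : Type*) [Field k] [Module k M] (N : ℕ) (G : List α → M) : M :=
  ∑ n ∈ Finset.range N, (n.factorial : k)⁻¹ • wsum L n G

theorem map_esum {M' : Type*} [AddCommMonoid M'] [Module k M'] (φ : M →ₗ[k] M') (N : ℕ)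
    (G : List α → M) : φ (esum L k N G) = esum L k N fun l => φ (G l) := by
  simp only [esum, map_sum, map_smul, map_wsum]

theorem esum_congr {N : ℕ} {F G : List α → M} (h : ∀ l, (∀ x ∈ l, ∃ i, x = L i) → F l = G l) :
    esum L k N F = esum L k N G :=
  Finset.sum_congr rfl fun _ _ => by rw [wsum_congr L fun l _ hl => h l hl]

theorem esum_add (N : ℕ) (F G : List α → M) :
    esum L k N (fun l => F l + G l) = esum L k N F + esum L k N G := by
  simp only [esum, wsum_add, smul_add, Finset.sum_add_distrib]

theorem esum_of_le {N N' : ℕ} (h : N ≤ N') {G : List α → M}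
    (hG : ∀ l, (∀ x ∈ l, ∃ i, x = L i) → N ≤ l.length → G l = 0) :
    esum L k N' G = esum L k N G := by
  refine (Finset.sum_subset (Finset.range_subset_range.2 h) fun n _ hn => ?_).symm
  rw [wsum_eq_zero L fun l hl hl' => hG l hl' ?_, smul_zero]
  simpa [hl] using hn

theorem esum_eq (N : ℕ) (G : List α → M) : esum L k N G =
    ∑ y ∈ (Finset.range N).sigma fun n => (Finset.univ : Finset (Fin n → ι)),
      (y.1.factorial : k)⁻¹ • G (List.ofFn fun i => L (y.2 i)) := by
  rw [Finset.sum_sigma]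
  simp only [esum, wsum, Finset.smul_sum]

theorem esum_comm (N N' : ℕ) (F : List α → List α → M) :
    (esum L k N fun S => esum L k N' fun T => F S T) =
      esum L k N' fun T => esum L k N fun S => F S T := by
  simp only [esum_eq, Finset.smul_sum]
  rw [Finset.sum_comm]
  exact Finset.sum_congr rfl fun _ _ => Finset.sum_congr rfl fun _ _ => smul_comm _ _ _

/-- The exponential formula: `1/n!` times a binomial coefficient is `1/s! · 1/t!`, so a sum over
splittings becomes a double sum. As only parts shorter than `N` contribute, words shorter than `2N`
account for all pairs. -/
theorem esum_psum [CharZero k] (N : ℕ) (G : List α → List α → M)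
    (hS : ∀ S T, (∀ x ∈ S, ∃ i, x = L i) → N ≤ S.length → G S T = 0)
    (hT : ∀ S T, (∀ x ∈ T, ∃ i, x = L i) → N ≤ T.length → G S T = 0) :
    esum L k (2 * N) (psum G) = esum L k N fun S => esum L k N fun T => G S T := by
  have h1 : ∀ n, (n.factorial : k)⁻¹ • wsum L n (psum G) = ∑ x ∈ Finset.HasAntidiagonal.antidiagonal n,
      (x.1.factorial : k)⁻¹ • (x.2.factorial : k)⁻¹ • wsum L x.1 fun S => wsum L x.2 (G S) := by
    intro n
    rw [wsum_psum, Finset.smul_sum]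
    refine Finset.sum_congr rfl fun x hx => ?_
    rw [← Nat.cast_smul_eq_nsmul k, smul_smul, smul_smul]
    congr 1
    have h := Nat.add_choose_mul_factorial_mul_factorial x.1 x.2
    rw [Finset.HasAntidiagonal.mem_antidiagonal.1 hx,
      ← Nat.choose_symm_of_eq_add (Finset.HasAntidiagonal.mem_antidiagonal.1 hx).symm] at h
    have h0 : ∀ a : ℕ, (a.factorial : k) ≠ 0 := fun a => Nat.cast_ne_zero.2 a.factorial_ne_zero
    rw [← h]
    have h2 : (n.choose x.1 : k) ≠ 0 := by
      refine Nat.cast_ne_zero.2 fun h3 => n.factorial_ne_zero ?_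
      rw [← h, h3]; simp
    push_cast
    field_simp [h0, h2]
  have h2 : ∀ s, wsum L s (fun S => esum L k N fun T => G S T) = ∑ t ∈ Finset.range N,
      (t.factorial : k)⁻¹ • wsum L s fun S => wsum L t (G S) := by
    intro s
    simp only [esum]
    rw [wsum_sum]
    refine Finset.sum_congr rfl fun t _ => ?_
    exact (map_wsum L (LinearMap.lsmul k M (t.factorial : k)⁻¹) s _).symm
  rw [esum, esum]
  simp only [h1, h2, Finset.smul_sum]
  rw [← Finset.sum_product', ← Finset.sum_fiberwise_of_maps_to (t := Finset.range (2 * N))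
    (g := fun x : ℕ × ℕ => x.1 + x.2)]
  · refine Finset.sum_congr rfl fun n _ => (Finset.sum_subset ?_ ?_).symm
    · intro x hx
      simpa using (Finset.mem_filter.1 hx).2
    · intro x hx hx'
      have : N ≤ x.1 ∨ N ≤ x.2 := by
        by_contra! h
        exact hx' (Finset.mem_filter.2 ⟨Finset.mem_product.2 ⟨Finset.mem_range.2 h.1,
          Finset.mem_range.2 h.2⟩, Finset.HasAntidiagonal.mem_antidiagonal.1 hx⟩)
      rcases this with h | h
      · rw [wsum_eq_zero L fun S hl hl' => ?_, smul_zero, smul_zero]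
        exact wsum_eq_zero L fun T _ _ => hS S T hl' (by omega)
      · rw [wsum_eq_zero L fun S hl hl' => ?_, smul_zero, smul_zero]
        exact wsum_eq_zero L fun T hlT hT' => hT S T hT' (by omega)
  · intro x hx
    simp only [Finset.mem_product, Finset.mem_range] at hx ⊢
    omega

end Wsum

/-! ### Koszul signs absorbed by even letters -/

section Coefficients

variable {k : Type u} [Field k] [CharZero k] {U W : Type*} [AddCommGroup U] [Module k U]
  [AddCommGroup W] [Module k W]
variable {𝒰 : ZMod 2 → Submodule k U} [DirectSum.Decomposition 𝒰] {A : NilpotentCdga.{u, v} k}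

variable (𝒰) in
/-- The letter is an even element of `U ⊗ A`. -/
def Letter.Even (h : Letter U A.carrier) : Prop := Letter.Good 𝒰 h ∧ h.2.1 = h.1

/-- Left multiplication by an element of `A`. -/
def leftMul (W : Type*) [AddCommGroup W] [Module k W] (a : A.carrier) :
    W ⊗[k] A.carrier →ₗ[k] W ⊗[k] A.carrier :=
  LinearMap.lTensor W (LinearMap.mulLeft k a)

@[simp]
theorem leftMul_tmul (a b : A.carrier) (x : W) :
    leftMul (A := A) W a (x ⊗ₜ b) = x ⊗ₜ (a * b) := rfl

theorem wordCoeff_mem {l : List (Letter U A.carrier)} (hl : ∀ h ∈ l, Letter.Even 𝒰 h) :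
    wordCoeff l ∈ A.gr (par l) := by
  induction l with
  | nil => exact SetLike.GradedOne.one_mem
  | cons h l ih =>
    rw [List.forall_mem_cons] at hl
    rw [par_cons]
    have := hl.1.1.2
    rw [hl.1.2] at this
    exact SetLike.mul_mem_graded this (ih hl.2)

/-- In terms of words, the signs in the sum over all unshuffles disappear. -/
theorem usum_eq_psum (G : List (Letter U A.carrier) → List (Letter U A.carrier) → W)
    {l : List (Letter U A.carrier)} (hl : ∀ h ∈ l, Letter.Even 𝒰 h) :
    coeffSign l • (usum G l ⊗ₜ[k] wordCoeff l) =
      psum (fun S T => (coeffSign S * coeffSign T * psign (par S * par T)) •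
        (G S T ⊗ₜ[k] (wordCoeff S * wordCoeff T))) l := by
  induction l generalizing G with
  | nil => simp [coeffSign, wordCoeff, psign_zero]
  | cons h l ih =>
    rw [List.forall_mem_cons] at hl
    have ha := hl.1.1.2
    rw [hl.1.2] at ha
    have h1 : coeffSign (h :: l) • (usum G (h :: l) ⊗ₜ[k] wordCoeff (h :: l)) =
        psign (h.1 * par l) • leftMul W h.2.2.2 (coeffSign l • (usum G (h :: l) ⊗ₜ wordCoeff l)) := by
      rw [map_zsmul, leftMul_tmul, smul_smul, coeffSign, hl.1.2]
      rfl
    rw [h1, usum_cons, TensorProduct.add_tmul, smul_add, ih _ hl.2, ih _ hl.2, map_add, smul_add,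
      psum_cons]
    congr 1
    · rw [← zsmulAddGroupHom_apply, map_psum, map_psum]
      refine psum_congr fun S T hS hT hp => ?_
      rw [map_zsmul, leftMul_tmul, zsmulAddGroupHom_apply, smul_smul, coeffSign, par_cons, hl.1.2,
        ← hp]
      have h2 : wordCoeff (h :: S) * wordCoeff T = h.2.2.2 * (wordCoeff S * wordCoeff T) := by
        simp [wordCoeff, mul_assoc]
      rw [h2]
      congr 1
      rw [mul_add, add_mul, psign_add, psign_add]
      ring
    · rw [← zsmulAddGroupHom_apply, map_psum, map_psum]
      refine psum_congr fun S T hS hT hp => ?_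
      have hS' := wordCoeff_mem (𝒰 := 𝒰) fun g hg => hl.2 g (hS.subset hg)
      -- Moving the coefficient of `h` past those of `S` yields the sign with which `usum` moves its
      -- vector; here the letters have to be even.
      have h2 : wordCoeff S * wordCoeff (h :: T) =
          psign (h.1 * par S) • (h.2.2.2 * (wordCoeff S * wordCoeff T)) := by
        have h3 := A.graded_comm _ _ _ hS' _ ha
        rw [wordCoeff, wordCoeff, List.map_cons, List.prod_cons, ← mul_assoc] at *
        rw [h3, smul_mul_assoc, mul_assoc, mul_comm (par S)]
        rfl
      rw [map_zsmul, leftMul_tmul, zsmulAddGroupHom_apply, smul_smul, coeffSign, par_cons, hl.1.2,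
        ← hp, h2, ← TensorProduct.smul_tmul', TensorProduct.tmul_smul, smul_smul, smul_smul]
      congr 1
      rw [mul_add, mul_add, psign_add, psign_add, mul_comm (par S) h.1]
      ring

end Coefficients

end Words

/-! ## Graded symmetric cochains on words -/

section Swap

variable {k : Type*} [Field k] [CharZero k] {U W : Type*} [AddCommGroup U] [Module k U]
  [AddCommGroup W] [Module k W]
variable {𝒰 : ZMod 2 → Submodule k U} [DirectSum.Decomposition 𝒰]

theorem ofFn_swap {α : Type*} (a : List α) (h h' : α) (b : List α) {n : ℕ} (x : Fin n → α)
    (hx : a ++ h :: h' :: b = List.ofFn x) : ∃ σ : Equiv.Perm (Fin n),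
      a ++ h' :: h :: b = List.ofFn fun i => x (σ i) := by
  have hn : n = a.length + (b.length + 2) := by
    have := congrArg List.length hx
    simpa using this.symm
  refine ⟨Equiv.swap ⟨a.length, by omega⟩ ⟨a.length + 1, by omega⟩, ?_⟩
  have hx' : ∀ i : Fin n, x i = (a ++ h :: h' :: b)[i.1]'(by simp; omega) := by
    intro i
    simp [hx]
  refine List.ext_getElem (by simp; omega) fun i h1 h2 => ?_
  rw [List.getElem_ofFn, hx']
  by_cases hi : i = a.length
  · subst hi
    simp [Equiv.swap_apply_left]
  · by_cases hi' : i = a.length + 1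
    · subst hi'
      simp [Equiv.swap_apply_right]
    · rw [Equiv.swap_apply_of_ne_of_ne (by simpa [Fin.ext_iff] using hi)
        (by simpa [Fin.ext_iff] using hi')]
      simp only
      rcases lt_or_ge i a.length with hlt | hge
      · rw [List.getElem_append_left hlt, List.getElem_append_left hlt]
      · obtain ⟨j, rfl⟩ : ∃ j, i = a.length + (j + 2) := ⟨i - a.length - 2, by omega⟩
        rw [List.getElem_append_right (by omega), List.getElem_append_right (by omega)]
        simp

/-- The Koszul sign of the transposition is not expanded: labelling the entries by their indices and
comparing `inversionSign` before and after the exchange determines it. -/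
theorem GradedSymmetric.swap_homog {f : Cochain k U W} (hf : GradedSymmetric 𝒰 f)
    {a b : List (ZMod 2 × U)} {h h' : ZMod 2 × U} (hl : Homog 𝒰 (a ++ h :: h' :: b)) :
    ev f ((a ++ h' :: h :: b).map Prod.snd) =
      psign (h.1 * h'.1) • ev f ((a ++ h :: h' :: b).map Prod.snd) := by
  obtain ⟨n, p, x, hx, hpx⟩ := exists_ofFn_homog 𝒰 hl
  set y : Fin n → (ZMod 2 × U) × ℕ := fun i => ((p i, x i), i) with hy
  have h1 : (List.ofFn y).map Prod.fst = a ++ h :: h' :: b := by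
    rw [hpx, List.map_ofFn]
    rfl
  obtain ⟨a, l, h2, rfl, hl2⟩ := List.map_eq_append_iff.1 h1
  obtain ⟨h, l, rfl, rfl, hl3⟩ := List.map_eq_cons_iff.1 hl2
  obtain ⟨h', b, rfl, rfl, rfl⟩ := List.map_eq_cons_iff.1 hl3
  obtain ⟨σ, hσ⟩ := ofFn_swap a h h' b y h2.symm
  have hnd : ((a ++ h :: h' :: b).map Prod.snd).Nodup := by
    rw [← h2, List.map_ofFn]
    exact List.nodup_ofFn.2 Fin.val_injective
  have hne : h.2 ≠ h'.2 := by
    intro h3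
    simp [List.nodup_append, h3] at hnd
  have h3 := koszulSign_of_adjacent (fun h h' => h.2 ≠ h'.2) inversionSign
    (fun a h h' b => inversionSign_swap a h h' b) p (fun i => (i : ℕ)) σ
    (fun i j hij _ hh => hij.ne' (σ.injective (Fin.val_injective hh)))
  have h4 : (List.ofFn fun i => (p i, (i : ℕ))) =
      (a ++ h :: h' :: b).map fun t => (t.1.1, t.2) := by
    rw [← h2, List.map_ofFn]
    rfl
  have h5 : (List.ofFn fun i => (p (σ i), (σ i : ℕ))) =
      (a ++ h' :: h :: b).map fun t => (t.1.1, t.2) := by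
    rw [hσ, List.map_ofFn]
    rfl
  rw [h4, h5, List.map_append, List.map_cons, List.map_cons, inversionSign_swap _ _ _ _ hne,
    List.map_append, List.map_cons, List.map_cons] at h3
  have h6 := mul_right_cancel₀ (inversionSign_ne_zero _) h3
  have h7 := hf n σ p x hx
  have h8 : (List.ofFn fun i => x (σ i)) = (a ++ h' :: h :: b).map fun t => t.1.2 := by
    rw [hσ, List.map_ofFn]
    rfl
  have h9 : List.ofFn x = (a ++ h :: h' :: b).map fun t => t.1.2 := by
    rw [← h2, List.map_ofFn]
    rfl
  rw [← ev_ofFn, ← ev_ofFn, h8, h9, ← h6] at h7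
  simpa [Function.comp_def] using h7

theorem GradedSymmetric.swap {f : Cochain k U W} (hf : GradedSymmetric 𝒰 f) {p q : ZMod 2}
    {x y : U} (hx : x ∈ 𝒰 p) (hy : y ∈ 𝒰 q) (a b : List U) :
    ev f (a ++ y :: x :: b) = psign (p * q) • ev f (a ++ x :: y :: b) := by
  have hm := multiAdd_ev f
  refine MultiAdd.ext_homog 𝒰 (f := fun a => ev f (a ++ y :: x :: b))
    (g := fun a => psign (p * q) • ev f (a ++ x :: y :: b)) ?_ ?_ (fun as has => ?_) a
  · intro c z z' d
    simpa using hm c z z' (d ++ y :: x :: b)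
  · intro c z z' d
    simpa using congrArg (psign (p * q) • ·) (hm c z z' (d ++ x :: y :: b))
  refine MultiAdd.ext_homog 𝒰 (f := fun b => ev f (as.map Prod.snd ++ y :: x :: b))
    (g := fun b => psign (p * q) • ev f (as.map Prod.snd ++ x :: y :: b)) ?_ ?_ (fun bs hbs => ?_) b
  · intro c z z' d
    simpa using hm (as.map Prod.snd ++ y :: x :: c) z z' d
  · intro c z z' d
    simpa using congrArg (psign (p * q) • ·) (hm (as.map Prod.snd ++ x :: y :: c) z z' d)
  simpa using hf.swap_homog (a := as) (b := bs) (h := (p, x)) (h' := (q, y))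
    (homog_append.2 ⟨has, homog_cons.2 ⟨hx, homog_cons.2 ⟨hy, hbs⟩⟩⟩)

end Swap

/-! ### The differential on words -/

section Differential

variable {k : Type u} [Field k] [CharZero k] {U W : Type*} [AddCommGroup U] [Module k U]
  [AddCommGroup W] [Module k W]
variable {𝒰 : ZMod 2 → Submodule k U} [DirectSum.Decomposition 𝒰] {A : NilpotentCdga.{u, v} k}

/-- The sum of `g h T` over all ways to remove a letter `h` from a word, leaving `T`. -/
def removeSum {α M : Type*} [AddCommMonoid M] (g : α → List α → M) : List α → M
  | [] => 0
  | h :: l => g h l + removeSum (fun h' T => g h' (h :: T)) l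
termination_by l => l.length

theorem removeSum_nil {α M : Type*} [AddCommMonoid M] (g : α → List α → M) :
    removeSum g [] = 0 := by rw [removeSum]

theorem removeSum_cons {α M : Type*} [AddCommMonoid M] (g : α → List α → M) (h : α) (l : List α) :
    removeSum g (h :: l) = g h l + removeSum (fun h' T => g h' (h :: T)) l := by rw [removeSum]

theorem map_removeSum {α M N : Type*} [AddCommMonoid M] [AddCommMonoid N] {Φ : Type*}
    [FunLike Φ M N] [AddMonoidHomClass Φ M N] (φ : Φ) (g : α → List α → M) (l : List α) :
    φ (removeSum g l) = removeSum (fun h T => φ (g h T)) l := by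
  induction l generalizing g with
  | nil => simp [removeSum_nil]
  | cons h l ih => rw [removeSum_cons, removeSum_cons, map_add, ih]

theorem removeSum_congr {α M : Type*} [AddCommMonoid M] {g g' : ZMod 2 × α → List (ZMod 2 × α) → M}
    {l : List (ZMod 2 × α)}
    (h : ∀ x T, x ∈ l → T.Sublist l → x.1 + par T = par l → g x T = g' x T) :
    removeSum g l = removeSum g' l := by
  induction l generalizing g g' with
  | nil => simp [removeSum_nil]
  | cons y l ih =>
    rw [removeSum_cons, removeSum_cons, h y l (by simp) (List.sublist_cons_self _ _) (by simp)]
    congr 1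
    refine ih fun x T hx hT hp => h _ _ (by simp [hx]) (hT.cons_cons y) ?_
    rw [par_cons, par_cons, ← hp]
    ring

/-- The function of two lists which is `g h T` on `[h]` and `T` and vanishes otherwise. -/
def onSingleton {α M : Type*} [AddCommMonoid M] (g : α → List α → M) (S T : List α) : M :=
  match S with
  | [h] => g h T
  | _ => 0

/-- The sum over all removals as a sum over all decompositions. -/
theorem psum_single {α M : Type*} [AddCommMonoid M] (g : α → List α → M) (l : List α) :
    psum (onSingleton g) l = removeSum g l := by
  have h0 : ∀ (F : List α → M) (l : List α),
      psum (fun S T => match S with | [] => F T | _ :: _ => 0) l = F l := by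
    intro F l
    have hz : ∀ l : List α, psum (fun _ _ => (0 : M)) l = 0 := by
      intro l
      induction l with
      | nil => simp
      | cons h l ih => rw [psum_cons, ih, add_zero]
    induction l generalizing F with
    | nil => simp
    | cons h l ih => rw [psum_cons, hz, zero_add, ih fun T => F (h :: T)]
  induction l generalizing g with
  | nil => simp [removeSum_nil, onSingleton]
  | cons h l ih =>
    rw [psum_cons, removeSum_cons, ← ih fun h' T => g h' (h :: T), ← h0 (g h) l]
    congr 2
    · funext S T
      cases S <;> rfl

/-- The differential of the coefficients of a word, for graded symmetric `F`. -/
theorem differential_wordCoeff (F : List U → W)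
    (hF : ∀ p q x y, x ∈ 𝒰 p → y ∈ 𝒰 q → ∀ a b,
      F (a ++ y :: x :: b) = psign (p * q) • F (a ++ x :: y :: b))
    {l : List (Letter U A.carrier)} (hl : ∀ h ∈ l, Letter.Even 𝒰 h) :
    (coeffSign l * psign (par l)) • (F (wordVec l) ⊗ₜ[k] A.d (wordCoeff l)) =
      removeSum (fun h T => (psign h.1 * psign ((h.1 + 1) * par T) * coeffSign T) •
        (F (h.2.2.1 :: wordVec T) ⊗ₜ[k] (A.d h.2.2.2 * wordCoeff T))) l := by
  induction l generalizing F with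
  | nil =>
    have h1 : A.d (1 : A.carrier) = 0 := by
      have := A.leibniz 0 1 SetLike.GradedOne.one_mem 1
      simpa [psign_zero] using this
    simp [removeSum_nil, wordCoeff, h1]
  | cons h l ih =>
    rw [List.forall_mem_cons] at hl
    have ha := hl.1.1.2
    rw [hl.1.2] at ha
    have h1 : A.d (wordCoeff (h :: l)) = A.d h.2.2.2 * wordCoeff l +
        psign h.1 • (h.2.2.2 * A.d (wordCoeff l)) := A.leibniz _ _ ha _
    have h2 := ih (fun l => F (h.2.2.1 :: l))
      (fun p q x y hx hy a b => hF p q x y hx hy (h.2.2.1 :: a) b) hl.2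
    rw [h1, TensorProduct.tmul_add, smul_add, removeSum_cons]
    congr 1
    · congr 1
      rw [coeffSign, par_cons, hl.1.2, add_mul, one_mul, psign_add, psign_add]
      ring
    · have h3 : (coeffSign (h :: l) * psign (par (h :: l))) • (F (wordVec (h :: l)) ⊗ₜ[k]
          (psign h.1 • (h.2.2.2 * A.d (wordCoeff l)))) = psign (h.1 * par l) • 
          leftMul W h.2.2.2 ((coeffSign l * psign (par l)) •
            (F (h.2.2.1 :: wordVec l) ⊗ₜ[k] A.d (wordCoeff l))) := by
        rw [map_zsmul, leftMul_tmul, TensorProduct.tmul_smul, smul_smul, smul_smul, coeffSign,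
          par_cons, hl.1.2, psign_add]
        congr 1
        linear_combination (psign (h.1 * par l) * coeffSign l * psign (par l)) *
          psign_mul_self h.1
      rw [h3, h2, ← zsmulAddGroupHom_apply, map_removeSum, map_removeSum]
      refine removeSum_congr fun g T hg hT hp => ?_
      have hg' := hl.2 g hg
      have hb := A.d_odd _ _ hg'.1.2
      rw [hg'.2] at hb
      -- The differentiated coefficient is moved to the front in `A`, while graded symmetry of `F`
      -- moves the matching vector to the front; the two signs differ because `A.d` is odd.
      have h4 : h.2.2.2 * (A.d g.2.2.2 * wordCoeff T) = psign (h.1 * (g.1 + 1)) •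
          (A.d g.2.2.2 * (h.2.2.2 * wordCoeff T)) := by
        rw [← mul_assoc, A.graded_comm _ _ _ ha _ hb, smul_mul_assoc, mul_assoc]
      have h5 := hF g.1 h.1 g.2.2.1 h.2.2.1 hg'.1.1 hl.1.1.1 [] (wordVec T)
      have h6 : wordCoeff (h :: T) = h.2.2.2 * wordCoeff T := rfl
      have h7 : wordVec (h :: T) = h.2.2.1 :: wordVec T := rfl
      simp only [List.nil_append] at h5
      rw [map_zsmul, leftMul_tmul, zsmulAddGroupHom_apply, smul_smul, h5, h6, h7, h4,
        ← TensorProduct.smul_tmul', TensorProduct.tmul_smul, smul_smul, smul_smul]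
      congr 1
      rw [← hp, par_cons, coeffSign, hl.1.2]
      have e : ∀ p q t : ZMod 2, psign (p * (q + t)) * (psign q * psign ((q + 1) * t)) *
          psign (q * p) * psign (p * (q + 1)) = psign q * psign ((q + 1) * (p + t)) *
            psign (p * t) := by decide
      linear_combination coeffSign T * e h.1 g.1 (par T)

end Differential

/-! ## `L_∞`-maps and Maurer-Cartan elements -/

section Push

theorem usum_map {α β M : Type*} [AddCommGroup M] (g : ZMod 2 × α → ZMod 2 × β)
    (hg : ∀ h, (g h).1 = h.1) (G : List (ZMod 2 × β) → List (ZMod 2 × β) → M)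
    (l : List (ZMod 2 × α)) :
    usum G (l.map g) = usum (fun S T => G (S.map g) (T.map g)) l := by
  have hp : ∀ l : List (ZMod 2 × α), par (l.map g) = par l := by
    intro l
    simp [par, Function.comp_def, hg]
  induction l generalizing G with
  | nil => simp
  | cons h l ih =>
    rw [List.map_cons, usum_cons, usum_cons, ih, ih]
    simp [hg, hp]

variable {k : Type u} [Field k] [CharZero k] {U W : Type*} [AddCommGroup U] [Module k U]
  [AddCommGroup W] [Module k W]
variable {𝒰 : ZMod 2 → Submodule k U} [DirectSum.Decomposition 𝒰] {A : NilpotentCdga.{u, v} k}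
variable {𝒲 : ZMod 2 → Submodule k W} [DirectSum.Decomposition 𝒲]

theorem parityInv_of_mem {p : ZMod 2} {x : W} (hx : x ∈ 𝒲 p) :
    parityInv 𝒲 x = psign p • x := by
  have h : parityInv 𝒲 = signTwist 𝒲 1 := (if_neg one_ne_zero).symm
  rw [h, signTwist_of_mem 𝒲 hx, one_mul]

/-- `u ↦ f(u, l)` as a linear map. -/
def evHead (f : Cochain k U W) (l : List U) : U →ₗ[k] W where
  toFun u := ev f (u :: l)
  map_add' x y := multiAdd_ev f [] x y l
  map_smul' c x := by
    have h : headCochain f (c • x) = c • headCochain f x := by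
      funext n
      exact map_smul (f (n + 1)).curryLeft c x
    rw [← ev_headCochain, h, ev_smul, ev_headCochain, RingHom.id_apply]

variable (A) in
/-- The insertion of an element of `U ⊗ A` as the first argument of `f`, the other arguments being
given by a word. -/
def insertHead (f : Cochain k U W) (T : List (Letter U A.carrier)) :
    U ⊗[k] A.carrier →ₗ[k] W ⊗[k] A.carrier :=
  coeffSign T • TensorProduct.map (evHead f (wordVec T))
    (LinearMap.mulRight k (wordCoeff T) ∘ₗ signTwist A.gr (par T))

theorem insertHead_tmul (f : Cochain k U W) (T : List (Letter U A.carrier)) (x : U)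
    {q : ZMod 2} {b : A.carrier} (hb : b ∈ A.gr q) :
    insertHead A f T (x ⊗ₜ b) = (coeffSign T * psign (par T * q)) •
      (ev f (x :: wordVec T) ⊗ₜ[k] (b * wordCoeff T)) := by
  rw [insertHead, LinearMap.smul_apply, TensorProduct.map_tmul, LinearMap.comp_apply,
    signTwist_of_mem _ hb, map_zsmul, TensorProduct.tmul_smul, smul_smul]
  rfl

theorem extWord_eq_zero (f : Cochain k U W) {l : List (Letter U A.carrier)}
    (hl : wordCoeff l = 0) : extWord f l = 0 := by
  rw [extWord, hl, TensorProduct.tmul_zero, smul_zero]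

variable {ι : Type*} [Fintype ι] {L : ι → Letter U A.carrier} (hL : ∀ i, Letter.Even 𝒰 (L i))

theorem even_of_word (hL : ∀ i, Letter.Even 𝒰 (L i)) {l : List (Letter U A.carrier)}
    (hl : ∀ x ∈ l, ∃ i, x = L i) : ∀ h ∈ l, Letter.Even 𝒰 h := by
  intro h hh
  obtain ⟨i, rfl⟩ := hl h hh
  exact hL i

theorem ev_symComp_word (f : Cochain k U W) (m : Cochain k U U) {l : List (Letter U A.carrier)}
    (hl : ∀ h ∈ l, Letter.Even 𝒰 h) : ev (symComp 𝒰 f m) (wordVec l) =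
      usum (fun S T => ev f (ev m (wordVec S) :: wordVec T)) l := by
  have h := ev_symComp f m (homog_vec (𝒰 := 𝒰) fun h hh => (hl h hh).1)
  rw [map_snd_vec, usum_map (fun h : Letter U A.carrier => (h.1, h.2.2.1)) (fun _ => rfl)] at h
  simpa only [map_snd_vec] using h

/-- By the exponential formula, the composite evaluated on ξ, …, ξ is `f(m(e^ξ), e^ξ)`. Here `T` is
the word filling the remaining slots. -/
theorem esum_symComp (f : Cochain k U W) (m : Cochain k U U) (hL : ∀ i, Letter.Even 𝒰 (L i))
    {N : ℕ} (hN : ∀ l, (∀ x ∈ l, ∃ i, x = L i) → N ≤ l.length → wordCoeff l = 0) :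
    esum L k (2 * N) (extWord (symComp 𝒰 f m)) =
      esum L k N fun T => insertHead A f T (esum L k N (extWord m)) := by
  have h1 : esum L k (2 * N) (extWord (symComp 𝒰 f m)) = esum L k (2 * N)
      (psum fun S T => (coeffSign S * coeffSign T * psign (par S * par T)) •
        (ev f (ev m (wordVec S) :: wordVec T) ⊗ₜ[k] (wordCoeff S * wordCoeff T))) := by
    refine esum_congr L fun l hl => ?_
    have hl' := even_of_word hL hl
    rw [extWord, ev_symComp_word f m hl', usum_eq_psum _ hl']
  rw [h1, esum_psum L N _ (fun S T hS hS' => by simp [hN S hS hS'])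
    (fun S T hT hT' => by simp [hN T hT hT'])]
  simp only [map_esum]
  rw [esum_comm]
  refine esum_congr L fun T hT => esum_congr L fun S hS => ?_
  rw [extWord, map_zsmul, insertHead_tmul f T _ (wordCoeff_mem (even_of_word hL hS)), smul_smul]
  congr 1
  rw [mul_comm (par S)]
  ring

/-- The chain rule `d f(e^ξ) = f(dξ, e^ξ)`. Differentiating a word differentiates one of its
letters, and graded symmetry puts this letter first; the removed letter is a subword of length one,
to which the exponential formula applies. -/
theorem coeffDiff_esum {f : Cochain k U W} (hf : GradedSymmetric 𝒰 f) (hf' : HasParity 𝒰 𝒲 0 f)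
    (hL : ∀ i, Letter.Even 𝒰 (L i))
    {N : ℕ} (hN : ∀ l, (∀ x ∈ l, ∃ i, x = L i) → N ≤ l.length → wordCoeff l = 0) (hN2 : 2 ≤ N) :
    coeffDiff 𝒲 A (esum L k N (extWord f)) =
      esum L k N fun T => insertHead A f T (coeffDiff 𝒰 A (∑ i, (L i).tensor)) := by
  have h1 : coeffDiff 𝒲 A (esum L k N (extWord f)) = esum L k (2 * N)
      (psum (onSingleton fun h T => (psign h.1 * psign ((h.1 + 1) * par T) * coeffSign T) •
        (ev f (h.2.2.1 :: wordVec T) ⊗ₜ[k] (A.d h.2.2.2 * wordCoeff T)))) := by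
    rw [← esum_of_le L (by omega : N ≤ 2 * N) fun l hl hl' => extWord_eq_zero f (hN l hl hl'),
      map_esum]
    refine esum_congr L fun l hl => ?_
    have hl' := even_of_word hL hl
    rw [psum_single, ← differential_wordCoeff (ev f) (fun p q x y hx hy a b => hf.swap hx hy a b)
      hl', extWord, map_zsmul, coeffDiff, TensorProduct.map_tmul, mul_smul]
    have h2 := (hasParity_iff 𝒰).1 hf' _ (homog_vec (𝒰 := 𝒰) fun h hh => (hl' h hh).1)
    rw [map_snd_vec, par_vec, add_zero] at h2
    rw [parityInv_of_mem h2, ← TensorProduct.smul_tmul']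
  rw [h1, esum_psum L N]
  · have h2 : ∀ F : Letter U A.carrier → List (Letter U A.carrier) → W ⊗[k] A.carrier,
        (esum L k N fun S => esum L k N fun T => onSingleton F S T) =
          ∑ i, esum L k N (F (L i)) := by
      intro F
      -- Only subwords of length one count, and `2 ≤ N` guarantees that this length lies in the
      -- range of summation.
      rw [esum, Finset.sum_eq_single 1]
      · rw [wsum_succ]
        simp [wsum_zero, onSingleton]
      · intro n _ hn
        rw [wsum_eq_zero L fun S hS _ => ?_, smul_zero]
        match S with
        | [] => simp [onSingleton, esum, wsum]
        | [h] => simp at hS; omega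
        | _ :: _ :: _ => simp [onSingleton, esum, wsum]
      · simp; omega
    rw [h2]
    simp only [map_sum]
    simp only [esum]
    rw [Finset.sum_comm]
    refine Finset.sum_congr rfl fun n _ => ?_
    rw [wsum_sum, Finset.smul_sum]
    refine Finset.sum_congr rfl fun i _ => ?_
    congr 1
    refine wsum_congr L fun T _ hT => ?_
    have hb := A.d_odd _ _ (hL i).1.2
    rw [Letter.tensor, coeffDiff, TensorProduct.map_tmul, parityInv_of_mem (hL i).1.1,
      ← TensorProduct.smul_tmul', map_zsmul, insertHead_tmul f T _ hb, smul_smul, (hL i).2,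
      mul_comm (par T)]
    congr 1
    ring
  · intro S T hS hS'
    match S with
    | [] => rfl
    | [h] => simp at hS'; omega
    | _ :: _ :: _ => rfl
  · intro S T hT hT'
    match S with
    | [] => rfl
    | [h] =>
      change _ • (_ ⊗ₜ[k] (_ * wordCoeff T)) = 0
      rw [hN T hT hT', mul_zero, TensorProduct.tmul_zero, smul_zero]
    | _ :: _ :: _ => rfl

/-- The extension of scalars of the unary component. -/
def extUnary (l : Cochain k W W) (A : NilpotentCdga.{u, v} k) :
    W ⊗[k] A.carrier →ₗ[k] W ⊗[k] A.carrier :=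
  LinearMap.rTensor A.carrier (evHead l [])

variable (𝒲) in
/-- The extension of scalars of the binary component. -/
def extBinary (l : Cochain k W W) (A : NilpotentCdga.{u, v} k) :
    W ⊗[k] A.carrier →ₗ[k] W ⊗[k] A.carrier →ₗ[k] W ⊗[k] A.carrier :=
  LinearMap.mk₂ k (fun x y => (((extendScalarsMulti 𝒲 A 2 (l 2)).curryLeft x).curryLeft y) Fin.elim0)
    (fun x x' y => by simp) (fun c x y => by simp) (fun x y y' => by simp) (fun c x y => by simp)

theorem extBinary_apply (l : Cochain k W W) (z : W ⊗[k] A.carrier) :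
    extBinary 𝒲 l A z z = extendScalars 𝒲 A 2 (fun _ => z) (l 2) := by
  change extendScalars 𝒲 A 2 (Fin.cons z (Fin.cons z Fin.elim0)) (l 2) = _
  congr 2
  funext i
  refine Fin.cases rfl (fun i => ?_) i
  refine Fin.cases rfl (fun i => i.elim0) i

theorem extUnary_apply (l : Cochain k W W) (z : W ⊗[k] A.carrier) :
    extUnary l A z = extendScalars 𝒲 A 1 (fun _ => z) (l 1) := by
  change extUnary l A z = ∑ q : ZMod 2, insertCoeff W A (TensorProduct.map
    (extendScalars 𝒲 A 0 Fin.elim0 ∘ₗ (l 1).curryLeft) (parityProj A.gr q) z)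
  induction z using TensorProduct.induction_on with
  | zero => simp
  | add x y hx hy => simp only [map_add, Finset.sum_add_distrib, hx, hy]
  | tmul x a =>
    have h1 : ∀ q : ZMod 2, insertCoeff W A (TensorProduct.map
        (extendScalars 𝒲 A 0 Fin.elim0 ∘ₗ (l 1).curryLeft) (parityProj A.gr q) (x ⊗ₜ[k] a)) =
        ev l [x] ⊗ₜ[k] parityProj A.gr q a := by
      intro q
      change (l 1).curryLeft x Fin.elim0 ⊗ₜ[k] (parityProj A.gr q a * 1) = _
      rw [mul_one]
      congr 1
      rw [MultilinearMap.curryLeft_apply]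
      exact (ev_ofFn l (Fin.cons x Fin.elim0 : Fin 1 → W)).symm.trans (by simp)
    rw [Finset.sum_congr rfl fun q _ => h1 q, ← TensorProduct.tmul_sum, sum_parityProj]
    rfl

variable (𝒲) in
/-- The value of `f` on an even word, as a letter. -/
def wordLetter (f : Cochain k U W) (l : List (Letter U A.carrier)) : Letter W A.carrier :=
  (par l, (par l, ev f (wordVec l), wordCoeff l))

theorem wordLetter_even {f : Cochain k U W} (hf : HasParity 𝒰 𝒲 0 f)
    {l : List (Letter U A.carrier)} (hl : ∀ h ∈ l, Letter.Even 𝒰 h) :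
    Letter.Even 𝒲 (wordLetter f l) := by
  have h2 := (hasParity_iff 𝒰).1 hf _ (homog_vec (𝒰 := 𝒰) fun h hh => (hl h hh).1)
  rw [map_snd_vec, par_vec, add_zero] at h2
  exact ⟨⟨h2, wordCoeff_mem hl⟩, rfl⟩

theorem extWord_eq_wordLetter (f : Cochain k U W) (l : List (Letter U A.carrier)) :
    extWord f l = coeffSign l • (wordLetter f l).tensor := rfl

theorem extBinary_tensor (l : Cochain k W W) {g h : Letter W A.carrier} (hg : Letter.Even 𝒲 g)
    (hh : Letter.Even 𝒲 h) : extBinary 𝒲 l A g.tensor h.tensor =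
      psign (g.1 * h.1) • (ev l [g.2.2.1, h.2.2.1] ⊗ₜ[k] (g.2.2.2 * h.2.2.2)) := by
  have h1 : extBinary 𝒲 l A g.tensor h.tensor =
      extendScalars 𝒲 A 2 (fun i => (Fin.cons g (Fin.cons h Fin.elim0) :
        Fin 2 → Letter W A.carrier) i |>.tensor) (l 2) := by
    change extendScalars 𝒲 A 2 (Fin.cons g.tensor (Fin.cons h.tensor Fin.elim0)) (l 2) = _
    congr 2
    funext i
    refine Fin.cases rfl (fun i => ?_) i
    refine Fin.cases rfl (fun i => i.elim0) i
  rw [h1, extendScalars_tensor]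
  · simp [extWord, coeffSign, wordVec, wordCoeff, hg.2, List.ofFn_succ, psign_zero]
  · intro i
    refine Fin.cases hg.1 (fun i => ?_) i
    refine Fin.cases hh.1 (fun i => i.elim0) i

theorem IsLInftyMap.map_word {m : Cochain k U U} {l : Cochain k W W} {f : Cochain k U W}
    (hf : IsLInftyMap 𝒰 𝒲 m l f) (hl : ∀ j, j ≠ 1 → j ≠ 2 → l j = 0)
    {ws : List (Letter U A.carrier)} (hws : ∀ h ∈ ws, Letter.Even 𝒰 h) :
    ev (symComp 𝒰 f m) (wordVec ws) = ev l [ev f (wordVec ws)] + (2 : k)⁻¹ •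
      usum (fun S T => ev l [ev f (wordVec S), ev f (wordVec T)]) ws := by
  obtain ⟨n, p, x, hx, hpx⟩ := exists_ofFn_homog 𝒰
    (homog_vec (𝒰 := 𝒰) fun h hh => (hws h hh).1)
  have h1 := hf.map n p x hx
  have h2 : wordVec ws = List.ofFn x := by
    rw [← map_snd_vec, hpx, map_snd_ofFn]
  rw [sum_blocks p x hl hf.zero, ← ev_ofFn, ← h2, ← hpx,
    usum_map (fun h : Letter U A.carrier => (h.1, h.2.2.1)) (fun _ => rfl)] at h1
  simpa only [map_snd_vec] using h1

/-- The image of a Maurer-Cartan element under an `L_∞`-map, for one finite-dimensional cdga. -/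
theorem IsLInftyMap.mc_esum {m : Cochain k U U} {l : Cochain k W W} {f : Cochain k U W}
    (hf : IsLInftyMap 𝒰 𝒲 m l f) (hl : ∀ j, j ≠ 1 → j ≠ 2 → l j = 0)
    (hL : ∀ i, Letter.Even 𝒰 (L i))
    {N : ℕ} (hN : ∀ l, (∀ x ∈ l, ∃ i, x = L i) → N ≤ l.length → wordCoeff l = 0) (hN2 : 2 ≤ N)
    (hξ : coeffDiff 𝒰 A (∑ i, (L i).tensor) + esum L k N (extWord m) = 0) :
    coeffDiff 𝒲 A (esum L k N (extWord f)) + (extUnary l A (esum L k N (extWord f)) +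
      (2 : k)⁻¹ • extBinary 𝒲 l A (esum L k N (extWord f)) (esum L k N (extWord f))) = 0 := by
  -- The equation for `f`, summed over all words: its quadratic part is a sum over splittings, which
  -- factors as `l_2` of two copies of the pushed forward element.
  have h1 : esum L k (2 * N) (extWord (symComp 𝒰 f m)) =
      extUnary l A (esum L k N (extWord f)) +
      (2 : k)⁻¹ • extBinary 𝒲 l A (esum L k N (extWord f)) (esum L k N (extWord f)) := by
    have h2 : esum L k (2 * N) (extWord (symComp 𝒰 f m)) = esum L k (2 * N) (fun ws =>
        extUnary l A (extWord f ws) + LinearMap.lsmul k (W ⊗[k] A.carrier) (2 : k)⁻¹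
          (psum (fun S T => extBinary 𝒲 l A (extWord f S) (extWord f T)) ws)) := by
      refine esum_congr L fun ws hws => ?_
      have hws' := even_of_word hL hws
      rw [extWord, hf.map_word hl hws', TensorProduct.add_tmul, smul_add]
      congr 1
      · rw [extWord, map_zsmul]
        rfl
      · rw [← TensorProduct.smul_tmul', smul_comm, usum_eq_psum _ hws', LinearMap.lsmul_apply]
        congr 1
        refine psum_congr fun S T hS hT _ => ?_
        rw [extWord_eq_wordLetter, extWord_eq_wordLetter, map_zsmul, map_zsmul,
          LinearMap.smul_apply, extBinary_tensor l
            (wordLetter_even hf.even fun h hh => hws' h (hS.subset hh))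
            (wordLetter_even hf.even fun h hh => hws' h (hT.subset hh)), smul_smul, smul_smul,
          mul_comm (coeffSign S)]
        rfl
    rw [h2, esum_add, ← map_esum, ← map_esum, LinearMap.lsmul_apply, esum_psum L N]
    · rw [esum_of_le L (by omega : N ≤ 2 * N) fun l hl hl' => extWord_eq_zero f (hN l hl hl')]
      congr 2
      rw [← LinearMap.flip_apply (extBinary 𝒲 l A), map_esum]
      exact esum_congr L fun S _ => by rw [LinearMap.flip_apply, map_esum]
    · intro S T hS hS'
      rw [extWord_eq_zero f (hN S hS hS'), map_zero, LinearMap.zero_apply]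
    · intro S T hT hT'
      rw [extWord_eq_zero f (hN T hT hT'), map_zero]
  -- Both contributions now have the form `f(-, e^ξ)`, and together they insert the left-hand side
  -- of the Maurer-Cartan equation for ξ.
  rw [← h1, esum_symComp f m hL hN, coeffDiff_esum hf.symm hf.even hL hN hN2, ← esum_add]
  simp only [← map_add, hξ, map_zero]
  simp [esum, wsum]

end Push

/-! ## Maurer-Cartan elements in terms of words -/

section MCWords

theorem finsum_eq_sum_range {M : Type*} [AddCommMonoid M] {F : ℕ → M} {N : ℕ}
    (h : ∀ n, N ≤ n → F n = 0) : ∑ᶠ n, F n = ∑ n ∈ Finset.range N, F n := by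
  refine finsum_eq_sum_of_support_subset F fun n hn => ?_
  rw [Finset.coe_range, Set.mem_Iio]
  by_contra hc
  exact hn (h n (not_lt.1 hc))

variable {k : Type u} [Field k] [CharZero k] {U W : Type*} [AddCommGroup U] [Module k U]
  [AddCommGroup W] [Module k W]
variable {𝒰 : ZMod 2 → Submodule k U} [DirectSum.Decomposition 𝒰] {A : NilpotentCdga.{u, v} k}
variable {𝒲 : ZMod 2 → Submodule k W} [DirectSum.Decomposition 𝒲]

theorem NilpotentCdga.mem_plus_iff {a : A.carrier} : a ∈ A.plus ↔ A.aug a = 0 := Iff.rfl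

theorem NilpotentCdga.exists_wordCoeff_eq_zero (A : NilpotentCdga.{u, v} k) :
    ∃ N, 2 ≤ N ∧ ∀ (U : Type*) (l : List (Letter U A.carrier)), (∀ h ∈ l, h.2.2.2 ∈ A.plus) →
      N ≤ l.length → wordCoeff l = 0 := by
  obtain ⟨N, hN⟩ := A.nilpotent
  -- A product of at least `N` elements of the augmentation ideal vanishes; the extra 2 only ensures
  -- the lower bound on the length.
  refine ⟨N + 2, by omega, fun U l hl hlen => ?_⟩
  have h1 : wordCoeff l ∈ A.plus ^ l.length := by
    clear hlen
    induction l with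
    | nil =>
      rw [List.length_nil, pow_zero]
      exact Submodule.mem_one.2 ⟨1, by simp [wordCoeff]⟩
    | cons h l ih =>
      rw [List.forall_mem_cons] at hl
      rw [List.length_cons, pow_succ']
      exact Submodule.mul_mem_mul hl.1 (ih hl.2)
  obtain ⟨j, hj⟩ := Nat.exists_eq_add_of_le (by omega : N ≤ l.length)
  rw [hj, pow_add] at h1
  have h2 : A.plus ^ N = ⊥ := hN
  rw [h2, Submodule.bot_mul] at h1
  simpa using h1

/-- That the augmentation ideal is graded is not an axiom. It holds because an odd element squares
to zero by graded commutativity, so its image in the field is zero. -/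
theorem NilpotentCdga.parityProj_mem_plus {a : A.carrier} (ha : a ∈ A.plus) (q : ZMod 2) :
    parityProj A.gr q a ∈ A.plus := by
  have h1 : parityProj A.gr 1 a ∈ A.plus := by
    set b := parityProj A.gr 1 a
    have hb : b ∈ A.gr 1 := parityProj_mem _ _ _
    have h2 := A.graded_comm 1 1 b hb b hb
    have h3 : psign (1 * 1) = -1 := by decide
    rw [h3, neg_one_smul, eq_neg_iff_add_eq_zero, ← two_smul k, smul_eq_zero] at h2
    have h4 : A.aug b * A.aug b = 0 := by
      rw [← map_mul, h2.resolve_left two_ne_zero, map_zero]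
    exact mul_self_eq_zero.1 h4
  have h0 : parityProj A.gr 0 a = a - parityProj A.gr 1 a := by
    rw [eq_sub_iff_add_eq]
    exact (Fin.sum_univ_two fun i : Fin 2 => parityProj A.gr i a).symm.trans
      (sum_parityProj A.gr a)
  by_cases hq : q = 0
  · rw [hq, h0]
    exact A.plus.sub_mem ha h1
  · have : q = 1 := by
      clear * - hq
      revert q; decide
    rw [this]
    exact h1

variable (𝒰 A) in
/-- The tensors of even letters with coefficients in the augmentation ideal. -/
def evenTensors : Set (U ⊗[k] A.carrier) :=
  {z | ∃ h : Letter U A.carrier, Letter.Even 𝒰 h ∧ h.2.2.2 ∈ A.plus ∧ h.tensor = z}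

theorem mem_span_evenTensors {ξ : U ⊗[k] A.carrier}
    (hplus : ξ ∈ LinearMap.range (LinearMap.lTensor U A.plus.subtype))
    (heven : ξ ∈ ⨆ q : ZMod 2,
      LinearMap.range (TensorProduct.map (𝒰 q).subtype (A.gr q).subtype)) :
    ξ ∈ Submodule.span k (evenTensors 𝒰 A) := by
  -- The projector onto the even part fixes ξ, and it maps tensors with coefficients in the
  -- augmentation ideal to sums of even letters; this uses both hypotheses simultaneously.
  set P : U ⊗[k] A.carrier →ₗ[k] U ⊗[k] A.carrier :=
    ∑ q : ZMod 2, TensorProduct.map (parityProj 𝒰 q) (parityProj A.gr q) with hP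
  have h1 : P ξ = ξ := by
    have : (⨆ q : ZMod 2, LinearMap.range (TensorProduct.map (𝒰 q).subtype (A.gr q).subtype)) ≤
        LinearMap.eqLocus P LinearMap.id := by
      refine iSup_le fun q => ?_
      rintro _ ⟨z, rfl⟩
      induction z using TensorProduct.induction_on with
      | zero => simp
      | add x y hx hy => rw [map_add]; exact Submodule.add_mem _ hx hy
      | tmul x a =>
        change P (x.1 ⊗ₜ a.1) = x.1 ⊗ₜ a.1
        rw [hP, LinearMap.sum_apply, Finset.sum_eq_single q]
        · rw [TensorProduct.map_tmul, parityProj_of_mem 𝒰 x.2, parityProj_of_mem A.gr a.2,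
            if_pos rfl, if_pos rfl]
        · intro q' _ hq'
          rw [TensorProduct.map_tmul, parityProj_of_mem 𝒰 x.2, if_neg hq', TensorProduct.zero_tmul]
        · simp
    exact this heven
  rw [← h1]
  obtain ⟨z, rfl⟩ := hplus
  clear h1 heven
  induction z using TensorProduct.induction_on with
  | zero => simp
  | add x y hx hy => rw [map_add, map_add]; exact Submodule.add_mem _ hx hy
  | tmul x a =>
    rw [LinearMap.lTensor_tmul, hP, LinearMap.sum_apply]
    refine Submodule.sum_mem _ fun q _ => Submodule.subset_span ?_
    exact ⟨(q, (q, parityProj 𝒰 q x, parityProj A.gr q a)),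
      ⟨⟨parityProj_mem _ _ _, parityProj_mem _ _ _⟩, rfl⟩,
      NilpotentCdga.parityProj_mem_plus a.2 q, rfl⟩

theorem span_evenTensors_le_plus : Submodule.span k (evenTensors 𝒰 A) ≤
    LinearMap.range (LinearMap.lTensor U A.plus.subtype) := by
  refine Submodule.span_le.2 ?_
  rintro _ ⟨h, h1, h2, rfl⟩
  exact ⟨h.2.2.1 ⊗ₜ ⟨h.2.2.2, h2⟩, rfl⟩

theorem span_evenTensors_le_even : Submodule.span k (evenTensors 𝒰 A) ≤ ⨆ q : ZMod 2,
    LinearMap.range (TensorProduct.map (𝒰 q).subtype (A.gr q).subtype) := by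
  refine Submodule.span_le.2 ?_
  rintro _ ⟨h, h1, h2, rfl⟩
  have ha := h1.1.2
  rw [h1.2] at ha
  exact Submodule.mem_iSup_of_mem h.1 ⟨⟨h.2.2.1, h1.1.1⟩ ⊗ₜ ⟨h.2.2.2, ha⟩, rfl⟩

theorem exists_letters {ξ : U ⊗[k] A.carrier} (hξ : ξ ∈ Submodule.span k (evenTensors 𝒰 A)) :
    ∃ (n : ℕ) (L : Fin n → Letter U A.carrier), (∀ i, Letter.Even 𝒰 (L i)) ∧
      (∀ i, (L i).2.2.2 ∈ A.plus) ∧ ξ = ∑ i, (L i).tensor := by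
  obtain ⟨n, c, g, hg⟩ := Submodule.mem_span_set'.1 hξ
  choose h h1 h2 h3 using fun i => (g i).2
  refine ⟨n, fun i => ((h i).1, ((h i).2.1, c i • (h i).2.2.1, (h i).2.2.2)),
    fun i => ⟨⟨Submodule.smul_mem _ _ (h1 i).1.1, (h1 i).1.2⟩, (h1 i).2⟩, h2, ?_⟩
  rw [← hg]
  refine Finset.sum_congr rfl fun i _ => ?_
  rw [← h3 i, Letter.tensor, Letter.tensor, TensorProduct.smul_tmul']

theorem extendScalars_sum {ι : Type*} [Fintype ι] (L : ι → Letter U A.carrier)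
    (hL : ∀ i, Letter.Good 𝒰 (L i)) (φ : Cochain k U W) (n : ℕ) :
    extendScalars 𝒰 A n (fun _ => ∑ i, (L i).tensor) (φ n) = wsum L n (extWord φ) := by
  classical
  rw [← extendScalarsMulti_apply, MultilinearMap.map_sum]
  refine Finset.sum_congr rfl fun r _ => ?_
  rw [extendScalarsMulti_apply, extendScalars_tensor φ _ fun i => hL (r i)]

theorem finsum_extendScalars {ι : Type*} [Fintype ι] {L : ι → Letter U A.carrier}
    (hL : ∀ i, Letter.Good 𝒰 (L i)) {φ : Cochain k U W} (hφ : φ 0 = 0) {N : ℕ}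
    (hN : ∀ l, (∀ x ∈ l, ∃ i, x = L i) → N ≤ l.length → wordCoeff l = 0) :
    ∑ᶠ r : ℕ, ((Nat.factorial (r + 1) : k))⁻¹ •
      extendScalars 𝒰 A (r + 1) (fun _ => ∑ i, (L i).tensor) (φ (r + 1)) =
    esum L k N (extWord φ) := by
  have h0 : wsum L 0 (extWord φ) = 0 := by
    rw [wsum_zero, extWord, wordVec, List.map_nil, ev_nil_eq_zero_iff.2 hφ,
      TensorProduct.zero_tmul, smul_zero]
  -- The infinite sum starts at arity one; the missing word of length zero contributes nothing
  -- because `φ 0 = 0`, so the shift of index is harmless.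
  rw [← esum_of_le L (Nat.le_succ N) fun l hl hl' => extWord_eq_zero φ (hN l hl hl'), esum,
    Finset.sum_range_succ', h0, smul_zero, add_zero, finsum_eq_sum_range (N := N)]
  · exact Finset.sum_congr rfl fun r _ => by rw [extendScalars_sum L hL]
  · intro r hr
    rw [extendScalars_sum L hL, wsum_eq_zero L fun l hl hl' => ?_, smul_zero]
    exact extWord_eq_zero φ (hN l hl' (by omega))

theorem lTensor_extWord {A' : NilpotentCdga.{u, v} k} (g : A.carrier →ₐ[k] A'.carrier)
    (f : Cochain k U W) (l : List (Letter U A.carrier)) :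
    LinearMap.lTensor W g.toLinearMap (extWord f l) =
      extWord f (l.map fun h => (h.1, (h.2.1, h.2.2.1, g h.2.2.2))) := by
  have h1 : coeffSign (l.map fun h => ((h.1, (h.2.1, h.2.2.1, g h.2.2.2)) : Letter U A'.carrier)) =
      coeffSign l := by
    induction l with
    | nil => rfl
    | cons h l ih => simp [coeffSign, ih, par, Function.comp_def]
  rw [extWord, extWord, h1, map_zsmul, LinearMap.lTensor_tmul]
  simp [wordVec, wordCoeff, Function.comp_def, map_list_prod]

theorem lTensor_esum {A' : NilpotentCdga.{u, v} k} (g : A.carrier →ₐ[k] A'.carrier)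
    (f : Cochain k U W) {ι : Type*} [Fintype ι] (L : ι → Letter U A.carrier) (N : ℕ) :
    LinearMap.lTensor W g.toLinearMap (esum L k N (extWord f)) =
      esum (fun i => (((L i).1, ((L i).2.1, (L i).2.2.1, g (L i).2.2.2)) : Letter U A'.carrier))
        k N (extWord f) := by
  rw [map_esum]
  simp only [lTensor_extWord, esum, wsum, List.map_ofFn]
  rfl

end MCWords

/-! ### Maurer-Cartan elements over formal cdgas -/

section Formal

variable {k : Type u} [Field k] [CharZero k] {U W : Type*} [AddCommGroup U] [Module k U]
  [AddCommGroup W] [Module k W]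
variable {𝒰 : ZMod 2 → Submodule k U} [DirectSum.Decomposition 𝒰] {A : FormalCdga.{u, v, w} k}
variable {𝒲 : ZMod 2 → Submodule k W} [DirectSum.Decomposition 𝒲]
variable {ξ : ∀ j, U ⊗[k] (A.level j).carrier}

/-- An even element as a sum of letters, at each level. -/
theorem IsEvenElement.exists_letters (hξ : IsEvenElement 𝒰 A ξ) (j : A.index) :
    ∃ (n : ℕ) (L : Fin n → Letter U (A.level j).carrier) (N : ℕ), (∀ i, Letter.Even 𝒰 (L i)) ∧
      (∀ i, (L i).2.2.2 ∈ (A.level j).plus) ∧ ξ j = ∑ i, (L i).tensor ∧ 2 ≤ N ∧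
      ∀ N', N ≤ N' → ∀ l, (∀ x ∈ l, ∃ i, x = L i) → N' ≤ l.length → wordCoeff l = 0 := by
  obtain ⟨n, L, h1, h2, h3⟩ :=
    _root_.exists_letters (mem_span_evenTensors (hξ.mem_plus j) (hξ.even j))
  obtain ⟨N, hN2, hN⟩ := (A.level j).exists_wordCoeff_eq_zero
  refine ⟨n, L, N, h1, h2, h3, hN2, fun N' hN' l hl hlen => hN U l ?_ (hN'.trans hlen)⟩
  intro h hh
  obtain ⟨i, rfl⟩ := hl h hh
  exact h2 i

theorem pushforward_isEvenElement (hξ : IsEvenElement 𝒰 A ξ) {f : Cochain k U W} (hf0 : f 0 = 0)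
    (hf : HasParity 𝒰 𝒲 0 f) : IsEvenElement 𝒲 A (pushforward 𝒰 f A ξ) := by
  have hspan : ∀ j, pushforward 𝒰 f A ξ j ∈ Submodule.span k (evenTensors 𝒲 (A.level j)) := by
    intro j
    obtain ⟨n, L, N, h1, h2, h3, hN2, hN⟩ := hξ.exists_letters j
    rw [pushforward, h3, finsum_extendScalars (fun i => (h1 i).1) hf0 (hN N le_rfl), esum]
    refine Submodule.sum_mem _ fun n _ => Submodule.smul_mem _ _ (Submodule.sum_mem _ fun r _ => ?_)
    set l := List.ofFn fun i => L (r i) with hl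
    have hl' : ∀ x ∈ l, ∃ i, x = L i := by
      intro x hx
      obtain ⟨i, rfl⟩ := List.mem_ofFn.1 hx
      exact ⟨r i, rfl⟩
    cases hlc : l with
    | nil =>
      have : extWord f ([] : List (Letter U (A.level j).carrier)) = 0 := by
        rw [extWord, wordVec, List.map_nil, ev_nil_eq_zero_iff.2 hf0, TensorProduct.zero_tmul,
          smul_zero]
      rw [this]
      exact Submodule.zero_mem _
    | cons h t =>
      rw [← hlc, extWord_eq_wordLetter]
      have hmem : wordCoeff l ∈ (A.level j).plus → (wordLetter f l).tensor ∈
          Submodule.span k (evenTensors 𝒲 (A.level j)) := fun hw =>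
        Submodule.subset_span ⟨wordLetter f l, wordLetter_even hf (even_of_word h1 hl'), hw, rfl⟩
      refine Submodule.smul_of_tower_mem _ (coeffSign l) (hmem ?_)
      rw [hlc] at hl' ⊢
      obtain ⟨i, hi⟩ := hl' h (by simp)
      rw [NilpotentCdga.mem_plus_iff, wordCoeff, List.map_cons, List.prod_cons, map_mul, hi,
        NilpotentCdga.mem_plus_iff.1 (h2 i), zero_mul]
  refine ⟨fun {i j} h => ?_, fun j => ?_, fun j => ?_⟩
  · obtain ⟨n, L, N, h1, h2, h3, hN2, hN⟩ := hξ.exists_letters j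
    obtain ⟨n', L', N', h1', h2', h3', hN2', hN'⟩ := hξ.exists_letters i
    have h4 : ξ i = ∑ a, Letter.tensor (A := A.level i)
        ((L a).1, ((L a).2.1, (L a).2.2.1, A.map h (L a).2.2.2)) := by
      rw [← hξ.compatible h, h3, map_sum]
      rfl
    have h5 : ∀ a, Letter.Good 𝒰 (A := A.level i)
        ((L a).1, ((L a).2.1, (L a).2.2.1, A.map h (L a).2.2.2)) :=
      fun a => ⟨(h1 a).1.1, A.map_gr h _ _ (h1 a).1.2⟩
    rw [pushforward, h3, finsum_extendScalars (fun i => (h1 i).1) hf0 (hN N le_rfl),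
      lTensor_esum, pushforward, h4, finsum_extendScalars h5 hf0]
    intro l hl hlen
    -- The element at level `i` is expressed by the images of the letters at level `j`. Long words
    -- in these images vanish since they are images of vanishing words, so the same bound `N` serves
    -- on both levels.
    have h6 : ∀ l : List (Letter U (A.level i).carrier), (∀ x ∈ l, ∃ a, x = ((L a).1, ((L a).2.1, (L a).2.2.1,
        A.map h (L a).2.2.2))) → ∃ l₀ : List (Letter U (A.level j).carrier),
          (∀ x ∈ l₀, ∃ a, x = L a) ∧ l₀.length = l.length ∧ wordCoeff l = A.map h (wordCoeff l₀) := by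
      intro l hl
      induction l with
      | nil => exact ⟨[], by simp, rfl, by simp [wordCoeff]⟩
      | cons x l ih =>
        rw [List.forall_mem_cons] at hl
        obtain ⟨l₀, e1, e2, e3⟩ := ih hl.2
        obtain ⟨a, ha⟩ := hl.1
        refine ⟨L a :: l₀, ?_, by simp [e2], ?_⟩
        · rw [List.forall_mem_cons]
          exact ⟨⟨a, rfl⟩, e1⟩
        · simp only [wordCoeff, List.map_cons, List.prod_cons, map_mul] at e3 ⊢
          rw [e3, ha]
    obtain ⟨l₀, e1, e2, e3⟩ := h6 l hl
    rw [e3, hN N le_rfl l₀ e1 (by omega), map_zero]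
  · exact span_evenTensors_le_plus (hspan j)
  · exact span_evenTensors_le_even (hspan j)

/-- An `L_∞`-map to an algebra with only unary and binary operations preserves Maurer-Cartan
elements. -/
theorem IsLInftyMap.isLInftyMC_pushforward {m : Cochain k U U} {l : Cochain k W W}
    {f : Cochain k U W} (hf : IsLInftyMap 𝒰 𝒲 m l f) (hm0 : m 0 = 0)
    (hl : ∀ j, j ≠ 1 → j ≠ 2 → l j = 0) (hξ : IsLInftyMC 𝒰 m A ξ) :
    IsLInftyMC 𝒲 l A (pushforward 𝒰 f A ξ) where
  toIsEvenElement := pushforward_isEvenElement hξ.toIsEvenElement hf.zero hf.even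
  eq j := by
    obtain ⟨n, L, N, h1, h2, h3, hN2, hN⟩ := hξ.toIsEvenElement.exists_letters j
    have h4 := hξ.eq j
    rw [h3, finsum_extendScalars (fun i => (h1 i).1) hm0 (hN N le_rfl)] at h4
    have h5 := hf.mc_esum hl h1 (hN N le_rfl) hN2 h4
    have h6 : pushforward 𝒰 f A ξ j = esum L k N (extWord f) := by
      rw [pushforward, h3, finsum_extendScalars (fun i => (h1 i).1) hf.zero (hN N le_rfl)]
    rw [h6, ← h5, finsum_eq_sum_range (N := 2)]
    · rw [Finset.sum_range_succ, Finset.sum_range_one, extUnary_apply (𝒲 := 𝒲), extBinary_apply]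
      simp
    · intro i hi
      rw [hl (i + 1) (by omega) (by omega), map_zero, smul_zero]

theorem pushforward_mem_range (hξ : IsEvenElement 𝒰 A ξ) {f : Cochain k U W} (hf0 : f 0 = 0)
    {S : Submodule k W} (hS : ∀ r x, f r x ∈ S) (j : A.index) :
    pushforward 𝒰 f A ξ j ∈ LinearMap.range (LinearMap.rTensor (A.level j).carrier S.subtype) := by
  obtain ⟨n, L, N, h1, h2, h3, hN2, hN⟩ := hξ.exists_letters j
  rw [pushforward, h3, finsum_extendScalars (fun i => (h1 i).1) hf0 (hN N le_rfl), esum]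
  refine Submodule.sum_mem _ fun n _ => Submodule.smul_mem _ _ (Submodule.sum_mem _ fun r _ => ?_)
  refine zsmul_mem ?_ _
  exact ⟨⟨_, hS _ _⟩ ⊗ₜ _, rfl⟩

end Formal

/-! ## Twisting by Maurer-Cartan elements -/

section TwistFormulas

variable {k : Type u} [Field k] [CharZero k] {U W : Type*} [AddCommGroup U] [Module k U]
  [AddCommGroup W] [Module k W]
variable {𝒰 : ZMod 2 → Submodule k U} [DirectSum.Decomposition 𝒰] {A : NilpotentCdga.{u, v} k}

theorem extendScalars_succ_tmul (φ : Cochain k U W) {n : ℕ} {z : Fin (n + 1) → U ⊗[k] A.carrier}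
    {x : U} {a : A.carrier} {q : ZMod 2} (ha : a ∈ A.gr q) (hz : z 0 = x ⊗ₜ a) :
    extendScalars 𝒰 A (n + 1) z (φ (n + 1)) = insertCoeff W A
      (extendScalars 𝒰 A n (fun i => LinearMap.rTensor A.carrier (signTwist 𝒰 q) (z i.succ))
        (headCochain φ x n) ⊗ₜ a) := by
  rw [extendScalars_succ, Finset.sum_eq_single q]
  · rw [hz, TensorProduct.map_tmul, parityProj_of_mem A.gr ha, if_pos rfl]
    rfl
  · intro q' _ hq
    rw [hz, TensorProduct.map_tmul, parityProj_of_mem A.gr ha, if_neg hq, TensorProduct.tmul_zero,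
      map_zero]
  · simp

theorem extendScalars_tmul_one (φ : Cochain k U W) {n : ℕ} (x : Fin n → U) :
    extendScalars 𝒰 A n (fun i => x i ⊗ₜ (1 : A.carrier)) (φ n) = φ n x ⊗ₜ 1 := by
  induction n generalizing φ with
  | zero =>
    rw [Subsingleton.elim x Fin.elim0]
    rfl
  | succ n ih =>
    rw [extendScalars_succ_tmul φ (q := 0) SetLike.GradedOne.one_mem rfl]
    have h1 : (fun i : Fin n => LinearMap.rTensor A.carrier (signTwist 𝒰 0)
        (x i.succ ⊗ₜ[k] (1 : A.carrier))) = fun i => x i.succ ⊗ₜ 1 := by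
      funext i
      rw [LinearMap.rTensor_tmul, signTwist_zero, LinearMap.id_apply]
    rw [h1, ih (headCochain φ (x 0)) fun i => x i.succ, insertCoeff_tmul, mul_one]
    congr 1
    change φ (n + 1) (Fin.cons (x 0) (fun i => x i.succ)) = φ (n + 1) x
    congr 1
    exact Fin.cons_self_tail x

/-- All coefficients of the word have to pass the vectors `xs`, which are therefore twisted by the
total parity of the word; the coefficients 1 cost nothing. -/
theorem extendScalars_word_append (φ : Cochain k U W) {l : List (Letter U A.carrier)}
    (hl : ∀ h ∈ l, Letter.Even 𝒰 h) (xs : List U) {n : ℕ} {z : Fin n → U ⊗[k] A.carrier}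
    (hz : List.ofFn z = l.map Letter.tensor ++ xs.map fun x => x ⊗ₜ (1 : A.carrier)) :
    extendScalars 𝒰 A n z (φ n) = coeffSign l •
      (ev φ (wordVec l ++ xs.map (signTwist 𝒰 (par l))) ⊗ₜ wordCoeff l) := by
  induction n generalizing φ l xs with
  | zero =>
    rw [List.ofFn_zero, eq_comm, List.append_eq_nil_iff, List.map_eq_nil_iff,
      List.map_eq_nil_iff] at hz
    rw [hz.1, hz.2]
    simp only [coeffSign, wordVec, wordCoeff, List.map_nil, List.prod_nil, one_smul,
      List.append_nil, ev_nil]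
    rfl
  | succ n ih =>
    cases l with
    | nil =>
      obtain ⟨N, x, rfl⟩ := exists_ofFn xs
      rw [List.map_nil, List.nil_append, List.map_ofFn] at hz
      obtain rfl : n + 1 = N := by simpa using congrArg List.length hz
      rw [List.ofFn_injective hz]
      have h0 : (par ([] : List (Letter U A.carrier))) = 0 := rfl
      simp only [coeffSign, wordVec, wordCoeff, List.map_nil, List.prod_nil, one_smul, h0,
        signTwist_zero, List.nil_append]
      refine (extendScalars_tmul_one φ x).trans ?_
      rw [← ev_ofFn, LinearMap.id_coe, List.map_id]
    | cons h l =>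
      rw [List.forall_mem_cons] at hl
      rw [List.ofFn_succ, List.map_cons, List.cons_append, List.cons.injEq] at hz
      rw [extendScalars_succ_tmul φ hl.1.1.2 hz.1, hl.1.2]
      set c := h.1 with hc
      have h1 := ih (headCochain φ h.2.2.1) (l := l.map (Letter.twist 𝒰 c))
        (fun g hg => by
          obtain ⟨g', hg', rfl⟩ := List.mem_map.1 hg
          refine ⟨⟨?_, (hl.2 g' hg').1.2⟩, (hl.2 g' hg').2⟩
          simp only [Letter.twist]
          rw [signTwist_of_mem 𝒰 (hl.2 g' hg').1.1]
          exact (𝒰 _).toAddSubgroup.zsmul_mem (hl.2 g' hg').1.1 _)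
        (xs.map (signTwist 𝒰 c))
        (z := fun i => LinearMap.rTensor A.carrier (signTwist 𝒰 c) (z i.succ)) (by
          have := congrArg (List.map (LinearMap.rTensor A.carrier (signTwist 𝒰 c))) hz.2
          rw [List.map_ofFn] at this
          refine Eq.trans this ?_
          simp [Function.comp_def, Letter.tensor, Letter.twist])
      have h2 : par (l.map (Letter.twist 𝒰 c)) = par l := by
        simp [par, Function.comp_def, Letter.twist]
      rw [h1, coeffSign_map_twist, wordVec_map_twist, wordCoeff_map_twist, h2, ev_headCochain]
      have h4 := map_signTwist_homog 𝒰 (homog_vec (𝒰 := 𝒰) fun g hg => (hl.2 g hg).1) c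
        (multiAdd_ev φ) [h.2.2.1] (xs.map (signTwist 𝒰 (c + par l)))
      rw [map_snd_vec, par_vec] at h4
      have h5 : (xs.map (signTwist 𝒰 c)).map (signTwist 𝒰 (par l)) =
          xs.map (signTwist 𝒰 (c + par l)) := by
        rw [List.map_map, add_comm]
        refine List.map_congr_left fun x _ => ?_
        rw [Function.comp_apply, signTwist_signTwist]
      rw [h5]
      simp only [List.cons_append, List.nil_append] at h4
      rw [h4]
      simp only [TensorProduct.smul_tmul', insertCoeff_tmul, coeffSign, wordVec, wordCoeff,
        List.map_cons, List.prod_cons, smul_smul, par_cons, List.cons_append, hl.1.2]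
      rw [mul_comm (coeffSign _)]

theorem evalCochain_tmul {n : ℕ} (x : Fin n → U) (φ : Cochain k U U) {a : A.carrier} {q : ZMod 2}
    (ha : a ∈ A.gr q) : evalCochain 𝒰 A n x (φ ⊗ₜ a) =
      φ n (fun i => signTwist 𝒰 q (x i)) ⊗ₜ a := by
  rw [evalCochain, LinearMap.sum_apply, Finset.sum_eq_single q]
  · rw [TensorProduct.map_tmul, parityProj_of_mem A.gr ha, if_pos rfl]
    rfl
  · intro q' _ hq
    rw [TensorProduct.map_tmul, parityProj_of_mem A.gr ha, if_neg hq, TensorProduct.tmul_zero]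
  · simp

theorem extendScalars_append_sum {ι : Type*} [Fintype ι] (z : ι → U ⊗[k] A.carrier) {r n : ℕ}
    (y : Fin n → U ⊗[k] A.carrier) (φ : MultilinearMap k (fun _ : Fin (r + n) => U) U) :
    extendScalars 𝒰 A (r + n) (Fin.append (fun _ : Fin r => ∑ i, z i) y) φ =
      ∑ p : Fin r → ι, extendScalars 𝒰 A (r + n) (Fin.append (fun i => z (p i)) y) φ := by
  classical
  simp only [← extendScalarsMulti_apply, ← curryArgs_apply]
  rw [MultilinearMap.map_sum, sum_apply]

/-- Evaluating the extension of a cochain with values in cochains. -/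
theorem evalCochain_extendScalars {ι : Type*} [Fintype ι] {L : ι → Letter U A.carrier}
    (hL : ∀ i, Letter.Even 𝒰 (L i)) {f : Cochain k U (Cochain k U U)} {r n : ℕ}
    {M : MultilinearMap k (fun _ : Fin (r + n) => U) U}
    (hf : ∀ w : Fin r → U, f r w n = curryArgs r n M w) (x : Fin n → U) :
    evalCochain 𝒰 A n x (extendScalars 𝒰 A r (fun _ => ∑ i, (L i).tensor) (f r)) =
      extendScalars 𝒰 A (r + n)
        (Fin.append (fun _ : Fin r => ∑ i, (L i).tensor) fun i => x i ⊗ₜ 1) M := by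
  classical
  rw [extendScalars_sum L fun i => (hL i).1, wsum, map_sum, extendScalars_append_sum]
  refine Finset.sum_congr rfl fun p _ => ?_
  have hl : ∀ h ∈ List.ofFn (fun i => L (p i)), Letter.Even 𝒰 h := by
    intro h hh
    obtain ⟨i, rfl⟩ := List.mem_ofFn.1 hh
    exact hL _
  -- The single map `M` is regarded as a cochain concentrated in arity `r + n`.
  have h1 := extendScalars_word_append (Pi.single (r + n) M : Cochain k U U) hl (List.ofFn x)
    (z := Fin.append (fun i => (L (p i)).tensor) fun i => x i ⊗ₜ 1) (by
      rw [List.ofFn_fin_append, List.map_ofFn, List.map_ofFn]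
      rfl)
  rw [Pi.single_eq_same] at h1
  rw [h1, extWord, map_zsmul, evalCochain_tmul x _ (wordCoeff_mem hl)]
  congr 2
  rw [wordVec, List.map_ofFn, List.map_ofFn, ← List.ofFn_fin_append, ev_ofFn, ev_ofFn,
    Pi.single_eq_same, hf, curryArgs_apply]
  rfl

/-- The coefficients of a word, with the sign of moving them to the right. -/
def signedCoeff {R : Type*} [Ring R] (l : List (Letter U R)) : R := coeffSign l • wordCoeff l

/-- For letters with vector parities `p, p'` and coefficient parities `a, a'`, the sign obtained and
the sign claimed differ by that of `(a + p)(a' + p')`. This is trivial as soon as one of the two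
letters is even. -/
theorem signedCoeff_swap {h h' : Letter U A.carrier} (hh : h.2.2.2 ∈ A.gr h.2.1)
    (hh' : h'.2.2.2 ∈ A.gr h'.2.1) (he : h.2.1 = h.1 ∨ h'.2.1 = h'.1)
    (a b : List (Letter U A.carrier)) :
    signedCoeff (a ++ h' :: h :: b) = psign (h.1 * h'.1) • signedCoeff (a ++ h :: h' :: b) := by
  have h1 : ∀ c : List (Letter U A.carrier), wordCoeff (a ++ c) = wordCoeff a * wordCoeff c := by
    simp [wordCoeff]
  have h2 : wordCoeff (h' :: h :: b) =
      psign (h.2.1 * h'.2.1) • wordCoeff (h :: h' :: b) := by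
    simp only [wordCoeff, List.map_cons, List.prod_cons, ← mul_assoc]
    rw [A.graded_comm _ _ _ hh' _ hh, smul_mul_assoc, mul_comm h.2.1]
  have h3 : coeffSign (a ++ h' :: h :: b) * psign (h.2.1 * h'.2.1) =
      psign (h.1 * h'.1) * coeffSign (a ++ h :: h' :: b) := by
    clear h1
    induction a with
    | nil =>
      simp only [List.nil_append, coeffSign, par_cons]
      simp only [← mul_assoc, ← psign_add]
      rw [mul_right_comm, ← psign_add]
      congr 2
      have h5 : (2 : ZMod 2) = 0 := rfl
      rcases he with he | he
      · rw [he]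
        ring_nf
        simp [h5]
      · rw [he]
        ring_nf
    | cons g a ih =>
      have h4 : par (a ++ h' :: h :: b) = par (a ++ h :: h' :: b) := by
        simp [par, add_left_comm]
      rw [List.cons_append, List.cons_append, coeffSign, coeffSign, mul_assoc, ih, h4,
        mul_left_comm]
  rw [signedCoeff, signedCoeff, h1, h1, h2, mul_smul_comm, smul_smul, h3, ← smul_smul]

theorem extWord_eq_signedCoeff (φ : Cochain k U W) (l : List (Letter U A.carrier)) :
    extWord φ l = ev φ (wordVec l) ⊗ₜ signedCoeff l := by
  rw [extWord, signedCoeff, TensorProduct.tmul_smul]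

/-- If every inverted pair contains an even letter, the Koszul signs on vectors and on coefficients
cancel, so the `A`-valued arguments are permuted without sign. -/
theorem extendScalars_permute_tensor {n : ℕ} {h : Fin n → Letter U A.carrier}
    (hh : ∀ i, Letter.Good 𝒰 (h i)) {τ : Equiv.Perm (Fin n)}
    (hτ : ∀ i j, i < j → τ j < τ i → (h (τ i)).2.1 = (h (τ i)).1 ∨ (h (τ j)).2.1 = (h (τ j)).1)
    (φ : MultilinearMap k (fun _ : Fin n => U) W) :
    extendScalars 𝒰 A n (fun i => (h i).tensor) (permute 𝒰 τ φ) =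
      extendScalars 𝒰 A n (fun i => (h (τ i)).tensor) φ := by
  classical
  have h1 := extendScalars_tensor (Pi.single n (permute 𝒰 τ φ) : Cochain k U W) h hh
  have h2 := extendScalars_tensor (Pi.single n φ : Cochain k U W) _ fun i => hh (τ i)
  rw [Pi.single_eq_same, extWord_eq_signedCoeff, wordVec, List.map_ofFn, ev_ofFn,
    Pi.single_eq_same] at h1 h2
  have h3 := koszulSign_of_adjacent (fun g g' : Letter U A.carrier => g.2.2.2 ∈ A.gr g.2.1 ∧
      g'.2.2.2 ∈ A.gr g'.2.1 ∧ (g.2.1 = g.1 ∨ g'.2.1 = g'.1)) signedCoeff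
    (fun a g g' b hR => signedCoeff_swap hR.1 hR.2.1 hR.2.2 a b) (fun i => (h i).1)
    (fun i => (h i).2) τ fun i j hi hj => ⟨(hh _).2, (hh _).2, (hτ i j hi hj).symm⟩
  rw [h1, h2]
  have h4 : (signedCoeff (List.ofFn fun i => h (τ i)) : A.carrier) = _ := h3
  rw [h4, TensorProduct.tmul_smul, TensorProduct.smul_tmul']
  congr 1
  exact permute_apply 𝒰 τ φ (p := fun i => (h i).1) fun i => (hh i).1

theorem extendScalars_permute {ι : Type*} [Fintype ι] {n : ℕ} {M : Fin n → ι → Letter U A.carrier}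
    (hM : ∀ i a, Letter.Good 𝒰 (M i a)) {τ : Equiv.Perm (Fin n)}
    (hτ : ∀ i j, i < j → τ j < τ i → (∀ a, (M (τ i) a).2.1 = (M (τ i) a).1) ∨
      ∀ a, (M (τ j) a).2.1 = (M (τ j) a).1)
    (φ : MultilinearMap k (fun _ : Fin n => U) W) :
    extendScalars 𝒰 A n (fun i => ∑ a, (M i a).tensor) (permute 𝒰 τ φ) =
      extendScalars 𝒰 A n (fun i => ∑ a, (M (τ i) a).tensor) φ := by
  classical
  rw [← extendScalarsMulti_apply, MultilinearMap.map_sum, ← extendScalarsMulti_apply,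
    MultilinearMap.map_sum, ← Equiv.sum_comp (Equiv.arrowCongr τ (Equiv.refl ι))]
  refine Finset.sum_congr rfl fun r _ => ?_
  rw [extendScalarsMulti_apply, extendScalarsMulti_apply]
  refine (extendScalars_permute_tensor (h := fun i => M i (r (τ.symm i))) (fun i => hM _ _)
    (fun i j hi hj => (hτ i j hi hj).imp (fun h => h _) fun h => h _) φ).trans ?_
  simp only [Equiv.symm_apply_apply]

/-- The vector `x ⊗ 1` as a sum of letters. -/
theorem tmul_one_eq_sum (x : U) : x ⊗ₜ[k] (1 : A.carrier) =
    ∑ q : ZMod 2, Letter.tensor (A := A) (q, (0, parityProj 𝒰 q x, 1)) := by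
  simp only [Letter.tensor]
  rw [← TensorProduct.sum_tmul, sum_parityProj]

theorem extendScalars_append_permute {ι : Type*} [Fintype ι] {L : ι → Letter U A.carrier}
    (hL : ∀ i, Letter.Even 𝒰 (L i)) {r n : ℕ} (x : Fin n → U) {τ : Equiv.Perm (Fin (r + n))}
    (hτ : ∀ i j, i < j → τ j < τ i → (τ i : ℕ) < r ∨ (τ j : ℕ) < r)
    (φ : MultilinearMap k (fun _ : Fin (r + n) => U) W) :
    extendScalars 𝒰 A (r + n)
        (Fin.append (fun _ : Fin r => ∑ i, (L i).tensor) fun i => x i ⊗ₜ 1) (permute 𝒰 τ φ) =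
      extendScalars 𝒰 A (r + n)
        (fun l => Fin.append (fun _ : Fin r => ∑ i, (L i).tensor) (fun i => x i ⊗ₜ 1) (τ l)) φ := by
  -- A common index type for two kinds of slots: the copies of ξ use the letters `L`, the vectors `x
  -- i ⊗ 1` use their two homogeneous components, and both are padded with zero letters.
  set M : Fin (r + n) → ι ⊕ ZMod 2 → Letter U A.carrier :=
    Fin.append (fun _ : Fin r => Sum.elim L fun _ => (0, (0, 0, 0))) fun i =>
      Sum.elim (fun _ => (0, (0, 0, 0))) fun q => (q, (0, parityProj 𝒰 q (x i), 1)) with hMdef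
  have h1 : Fin.append (fun _ : Fin r => ∑ i, (L i).tensor) (fun i => x i ⊗ₜ[k] (1 : A.carrier)) =
      fun i => ∑ a, (M i a).tensor := by
    funext i
    refine Fin.addCases (fun i => ?_) (fun i => ?_) i
    · simp [hMdef, Letter.tensor]
    · simp only [hMdef, Fin.append_right, Fintype.sum_sum_type, Sum.elim_inl, Sum.elim_inr]
      rw [tmul_one_eq_sum (𝒰 := 𝒰)]
      simp [Letter.tensor]
  rw [h1]
  refine extendScalars_permute ?_ ?_ φ
  · intro i a
    revert a
    refine Fin.addCases (fun i => ?_) (fun i => ?_) i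
    · rintro (a | a)
      · simpa [hMdef] using (hL a).1
      · simp [hMdef, Letter.Good]
    · rintro (a | a)
      · simp [hMdef, Letter.Good]
      · simp only [hMdef, Fin.append_right, Sum.elim_inr]
        exact ⟨parityProj_mem _ _ _, SetLike.GradedOne.one_mem⟩
  · have h2 : ∀ i : Fin (r + n), (i : ℕ) < r → ∀ a, (M i a).2.1 = (M i a).1 := by
      intro i hi a
      obtain ⟨i, rfl⟩ : ∃ i' : Fin r, i = Fin.castAdd n i' := ⟨⟨i, hi⟩, rfl⟩
      rcases a with a | a
      · simpa [hMdef] using (hL a).2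
      · simp [hMdef]
    exact fun i j hi hj => (hτ i j hi hj).imp (h2 _) (h2 _)

end TwistFormulas

/-! ### Factorials against permutations and shuffles -/

section TwistSums

variable {k : Type u} [Field k] [CharZero k] {U W : Type*} [AddCommGroup U] [Module k U]
  [AddCommGroup W] [Module k W]
variable {𝒰 : ZMod 2 → Submodule k U} [DirectSum.Decomposition 𝒰] {A : NilpotentCdga.{u, v} k}

/-- Even elements are permuted without sign, so the symmetrization consists of `n!` equal terms.
This is why the two notions of Maurer-Cartan element agree. -/
theorem extendScalars_symmetrization {ι : Type*} [Fintype ι] {L : ι → Letter U A.carrier}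
    (hL : ∀ i, Letter.Even 𝒰 (L i)) (m : Cochain k U U) (n : ℕ) :
    extendScalars 𝒰 A n (fun _ => ∑ i, (L i).tensor) (symmetrization 𝒰 m n) =
      n.factorial • extendScalars 𝒰 A n (fun _ => ∑ i, (L i).tensor) (m n) := by
  rw [symmetrization, map_sum]
  refine (Finset.sum_congr rfl fun σ _ => extendScalars_permute (M := fun _ : Fin n => L)
    (fun _ a => (hL a).1) (fun i j _ _ => Or.inl fun a => (hL a).2) (m n)).trans ?_
  rw [Finset.sum_const, Finset.card_univ, Fintype.card_perm, Fintype.card_fin]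

-- Permuting the copies of ξ changes nothing, and a shuffle inverts only pairs containing a copy of
-- ξ. So the `r!` permutations contribute equally and the shuffles carry no sign.
open Classical in
theorem extendScalars_shuffleSum {ι : Type*} [Fintype ι] {L : ι → Letter U A.carrier}
    (hL : ∀ i, Letter.Even 𝒰 (L i)) {r n : ℕ} (x : Fin n → U)
    (φ : MultilinearMap k (fun _ : Fin (r + n) => U) W) :
    extendScalars 𝒰 A (r + n) (Fin.append (fun _ : Fin r => ∑ i, (L i).tensor) fun i => x i ⊗ₜ 1)
        (∑ σ : Equiv.Perm (Fin r), permute 𝒰 (leftPerm r n σ) (shuffleSum 𝒰 r n φ)) =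
      r.factorial • ∑ τ : Equiv.Perm (Fin (r + n)) with IsShuffle r n τ,
        extendScalars 𝒰 A (r + n) (fun l => Fin.append (fun _ : Fin r => ∑ i, (L i).tensor)
          (fun i => x i ⊗ₜ 1) (τ l)) φ := by
  set y := Fin.append (fun _ : Fin r => ∑ i, (L i).tensor) fun i => x i ⊗ₜ[k] (1 : A.carrier)
    with hy
  have h1 : ∀ σ : Equiv.Perm (Fin r), extendScalars 𝒰 A (r + n) y
      (permute 𝒰 (leftPerm r n σ) (shuffleSum 𝒰 r n φ)) =
        extendScalars 𝒰 A (r + n) y (shuffleSum 𝒰 r n φ) := by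
    intro σ
    rw [extendScalars_append_permute hL x]
    · congr 2
      funext l
      refine Fin.addCases (fun i => ?_) (fun i => ?_) l
      · rw [leftPerm_castAdd, hy, Fin.append_left, Fin.append_left]
      · rw [leftPerm_natAdd]
    · intro i j
      refine Fin.addCases (fun i => ?_) (fun i => ?_) i
      · intro _ _
        rw [leftPerm_castAdd]
        exact Or.inl (σ i).2
      · refine Fin.addCases (fun j => ?_) (fun j => ?_) j
        · intro _ _
          rw [leftPerm_castAdd]
          exact Or.inr (σ j).2
        · intro h h'
          rw [leftPerm_natAdd, leftPerm_natAdd] at h'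
          exact absurd h (not_lt.2 h'.le)
  rw [map_sum, Finset.sum_congr rfl fun σ _ => h1 σ, Finset.sum_const, Finset.card_univ,
    Fintype.card_perm, Fintype.card_fin, shuffleSum, map_sum]
  congr 1
  refine Finset.sum_congr rfl fun τ hτ => extendScalars_append_permute hL x ?_ φ
  intro i j hij hji
  by_contra hc
  push Not at hc
  have := (Finset.mem_filter.1 hτ).2 (τ j) (τ i) hji (Or.inr hc.2)
  rw [Equiv.symm_apply_apply, Equiv.symm_apply_apply] at this
  exact absurd hij (not_lt.2 this.le)

/-- The components of an element twisted by the sum of even letters. -/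
theorem evalCochain_sum_eq {ι : Type*} [Fintype ι] {L : ι → Letter U A.carrier}
    (hL : ∀ i, Letter.Even 𝒰 (L i)) {N : ℕ}
    (hN : ∀ l, (∀ x ∈ l, ∃ i, x = L i) → N ≤ l.length → wordCoeff l = 0)
    (f : Cochain k U (Cochain k U U)) {n : ℕ} (x : Fin n → U) {T : ℕ → U ⊗[k] A.carrier}
    (hT : ∀ r, (((r + 1).factorial : k))⁻¹ • evalCochain 𝒰 A n x (extendScalars 𝒰 A (r + 1)
      (fun _ => ∑ i, (L i).tensor) (f (r + 1))) = T (r + 1)) :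
    evalCochain 𝒰 A n x (∑ᶠ r : ℕ, ((Nat.factorial (r + 1) : k))⁻¹ •
      extendScalars 𝒰 A (r + 1) (fun _ => ∑ i, (L i).tensor) (f (r + 1))) =
        ∑ᶠ r, T r - T 0 := by
  have h0 : ∀ r, N ≤ r → extendScalars 𝒰 A (r + 1) (fun _ => ∑ i, (L i).tensor) (f (r + 1)) = 0 := by
    intro r hr
    rw [extendScalars_sum L fun i => (hL i).1, wsum_eq_zero L fun l hl hl' => ?_]
    exact extWord_eq_zero f (hN l hl' (by omega))
  -- The twist includes the term without ξ, which the pushforward lacks. This accounts for the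
  -- subtraction of `T 0`, which is `m` in the applications.
  rw [finsum_eq_sum_range (N := N) fun r hr => by rw [h0 r hr, smul_zero],
    finsum_eq_sum_range (N := N + 1) (F := T), Finset.sum_range_succ', add_sub_cancel_right, map_sum]
  · exact Finset.sum_congr rfl fun r _ => by rw [map_smul, hT]
  · intro r hr
    obtain ⟨r, rfl⟩ := Nat.exists_eq_succ_of_ne_zero (by omega : r ≠ 0)
    rw [← hT r, h0 r (by omega), map_zero, smul_zero]

theorem extendScalars_append_zero {n : ℕ} (y : Fin 0 → U ⊗[k] A.carrier) (x : Fin n → U)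
    (m : Cochain k U W) : extendScalars 𝒰 A (0 + n) (Fin.append y fun i => x i ⊗ₜ 1) (m (0 + n)) =
      m n x ⊗ₜ 1 := by
  have h1 := extendScalars_word_append (𝒰 := 𝒰) (A := A) m (l := []) (by simp) (List.ofFn x)
    (z := Fin.append y fun i => x i ⊗ₜ 1) (by
      rw [List.ofFn_fin_append, List.map_ofFn]
      rfl)
  rw [h1]
  have h0 : (par ([] : List (Letter U A.carrier))) = 0 := rfl
  simp only [coeffSign, wordVec, wordCoeff, List.map_nil, List.prod_nil, one_smul, h0,
    signTwist_zero, List.nil_append, LinearMap.id_coe, List.map_id, ev_ofFn]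

theorem isShuffle_zero_iff {n : ℕ} {τ : Equiv.Perm (Fin (0 + n))} : IsShuffle 0 n τ ↔ τ = 1 := by
  constructor
  · intro h
    have h1 : StrictMono τ.symm := fun i j hij => h i j hij (Or.inr (Nat.zero_le _))
    have h2 : (τ.symm : Fin (0 + n) → Fin (0 + n)) = id :=
      (h1.range_inj strictMono_id).1 (by simp)
    refine Equiv.ext fun i => ?_
    have h3 := congrFun h2 (τ i)
    rw [Equiv.symm_apply_apply] at h3
    exact h3.symm
  · rintro rfl i j hij _
    exact hij

end TwistSums

/-! ### Maurer-Cartan elements are sent to twists -/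

section Sends

variable {k : Type u} [Field k] [CharZero k] {U : Type*} [AddCommGroup U] [Module k U]
variable {𝒰 : ZMod 2 → Submodule k U} [DirectSum.Decomposition 𝒰]

theorem isAInftyMC_iff {m : Cochain k U U} {A : FormalCdga.{u, v, w} k}
    {ξ : ∀ j, U ⊗[k] (A.level j).carrier} :
    IsAInftyMC 𝒰 m A ξ ↔ IsLInftyMC 𝒰 (symmetrization 𝒰 m) A ξ := by
  have key : IsEvenElement 𝒰 A ξ → ∀ j i, ((Nat.factorial (i + 1) : k))⁻¹ •
      extendScalars 𝒰 (A.level j) (i + 1) (fun _ => ξ j) (symmetrization 𝒰 m (i + 1)) =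
      extendScalars 𝒰 (A.level j) (i + 1) (fun _ => ξ j) (m (i + 1)) := by
    intro hξ j i
    obtain ⟨n, L, N, h1, h2, h3, hN2, hN⟩ := hξ.exists_letters j
    rw [h3, extendScalars_symmetrization h1, ← Nat.cast_smul_eq_nsmul k, smul_smul,
      inv_mul_cancel₀ (Nat.cast_ne_zero.2 (Nat.factorial_ne_zero _)), one_smul]
  constructor
  · refine fun hξ => ⟨hξ.toIsEvenElement, fun j => ?_⟩
    simp only [key hξ.toIsEvenElement]
    exact hξ.eq j
  · refine fun hξ => ⟨hξ.toIsEvenElement, fun j => ?_⟩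
    have := hξ.eq j
    simp only [key hξ.toIsEvenElement] at this
    exact this

theorem sendsMCToTwist_lInfty {m : Cochain k U U} (hm : IsLInfty 𝒰 m)
    {S : Submodule k (Cochain k U U)} (hS : ∀ r x, lInftyTwistingMap m r x ∈ S) :
    SendsMCToTwist.{u, v, w} 𝒰 (deformationStructure 𝒰 (symCompₗ 𝒰) m) S (IsLInftyMC 𝒰 m)
      (lInftyTwist 𝒰 m) m (lInftyTwistingMap m) := by
  intro A ξ hξ
  have hf := isLInftyMap_lInftyTwistingMap hm
  refine ⟨hf.isLInftyMC_pushforward hm.zero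
    (deformationStructure_eq_zero _ _) hξ, fun j => ⟨pushforward_mem_range hξ.toIsEvenElement
      hf.zero hS j, fun n x => ?_⟩⟩
  obtain ⟨N', L, N, h1, h2, h3, hN2, hN⟩ := hξ.toIsEvenElement.exists_letters j
  rw [pushforward, h3, lInftyTwist]
  refine (evalCochain_sum_eq h1 (hN N le_rfl) _ x (T := fun i => ((Nat.factorial i : k))⁻¹ •
    extendScalars 𝒰 (A.level j) (i + (n + 1)) (Fin.append (fun _ : Fin i => ∑ a, (L a).tensor)
      fun a => x a ⊗ₜ 1) (m (i + (n + 1)))) fun r => ?_).trans ?_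
  · rw [evalCochain_extendScalars h1 (M := m (r + 1 + (n + 1)))]
    intro w
    rw [lInftyTwistingMap, if_neg (Nat.succ_ne_zero r)]
    change (if n + 1 = 0 then 0 else curryArgs (r + 1) (n + 1) (m (r + 1 + (n + 1)))) w = _
    rw [if_neg (Nat.succ_ne_zero n)]
  · congr 1
    simp only [Nat.factorial_zero, Nat.cast_one, inv_one, one_smul]
    exact extendScalars_append_zero _ x m

theorem sendsMCToTwist_aInfty {m : Cochain k U U} (hm : IsAInfty 𝒰 m)
    {S : Submodule k (Cochain k U U)} (hS : ∀ r x, aInftyTwistingMap 𝒰 m r x ∈ S) :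
    SendsMCToTwist.{u, v, w} 𝒰 (deformationStructure 𝒰 (tensorCompₗ 𝒰) m) S (IsAInftyMC 𝒰 m)
      (aInftyTwist 𝒰 m) m (aInftyTwistingMap 𝒰 m) := by
  classical
  intro A ξ hξ
  have hf := isLInftyMap_aInftyTwistingMap hm
  refine ⟨hf.isLInftyMC_pushforward (symmetrization_zero hm.zero)
    (deformationStructure_eq_zero _ _) (isAInftyMC_iff.1 hξ), fun j => ⟨pushforward_mem_range
      hξ.toIsEvenElement hf.zero hS j, fun n x => ?_⟩⟩
  obtain ⟨N', L, N, h1, h2, h3, hN2, hN⟩ := hξ.toIsEvenElement.exists_letters j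
  rw [pushforward, h3, aInftyTwist]
  refine (evalCochain_sum_eq h1 (hN N le_rfl) _ x (T := fun i =>
    ∑ τ : Equiv.Perm (Fin (i + (n + 1))) with IsShuffle i (n + 1) τ,
      extendScalars 𝒰 (A.level j) (i + (n + 1)) (fun l => Fin.append
        (fun _ : Fin i => ∑ a, (L a).tensor) (fun a => x a ⊗ₜ 1) (τ l)) (m (i + (n + 1))))
      fun r => ?_).trans ?_
  · rw [evalCochain_extendScalars h1 (M := ∑ σ : Equiv.Perm (Fin (r + 1)),
      permute 𝒰 (leftPerm (r + 1) (n + 1) σ)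
        (shuffleSum 𝒰 (r + 1) (n + 1) (m (r + 1 + (n + 1))))), extendScalars_shuffleSum h1,
      ← Nat.cast_smul_eq_nsmul k, smul_smul,
      inv_mul_cancel₀ (Nat.cast_ne_zero.2 (Nat.factorial_ne_zero _)), one_smul]
    intro w
    rw [aInftyTwistingMap, if_neg (Nat.succ_ne_zero r)]
    change (if n + 1 = 0 then 0 else curryArgs (r + 1) (n + 1) _) w = _
    rw [if_neg (Nat.succ_ne_zero n)]
  · congr 1
    simp only [isShuffle_zero_iff, Finset.filter_eq', Finset.mem_univ, if_true,
      Finset.sum_singleton, Equiv.Perm.coe_one, id_eq]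
    exact extendScalars_append_zero _ x m

end Sends

/-! ## Free graded commutative algebras on square zero generators -/

section FreeAlgebra

variable {ι : Type v} [LinearOrder ι]

/-- The sign of the product of the monomials given by `S` and `T`. -/
def monomialSign (p : ι → ZMod 2) (S T : Finset ι) : ℤ :=
  ∏ i ∈ S, ∏ j ∈ T, if j < i then psign (p i * p j) else 1

variable (p : ι → ZMod 2)

theorem monomialSign_union_left {S T : Finset ι} (h : Disjoint S T) (X : Finset ι) :
    monomialSign p (S ∪ T) X = monomialSign p S X * monomialSign p T X :=
  Finset.prod_union h

theorem monomialSign_union_right {S T : Finset ι} (h : Disjoint S T) (X : Finset ι) :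
    monomialSign p X (S ∪ T) = monomialSign p X S * monomialSign p X T := by
  rw [monomialSign, monomialSign, monomialSign, ← Finset.prod_mul_distrib]
  exact Finset.prod_congr rfl fun i _ => Finset.prod_union h

@[simp]
theorem monomialSign_empty_left (S : Finset ι) : monomialSign p ∅ S = 1 := by simp [monomialSign]

@[simp]
theorem monomialSign_empty_right (S : Finset ι) : monomialSign p S ∅ = 1 := by simp [monomialSign]

theorem monomialSign_comm {S T : Finset ι} (h : Disjoint S T) :
    monomialSign p S T = psign ((∑ i ∈ S, p i) * ∑ j ∈ T, p j) * monomialSign p T S := by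
  rw [Finset.sum_mul_sum, psign_sum, monomialSign, monomialSign, Finset.prod_comm (s := T),
    ← Finset.prod_mul_distrib]
  refine Finset.prod_congr rfl fun i hi => ?_
  rw [psign_sum, ← Finset.prod_mul_distrib]
  refine Finset.prod_congr rfl fun j hj => ?_
  have hij : i ≠ j := fun hij => Finset.disjoint_left.1 h hi (hij ▸ hj)
  rcases lt_or_gt_of_ne hij with h1 | h1
  · rw [if_neg h1.not_gt, if_pos h1, mul_comm (p j), psign_mul_self]
  · rw [if_pos h1, if_neg h1.not_gt, mul_one]

/-- The free graded commutative algebra on generators of parities `p i` and square zero: the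
functions on the set of monomials. -/
def SqZeroAlgebra (k : Type u) (_p : ι → ZMod 2) : Type (max u v) := Finset ι → k

namespace SqZeroAlgebra

variable {p} {k : Type u} [Field k]

instance : AddCommGroup (SqZeroAlgebra k p) := inferInstanceAs (AddCommGroup (Finset ι → k))

instance : Module k (SqZeroAlgebra k p) := inferInstanceAs (Module k (Finset ι → k))

instance [Finite ι] : FiniteDimensional k (SqZeroAlgebra k p) :=
  inferInstanceAs (Module.Finite k (Finset ι → k))

@[ext]
theorem ext {a b : SqZeroAlgebra k p} (h : ∀ S : Finset ι, a S = b S) : a = b := funext h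

theorem add_apply (a b : SqZeroAlgebra k p) (S : Finset ι) : (a + b) S = a S + b S := rfl

theorem zero_apply (S : Finset ι) : (0 : SqZeroAlgebra k p) S = 0 := rfl

theorem smul_apply (c : k) (a : SqZeroAlgebra k p) (S : Finset ι) : (c • a) S = c * a S := rfl

instance : Mul (SqZeroAlgebra k p) where
  mul a b S := ∑ T ∈ S.powerset, (monomialSign p T (S \ T) : k) * (a T * b (S \ T))

instance : One (SqZeroAlgebra k p) where
  one S := if S = ∅ then 1 else 0

theorem mul_apply (a b : SqZeroAlgebra k p) (S : Finset ι) :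
    (a * b) S = ∑ T ∈ S.powerset, (monomialSign p T (S \ T) : k) * (a T * b (S \ T)) := rfl

theorem one_apply (S : Finset ι) : (1 : SqZeroAlgebra k p) S = if S = ∅ then 1 else 0 := rfl

protected theorem mul_assoc (a b c : SqZeroAlgebra k p) : a * b * c = a * (b * c) := by
  ext S
  simp only [mul_apply, Finset.sum_mul, Finset.mul_sum]
  rw [Finset.sum_sigma', Finset.sum_sigma']
  -- Both sides run over ordered partitions of `S` into three parts; a chain `R ⊆ T ⊆ S` is recorded
  -- either as `(T, R)` or as `(R, T \ R)`.
  refine Finset.sum_bij' (fun x _ => ⟨x.2, x.1 \ x.2⟩) (fun x _ => ⟨x.1 ∪ x.2, x.1⟩) ?_ ?_ ?_ ?_ ?_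
  · rintro ⟨T, R⟩ h
    simp only [Finset.mem_sigma, Finset.mem_powerset] at h ⊢
    exact ⟨h.2.trans h.1, Finset.sdiff_subset_sdiff h.1 le_rfl⟩
  · rintro ⟨R, Q⟩ h
    simp only [Finset.mem_sigma, Finset.mem_powerset] at h ⊢
    exact ⟨Finset.union_subset h.1 (h.2.trans Finset.sdiff_subset), Finset.subset_union_left⟩
  · rintro ⟨T, R⟩ h
    simp only [Finset.mem_sigma, Finset.mem_powerset] at h
    simp only [Finset.union_sdiff_of_subset h.2]
  · rintro ⟨R, Q⟩ h
    simp only [Finset.mem_sigma, Finset.mem_powerset] at h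
    have h1 : Disjoint Q R := Finset.disjoint_of_subset_left h.2 Finset.sdiff_disjoint
    simp only [Finset.union_sdiff_cancel_left h1.symm]
  · rintro ⟨T, R⟩ h
    simp only [Finset.mem_sigma, Finset.mem_powerset] at h
    have h1 : (S \ R) \ (T \ R) = S \ T := by
      ext i
      simp only [Finset.mem_sdiff]
      have := @h.2 i
      tauto
    have h2 : S \ R = (T \ R) ∪ (S \ T) := by
      ext i
      simp only [Finset.mem_sdiff, Finset.mem_union]
      have := @h.2 i
      have := @h.1 i
      tauto
    have h3 : monomialSign p T (S \ T) =
        monomialSign p R (S \ T) * monomialSign p (T \ R) (S \ T) := by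
      conv_lhs => rw [← Finset.union_sdiff_of_subset h.2]
      rw [monomialSign_union_left p Finset.disjoint_sdiff]
      simp only [Finset.union_sdiff_of_subset h.2]
    have h4 : monomialSign p R (S \ R) = monomialSign p R (T \ R) * monomialSign p R (S \ T) := by
      rw [h2, monomialSign_union_right]
      exact Finset.disjoint_of_subset_left Finset.sdiff_subset Finset.disjoint_sdiff
    simp only [h1, h3, h4]
    push_cast
    ring

instance : Ring (SqZeroAlgebra k p) :=
  { (inferInstance : AddCommGroup (SqZeroAlgebra k p)) with
    mul := (· * ·)
    one := 1
    left_distrib := fun a b c => by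
      ext S
      simp only [mul_apply, add_apply, mul_add, Finset.sum_add_distrib]
    right_distrib := fun a b c => by
      ext S
      simp only [mul_apply, add_apply, mul_add, add_mul, Finset.sum_add_distrib]
    zero_mul := fun a => by
      ext S
      simp [mul_apply, zero_apply]
    mul_zero := fun a => by
      ext S
      simp [mul_apply, zero_apply]
    mul_assoc := SqZeroAlgebra.mul_assoc
    one_mul := fun a => by
      ext S
      rw [mul_apply, Finset.sum_eq_single ∅]
      · simp [one_apply]
      · intro T _ hT
        simp [one_apply, hT]
      · simp
    mul_one := fun a => by
      ext S
      rw [mul_apply, Finset.sum_eq_single S]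
      · simp [one_apply]
      · intro T hT hTS
        have : S \ T ≠ ∅ := fun h => hTS (Finset.Subset.antisymm (Finset.mem_powerset.1 hT)
          (Finset.sdiff_eq_empty_iff_subset.1 h))
        simp [one_apply, this]
      · simp }

instance : Algebra k (SqZeroAlgebra k p) :=
  Algebra.ofModule
    (fun c a b => by
      ext S
      simp only [mul_apply, smul_apply, Finset.mul_sum]
      exact Finset.sum_congr rfl fun T _ => by ring)
    (fun c a b => by
      ext S
      simp only [mul_apply, smul_apply, Finset.mul_sum]
      exact Finset.sum_congr rfl fun T _ => by ring)

variable (k p) in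
/-- The elements of parity `i`. -/
def grading (i : ZMod 2) : Submodule k (SqZeroAlgebra k p) where
  carrier := {a | ∀ S : Finset ι, ∑ j ∈ S, p j ≠ i → a S = 0}
  add_mem' h h' S hS := by rw [add_apply, h S hS, h' S hS, add_zero]
  zero_mem' _ _ := rfl
  smul_mem' c a h S hS := by rw [smul_apply, h S hS, mul_zero]

theorem sum_apply {α : Type*} (s : Finset α) (a : α → SqZeroAlgebra k p) (S : Finset ι) :
    (∑ x ∈ s, a x) S = ∑ x ∈ s, a x S := Finset.sum_apply (M := fun _ : Finset ι => k) S s a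

variable (p) in
/-- The linear map `a ↦ (S ↦ c S * a (f S))`. -/
def weightedPullback (c : Finset ι → k) (f : Finset ι → Finset ι) :
    SqZeroAlgebra k p →ₗ[k] SqZeroAlgebra k p where
  toFun a S := c S * a (f S)
  map_add' a b := funext fun S => mul_add (c S) (a (f S)) (b (f S))
  map_smul' r a := funext fun S => mul_left_comm (c S) r (a (f S))

theorem weightedPullback_apply (c : Finset ι → k) (f : Finset ι → Finset ι)
    (a : SqZeroAlgebra k p) (S : Finset ι) : weightedPullback p c f a S = c S * a (f S) := rfl

variable (k p) in
/-- The projection to the elements of parity `i`. -/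
def proj (i : ZMod 2) : SqZeroAlgebra k p →ₗ[k] SqZeroAlgebra k p :=
  weightedPullback p (fun S => if ∑ j ∈ S, p j = i then 1 else 0) id

theorem proj_apply (i : ZMod 2) (a : SqZeroAlgebra k p) (S : Finset ι) :
    proj p k i a S = if ∑ j ∈ S, p j = i then a S else 0 := by
  simp [proj, weightedPullback_apply]

theorem proj_mem (i : ZMod 2) (a : SqZeroAlgebra k p) : proj p k i a ∈ grading p k i :=
  fun S hS => by rw [proj_apply, if_neg hS]

theorem sum_proj (a : SqZeroAlgebra k p) : ∑ i, proj p k i a = a := by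
  ext S
  rw [sum_apply]
  simp [proj_apply]

theorem proj_of_mem (i j : ZMod 2) {a : SqZeroAlgebra k p} (ha : a ∈ grading p k j) :
    proj p k i a = if i = j then a else 0 := by
  ext S
  rw [proj_apply]
  by_cases hS : ∑ l ∈ S, p l = j
  · rw [hS]
    by_cases hij : i = j
    · rw [if_pos hij, if_pos hij.symm]
    · rw [if_neg hij, if_neg (Ne.symm hij), zero_apply]
  · rw [ha S hS, ite_self]
    split_ifs
    · exact (ha S hS).symm
    · rfl

theorem one_mem : (1 : SqZeroAlgebra k p) ∈ grading p k 0 := by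
  intro S hS
  rw [one_apply, if_neg]
  rintro rfl
  exact hS rfl

theorem sum_add_sum_sdiff {S T : Finset ι} (h : T ⊆ S) :
    ∑ i ∈ T, p i + ∑ i ∈ S \ T, p i = ∑ i ∈ S, p i := by
  rw [add_comm]
  exact Finset.sum_sdiff h

theorem mul_mem {i j : ZMod 2} {a b : SqZeroAlgebra k p} (ha : a ∈ grading p k i)
    (hb : b ∈ grading p k j) : a * b ∈ grading p k (i + j) := by
  intro S hS
  rw [mul_apply]
  refine Finset.sum_eq_zero fun T hT => ?_
  rw [Finset.mem_powerset] at hT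
  by_cases hi : ∑ l ∈ T, p l = i
  · have hj : ∑ l ∈ S \ T, p l ≠ j := fun hj => hS (by rw [← sum_add_sum_sdiff hT, hi, hj])
    rw [hb _ hj, mul_zero, mul_zero]
  · rw [ha _ hi, zero_mul, mul_zero]

theorem mul_comm_of_mem {i j : ZMod 2} {a b : SqZeroAlgebra k p} (ha : a ∈ grading p k i)
    (hb : b ∈ grading p k j) : a * b = psign (i * j) • (b * a) := by
  rw [← Int.cast_smul_eq_zsmul k]
  ext S
  rw [smul_apply, mul_apply, mul_apply, Finset.mul_sum]
  refine Finset.sum_nbij' (fun T => S \ T) (fun T => S \ T) ?_ ?_ ?_ ?_ ?_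
  · simp
  · simp
  · intro T hT
    exact Finset.sdiff_sdiff_eq_self (Finset.mem_powerset.1 hT)
  · intro T hT
    exact Finset.sdiff_sdiff_eq_self (Finset.mem_powerset.1 hT)
  · intro T hT
    rw [Finset.sdiff_sdiff_eq_self (Finset.mem_powerset.1 hT)]
    by_cases hi : ∑ l ∈ T, p l = i
    · by_cases hj : ∑ l ∈ S \ T, p l = j
      · rw [monomialSign_comm p Finset.disjoint_sdiff, hi, hj]
        push_cast
        ring
      · rw [hb _ hj]
        ring
    · rw [ha _ hi]
      ring

variable (k p) in
/-- The derivative with respect to the first generator. -/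
def deriv (o : ι) : SqZeroAlgebra k p →ₗ[k] SqZeroAlgebra k p :=
  weightedPullback p (fun S => if o ∈ S then 0 else 1) (insert o)

theorem deriv_apply (o : ι) (a : SqZeroAlgebra k p) (S : Finset ι) :
    deriv p k o a S = if o ∈ S then 0 else a (insert o S) := by
  simp [deriv, weightedPullback_apply]

theorem deriv_deriv (o : ι) (a : SqZeroAlgebra k p) : deriv p k o (deriv p k o a) = 0 := by
  ext S
  rw [deriv_apply, deriv_apply, if_pos (Finset.mem_insert_self o S), ite_self, zero_apply]

variable {o : ι}

theorem deriv_mem (hp : p o = 1) {i : ZMod 2} {a : SqZeroAlgebra k p} (ha : a ∈ grading p k i) :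
    deriv p k o a ∈ grading p k (i + 1) := by
  intro S hS
  rw [deriv_apply]
  split_ifs with h
  · rfl
  · refine ha _ fun h1 => hS ?_
    rw [Finset.sum_insert h, hp] at h1
    rw [← h1, add_right_comm]
    have : (1 : ZMod 2) + 1 = 0 := rfl
    rw [this, zero_add]

/-- The generator `o` is the smallest one, so it already stands at the front of the left monomial.
-/
theorem monomialSign_insert_left (ho : ∀ i, o ≤ i) {S : Finset ι} (h : o ∉ S) (T : Finset ι) :
    monomialSign p (insert o S) T = monomialSign p S T := by
  rw [monomialSign, Finset.prod_insert h, Finset.prod_eq_one, one_mul]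
  · rfl
  · intro j _
    rw [if_neg (ho j).not_gt]

/-- To reach the front, the odd generator `o` has to cross all of `S`. -/
theorem monomialSign_insert_right (ho : ∀ i, o ≤ i) (hp : p o = 1) {S T : Finset ι} (h : o ∉ T)
    (hS : o ∉ S) : monomialSign p S (insert o T) = psign (∑ i ∈ S, p i) * monomialSign p S T := by
  rw [monomialSign, monomialSign, psign_sum, ← Finset.prod_mul_distrib]
  refine Finset.prod_congr rfl fun i hi => ?_
  have : o < i := lt_of_le_of_ne (ho i) fun h => hS (h ▸ hi)
  rw [Finset.prod_insert h, if_pos this, hp, mul_one]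

theorem deriv_mul (ho : ∀ i, o ≤ i) (hp : p o = 1) {i : ZMod 2} {a : SqZeroAlgebra k p}
    (ha : a ∈ grading p k i) (b : SqZeroAlgebra k p) :
    deriv p k o (a * b) = deriv p k o a * b + psign i • (a * deriv p k o b) := by
  rw [← Int.cast_smul_eq_zsmul k]
  ext S
  rw [add_apply, smul_apply, deriv_apply, mul_apply, mul_apply, mul_apply]
  by_cases h : o ∈ S
  · obtain ⟨S, h', rfl⟩ : ∃ S', o ∉ S' ∧ insert o S' = S :=
      ⟨S.erase o, Finset.notMem_erase o S, Finset.insert_erase h⟩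
    -- At a monomial containing `o` the left side vanishes; on the right the two products in which
    -- both factors lose the same `o` cancel, by the sign of crossing `T`.
    rw [if_pos h, Finset.sum_powerset_insert h', Finset.sum_powerset_insert h', mul_add,
      Finset.mul_sum, Finset.mul_sum, add_add_add_comm, ← Finset.sum_add_distrib,
      ← Finset.sum_add_distrib, eq_comm, ← Finset.sum_add_distrib]
    refine Finset.sum_eq_zero fun T hT => ?_
    have hT' : o ∉ T := fun h => h' (Finset.mem_powerset.1 hT h)
    have h1 : o ∉ S \ T := fun h => h' (Finset.mem_sdiff.1 h).1
    rw [Finset.insert_sdiff_of_notMem _ hT', Finset.insert_sdiff_insert,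
      Finset.sdiff_insert_of_notMem h', deriv_apply, deriv_apply, deriv_apply, deriv_apply,
      if_neg hT', if_pos (Finset.mem_insert_self _ _), if_pos (Finset.mem_insert_self _ _),
      if_neg h1, monomialSign_insert_right ho hp h1 hT', monomialSign_insert_left ho hT']
    by_cases hi : ∑ l ∈ insert o T, p l = i
    · rw [Finset.sum_insert hT', hp] at hi
      rw [← hi, psign_add]
      have : psign 1 = -1 := rfl
      rw [this]
      push_cast
      ring
    · rw [ha _ hi]
      ring
  · rw [if_neg h, Finset.sum_powerset_insert h, add_comm, Finset.mul_sum]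
    congr 1
    · refine Finset.sum_congr rfl fun T hT => ?_
      have hT' : o ∉ T := fun h' => h (Finset.mem_powerset.1 hT h')
      rw [deriv_apply, if_neg hT', Finset.insert_sdiff_insert, Finset.sdiff_insert_of_notMem h,
        monomialSign_insert_left ho hT']
    · refine Finset.sum_congr rfl fun T hT => ?_
      have hT' : o ∉ T := fun h' => h (Finset.mem_powerset.1 hT h')
      have h1 : o ∉ S \ T := fun h' => h (Finset.mem_sdiff.1 h').1
      rw [deriv_apply, if_neg h1, Finset.insert_sdiff_of_notMem _ hT',
        monomialSign_insert_right ho hp h1 hT']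
      by_cases hi : ∑ l ∈ T, p l = i
      · rw [hi]
        push_cast
        ring
      · rw [ha _ hi]
        ring

end SqZeroAlgebra

end FreeAlgebra

/-! ### The test algebra with its differential -/

section TwistedAlgebra

variable {ι : Type v} [LinearOrder ι] {p : ι → ZMod 2} {k : Type u} [Field k] {o : ι}

namespace SqZeroAlgebra

theorem mul_apply_empty (a b : SqZeroAlgebra k p) : (a * b) ∅ = a ∅ * b ∅ := by
  simp [mul_apply]

theorem mul_apply_singleton (a b : SqZeroAlgebra k p) (i : ι) :
    (a * b) {i} = a ∅ * b {i} + a {i} * b ∅ := by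
  rw [mul_apply, ← insert_empty_eq i, Finset.sum_powerset_insert (Finset.notMem_empty i)]
  simp

theorem algebraMap_apply (c : k) (S : Finset ι) :
    algebraMap k (SqZeroAlgebra k p) c S = if S = ∅ then c else 0 := by
  rw [Algebra.algebraMap_eq_smul_one, smul_apply, one_apply]
  simp

variable (k p o) in
/-- The subalgebra of elements without linear term in the generator `o`. -/
def noLinear : Subalgebra k (SqZeroAlgebra k p) where
  carrier := {a | a {o} = 0}
  mul_mem' {a b} ha hb := by
    change (a * b) {o} = 0
    rw [mul_apply_singleton, show a {o} = 0 from ha, show b {o} = 0 from hb, mul_zero, zero_mul,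
      add_zero]
  add_mem' {a b} ha hb := by
    change (a + b) {o} = 0
    rw [add_apply, show a {o} = 0 from ha, show b {o} = 0 from hb, add_zero]
  algebraMap_mem' c := by
    change algebraMap k (SqZeroAlgebra k p) c {o} = 0
    rw [algebraMap_apply, if_neg (Finset.singleton_ne_empty o)]

theorem mem_noLinear {a : SqZeroAlgebra k p} : a ∈ noLinear p k o ↔ a {o} = 0 := Iff.rfl

theorem proj_mem_noLinear (i : ZMod 2) {a : SqZeroAlgebra k p} (ha : a ∈ noLinear p k o) :
    proj p k i a ∈ noLinear p k o := by
  rw [mem_noLinear] at *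
  rw [proj_apply, ha, ite_self]

theorem deriv_mem_noLinear (a : SqZeroAlgebra k p) : deriv p k o a ∈ noLinear p k o := by
  rw [mem_noLinear, deriv_apply, if_pos (Finset.mem_singleton_self o)]

variable (k p o) in
/-- The grading of `noLinear`. -/
def noLinearGrading (i : ZMod 2) : Submodule k (noLinear p k o) :=
  (grading p k i).comap (noLinear p k o).val.toLinearMap

instance : DirectSum.Decomposition (noLinearGrading p k o) :=
  decompositionOfProj _
    (fun i => ((proj p k i).comp (noLinear p k o).val.toLinearMap).codRestrict
      (Subalgebra.toSubmodule (noLinear p k o)) fun a => proj_mem_noLinear i a.2)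
    (fun i a => proj_mem i a.1)
    (fun a => Subtype.ext (by
      rw [AddSubmonoidClass.coe_finsetSum]
      exact sum_proj a.1))
    (fun i j a ha => Subtype.ext (by
      refine (proj_of_mem i j (a := a.1) ha).trans ?_
      split_ifs <;> rfl))

instance : GradedAlgebra (noLinearGrading p k o) where
  one_mem := one_mem
  mul_mem _ _ _ _ ha hb := mul_mem ha hb

variable (k p o) in
/-- The constant term. -/
def constantTerm : noLinear p k o →ₐ[k] k where
  toFun a := a.1 ∅
  map_one' := (one_apply (p := p) ∅).trans (if_pos rfl)
  map_mul' a b := mul_apply_empty a.1 b.1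
  map_zero' := rfl
  map_add' _ _ := rfl
  commutes' c := (algebraMap_apply (p := p) c ∅).trans (if_pos rfl)

/-- Without constant term every factor contributes at least one generator, so a product of `n`
factors only has monomials in at least `n` generators. Nilpotency follows because the generators are
finite in number. -/
theorem pow_ker_constantTerm_apply {n : ℕ} {a : noLinear p k o}
    (ha : a ∈ LinearMap.ker (constantTerm p k o).toLinearMap ^ n) {S : Finset ι}
    (hS : S.card < n) : a.1 S = 0 := by
  induction n generalizing a S with
  | zero => exact absurd hS (Nat.not_lt_zero _)
  | succ n ih =>
    rw [pow_succ'] at ha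
    induction ha using Submodule.mul_induction_on' with
    | mem_mul_mem b hb c hc =>
      change (b.1 * c.1) S = 0
      rw [mul_apply]
      refine Finset.sum_eq_zero fun T hT => ?_
      rw [Finset.mem_powerset] at hT
      by_cases h : T = ∅
      · have : b.1 ∅ = 0 := hb
        rw [h, this, zero_mul, mul_zero]
      · rw [ih hc, mul_zero, mul_zero]
        have h1 := Finset.card_pos.2 (Finset.nonempty_iff_ne_empty.2 h)
        have h2 := Finset.card_sdiff_add_card_eq_card hT
        omega
    | add b _ c _ hb hc =>
      change (b.1 + c.1) S = 0
      rw [add_apply, hb, hc, add_zero]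

variable (k p) in
/-- The derivative on `noLinear`. -/
def noLinearDeriv (o : ι) : noLinear p k o →ₗ[k] noLinear p k o :=
  ((deriv p k o).comp (noLinear p k o).val.toLinearMap).codRestrict
      (Subalgebra.toSubmodule (noLinear p k o)) fun a => deriv_mem_noLinear a.1

variable (k) in
/-- The free graded commutative dg algebra on square zero generators `t i`, `i ≠ o`, together with
generators `θ t`, where `d (θ t) = t` for every nontrivial monomial `t` in the `t i`. -/
def twistedCdga [Fintype ι] (ho : ∀ i, o ≤ i) (hp : p o = 1) : NilpotentCdga.{u, max u v} k where
  carrier := noLinear p k o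
  gr := noLinearGrading p k o
  finiteDimensional := inferInstanceAs (FiniteDimensional k (Subalgebra.toSubmodule (noLinear p k o)))
  graded_comm i j a ha b hb := Subtype.ext (mul_comm_of_mem (a := a.1) (b := b.1) ha hb)
  d := noLinearDeriv p k o
  d_odd i a ha := deriv_mem hp (a := a.1) ha
  d_d a := Subtype.ext (deriv_deriv o a.1)
  leibniz i a ha b := Subtype.ext (deriv_mul ho hp (a := a.1) ha b.1)
  aug := constantTerm p k o
  aug_d a _ := by
    -- The constant term of the derivative is the coefficient of the generator `o` alone. Excluding
    -- that coefficient is what keeps the augmentation ideal stable under the differential.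
    change deriv p k o a.1 ∅ = 0
    rw [deriv_apply, if_neg (Finset.notMem_empty o), insert_empty_eq]
    exact a.2
  nilpotent := ⟨Fintype.card ι + 1, by
    rw [eq_bot_iff]
    intro a ha
    refine Subtype.ext (ext fun S => pow_ker_constantTerm_apply ha ?_)
    exact Nat.lt_succ_of_le (Finset.card_le_univ S)⟩

end SqZeroAlgebra

end TwistedAlgebra

/-! ## Maurer-Cartan elements with prescribed leading part -/

section Curvature

variable {k : Type u} [Field k] [CharZero k] {U W : Type*} [AddCommGroup U] [Module k U]
  [AddCommGroup W] [Module k W]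
variable {𝒰 : ZMod 2 → Submodule k U} [DirectSum.Decomposition 𝒰] {A : NilpotentCdga.{u, v} k}

theorem parityInv_parityInv (x : U) : parityInv 𝒰 (parityInv 𝒰 x) = x := by
  have h : parityInv 𝒰 = signTwist 𝒰 1 := (if_neg one_ne_zero).symm
  rw [h, signTwist_signTwist]
  rfl

theorem coeffDiff_coeffDiff (z : U ⊗[k] A.carrier) :
    coeffDiff 𝒰 A (coeffDiff 𝒰 A z) = 0 := by
  induction z using TensorProduct.induction_on with
  | zero => simp
  | add x y hx hy => rw [map_add, map_add, hx, hy, add_zero]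
  | tmul x a =>
    rw [coeffDiff, TensorProduct.map_tmul, TensorProduct.map_tmul, A.d_d, TensorProduct.tmul_zero]

theorem parityInv_parityRev (x : U) : parityInv (parityRev 𝒰) x = -parityInv 𝒰 x := by
  refine induction_homogeneous 𝒰 (P := fun x => parityInv (parityRev 𝒰) x = -parityInv 𝒰 x)
    (by simp) ?_ ?_ x
  · intro x y hx hy
    rw [map_add, map_add, hx, hy, neg_add]
  · intro q x hx
    have hx' : x ∈ parityRev 𝒰 (q + 1) := by
      change x ∈ 𝒰 (q + 1 + 1)
      rw [add_assoc, show (1 : ZMod 2) + 1 = 0 from rfl, add_zero]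
      exact hx
    rw [parityInv_of_mem hx, parityInv_of_mem hx', psign_add, show psign 1 = -1 from rfl,
      mul_neg_one, neg_smul]

theorem coeffDiff_parityRev (z : U ⊗[k] A.carrier) :
    coeffDiff (parityRev 𝒰) A z = -coeffDiff 𝒰 A z := by
  have : parityInv (parityRev 𝒰) = -parityInv 𝒰 := LinearMap.ext parityInv_parityRev
  rw [coeffDiff, coeffDiff, this, ← neg_one_smul k (parityInv 𝒰), TensorProduct.map_smul_left,
    LinearMap.smul_apply, neg_one_smul]

/-- The Bianchi identity for the curvature of a sum of even letters. -/
theorem IsLInfty.coeffDiff_curvature {m : Cochain k U U} (hm : IsLInfty 𝒰 m) {ι : Type*}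
    [Fintype ι] {L : ι → Letter U A.carrier} (hL : ∀ i, Letter.Even 𝒰 (L i)) {N : ℕ}
    (hN : ∀ l, (∀ x ∈ l, ∃ i, x = L i) → N ≤ l.length → wordCoeff l = 0) (hN2 : 2 ≤ N) :
    coeffDiff 𝒰 A (coeffDiff 𝒰 A (∑ i, (L i).tensor) + esum L k N (extWord m)) =
      -esum L k N fun T => insertHead A m T
        (coeffDiff 𝒰 A (∑ i, (L i).tensor) + esum L k N (extWord m)) := by
  have h1 := esum_symComp m m hL hN
  rw [hm.square] at h1
  have h2 : esum L k (2 * N) (extWord (0 : Cochain k U U)) = (0 : U ⊗[k] A.carrier) := by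
    rw [esum, Finset.sum_eq_zero]
    intro n _
    rw [wsum_eq_zero L fun l _ _ => ?_, smul_zero]
    obtain ⟨r, x, hx⟩ := exists_ofFn (wordVec l)
    rw [extWord, hx, ev_ofFn]
    change coeffSign l • ((0 : U) ⊗ₜ[k] wordCoeff l) = 0
    rw [TensorProduct.zero_tmul, smul_zero]
  -- An odd `m` is an even map to the parity reversed space. The chain rule then applies, at the
  -- price of a sign in the differential of the target.
  have h3 : HasParity 𝒰 (parityRev 𝒰) 0 m := by
    intro n p x hx
    have := hm.odd n p x hx
    change _ ∈ 𝒰 (_ + 0 + 1)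
    rwa [add_zero]
  have h4 := coeffDiff_esum (𝒲 := parityRev 𝒰) hm.symm h3 hL hN hN2
  rw [coeffDiff_parityRev, neg_eq_iff_eq_neg] at h4
  rw [map_add, coeffDiff_coeffDiff, zero_add, h4]
  simp only [map_add]
  rw [esum_add, ← h1, h2, add_zero]

/-- The sum over words is a multilinear expansion, so it depends on the letters only through their
sum. -/
theorem esum_extWord_congr {ι ι' : Type*} [Fintype ι] [Fintype ι'] {L : ι → Letter U A.carrier}
    {L' : ι' → Letter U A.carrier} (hL : ∀ i, Letter.Good 𝒰 (L i))
    (hL' : ∀ i, Letter.Good 𝒰 (L' i)) (h : ∑ i, (L i).tensor = ∑ i, (L' i).tensor)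
    (φ : Cochain k U W) (N : ℕ) : esum L k N (extWord φ) = esum L' k N (extWord φ) := by
  rw [esum, esum]
  refine Finset.sum_congr rfl fun n _ => ?_
  rw [← extendScalars_sum L hL, ← extendScalars_sum L' hL', h]

/-- A homomorphism `π` and a homotopy `h` contracting the kernel of `π`. -/
structure Contraction (A : NilpotentCdga.{u, v} k) where
  π : A.carrier →ₐ[k] A.carrier
  h : A.carrier →ₗ[k] A.carrier
  π_gr : ∀ q, ∀ a ∈ A.gr q, π a ∈ A.gr q
  h_gr : ∀ q, ∀ a ∈ A.gr q, h a ∈ A.gr (q + 1)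
  h_plus : ∀ a, h a ∈ A.plus
  h_π : ∀ a, h (π a) = h a
  π_h : ∀ a, π (h a) = 0
  h_d : ∀ a, h (A.d a) = a - π a
  d_h : ∀ a ∈ A.plus, A.d (h a) = π a

namespace Contraction

variable (C : Contraction A)

theorem π_signTwist (q : ZMod 2) (a : A.carrier) :
    C.π (signTwist A.gr q a) = signTwist A.gr q (C.π a) := by
  refine induction_homogeneous A.gr
    (P := fun a => C.π (signTwist A.gr q a) = signTwist A.gr q (C.π a)) (by simp) ?_ ?_ a
  · intro x y hx hy
    rw [map_add, map_add, hx, hy, map_add, map_add]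
  · intro p x hx
    rw [signTwist_of_mem A.gr hx, signTwist_of_mem A.gr (C.π_gr p x hx), map_zsmul]

/-- Since `π` is multiplicative and preserves parity, inserting an element killed by `π` gives an
element killed by `π`. -/
theorem lTensor_insertHead (m : Cochain k U W) (T : List (Letter U A.carrier))
    {z : U ⊗[k] A.carrier} (hz : LinearMap.lTensor U C.π.toLinearMap z = 0) :
    LinearMap.lTensor W C.π.toLinearMap (insertHead A m T z) = 0 := by
  have h1 : LinearMap.lTensor W C.π.toLinearMap (insertHead A m T z) =
      coeffSign T • TensorProduct.map (evHead m (wordVec T))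
        (LinearMap.mulRight k (C.π (wordCoeff T)) ∘ₗ signTwist A.gr (par T))
        (LinearMap.lTensor U C.π.toLinearMap z) := by
    clear hz
    induction z using TensorProduct.induction_on with
    | zero => simp
    | add x y hx hy => rw [map_add, map_add, hx, hy, map_add, map_add, smul_add]
    | tmul x a =>
      rw [insertHead, LinearMap.smul_apply, map_zsmul, TensorProduct.map_tmul,
        LinearMap.lTensor_tmul, LinearMap.lTensor_tmul, TensorProduct.map_tmul]
      congr 2
      change C.π (signTwist A.gr (par T) a * wordCoeff T) =
        signTwist A.gr (par T) (C.π a) * C.π (wordCoeff T)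
      rw [map_mul, C.π_signTwist]
  rw [h1, hz, map_zero, smul_zero]

variable (𝒰) in
/-- The homotopy on `U ⊗ A`. -/
def homotopy : U ⊗[k] A.carrier →ₗ[k] U ⊗[k] A.carrier := TensorProduct.map (parityInv 𝒰) C.h

theorem homotopy_coeffDiff (z : U ⊗[k] A.carrier) : C.homotopy 𝒰 (coeffDiff 𝒰 A z) =
    z - LinearMap.lTensor U C.π.toLinearMap z := by
  induction z using TensorProduct.induction_on with
  | zero => simp
  | add x y hx hy =>
    rw [map_add, map_add, hx, hy, map_add]
    abel
  | tmul x a =>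
    rw [coeffDiff, homotopy, TensorProduct.map_tmul, TensorProduct.map_tmul, parityInv_parityInv,
      C.h_d, TensorProduct.tmul_sub]
    rfl

theorem homotopy_lTensor (z : U ⊗[k] A.carrier) :
    C.homotopy 𝒰 (LinearMap.lTensor U C.π.toLinearMap z) = C.homotopy 𝒰 z := by
  induction z using TensorProduct.induction_on with
  | zero => simp
  | add x y hx hy => rw [map_add, map_add, hx, hy, map_add]
  | tmul x a =>
    rw [homotopy, LinearMap.lTensor_tmul, TensorProduct.map_tmul, TensorProduct.map_tmul]
    exact congrArg _ (C.h_π a)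

theorem lTensor_homotopy (z : U ⊗[k] A.carrier) :
    LinearMap.lTensor U C.π.toLinearMap (C.homotopy 𝒰 z) = 0 := by
  induction z using TensorProduct.induction_on with
  | zero => simp
  | add x y hx hy => rw [map_add, map_add, hx, hy, add_zero]
  | tmul x a =>
    rw [homotopy, TensorProduct.map_tmul, LinearMap.lTensor_tmul]
    exact (congrArg _ (C.π_h a)).trans (TensorProduct.tmul_zero _ _)

theorem lTensor_esum_eq {ι ι' : Type*} [Fintype ι] [Fintype ι'] {L : ι → Letter U A.carrier}
    {L' : ι' → Letter U A.carrier} (hL : ∀ i, Letter.Good 𝒰 (L i))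
    (hL' : ∀ i, Letter.Good 𝒰 (L' i))
    (h : LinearMap.lTensor U C.π.toLinearMap (∑ i, (L' i).tensor) = ∑ i, (L i).tensor)
    (φ : Cochain k U W) (N : ℕ) :
    LinearMap.lTensor W C.π.toLinearMap (esum L' k N (extWord φ)) = esum L k N (extWord φ) := by
  rw [lTensor_esum]
  refine esum_extWord_congr (𝒰 := 𝒰) (L := fun i =>
    (((L' i).1, ((L' i).2.1, (L' i).2.2.1, C.π (L' i).2.2.2)) : Letter U A.carrier))
      (fun i => ⟨(hL' i).1, C.π_gr _ _ (hL' i).2⟩) hL ?_ φ N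
  rw [← h, map_sum]
  rfl

theorem exists_mc {m : Cochain k U U} (hm : IsLInfty 𝒰 m) {ι : Type*} [Fintype ι]
    {L : ι → Letter U A.carrier} (hL : ∀ i, Letter.Even 𝒰 (L i))
    (hplus : ∀ i, (L i).2.2.2 ∈ A.plus) (hπ : ∀ i, C.π (L i).2.2.2 = (L i).2.2.2)
    (hd : ∀ i, A.d (L i).2.2.2 = 0) : ∃ ξ ∈ Submodule.span k (evenTensors 𝒰 A),
      LinearMap.lTensor U C.π.toLinearMap ξ = ∑ i, (L i).tensor ∧
      ∀ (n : ℕ) (L' : Fin n → Letter U A.carrier), (∀ i, Letter.Even 𝒰 (L' i)) →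
        (∀ i, (L' i).2.2.2 ∈ A.plus) → ξ = ∑ i, (L' i).tensor → ∀ N, 2 ≤ N →
        (∀ l : List (Letter U A.carrier), (∀ x ∈ l, x.2.2.2 ∈ A.plus) → N ≤ l.length →
          wordCoeff l = 0) →
        coeffDiff 𝒰 A (∑ i, (L' i).tensor) + esum L' k N (extWord m) = 0 := by
  obtain ⟨N₀, -, hN₀⟩ := A.exists_wordCoeff_eq_zero
  have hword : ∀ l : List (Letter U A.carrier), (∀ x ∈ l, ∃ i, x = L i) →
      C.π (wordCoeff l) = wordCoeff l := by
    intro l hl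
    rw [wordCoeff, map_list_prod, List.map_map]
    congr 1
    refine List.map_congr_left fun x hx => ?_
    obtain ⟨i, rfl⟩ := hl x hx
    exact hπ i
  set X := esum L k N₀ (extWord m) with hX
  have hX1 : LinearMap.lTensor U C.π.toLinearMap X = X := by
    rw [hX, map_esum]
    refine esum_congr L fun l hl => ?_
    rw [extWord, map_zsmul, LinearMap.lTensor_tmul]
    exact congrArg (fun t => coeffSign l • (_ ⊗ₜ[k] t)) (hword l hl)
  have hX2 : coeffDiff 𝒰 A (C.homotopy 𝒰 X) = X := by
    rw [hX, map_esum, map_esum]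
    refine esum_congr L fun l hl => ?_
    cases l with
    | nil =>
      rw [extWord, wordVec, List.map_nil, ev_nil_eq_zero_iff.2 hm.zero, TensorProduct.zero_tmul,
        smul_zero, map_zero, map_zero]
    | cons g l =>
      rw [extWord, map_zsmul, map_zsmul, homotopy, coeffDiff, TensorProduct.map_tmul,
        TensorProduct.map_tmul, parityInv_parityInv, C.d_h, hword _ hl]
      obtain ⟨i, rfl⟩ := hl g (by simp)
      rw [NilpotentCdga.mem_plus_iff, wordCoeff, List.map_cons, List.prod_cons, map_mul,
        NilpotentCdga.mem_plus_iff.1 (hplus i), zero_mul]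
  have hdL : coeffDiff 𝒰 A (∑ i, (L i).tensor) = 0 := by
    rw [map_sum]
    refine Finset.sum_eq_zero fun i _ => ?_
    rw [Letter.tensor, coeffDiff, TensorProduct.map_tmul, hd, TensorProduct.tmul_zero]
  have hξπ : LinearMap.lTensor U C.π.toLinearMap (∑ i, (L i).tensor - C.homotopy 𝒰 X) =
      ∑ i, (L i).tensor := by
    rw [map_sub, C.lTensor_homotopy, sub_zero, map_sum]
    refine Finset.sum_congr rfl fun i _ => ?_
    rw [Letter.tensor, LinearMap.lTensor_tmul]
    exact congrArg _ (hπ i)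
  refine ⟨∑ i, (L i).tensor - C.homotopy 𝒰 X, ?_, hξπ, ?_⟩
  · refine Submodule.sub_mem _ (Submodule.sum_mem _ fun i _ => Submodule.subset_span
      ⟨L i, hL i, hplus i, rfl⟩) ?_
    rw [hX, map_esum, esum]
    refine Submodule.sum_mem _ fun n _ => Submodule.smul_mem _ _ (Submodule.sum_mem _ fun r _ => ?_)
    set l := List.ofFn fun i => L (r i) with hl
    have hl' : ∀ h ∈ l, Letter.Even 𝒰 h := by
      intro h hh
      obtain ⟨i, rfl⟩ := List.mem_ofFn.1 hh
      exact hL _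
    have h2 := (hasParity_iff 𝒰).1 hm.odd _ (homog_vec (𝒰 := 𝒰) fun h hh => (hl' h hh).1)
    rw [map_snd_vec, par_vec] at h2
    change C.homotopy 𝒰 (extWord m l) ∈ _
    rw [extWord, map_zsmul]
    refine Submodule.smul_of_tower_mem _ (coeffSign l) (Submodule.subset_span ?_)
    refine ⟨(par l + 1, (par l + 1, parityInv 𝒰 (ev m (wordVec l)), C.h (wordCoeff l))),
      ⟨⟨?_, C.h_gr _ _ (wordCoeff_mem hl')⟩, rfl⟩, C.h_plus _, rfl⟩
    change parityInv 𝒰 (ev m (wordVec l)) ∈ 𝒰 (par l + 1)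
    rw [parityInv_of_mem h2]
    exact Submodule.smul_of_tower_mem _ _ h2
  · intro n L' h1 h2 h3 N hN2 hN
    have hN' : ∀ l, (∀ x ∈ l, ∃ i, x = L' i) → N ≤ l.length → wordCoeff l = 0 := by
      intro l hl
      refine hN l fun x hx => ?_
      obtain ⟨i, rfl⟩ := hl x hx
      exact h2 i
    have hB := hm.coeffDiff_curvature h1 hN' hN2
    -- The correction is killed by `π`, so `π` sends ξ to the original sum and, being
    -- multiplicative, `m(e^ξ)` to `X`.
    have h4 : LinearMap.lTensor U C.π.toLinearMap (esum L' k N (extWord m)) = X := by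
      rw [C.lTensor_esum_eq (𝒰 := 𝒰) (L := L) (fun i => (hL i).1) (fun i => (h1 i).1) (by rw [← h3, hξπ])]
      have hNL : ∀ l : List (Letter U A.carrier), (∀ x ∈ l, ∃ i, x = L i) →
          ∀ x ∈ l, x.2.2.2 ∈ A.plus := by
        intro l hl x hx
        obtain ⟨i, rfl⟩ := hl x hx
        exact hplus i
      rcases le_total N N₀ with h | h
      · exact (esum_of_le L h fun l hl hl' => extWord_eq_zero m (hN l (hNL l hl) hl')).symm
      · exact esum_of_le L h fun l hl hl' => extWord_eq_zero m (hN₀ U l (hNL l hl) hl')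
    set Y := coeffDiff 𝒰 A (∑ i, (L' i).tensor) + esum L' k N (extWord m) with hY
    have h5 : LinearMap.lTensor U C.π.toLinearMap Y = 0 := by
      rw [hY, ← h3, map_sub, hdL, hX2, map_add, h4, zero_sub, map_neg, hX1, neg_add_cancel]
    -- As `π Y = 0`, the homotopy recovers `Y` from `dY`. It depends on `dY` only through `π (dY)`,
    -- and by Bianchi `dY` is a sum of insertions of `Y`, all killed by `π`.
    have h6 := C.homotopy_coeffDiff (𝒰 := 𝒰) Y
    rw [h5, sub_zero, ← C.homotopy_lTensor, hB, map_neg, map_esum] at h6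
    rw [← h6]
    simp only [C.lTensor_insertHead m _ h5]
    simp [esum, wsum]

end Contraction

end Curvature

/-! ### The contraction of the test algebra -/

section TwistedContraction

variable {ι : Type v} [LinearOrder ι] {p : ι → ZMod 2} {k : Type u} [Field k] {o : ι}

namespace SqZeroAlgebra

variable (k p) in
/-- The projection which kills the generator `o`. -/
def killFirst (o : ι) : SqZeroAlgebra k p →ₗ[k] SqZeroAlgebra k p :=
  weightedPullback p (fun S => if o ∈ S then 0 else 1) id

theorem killFirst_apply (o : ι) (a : SqZeroAlgebra k p) (S : Finset ι) :
    killFirst p k o a S = if o ∈ S then 0 else a S := by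
  simp [killFirst, weightedPullback_apply]

theorem killFirst_mul (a b : SqZeroAlgebra k p) :
    killFirst p k o (a * b) = killFirst p k o a * killFirst p k o b := by
  ext S
  rw [killFirst_apply, mul_apply, mul_apply]
  split_ifs with h
  · refine (Finset.sum_eq_zero fun T hT => ?_).symm
    rw [killFirst_apply, killFirst_apply]
    by_cases h1 : o ∈ T
    · rw [if_pos h1, zero_mul, mul_zero]
    · rw [if_pos (Finset.mem_sdiff.2 ⟨h, h1⟩), mul_zero, mul_zero]
  · refine Finset.sum_congr rfl fun T hT => ?_
    rw [killFirst_apply, killFirst_apply, if_neg fun h1 => h (Finset.mem_powerset.1 hT h1),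
      if_neg fun h1 => h (Finset.mem_sdiff.1 h1).1]

variable (k p o) in
/-- `killFirst` as an endomorphism of `noLinear`. -/
def noLinearProj : noLinear p k o →ₐ[k] noLinear p k o :=
  AlgHom.ofLinearMap
    (((killFirst p k o).comp (noLinear p k o).val.toLinearMap).codRestrict
      (Subalgebra.toSubmodule (noLinear p k o)) fun a => by
        change killFirst p k o a.1 {o} = 0
        rw [killFirst_apply, if_pos (Finset.mem_singleton_self o)])
    (Subtype.ext (ext fun S => by
      change killFirst p k o 1 S = (1 : SqZeroAlgebra k p) S
      rw [killFirst_apply, one_apply]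
      split_ifs with h1 h2 <;> simp_all))
    (fun a b => Subtype.ext (killFirst_mul a.1 b.1))

variable (k p) in
/-- Multiplication by the generator `o`, and zero on constants. -/
def mulFirst (o : ι) : SqZeroAlgebra k p →ₗ[k] SqZeroAlgebra k p :=
  weightedPullback p (fun S => if o ∈ S ∧ S ≠ {o} then 1 else 0) fun S => S.erase o

theorem mulFirst_apply (o : ι) (a : SqZeroAlgebra k p) (S : Finset ι) :
    mulFirst p k o a S = if o ∈ S ∧ S ≠ {o} then a (S.erase o) else 0 := by
  simp [mulFirst, weightedPullback_apply]

variable (k p o) in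
/-- `mulFirst` as an endomorphism of `noLinear`. -/
def noLinearHomotopy : noLinear p k o →ₗ[k] noLinear p k o :=
  ((mulFirst p k o).comp (noLinear p k o).val.toLinearMap).codRestrict
    (Subalgebra.toSubmodule (noLinear p k o)) fun a => by
      change mulFirst p k o a.1 {o} = 0
      rw [mulFirst_apply, if_neg fun h => h.2 rfl]

variable (k) in
/-- The contraction of `twistedCdga` given by multiplication by the first generator. -/
def twistedContraction [Fintype ι] (ho : ∀ i, o ≤ i) (hp : p o = 1) :
    Contraction (twistedCdga k ho hp) where
  π := noLinearProj p k o
  h := noLinearHomotopy p k o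
  π_gr q a ha S hS := by
    change killFirst p k o a.1 S = 0
    have : a.1 S = 0 := ha S hS
    rw [killFirst_apply, this, ite_self]
  h_gr q a ha S hS := by
    change mulFirst p k o a.1 S = 0
    rw [mulFirst_apply]
    split_ifs with h
    · refine ha _ fun h1 => hS ?_
      rw [← Finset.add_sum_erase S p h.1, h1, hp, add_comm]
    · rfl
  h_plus a := by
    change mulFirst p k o a.1 ∅ = 0
    rw [mulFirst_apply, if_neg fun h => Finset.notMem_empty _ h.1]
  h_π a := Subtype.ext (ext fun S => by
    change mulFirst p k o (killFirst p k o a.1) S = mulFirst p k o a.1 S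
    rw [mulFirst_apply, mulFirst_apply, killFirst_apply, if_neg (Finset.notMem_erase o S)])
  π_h a := Subtype.ext (ext fun S => by
    change killFirst p k o (mulFirst p k o a.1) S = 0
    rw [killFirst_apply, mulFirst_apply]
    split_ifs with h h'
    · rfl
    · exact absurd h'.1 h
    · rfl)
  h_d a := Subtype.ext (ext fun S => by
    change mulFirst p k o (deriv p k o a.1) S = (a.1 - killFirst p k o a.1) S
    rw [sub_eq_add_neg, ← neg_one_smul k, add_apply, smul_apply, mulFirst_apply, killFirst_apply,
      deriv_apply, if_neg (Finset.notMem_erase o S)]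
    by_cases h : o ∈ S
    · rw [if_pos h, Finset.insert_erase h, mul_zero, add_zero]
      split_ifs with h'
      · rfl
      · have h1 : S = {o} := by
          by_contra h2
          exact h' ⟨h, h2⟩
        rw [h1]
        exact a.2.symm
    · rw [if_neg fun h' => h h'.1, if_neg h]
      ring)
  d_h a ha := Subtype.ext (ext fun S => by
    change deriv p k o (mulFirst p k o a.1) S = killFirst p k o a.1 S
    rw [deriv_apply, killFirst_apply]
    split_ifs with h
    · rfl
    · rw [mulFirst_apply, Finset.erase_insert h]
      split_ifs with h'
      · rfl
      · have h1 : S = ∅ := by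
          by_contra h2
          refine h' ⟨Finset.mem_insert_self _ _, fun h3 => h2 ?_⟩
          rw [← Finset.erase_insert h, h3, Finset.erase_singleton]
        rw [h1]
        exact ha.symm)

variable (k p) in
/-- The generators. -/
def gen (i : ι) : SqZeroAlgebra k p := fun S => if S = {i} then 1 else 0

theorem gen_apply (i : ι) (S : Finset ι) : gen p k i S = if S = {i} then 1 else 0 := rfl

theorem gen_mul_apply (i : ι) (b : SqZeroAlgebra k p) (S : Finset ι) : (gen p k i * b) S =
    if i ∈ S then (monomialSign p {i} (S.erase i) : k) * b (S.erase i) else 0 := by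
  rw [mul_apply]
  split_ifs with h
  · rw [Finset.sum_eq_single {i}]
    · rw [gen_apply, if_pos rfl, one_mul, Finset.sdiff_singleton_eq_erase]
    · intro T _ hT
      rw [gen_apply, if_neg hT, zero_mul, mul_zero]
    · intro h'
      exact absurd (Finset.mem_powerset.2 (Finset.singleton_subset_iff.2 h)) h'
  · refine Finset.sum_eq_zero fun T hT => ?_
    rw [gen_apply, if_neg, zero_mul, mul_zero]
    rintro rfl
    exact h (Finset.singleton_subset_iff.1 (Finset.mem_powerset.1 hT))

theorem monomialSign_ne_zero (S T : Finset ι) : (monomialSign p S T : k) ≠ 0 := by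
  have h : IsUnit (monomialSign p S T) := by
    rw [monomialSign, IsUnit.prod_iff]
    intro i _
    rw [IsUnit.prod_iff]
    intro j _
    split_ifs
    · exact IsUnit.of_mul_eq_one _ (psign_mul_self _)
    · exact isUnit_one
  exact (h.map (Int.castRingHom k)).ne_zero

/-- A repeated generator makes the product zero; otherwise the product is a single monomial with
coefficient a sign. -/
theorem prod_gen_apply_ne_zero_iff (l : List ι) (S : Finset ι) :
    (l.map (gen p k)).prod S ≠ 0 ↔ l.Nodup ∧ l.toFinset = S := by
  induction l generalizing S with
  | nil => 
    rw [List.map_nil, List.prod_nil, one_apply]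
    simp [eq_comm]
  | cons i l ih =>
    rw [List.map_cons, List.prod_cons, gen_mul_apply, List.nodup_cons, List.toFinset_cons]
    split_ifs with h
    · rw [mul_ne_zero_iff, ih, and_iff_right (monomialSign_ne_zero _ _)]
      constructor
      · rintro ⟨h1, h2⟩
        refine ⟨⟨fun h3 => ?_, h1⟩, by rw [h2, Finset.insert_erase h]⟩
        exact Finset.notMem_erase i S (h2 ▸ List.mem_toFinset.2 h3)
      · rintro ⟨⟨h1, h2⟩, rfl⟩
        exact ⟨h2, (Finset.erase_insert fun h3 => h1 (List.mem_toFinset.1 h3)).symm⟩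
    · refine iff_of_false (fun h1 => h1 rfl) fun h1 => h (h1.2 ▸ Finset.mem_insert_self _ _)

variable (k p) in
/-- The generators of `noLinear`. -/
def noLinearGen {i : ι} (hi : i ≠ o) : noLinear p k o :=
  ⟨gen p k i, if_neg fun h => hi (Finset.singleton_injective h).symm⟩

variable (k p o) in
/-- The coefficient of a monomial. -/
def coeffFunctional (S : Finset ι) : noLinear p k o →ₗ[k] k where
  toFun a := a.1 S
  map_add' _ _ := rfl
  map_smul' _ _ := rfl

theorem coeffFunctional_prod_gen_ne_zero_iff (S : Finset ι) {n : ℕ} {q : Fin n → ι}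
    (hq : ∀ i, q i ≠ o) :
    coeffFunctional p k o S (List.ofFn fun i => noLinearGen p k (hq i)).prod ≠ 0 ↔
      Function.Injective q ∧ ∀ i, i ∈ S ↔ ∃ j, q j = i := by
  have h : coeffFunctional p k o S (List.ofFn fun i => noLinearGen p k (hq i)).prod =
      ((List.ofFn q).map (gen p k)).prod S := by
    change (noLinear p k o).val (List.ofFn fun i => noLinearGen p k (hq i)).prod S = _
    rw [map_list_prod, List.map_ofFn, List.map_ofFn]
    rfl
  rw [h, prod_gen_apply_ne_zero_iff, List.nodup_ofFn]
  refine and_congr_right fun _ => ?_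
  rw [eq_comm, Finset.ext_iff]
  simp only [List.mem_toFinset, List.mem_ofFn]

theorem deriv_gen {i : ι} (hi : i ≠ o) : deriv p k o (gen p k i) = 0 := by
  ext S
  rw [deriv_apply, gen_apply, zero_apply]
  split_ifs with h h'
  · rfl
  · have h1 := Finset.mem_insert_self o S
    rw [h', Finset.mem_singleton] at h1
    exact absurd h1.symm hi
  · rfl

theorem killFirst_gen {i : ι} (hi : i ≠ o) : killFirst p k o (gen p k i) = gen p k i := by
  ext S
  rw [killFirst_apply, gen_apply]
  split_ifs with h h'
  · rw [h', Finset.mem_singleton] at h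
    exact absurd h.symm hi
  · rfl
  · rfl
  · rfl

variable (k) in
/-- For given parities `p i`, there are a finite-dimensional cdga with a contraction, and closed
elements `t i` of these parities with nonzero product. -/
theorem exists_testAlgebra {r : ℕ} (p : Fin r → ZMod 2) :
    ∃ (A : NilpotentCdga.{u, max u v} k) (C : Contraction A) (t : Fin r → A.carrier)
      (c : A.carrier →ₗ[k] k) (q : ZMod 2), (∀ i, t i ∈ A.gr (p i)) ∧ (∀ i, t i ∈ A.plus) ∧
      (∀ i, C.π (t i) = t i) ∧ (∀ i, A.d (t i) = 0) ∧ (∀ a, c (C.π a) = c a) ∧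
      (∀ i, ∀ a ∈ A.gr i, i ≠ q → c a = 0) ∧ ∀ (n : ℕ) (s : Fin n → Fin r),
        c (List.ofFn fun i => t (s i)).prod ≠ 0 ↔ Function.Bijective s := by
  -- Index `0` is the auxiliary odd generator, placed first; the given parities belong to the
  -- remaining indices.
  set p' : ULift.{v} (Fin (r + 1)) → ZMod 2 :=
    fun i => Fin.cons (α := fun _ => ZMod 2) 1 p i.down with hp'
  set o : ULift.{v} (Fin (r + 1)) := ⟨0⟩ with ho'
  have ho : ∀ i, o ≤ i := fun i => Fin.zero_le i.down
  have hp : p' o = 1 := rfl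
  set κ : Fin r → ULift.{v} (Fin (r + 1)) := fun i => ⟨i.succ⟩ with hκ'
  have hκ : Function.Injective κ := fun i j h => Fin.succ_injective _ (congrArg ULift.down h)
  have hκo : ∀ i, κ i ≠ o := fun i h => Fin.succ_ne_zero i (congrArg ULift.down h)
  -- The monomial containing every `t i` once and not the auxiliary generator. Its coefficient is
  -- the functional `c`, so only words using each letter exactly once are seen.
  set S : Finset (ULift.{v} (Fin (r + 1))) := Finset.univ.image κ with hS
  have hoS : o ∉ S := by
    rw [hS, Finset.mem_image]
    rintro ⟨i, -, hi⟩
    exact hκo i hi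
  refine ⟨twistedCdga k ho hp, twistedContraction k ho hp, fun i => noLinearGen p' k (hκo i),
    coeffFunctional p' k o S, ∑ j ∈ S, p' j, fun i T hT => if_neg fun h => hT ?_, fun i => ?_,
    fun i => Subtype.ext (killFirst_gen (hκo i)), fun i => Subtype.ext (deriv_gen (hκo i)),
    fun a => ?_, fun i a ha hi => ha S hi.symm, fun n s => ?_⟩
  · rw [h, Finset.sum_singleton]
    rfl
  · change gen p' k (κ i) ∅ = 0
    rw [gen_apply, if_neg (Finset.singleton_ne_empty _).symm]
  · change killFirst p' k o a.1 S = a.1 S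
    rw [killFirst_apply, if_neg hoS]
  · refine (coeffFunctional_prod_gen_ne_zero_iff S fun i => hκo (s i)).trans ?_
    constructor
    · rintro ⟨h1, h2⟩
      refine ⟨fun i j h => h1 (congrArg κ h), fun j => ?_⟩
      obtain ⟨i, hi⟩ := (h2 (κ j)).1 (Finset.mem_image_of_mem κ (Finset.mem_univ j))
      exact ⟨i, hκ hi⟩
    · intro h
      refine ⟨hκ.comp h.1, fun i => ?_⟩
      rw [hS, Finset.mem_image]
      constructor
      · rintro ⟨j, -, rfl⟩
        obtain ⟨l, rfl⟩ := h.2 j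
        exact ⟨l, rfl⟩
      · rintro ⟨l, rfl⟩
        exact ⟨s l, Finset.mem_univ _, rfl⟩

end SqZeroAlgebra

end TwistedContraction

/-! ## Uniqueness -/

section TestElement

theorem coeffSign_ne_zero {U R : Type*} (l : List (Letter U R)) : coeffSign l ≠ 0 := by
  induction l with
  | nil => exact one_ne_zero
  | cons h l ih =>
    rw [coeffSign]
    exact mul_ne_zero (fun h0 => one_ne_zero ((psign_mul_self (h.2.1 * par l)).symm.trans
      (by rw [h0, zero_mul]))) ih

variable {k : Type u} [Field k] [CharZero k] {U W : Type*} [AddCommGroup U] [Module k U]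
  [AddCommGroup W] [Module k W]
variable {𝒰 : ZMod 2 → Submodule k U} [DirectSum.Decomposition 𝒰]

theorem permute_eq_self {f : Cochain k U W} (hf : GradedSymmetric 𝒰 f) {n : ℕ}
    (σ : Equiv.Perm (Fin n)) {p : Fin n → ZMod 2} {x : Fin n → U} (hx : ∀ i, x i ∈ 𝒰 (p i)) :
    permute 𝒰 σ (f n) x = f n x := by
  rw [permute_apply 𝒰 σ (f n) hx, hf n σ p x hx, smul_smul]
  have : koszulSign p σ * koszulSign p σ = 1 := by
    simp only [koszulSign, ← Finset.prod_mul_distrib]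
    refine Finset.prod_eq_one fun i _ => Finset.prod_eq_one fun j _ => ?_
    split_ifs
    · exact psign_mul_self _
    · exact one_mul 1
  rw [this, one_smul]

theorem extWord_perm {A : NilpotentCdga.{u, v} k} {f : Cochain k U W} (hf : GradedSymmetric 𝒰 f)
    {n : ℕ} {L : Fin n → Letter U A.carrier} (hL : ∀ i, Letter.Even 𝒰 (L i))
    (σ : Equiv.Perm (Fin n)) :
    extWord f (List.ofFn fun i => L (σ i)) = extWord f (List.ofFn L) := by
  have h1 : permute 𝒰 σ (f n) = f n := by
    ext x
    rw [← sum_map_parityProj 𝒰 (permute 𝒰 σ (f n)), ← sum_map_parityProj 𝒰 (f n)]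
    exact Finset.sum_congr rfl fun p _ =>
      permute_eq_self hf σ (p := p) fun i => parityProj_mem 𝒰 (p i) (x i)
  rw [← extendScalars_tensor f _ fun i => (hL (σ i)).1, ← extendScalars_tensor f _ fun i => (hL i).1,
    ← extendScalars_permute_tensor (fun i => (hL i).1) (fun i j _ _ => Or.inl (hL _).2), h1]

/-- The part of `f` seen by a test element all of whose letters are needed. -/
theorem functional_esum {A : NilpotentCdga.{u, v} k} {f : Cochain k U W} (hf : GradedSymmetric 𝒰 f)
    {r : ℕ} {L : Fin r → Letter U A.carrier} (hL : ∀ i, Letter.Even 𝒰 (L i))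
    (c : A.carrier →ₗ[k] k)
    (hc : ∀ (n : ℕ) (q : Fin n → Fin r), c (wordCoeff (List.ofFn fun i => L (q i))) ≠ 0 →
      Function.Bijective q) {N : ℕ} (hN : r < N) :
    TensorProduct.rid k W (LinearMap.lTensor W c (esum L k N (extWord f))) =
      ((coeffSign (List.ofFn L) : k) * c (wordCoeff (List.ofFn L))) •
        f r (fun i => (L i).2.2.1) := by
  set F : List (Letter U A.carrier) → W := fun l =>
    TensorProduct.rid k W (LinearMap.lTensor W c (extWord f l)) with hF
  have h1 : ∀ l, F l = ((coeffSign l : k) * c (wordCoeff l)) • ev f (wordVec l) := by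
    intro l
    simp only [hF, extWord, map_zsmul, LinearMap.lTensor_tmul, TensorProduct.rid_tmul]
    rw [← Int.cast_smul_eq_zsmul k, smul_smul]
  have h2 : TensorProduct.rid k W (LinearMap.lTensor W c (esum L k N (extWord f))) =
      esum L k N F := by
    rw [map_esum]
    exact map_esum L (TensorProduct.rid k W).toLinearMap N _
  rw [h2, esum, Finset.sum_eq_single r]
  -- The words that survive are the `r!` rearrangements of `L`. They have equal values by graded
  -- symmetry, which cancels the weight `1/r!`.
  · have h3 : wsum L r F = ∑ _σ : Equiv.Perm (Fin r), F (List.ofFn L) := by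
      refine (Fintype.sum_of_injective (fun σ : Equiv.Perm (Fin r) => (σ : Fin r → Fin r))
        DFunLike.coe_injective _ _ ?_ ?_).symm
      · intro q hq
        rw [h1]
        by_cases h : c (wordCoeff (List.ofFn fun i => L (q i))) = 0
        · rw [h, mul_zero, zero_smul]
        · exact absurd ⟨Equiv.ofBijective q (hc r q h), rfl⟩ hq
      · intro σ
        simp only [hF]
        rw [extWord_perm hf hL]
    rw [h3, Finset.sum_const, Finset.card_univ, Fintype.card_perm, Fintype.card_fin,
      ← Nat.cast_smul_eq_nsmul k, smul_smul,
      inv_mul_cancel₀ (Nat.cast_ne_zero.2 (Nat.factorial_ne_zero _)), one_smul, h1, wordVec,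
      List.map_ofFn, ev_ofFn]
    rfl
  · intro n _ hn
    rw [wsum, Finset.sum_eq_zero, smul_zero]
    intro q _
    rw [h1]
    by_cases h : c (wordCoeff (List.ofFn fun i => L (q i))) = 0
    · rw [h, mul_zero, zero_smul]
    · exact absurd (by simpa using Fintype.card_of_bijective (hc n q h)) hn
  · intro h
    exact absurd (Finset.mem_range.2 hN) h

end TestElement

/-! ### An `L_∞`-map is determined by its Maurer-Cartan values -/

section Uniqueness

/-- A finite-dimensional cdga as a formal cdga. -/
def constantFormalCdga {k : Type u} [Field k] (A : NilpotentCdga.{u, v} k) :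
    FormalCdga.{u, v, w} k where
  index := PUnit
  directed := ⟨fun a _ => ⟨a, le_rfl, le_rfl⟩⟩
  nonempty := inferInstance
  level _ := A
  map _ := AlgHom.id k A.carrier
  map_gr _ _ _ ha := ha
  map_d _ _ := rfl
  map_refl _ _ := rfl
  map_trans _ _ _ := rfl

theorem isEvenElement_constant {k : Type u} [Field k] [CharZero k] {U : Type*} [AddCommGroup U]
    [Module k U]
    {𝒰 : ZMod 2 → Submodule k U} [DirectSum.Decomposition 𝒰] {A : NilpotentCdga.{u, v} k}
    {ξ : U ⊗[k] A.carrier} (hξ : ξ ∈ Submodule.span k (evenTensors 𝒰 A)) :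
    IsEvenElement 𝒰 (constantFormalCdga.{u, v, w} A) fun _ => ξ where
  compatible _ := by
    change LinearMap.lTensor U (LinearMap.id : A.carrier →ₗ[k] A.carrier) ξ = ξ
    rw [LinearMap.lTensor_id, LinearMap.id_apply]
  mem_plus _ := span_evenTensors_le_plus hξ
  even _ := span_evenTensors_le_even hξ

variable {k : Type u} [Field k] [CharZero k] {U : Type v} [AddCommGroup U] [Module k U]
variable {𝒰 : ZMod 2 → Submodule k U} [DirectSum.Decomposition 𝒰]

/-- The functional sees only coefficients of parity `q`, and for these the twist of the arguments
cancels the sign built into `evalCochain`. -/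
theorem rid_lTensor_evalCochain {A : NilpotentCdga.{u, w} k} {c : A.carrier →ₗ[k] k} {q : ZMod 2}
    (hc : ∀ i, ∀ a ∈ A.gr i, i ≠ q → c a = 0) {n : ℕ} (x : Fin n → U)
    (z : Cochain k U U ⊗[k] A.carrier) :
    TensorProduct.rid k U (LinearMap.lTensor U c
      (evalCochain 𝒰 A n (fun i => signTwist 𝒰 q (x i)) z)) =
      (TensorProduct.rid k (Cochain k U U) (LinearMap.lTensor (Cochain k U U) c z)) n x := by
  induction z using TensorProduct.induction_on with
  | zero =>
    simp only [map_zero]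
    rfl
  | add y z hy hz =>
    simp only [map_add, hy, hz]
    rfl
  | tmul φ a =>
    refine induction_homogeneous A.gr (P := fun a => TensorProduct.rid k U (LinearMap.lTensor U c
      (evalCochain 𝒰 A n (fun i => signTwist 𝒰 q (x i)) (φ ⊗ₜ[k] a))) =
      (TensorProduct.rid k (Cochain k U U) (LinearMap.lTensor (Cochain k U U) c (φ ⊗ₜ[k] a))) n x)
      ?_ ?_ ?_ a
    · simp only [TensorProduct.tmul_zero, map_zero]
      rfl
    · intro y z hy hz
      simp only [TensorProduct.tmul_add, map_add, hy, hz]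
      rfl
    · intro i a ha
      rw [evalCochain_tmul _ _ ha, LinearMap.lTensor_tmul, LinearMap.lTensor_tmul,
        TensorProduct.rid_tmul, TensorProduct.rid_tmul]
      by_cases hi : i = q
      · subst hi
        have h2 : ∀ j : ZMod 2, j + j = 0 := by decide
        simp only [signTwist_signTwist, h2, signTwist_zero, LinearMap.id_apply]
        rfl
      · rw [hc i a ha hi, zero_smul, zero_smul]
        rfl

/-- Since `c` factors through `π` and `π` sends ξ to the sum of the letters `L`, the functional
reads the pushforward of ξ as if ξ were that sum, although the sum itself need not be a
Maurer-Cartan element. -/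
theorem Contraction.exists_test {A : NilpotentCdga.{u, v} k} (C : Contraction A) {U : Type*}
    [AddCommGroup U] [Module k U] {𝒰 : ZMod 2 → Submodule k U} [DirectSum.Decomposition 𝒰]
    {m : Cochain k U U} (hm : IsLInfty 𝒰 m) {r : ℕ} {L : Fin r → Letter U A.carrier}
    (hL : ∀ i, Letter.Even 𝒰 (L i)) (hplus : ∀ i, (L i).2.2.2 ∈ A.plus)
    (hπ : ∀ i, C.π (L i).2.2.2 = (L i).2.2.2) (hd : ∀ i, A.d (L i).2.2.2 = 0)
    {c : A.carrier →ₗ[k] k} (hcπ : ∀ a, c (C.π a) = c a)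
    (hc : ∀ (n : ℕ) (q : Fin n → Fin r), c (wordCoeff (List.ofFn fun i => L (q i))) ≠ 0 →
      Function.Bijective q) :
    ∃ ξ : U ⊗[k] A.carrier, IsLInftyMC 𝒰 m (constantFormalCdga.{u, v, w} A) (fun _ => ξ) ∧
      ∀ f : Cochain k U (Cochain k U U), f 0 = 0 → GradedSymmetric 𝒰 f →
        TensorProduct.rid k (Cochain k U U) (LinearMap.lTensor (Cochain k U U) c
          (pushforward 𝒰 f (constantFormalCdga.{u, v, w} A) (fun _ => ξ) PUnit.unit)) =
            ((coeffSign (List.ofFn L) : k) * c (wordCoeff (List.ofFn L))) •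
              f r (fun i => (L i).2.2.1) := by
  obtain ⟨ξ, h1, h2, h3⟩ := C.exists_mc hm hL hplus hπ hd
  obtain ⟨n, L', g1, g2, g3⟩ := exists_letters h1
  obtain ⟨N₁, hN1, hN1'⟩ := A.exists_wordCoeff_eq_zero
  -- Large enough both for long words to vanish and for words of length `r` to be included.
  set N := max N₁ (r + 1) with hN
  have hNv : ∀ l : List (Letter U A.carrier), (∀ x ∈ l, x.2.2.2 ∈ A.plus) → N ≤ l.length →
      wordCoeff l = 0 := fun l hl hl' => hN1' U l hl ((le_max_left _ _).trans hl')
  have hNL' : ∀ l, (∀ x ∈ l, ∃ i, x = L' i) → N ≤ l.length → wordCoeff l = 0 := by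
    intro l hl
    refine hNv l fun x hx => ?_
    obtain ⟨i, rfl⟩ := hl x hx
    exact g2 i
  refine ⟨ξ, ⟨isEvenElement_constant h1, fun j => ?_⟩, fun f hf0 hf => ?_⟩
  · change coeffDiff 𝒰 A ξ + ∑ᶠ i : ℕ, ((Nat.factorial (i + 1) : k))⁻¹ •
      extendScalars 𝒰 A (i + 1) (fun _ => ξ) (m (i + 1)) = 0
    have := h3 n L' g1 g2 g3 N (hN1.trans (le_max_left _ _)) hNv
    rwa [← finsum_extendScalars (fun i => (g1 i).1) hm.zero hNL', ← g3] at this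
  · have h4 : pushforward 𝒰 f (constantFormalCdga.{u, v, w} A) (fun _ => ξ) PUnit.unit =
        esum L' k N (extWord f) := by
      rw [← finsum_extendScalars (fun i => (g1 i).1) hf0 hNL', ← g3]
      rfl
    have h5 : c.comp C.π.toLinearMap = c := LinearMap.ext hcπ
    have h6 := C.lTensor_esum_eq (𝒰 := 𝒰) (L := L) (fun i => (hL i).1) (fun i => (g1 i).1)
      (by rw [← g3, h2]) f N
    rw [h4, ← functional_esum hf hL c hc (Nat.lt_of_succ_le (le_max_right _ _)), ← h6,
      ← LinearMap.comp_apply (LinearMap.lTensor (Cochain k U U) c), ← LinearMap.lTensor_comp, h5]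

/-- Every component of an `L_∞`-map can be read off from the image of one Maurer-Cartan element. -/
theorem IsLInfty.exists_test {m : Cochain k U U} (hm : IsLInfty 𝒰 m) {r : ℕ}
    {p : Fin r → ZMod 2} {x : Fin r → U} (hx : ∀ i, x i ∈ 𝒰 (p i)) :
    ∃ (A : NilpotentCdga.{u, max u v} k) (ξ : U ⊗[k] A.carrier) (c : A.carrier →ₗ[k] k)
      (q : ZMod 2) (ε : k), IsLInftyMC 𝒰 m (constantFormalCdga.{u, max u v, w} A) (fun _ => ξ) ∧
      ε ≠ 0 ∧ (∀ i, ∀ a ∈ A.gr i, i ≠ q → c a = 0) ∧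
      ∀ f : Cochain k U (Cochain k U U), f 0 = 0 → GradedSymmetric 𝒰 f →
        TensorProduct.rid k (Cochain k U U) (LinearMap.lTensor (Cochain k U U) c
          (pushforward 𝒰 f (constantFormalCdga.{u, max u v, w} A) (fun _ => ξ) PUnit.unit)) =
            ε • f r x := by
  obtain ⟨A, C, t, c, q, h1, h2, h3, h4, h5, h6, h7⟩ := SqZeroAlgebra.exists_testAlgebra.{u, v} k p
  set L : Fin r → Letter U A.carrier := fun i => (p i, (p i, x i, t i)) with hL'
  have hL : ∀ i, Letter.Even 𝒰 (L i) := fun i => ⟨⟨hx i, h1 i⟩, rfl⟩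
  have hword : ∀ (n : ℕ) (s : Fin n → Fin r), c (wordCoeff (List.ofFn fun i => L (s i))) ≠ 0 ↔
      Function.Bijective s := by
    intro n s
    rw [← h7, wordCoeff, List.map_ofFn]
    rfl
  obtain ⟨ξ, hξ, h⟩ := C.exists_test.{u, max u v, w} hm hL h2 h3 h4 h5 fun n s => (hword n s).1
  refine ⟨A, ξ, c, q, _, hξ, ?_, h6, h⟩
  exact mul_ne_zero (Int.cast_ne_zero.2 (coeffSign_ne_zero _))
    ((hword r id).2 Function.bijective_id)

/-- An `L_∞`-map is determined by its values on Maurer-Cartan elements. -/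
theorem eq_of_sendsMCToTwist {m mL : Cochain k U U} (hmL : IsLInfty 𝒰 mL)
    {l : Cochain k (Cochain k U U) (Cochain k U U)} {S : Submodule k (Cochain k U U)}
    (hS : ∀ φ ∈ S, φ 0 = 0)
    {isMC : ∀ A : FormalCdga.{u, max u v, w} k, (∀ j, U ⊗[k] (A.level j).carrier) → Prop}
    (hMC : ∀ A ξ, IsLInftyMC 𝒰 mL A ξ → isMC A ξ)
    {twist : ∀ A : NilpotentCdga.{u, max u v} k, U ⊗[k] A.carrier → ∀ n : ℕ,
      (Fin n → U ⊗[k] A.carrier) → U ⊗[k] A.carrier} {f g : Cochain k U (Cochain k U U)}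
    (hf0 : f 0 = 0) (hfs : GradedSymmetric 𝒰 f) (hfS : ∀ r x, f r x ∈ S)
    (hf : SendsMCToTwist 𝒰 l S isMC twist m f)
    (hg0 : g 0 = 0) (hgs : GradedSymmetric 𝒰 g) (hgS : ∀ r x, g r x ∈ S)
    (hg : SendsMCToTwist 𝒰 l S isMC twist m g) : g = f := by
  refine ev_ext fun w => MultiAdd.ext_homog 𝒰 (multiAdd_ev g) (multiAdd_ev f) (fun ws hws => ?_) w
  obtain ⟨r, p, x, hx, rfl⟩ := exists_ofFn_homog 𝒰 hws
  rw [map_snd_ofFn, ev_ofFn, ev_ofFn]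
  -- The test element depends only on `mL` and the arguments, so it serves for `f` and `g` alike,
  -- and both send it to the same twist.
  obtain ⟨A, ξ, c, q, ε, hξ, hε, hc, h⟩ := IsLInfty.exists_test.{u, v, w} hmL hx
  funext n
  cases n with
  -- The twist is compared in positive arities only; in arity zero both values vanish because they
  -- lie in `S`.
  | zero => rw [hS _ (hgS r x), hS _ (hfS r x)]
  | succ n =>
    ext y
    have h1 := ((hf _ _ (hMC _ _ hξ)).2 PUnit.unit).2 n fun i => signTwist 𝒰 q (y i)
    have h2 := ((hg _ _ (hMC _ _ hξ)).2 PUnit.unit).2 n fun i => signTwist 𝒰 q (y i)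
    have h3 := congrArg (fun z => TensorProduct.rid k U (LinearMap.lTensor U c z)) (h2.trans h1.symm)
    have h4 := (rid_lTensor_evalCochain hc y _).symm.trans (h3.trans (rid_lTensor_evalCochain hc y _))
    rw [h g hg0 hgs, h f hf0 hfs] at h4
    exact smul_right_injective U hε h4

end Uniqueness

/-! ### Existence and uniqueness combined -/

section TwistingMaps

variable {k : Type u} [Field k] [CharZero k] {U : Type v} [AddCommGroup U] [Module k U]
  {𝒰 : ZMod 2 → Submodule k U} [DirectSum.Decomposition 𝒰] {m : Cochain k U U}
  {S : Submodule k (Cochain k U U)}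

theorem isTwistingLInftyMap_lInfty (hm : IsLInfty 𝒰 m) (hS : ∀ φ ∈ S, φ 0 = 0)
    (target : IsDGLAOn (cochainGrading 𝒰 𝒰)
      (superCommutator (cochainGrading 𝒰 𝒰) (symCompₗ 𝒰) m)
      (superCommutator (cochainGrading 𝒰 𝒰) (symCompₗ 𝒰)) S)
    (hmem : ∀ w, ev (lInftyTwistingMap m) w ∈ S) :
    IsTwistingLInftyMap.{u, max u v, w} 𝒰 (symCompₗ 𝒰) m m S (IsLInftyMC 𝒰 m)
      (lInftyTwist 𝒰 m) (lInftyTwistingMap m) := by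
  have hf := isLInftyMap_lInftyTwistingMap hm
  have mem := apply_mem_of_ev hmem
  have sends := sendsMCToTwist_lInfty.{u, max u v, w} hm mem
  exact ⟨hm, target, hf, mem, sends, fun g hg hgS hgs => eq_of_sendsMCToTwist hm hS
    (fun _ _ h => h) hf.zero hf.symm mem sends hg.zero hg.symm hgS hgs⟩

theorem isTwistingLInftyMap_aInfty (hm : IsAInfty 𝒰 m) (hS : ∀ φ ∈ S, φ 0 = 0)
    (target : IsDGLAOn (cochainGrading 𝒰 𝒰)
      (superCommutator (cochainGrading 𝒰 𝒰) (tensorCompₗ 𝒰) m)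
      (superCommutator (cochainGrading 𝒰 𝒰) (tensorCompₗ 𝒰)) S)
    (hmem : ∀ w, ev (aInftyTwistingMap 𝒰 m) w ∈ S) :
    IsTwistingLInftyMap.{u, max u v, w} 𝒰 (tensorCompₗ 𝒰) m (symmetrization 𝒰 m) S
      (IsAInftyMC 𝒰 m) (aInftyTwist 𝒰 m) (aInftyTwistingMap 𝒰 m) := by
  have hf := isLInftyMap_aInftyTwistingMap hm
  have mem := apply_mem_of_ev hmem
  have sends := sendsMCToTwist_aInfty.{u, max u v, w} hm mem
  exact ⟨isLInfty_symmetrization hm, target, hf, mem, sends, fun g hg hgS hgs =>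
    eq_of_sendsMCToTwist (isLInfty_symmetrization hm) hS (fun _ _ h => isAInftyMC_iff.2 h)
      hf.zero hf.symm mem sends hg.zero hg.symm hgS hgs⟩

end TwistingMaps

end

/-! ### The four cases of the theorem -/

theorem mainTheorem1 {k : Type u} [Field k] [CharZero k] {V : Type v} [AddCommGroup V]
    [Module k V] (𝒱 : ZMod 2 → Submodule k V) [DirectSum.Decomposition 𝒱] :
    (∀ m : Cochain k V V, IsLInfty (parityRev 𝒱) m →
      IsTwistingLInftyMap.{u, max u v, w} (parityRev 𝒱) (symCompₗ (parityRev 𝒱)) m m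
        (truncCE 𝒱)
        (IsLInftyMC (parityRev 𝒱) m) (lInftyTwist (parityRev 𝒱) m)
        (lInftyTwistingMap m)) ∧
    (∀ (m : Cochain k V V) (B : V →ₗ[k] V →ₗ[k] k) (c : ZMod 2), IsInnerProduct 𝒱 B c →
      IsLInfty (parityRev 𝒱) m → m ∈ cyclicCochains 𝒱 B →
      IsTwistingLInftyMap.{u, max u v, w} (parityRev 𝒱) (symCompₗ (parityRev 𝒱)) m m
        (truncCE 𝒱 ⊓ cyclicCochains 𝒱 B)
        (IsLInftyMC (parityRev 𝒱) m) (lInftyTwist (parityRev 𝒱) m)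
        (lInftyTwistingMap m)) ∧
    (∀ m : Cochain k V V, IsAInfty (parityRev 𝒱) m →
      IsTwistingLInftyMap.{u, max u v, w} (parityRev 𝒱) (tensorCompₗ (parityRev 𝒱)) m
        (symmetrization (parityRev 𝒱) m)
        (truncHoch k V)
        (IsAInftyMC (parityRev 𝒱) m) (aInftyTwist (parityRev 𝒱) m)
        (aInftyTwistingMap (parityRev 𝒱) m)) ∧
    (∀ (m : Cochain k V V) (B : V →ₗ[k] V →ₗ[k] k) (c : ZMod 2), IsInnerProduct 𝒱 B c →
      IsAInfty (parityRev 𝒱) m → m ∈ cyclicCochains 𝒱 B →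
      IsTwistingLInftyMap.{u, max u v, w} (parityRev 𝒱) (tensorCompₗ (parityRev 𝒱)) m
        (symmetrization (parityRev 𝒱) m)
        (truncHoch k V ⊓ cyclicCochains 𝒱 B)
        (IsAInftyMC (parityRev 𝒱) m) (aInftyTwist (parityRev 𝒱) m)
        (aInftyTwistingMap (parityRev 𝒱) m)) := by
  refine ⟨fun m hm => ?_, fun m B c hB hm hmc => ?_, fun m hm => ?_, fun m B c hB hm hmc => ?_⟩
  · exact isTwistingLInftyMap_lInfty hm (fun _ h => h.1) (isDGLAOn_truncCE hm)
      (lInftyTwistingMap_mem_truncCE hm)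
  · exact isTwistingLInftyMap_lInfty hm (fun _ h => h.1.1) (isDGLAOn_cyclic_truncCE hm hB hmc)
      (fun x => ⟨lInftyTwistingMap_mem_truncCE hm x,
        lInftyTwistingMap_mem_cyclicCochains hm hB hmc x⟩)
  · exact isTwistingLInftyMap_aInfty hm (fun _ h => h) (isDGLAOn_truncHoch hm)
      (aInftyTwistingMap_mem_truncHoch m)
  · exact isTwistingLInftyMap_aInfty hm (fun _ h => h.1) (isDGLAOn_cyclic_truncHoch hm hB hmc)
      (fun x => ⟨aInftyTwistingMap_mem_truncHoch m x,
        aInftyTwistingMap_mem_cyclicCochains hB hm.odd hmc x⟩)
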